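/- **Notation.** Let $\mathbb D\subset\mathbb C$ be the open unit disc, $\mathbb T$ the unit circle and $\alpha\in(0,1)$. For $k\in\mathbb N$, $\mathscr C^{k,\alpha}(\mathbb D)$ is the space of functions of class $C^k$ on the disc (up to the boundary) whose derivative of order $k$ is $\alpha$-Hölder continuous, with its usual norm (the sum of the sup norms of the derivatives of order at most $k$ and of the $\alpha$-Hölder seminorm of the derivative of order $k$). Let $\mathscr C^{k,\alpha}_s(\mathbb D)$ be the subspace of the real functions of the form $g(re^{i\theta})=\sum_{n\ge 0}g_n(r)\cos(n\theta)$, and let $\mathscr{HC}^{k,\alpha}(\mathbb D)$ be the real subspace of the $\phi\in\mathscr C^{k,\alpha}(\mathbb D)$ that are holomorphic in $\mathbb D$ and satisfy $\phi(0)=0$, $\phi'(0)=0$ and $\overline{\phi(z)}=\phi(\overline z)$ for $z\in\overline{\mathbb D}$. $B_X(0,r)$ is the open ball of $X$ of centre $0$ and radius $r$. Let $f_0:\overline{\mathbb D}\to\mathbb R$ be a radial function in $\mathscr C^{1,\alpha}(\mathbb D)$, and write $f_0(s)$ for its value on $|z|=s$. For $\Omega\in\mathbb R$, $g\in\mathscr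 C^{1,\alpha}_s(\mathbb D)$, $\phi\in\mathscr{HC}^{2,\alpha}(\mathbb D)$, put $f=f_0+g$, $\Phi=\mathrm{Id}+\phi$ and, for $w\in\mathbb T$, $$F(\Omega,g,\phi)(w)=\mathrm{Im}\left[\left(\Omega\,\overline{\Phi(w)}-\frac1{2\pi}\int_{\mathbb D}\frac{f(y)}{\Phi(w)-\Phi(y)}|\Phi'(y)|^2\,dA(y)\right)\Phi'(w)\,w\right].$$ Let $$\widehat\Omega_n=\int_0^1 sf_0(s)\,ds-\frac{n+1}{n}\int_0^1 s^{2n+1}f_0(s)\,ds\quad(n\ge1),\qquad \widehat\Omega_\infty=\int_0^1 sf_0(s)\,ds,$$ and $\mathcal S_{\rm sing}=\{\widehat\Omega_n: n\in\{1,2,\dots\}\cup\{\infty\}\}$. **Proposition.** Let $I\subset\mathbb R$ be an open interval with $\overline I\subset\mathbb R\setminus\mathcal S_{\rm sing}$. Then there are $\delta,\varepsilon\in(0,1)$ and a function of class $\mathscr C^1$ $$\mathcal N: I\times B_{\mathscr C^{1,\alpha}_s}(0,\delta)\longrightarrow B_{\mathscr{HC}^{2,\alpha}}(0,\varepsilon)$$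 such that, for all $(\Omega,g,\phi)\in I\times B_{\mathscr C^{1,\alpha}_s}(0,\delta)\times B_{\mathscr{HC}^{2,\alpha}}(0,\varepsilon)$, $$F(\Omega,g,\phi)=0\ \text{ on }\mathbb T\iff \phi=\mathcal N(\Omega,g).$$ Moreover, for all $\Omega\in I$ and all $h\in\mathscr C^{1,\alpha}_s(\mathbb D)$, $h(re^{i\theta})=\sum_{n\ge0}h_n(r)\cos(n\theta)$, $$D_g\mathcal N(\Omega,0)h(z)=z\sum_{n\ge1}A_nz^n\quad(z\in\overline{\mathbb D}),\qquad A_n=\frac{\int_0^1 s^{n+1}h_n(s)\,ds}{2n\,(\widehat\Omega_n-\Omega)},$$ and there is a constant $C$, independent of $\Omega\in I$ and of $h$, such that $$\|D_g\mathcal N(\Omega,0)h\|_{\mathscr C^{2,\alpha}(\mathbb D)}\le C\,\|h\|_{\mathscr C^{1,\alpha}(\mathbb D)}.$$ -/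

import Mathlib

open scoped NNReal

noncomputable section

namespace RotatingVortex

/-- The closed unit disc of the complex plane. -/
abbrev closedDisc : Set ℂ := Metric.closedBall 0 1

theorem uniqueDiffOn_closedDisc : UniqueDiffOn ℝ closedDisc := by
  refine uniqueDiffOn_convex (convex_closedBall 0 1) ?_
  rw [interior_closedBall _ one_ne_zero]
  exact ⟨0, Metric.mem_ball_self one_pos⟩

section Holder

variable (k : ℕ) (α : ℝ≥0) (E : Type*) [NormedAddCommGroup E] [NormedSpace ℝ E]

/-- The functions of class `C^{k,α}` on the closed unit disc: `f` is of class `C^k` (in the real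
sense) up to the boundary and its derivative of order `k` is `α`-Hölder continuous. A function on
the closed disc is encoded as a function on `ℂ` that is `0` outside of the closed disc. -/
def holderSubmodule : Submodule ℝ (ℂ → E) where
  carrier := {f | ContDiffOn ℝ k f closedDisc ∧
    MemHolder α (closedDisc.domRestrict (iteratedFDerivWithin ℝ k f closedDisc)) ∧
    ∀ z ∉ closedDisc, f z = 0}
  zero_mem' := by
    refine ⟨contDiffOn_const, ?_, fun _ _ => rfl⟩
    have : closedDisc.domRestrict (iteratedFDerivWithin ℝ k (0 : ℂ → E) closedDisc) = 0 := by
      funext z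
      simp [Set.domRestrict_apply]
    rw [this]
    exact memHolder_zero
  add_mem' := by
    rintro f g ⟨hf, hf', hf0⟩ ⟨hg, hg', hg0⟩
    refine ⟨hf.add hg, ?_, fun z hz => by simp [hf0 z hz, hg0 z hz]⟩
    have : closedDisc.domRestrict (iteratedFDerivWithin ℝ k (f + g) closedDisc) =
        closedDisc.domRestrict (iteratedFDerivWithin ℝ k f closedDisc) +
          closedDisc.domRestrict (iteratedFDerivWithin ℝ k g closedDisc) := by
      funext z
      exact iteratedFDerivWithin_add_apply (hf z z.2) (hg z z.2) uniqueDiffOn_closedDisc z.2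
    rw [this]
    exact hf'.add hg'
  smul_mem' := by
    rintro c f ⟨hf, hf', hf0⟩
    refine ⟨contDiffOn_const.smul hf, ?_, fun z hz => by simp [hf0 z hz]⟩
    have : closedDisc.domRestrict (iteratedFDerivWithin ℝ k (c • f) closedDisc) =
        c • closedDisc.domRestrict (iteratedFDerivWithin ℝ k f closedDisc) := by
      funext z
      exact iteratedFDerivWithin_const_smul_apply (hf z z.2) uniqueDiffOn_closedDisc z.2
    rw [this]
    exact hf'.smul

/-- The Hölder space `C^{k,α}` of the closed unit disc, with values in `E`. -/
def HolderSpace : Type _ := ↥(holderSubmodule k α E)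

variable {k α E}

namespace HolderSpace

instance : AddCommGroup (HolderSpace k α E) :=
  inferInstanceAs (AddCommGroup ↥(holderSubmodule k α E))

instance : Module ℝ (HolderSpace k α E) :=
  inferInstanceAs (Module ℝ ↥(holderSubmodule k α E))

instance : CoeFun (HolderSpace k α E) (fun _ => ℂ → E) := ⟨fun f => f.1⟩

/-- The derivative of order `j`, on the closed disc. -/
def iterDeriv (j : ℕ) (f : ℂ → E) (z : closedDisc) :
    ContinuousMultilinearMap ℝ (fun _ : Fin j => ℂ) E :=
  iteratedFDerivWithin ℝ j f closedDisc z

/-- The usual norm of `C^{k,α}`: the sup norms of the derivatives of order at most `k`, plus the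
`α`-Hölder seminorm of the derivative of order `k`. -/
instance : Norm (HolderSpace k α E) :=
  ⟨fun f => (∑ j ∈ Finset.range (k + 1), ⨆ z : closedDisc, ‖iterDeriv j f z‖) +
    (nnHolderNorm α (iterDeriv k f) : ℝ)⟩

theorem norm_def (f : HolderSpace k α E) :
    ‖f‖ = (∑ j ∈ Finset.range (k + 1), ⨆ z : closedDisc, ‖iterDeriv j f z‖) +
      (nnHolderNorm α (iterDeriv k f) : ℝ) := rfl

theorem contDiffOn (f : HolderSpace k α E) : ContDiffOn ℝ k f closedDisc := f.2.1

theorem memHolder (f : HolderSpace k α E) : MemHolder α (iterDeriv k f) := f.2.2.1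

theorem apply_add (f g : HolderSpace k α E) (z : ℂ) : (f + g) z = f z + g z := rfl

theorem apply_smul (c : ℝ) (f : HolderSpace k α E) (z : ℂ) : (c • f) z = c • f z := rfl

theorem apply_zero (z : ℂ) : (0 : HolderSpace k α E) z = 0 := rfl

theorem iterDeriv_add {j : ℕ} (hj : j ≤ k) (f g : HolderSpace k α E) :
    iterDeriv j (f + g : HolderSpace k α E) = iterDeriv j f + iterDeriv j g := by
  funext z
  have hj' : (j : WithTop ℕ∞) ≤ k := by exact_mod_cast hj
  exact iteratedFDerivWithin_add_apply ((f.contDiffOn z z.2).of_le hj')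
    ((g.contDiffOn z z.2).of_le hj') uniqueDiffOn_closedDisc z.2

theorem iterDeriv_smul {j : ℕ} (hj : j ≤ k) (c : ℝ) (f : HolderSpace k α E) :
    iterDeriv j (c • f : HolderSpace k α E) = c • iterDeriv j f := by
  funext z
  have hj' : (j : WithTop ℕ∞) ≤ k := by exact_mod_cast hj
  exact iteratedFDerivWithin_const_smul_apply ((f.contDiffOn z z.2).of_le hj')
    uniqueDiffOn_closedDisc z.2

theorem bddAbove_iterDeriv {j : ℕ} (hj : j ≤ k) (f : HolderSpace k α E) :
    BddAbove (Set.range fun z : closedDisc => ‖iterDeriv j f z‖) := by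
  have hj' : (j : WithTop ℕ∞) ≤ k := by exact_mod_cast hj
  have hc : ContinuousOn (fun z => ‖iteratedFDerivWithin ℝ j f closedDisc z‖) closedDisc :=
    (f.contDiffOn.continuousOn_iteratedFDerivWithin hj' uniqueDiffOn_closedDisc).norm
  obtain ⟨M, hM⟩ := (isCompact_closedBall (0 : ℂ) 1).bddAbove_image hc
  refine ⟨M, ?_⟩
  rintro _ ⟨z, rfl⟩
  exact hM ⟨z, z.2, rfl⟩

instance : Nonempty closedDisc := ⟨⟨0, Metric.mem_closedBall_self zero_le_one⟩⟩

theorem norm_apply_le (f : HolderSpace k α E) (z : ℂ) : ‖f z‖ ≤ ‖f‖ := by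
  have hnn : ∀ j : ℕ, 0 ≤ ⨆ z : closedDisc, ‖iterDeriv j f z‖ := fun j =>
    Real.iSup_nonneg fun _ => norm_nonneg _
  have h0 : 0 ≤ ‖f‖ := by
    rw [norm_def]
    exact add_nonneg (Finset.sum_nonneg fun j _ => hnn j) (NNReal.coe_nonneg _)
  by_cases hz : z ∈ closedDisc
  · have h1 : ‖f z‖ ≤ ⨆ z : closedDisc, ‖iterDeriv 0 f z‖ := by
      have := le_ciSup (f.bddAbove_iterDeriv (Nat.zero_le k)) ⟨z, hz⟩
      simpa [iterDeriv] using this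
    have h2 : (⨆ z : closedDisc, ‖iterDeriv 0 f z‖) ≤
        ∑ j ∈ Finset.range (k + 1), ⨆ z : closedDisc, ‖iterDeriv j f z‖ :=
      Finset.single_le_sum (f := fun j => ⨆ z : closedDisc, ‖iterDeriv j f z‖)
        (fun j _ => hnn j) (Finset.mem_range.2 (Nat.succ_pos k))
    rw [norm_def]
    linarith [NNReal.coe_nonneg (nnHolderNorm α (iterDeriv k f))]
  · rw [f.2.2.2 z hz, norm_zero]
    exact h0

theorem normCore : NormedSpace.Core ℝ (HolderSpace k α E) where
  norm_nonneg f := (norm_nonneg _).trans (f.norm_apply_le 0)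
  norm_smul c f := by
    rw [norm_def, norm_def, mul_add, Finset.mul_sum]
    congr 1
    · refine Finset.sum_congr rfl fun j hj => ?_
      rw [iterDeriv_smul (Nat.lt_succ_iff.1 (Finset.mem_range.1 hj)),
        Real.mul_iSup_of_nonneg (norm_nonneg c)]
      simp [norm_smul]
    · rw [iterDeriv_smul le_rfl, f.memHolder.nnHolderNorm_smul]
      simp
  norm_triangle f g := by
    rw [norm_def, norm_def, norm_def]
    have h1 : (nnHolderNorm α (iterDeriv k (f + g : HolderSpace k α E)) : ℝ) ≤
        nnHolderNorm α (iterDeriv k f) + nnHolderNorm α (iterDeriv k g) := by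
      rw [iterDeriv_add le_rfl]
      exact_mod_cast f.memHolder.nnHolderNorm_add_le g.memHolder
    have h2 : (∑ j ∈ Finset.range (k + 1),
          ⨆ z : closedDisc, ‖iterDeriv j (f + g : HolderSpace k α E) z‖) ≤
        (∑ j ∈ Finset.range (k + 1), ⨆ z : closedDisc, ‖iterDeriv j f z‖) +
          ∑ j ∈ Finset.range (k + 1), ⨆ z : closedDisc, ‖iterDeriv j g z‖ := by
      rw [← Finset.sum_add_distrib]
      refine Finset.sum_le_sum fun j hj => ?_
      have hj' : j ≤ k := Nat.lt_succ_iff.1 (Finset.mem_range.1 hj)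
      rw [iterDeriv_add hj']
      refine ciSup_le fun z => (norm_add_le _ _).trans ?_
      exact add_le_add (le_ciSup (f.bddAbove_iterDeriv hj') z)
        (le_ciSup (g.bddAbove_iterDeriv hj') z)
    linarith
  norm_eq_zero_iff f := by
    constructor
    · intro h
      refine Subtype.ext (funext fun z => ?_)
      have := f.norm_apply_le z
      rw [h] at this
      exact norm_le_zero_iff.1 this
    · rintro rfl
      have h0 : ∀ j ≤ k, iterDeriv j (0 : HolderSpace k α E) = 0 := by
        intro j hj
        have := iterDeriv_smul hj (0 : ℝ) (0 : HolderSpace k α E)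
        simpa using this
      rw [norm_def, h0 k le_rfl, nnHolderNorm_zero, NNReal.coe_zero, add_zero]
      refine Finset.sum_eq_zero fun j hj => ?_
      rw [h0 j (Nat.lt_succ_iff.1 (Finset.mem_range.1 hj))]
      simp

instance : NormedAddCommGroup (HolderSpace k α E) := NormedAddCommGroup.ofCore normCore

instance : NormedSpace ℝ (HolderSpace k α E) := NormedSpace.ofCore normCore

end HolderSpace

end Holder

/-- `g(r e^{iθ}) = ∑_{n ≥ 0} c_n(r) cos(nθ)` in the unit disc. -/
def HasCosineExpansion (g : ℂ → ℝ) (c : ℕ → ℝ → ℝ) : Prop :=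
  ∀ r ∈ Set.Ico (0 : ℝ) 1, ∀ θ : ℝ,
    HasSum (fun n : ℕ => c n r * Real.cos (n * θ)) (g (r * Complex.exp (θ * Complex.I)))

/-- The space `C_s^{k,α}` of the real functions of class `C^{k,α}` on the disc of the form
`g(r e^{iθ}) = ∑_{n ≥ 0} g_n(r) cos(nθ)`, a normed space for the norm of `C^{k,α}`. -/
def symmHolder (k : ℕ) (α : ℝ≥0) : Submodule ℝ (HolderSpace k α ℝ) where
  carrier := {g | ∃ c, HasCosineExpansion g c}
  zero_mem' := ⟨0, fun r _ θ => by
    simp [HolderSpace.apply_zero, hasSum_zero]⟩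
  add_mem' := by
    rintro f g ⟨c, hc⟩ ⟨d, hd⟩
    refine ⟨c + d, fun r hr θ => ?_⟩
    simpa [HolderSpace.apply_add, add_mul] using (hc r hr θ).add (hd r hr θ)
  smul_mem' := by
    rintro a f ⟨c, hc⟩
    refine ⟨a • c, fun r hr θ => ?_⟩
    simpa [HolderSpace.apply_smul, mul_assoc] using (hc r hr θ).mul_left a

/-- The space `HC^{k,α}` of the functions `φ` of class `C^{k,α}` on the closed disc that are
holomorphic in the open disc, with `φ(0) = 0`, `φ'(0) = 0` and `conj (φ(z)) = φ(conj z)`; a normed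
space over `ℝ` for the norm of `C^{k,α}`. -/
def holHolder (k : ℕ) (α : ℝ≥0) : Submodule ℝ (HolderSpace k α ℂ) where
  carrier := {φ | DifferentiableOn ℂ φ (Metric.ball 0 1) ∧ φ 0 = 0 ∧ deriv φ 0 = 0 ∧
    ∀ z ∈ closedDisc, starRingEnd ℂ (φ z) = φ (starRingEnd ℂ z)}
  zero_mem' := by
    have h : ((0 : HolderSpace k α ℂ) : ℂ → ℂ) = fun _ => 0 := rfl
    refine ⟨?_, rfl, ?_, fun z _ => ?_⟩
    · rw [h]; exact differentiableOn_const 0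
    · rw [h]; exact deriv_const 0 0
    · simp [HolderSpace.apply_zero]
  add_mem' := by
    rintro f g ⟨hf, hf0, hf1, hfs⟩ ⟨hg, hg0, hg1, hgs⟩
    have h : ((f + g : HolderSpace k α ℂ) : ℂ → ℂ) = (f : ℂ → ℂ) + (g : ℂ → ℂ) := rfl
    have h0 : Metric.ball (0 : ℂ) 1 ∈ nhds (0 : ℂ) := Metric.ball_mem_nhds 0 one_pos
    refine ⟨?_, ?_, ?_, fun z hz => ?_⟩
    · rw [h]; exact hf.add hg
    · rw [HolderSpace.apply_add, hf0, hg0, add_zero]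
    · rw [h, deriv_add (hf.differentiableAt h0) (hg.differentiableAt h0), hf1, hg1, add_zero]
    · rw [HolderSpace.apply_add, HolderSpace.apply_add, map_add, hfs z hz, hgs z hz]
  smul_mem' := by
    rintro a f ⟨hf, hf0, hf1, hfs⟩
    have h : ((a • f : HolderSpace k α ℂ) : ℂ → ℂ) = a • (f : ℂ → ℂ) := rfl
    have h0 : Metric.ball (0 : ℂ) 1 ∈ nhds (0 : ℂ) := Metric.ball_mem_nhds 0 one_pos
    refine ⟨?_, ?_, ?_, fun z hz => ?_⟩
    · rw [h]; exact hf.const_smul a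
    · rw [HolderSpace.apply_smul, hf0, smul_zero]
    · rw [h, deriv_const_smul a (hf.differentiableAt h0), hf1, smul_zero]
    · rw [HolderSpace.apply_smul, HolderSpace.apply_smul, ← hfs z hz]
      simp

/-- The complex derivative of a function on the closed disc, at a point of the closed disc; on the
unit circle it is the derivative within the closed disc. -/
def discDeriv (Φ : ℂ → ℂ) (z : ℂ) : ℂ := derivWithin Φ closedDisc z

/-- The boundary functional at a point `w` of the unit circle,
`Im [(Ω conj(Φ(w)) - (1/2π) ∫_𝔻 f(y) |Φ'(y)|² / (Φ(w) - Φ(y)) dA(y)) Φ'(w) w]`,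
for the density `f` and the conformal map `Φ`. -/
def boundaryDefect (Ω : ℝ) (f : ℂ → ℝ) (Φ : ℂ → ℂ) (w : ℂ) : ℝ :=
  (((Ω : ℂ) * starRingEnd ℂ (Φ w) -
      1 / (2 * (Real.pi : ℂ)) *
        ∫ y in Metric.ball (0 : ℂ) 1,
          (f y : ℂ) / (Φ w - Φ y) * ((‖discDeriv Φ y‖ ^ 2 : ℝ) : ℂ)) *
    discDeriv Φ w * w).im

/-- The functional `F(Ω, g, φ)`, with density `f₀ + g` and conformal map `Id + φ`. -/
def boundaryF (f₀ : ℂ → ℝ) (Ω : ℝ) (g : ℂ → ℝ) (φ : ℂ → ℂ) (w : ℂ) : ℝ :=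
  boundaryDefect Ω (fun z => f₀ z + g z) (fun z => z + φ z) w

/-- `Ω̂_n = ∫₀¹ s f₀(s) ds - ((n+1)/n) ∫₀¹ s^{2n+1} f₀(s) ds`, for `n ≥ 1`. -/
def OmegaHat (f₀ : ℂ → ℝ) (n : ℕ) : ℝ :=
  (∫ s in (0 : ℝ)..1, s * f₀ (s : ℂ)) -
    ((n : ℝ) + 1) / n * ∫ s in (0 : ℝ)..1, s ^ (2 * n + 1) * f₀ (s : ℂ)

/-- The limit `Ω̂_∞ = ∫₀¹ s f₀(s) ds`. -/
def OmegaHatInfty (f₀ : ℂ → ℝ) : ℝ := ∫ s in (0 : ℝ)..1, s * f₀ (s : ℂ)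

/-- The singular set `{Ω̂_n : n ∈ {1, 2, …} ∪ {∞}}`. -/
def singularSet (f₀ : ℂ → ℝ) : Set ℝ :=
  {Ω | (∃ n : ℕ, 1 ≤ n ∧ Ω = OmegaHat f₀ n) ∨ Ω = OmegaHatInfty f₀}

/-- `A_n = ∫₀¹ s^{n+1} h_n(s) ds / (2n (Ω̂_n - Ω))`, for `n ≥ 1`. -/
def coeffA (f₀ : ℂ → ℝ) (Ω : ℝ) (h : ℕ → ℝ → ℝ) (n : ℕ) : ℝ :=
  (∫ s in (0 : ℝ)..1, s ^ (n + 1) * h n s) / (2 * n * (OmegaHat f₀ n - Ω))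

end RotatingVortex

end

set_option linter.unusedSectionVars false

open Set Filter Topology MeasureTheory

noncomputable section

/-! The unknown `φ` is traded for its second derivative `p`, which runs over `holSymm α`, the
holomorphic `α`-Hölder functions with real Taylor coefficients. Since `φ(0) = φ'(0) = 0`, the double
primitive of `p` recovers `φ`, and `holEquiv` is an isomorphism of normed spaces.

The boundary functional is the imaginary part, on the circle, of a function `G` that is holomorphic
in the disc (`boundaryDefect_eq`). For the velocity, divided differences split `Φ'(w) / (Φ(w) -
Φ(y))` into `1 / (w - y)` and a regular kernel, holomorphic in `w`. On `|w| = 1` the quotient `w /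
(w - y)` is the conjugate of `1 / (1 - w ȳ)`; the density `f |Φ'|²` is real, so up to the sign of
the imaginary part the singular term is a Cauchy integral that is holomorphic in `w`. For the
rotation, `Im (w Φ' conj Φ)` is the imaginary part of the Cauchy integral of an explicit density
(`im_mul_deriv_mul_conj`). By the maximum principle and the symmetry, `Im G = 0` on the circle if
and only if `G' = 0` (`boundary_iff_defect_eq_zero`).

The equation is thus `defect Ω r p = 0` with `r = f₀ + g`. It is affine in `Ω` and loses no
derivative: `G'` is made of products, an inverse in the Banach algebra `HolderAlg`, the Bergman
projection and weakly singular integrals, all bounded on Hölder functions. So it is smooth near `p =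
0`.

As `f₀` is radial, `p = 0` solves the equation with `g = 0` for every `Ω`. There the linearization
in `p` is diagonal on Taylor coefficients, with symbol `(k + 1) / (k + 2) * (Ω - Ω̂_{k+1})`
(`linearization_comp`). Off the compact singular set the symbol is at least a multiple of `1 + |Ω|`.
Its inverse is `(Ω - Ω̂_∞)⁻¹` plus a sequence of size `O(1 / (k + 1))`; such a sequence consists of
Fourier coefficients of an integrable function, so the remainder is an average of rotations and is
bounded on Hölder functions (`exists_multiplier`). Identities between operators on `holSymm α` are
checked on powers of `z`: polynomials are dense for the sup norm, and the functionals involved are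
bounded for that norm.

A contraction argument with this inverse, uniform in `Ω` although `I` may be unbounded, gives the
solution map (`exists_uniform_implicitFunction`). Differentiating the equation gives its derivative:
the Taylor coefficients of `p`, divided by `(k + 1)(k + 2)`, are the numbers `A_{k+1}`, and the
bound on the inverse is the final estimate. -/

namespace RotatingVortex

/-! ### The Banach algebra of bounded Hölder functions -/

section HolderAlg

variable (α : ℝ≥0) (S : Type*) [MetricSpace S]

/-- The bounded `α`-Hölder functions `S → ℂ`. -/
def holderSubalgebra : Subalgebra ℝ (S → ℂ) where
  carrier := {f | ∃ K, (∀ x, ‖f x‖ ≤ K) ∧ ∀ x y, ‖f x - f y‖ ≤ K * dist x y ^ (α : ℝ)}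
  add_mem' := by
    rintro f g ⟨K, h1, h2⟩ ⟨L, h3, h4⟩
    refine ⟨K + L, fun x => (norm_add_le _ _).trans (add_le_add (h1 x) (h3 x)), fun x y => ?_⟩
    rw [show (f + g) x - (f + g) y = (f x - f y) + (g x - g y) by simp; ring, add_mul]
    exact (norm_add_le _ _).trans (add_le_add (h2 x y) (h4 x y))
  mul_mem' := by
    rintro f g ⟨K, h1, h2⟩ ⟨L, h3, h4⟩
    refine ⟨max (K * L) (2 * (K * L)), fun x => le_max_of_le_left ?_, fun x y => ?_⟩
    · rw [Pi.mul_apply, norm_mul]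
      exact mul_le_mul (h1 x) (h3 x) (norm_nonneg _) ((norm_nonneg _).trans (h1 x))
    · have hK := (norm_nonneg _).trans (h1 x)
      have e : (f * g) x - (f * g) y = f x * (g x - g y) + (f x - f y) * g y := by simp; ring
      rw [e]
      have hd : 0 ≤ dist x y ^ (α : ℝ) := by positivity
      calc _ ≤ ‖f x‖ * ‖g x - g y‖ + ‖f x - f y‖ * ‖g y‖ := by
            rw [← norm_mul, ← norm_mul]; exact norm_add_le _ _
        _ ≤ K * (L * dist x y ^ (α : ℝ)) + (K * dist x y ^ (α : ℝ)) * L :=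
            add_le_add (mul_le_mul (h1 x) (h4 x y) (norm_nonneg _) hK)
              (mul_le_mul (h2 x y) (h3 y) (norm_nonneg _) (by positivity))
        _ = 2 * (K * L) * dist x y ^ (α : ℝ) := by ring
        _ ≤ _ := mul_le_mul_of_nonneg_right (le_max_right _ _) hd
  algebraMap_mem' := by
    intro r
    refine ⟨‖r‖, fun x => by simp, fun x y => ?_⟩
    have : 0 ≤ ‖r‖ * dist x y ^ (α : ℝ) := by positivity
    simpa using this

/-- The Banach algebra of the bounded `α`-Hölder functions `S → ℂ`. -/
def HolderAlg : Type _ := ↥(holderSubalgebra α S)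

variable {α S}

namespace HolderAlg

instance : CommRing (HolderAlg α S) := inferInstanceAs (CommRing ↥(holderSubalgebra α S))

instance : Algebra ℝ (HolderAlg α S) := inferInstanceAs (Algebra ℝ ↥(holderSubalgebra α S))

instance : FunLike (HolderAlg α S) S ℂ := ⟨fun f => f.1, Subtype.val_injective⟩

@[ext] theorem ext_fun {f g : HolderAlg α S} (h : ∀ x, f x = g x) : f = g :=
  DFunLike.ext f g h

@[simp] theorem add_apply (f g : HolderAlg α S) (x : S) : (f + g) x = f x + g x := rfl
@[simp] theorem sub_apply (f g : HolderAlg α S) (x : S) : (f - g) x = f x - g x := rfl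
@[simp] theorem neg_apply (f : HolderAlg α S) (x : S) : (-f) x = -f x := rfl
@[simp] theorem mul_apply (f g : HolderAlg α S) (x : S) : (f * g) x = f x * g x := rfl
@[simp] theorem smul_apply (c : ℝ) (f : HolderAlg α S) (x : S) : (c • f) x = c • f x := rfl
@[simp] theorem zero_apply (x : S) : (0 : HolderAlg α S) x = 0 := rfl
@[simp] theorem one_apply (x : S) : (1 : HolderAlg α S) x = 1 := rfl

/-- The sup norm. -/
def supNorm (f : HolderAlg α S) : ℝ := ⨆ x, ‖f x‖

/-- The Hölder seminorm. -/
def semiNorm (f : HolderAlg α S) : ℝ :=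
  ⨆ q : S × S, ‖f q.1 - f q.2‖ / dist q.1 q.2 ^ (α : ℝ)

/-- The sum, rather than the maximum, is submultiplicative with constant one: by the Leibniz rule
the product of two such norms exceeds the bound needed by the product of the seminorms. -/
instance : Norm (HolderAlg α S) := ⟨fun f => supNorm f + semiNorm f⟩

theorem norm_def (f : HolderAlg α S) : ‖f‖ = supNorm f + semiNorm f := rfl

theorem supNorm_nonneg (f : HolderAlg α S) : 0 ≤ supNorm f :=
  Real.iSup_nonneg fun _ => norm_nonneg _

theorem semiNorm_nonneg (f : HolderAlg α S) : 0 ≤ semiNorm f :=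
  Real.iSup_nonneg fun _ => by positivity

theorem norm_apply_le_supNorm (f : HolderAlg α S) (x : S) : ‖f x‖ ≤ supNorm f := by
  obtain ⟨K, h, -⟩ := f.2
  exact le_ciSup (f := fun x => ‖f x‖) ⟨K, by rintro _ ⟨x, rfl⟩; exact h x⟩ x

theorem norm_sub_le_semiNorm (f : HolderAlg α S) (x y : S) :
    ‖f x - f y‖ ≤ semiNorm f * dist x y ^ (α : ℝ) := by
  obtain ⟨K, h0, h⟩ := f.2
  have hK : 0 ≤ K := (norm_nonneg _).trans (h0 x)
  rcases eq_or_ne x y with rfl | hxy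
  · simpa using mul_nonneg (semiNorm_nonneg f) (Real.rpow_nonneg (le_refl (0 : ℝ)) (α : ℝ))
  · have hd : 0 < dist x y ^ (α : ℝ) := Real.rpow_pos_of_pos (dist_pos.2 hxy) _
    rw [← div_le_iff₀ hd]
    refine le_ciSup (f := fun q : S × S => ‖f q.1 - f q.2‖ / dist q.1 q.2 ^ (α : ℝ)) ⟨K, ?_⟩ (x, y)
    rintro _ ⟨q, rfl⟩
    exact div_le_of_le_mul₀ (by positivity) hK (h q.1 q.2)

theorem supNorm_le_norm (f : HolderAlg α S) : supNorm f ≤ ‖f‖ :=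
  le_add_of_nonneg_right (semiNorm_nonneg f)

theorem semiNorm_le_norm (f : HolderAlg α S) : semiNorm f ≤ ‖f‖ :=
  le_add_of_nonneg_left (supNorm_nonneg f)

theorem norm_nonneg' (f : HolderAlg α S) : 0 ≤ ‖f‖ :=
  add_nonneg (supNorm_nonneg f) (semiNorm_nonneg f)

theorem norm_apply_le (f : HolderAlg α S) (x : S) : ‖f x‖ ≤ ‖f‖ :=
  (f.norm_apply_le_supNorm x).trans f.supNorm_le_norm

theorem norm_sub_le (f : HolderAlg α S) (x y : S) : ‖f x - f y‖ ≤ ‖f‖ * dist x y ^ (α : ℝ) :=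
  (f.norm_sub_le_semiNorm x y).trans
    (mul_le_mul_of_nonneg_right f.semiNorm_le_norm (by positivity))

theorem supNorm_le {f : HolderAlg α S} {a : ℝ} (ha : 0 ≤ a) (h : ∀ x, ‖f x‖ ≤ a) :
    supNorm f ≤ a := Real.iSup_le h ha

theorem semiNorm_le {f : HolderAlg α S} {a : ℝ} (ha : 0 ≤ a)
    (h : ∀ x y, ‖f x - f y‖ ≤ a * dist x y ^ (α : ℝ)) : semiNorm f ≤ a :=
  Real.iSup_le (fun q => div_le_of_le_mul₀ (by positivity) ha (h q.1 q.2)) ha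

theorem norm_le {f : HolderAlg α S} {a b : ℝ} (ha : 0 ≤ a) (hb : 0 ≤ b) (h : ∀ x, ‖f x‖ ≤ a)
    (h' : ∀ x y, ‖f x - f y‖ ≤ b * dist x y ^ (α : ℝ)) : ‖f‖ ≤ a + b :=
  add_le_add (supNorm_le ha h) (semiNorm_le hb h')

theorem supNorm_add (f g : HolderAlg α S) : supNorm (f + g) ≤ supNorm f + supNorm g :=
  supNorm_le (add_nonneg f.supNorm_nonneg g.supNorm_nonneg) fun x =>
    (norm_add_le _ _).trans (add_le_add (f.norm_apply_le_supNorm x) (g.norm_apply_le_supNorm x))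

theorem semiNorm_add (f g : HolderAlg α S) : semiNorm (f + g) ≤ semiNorm f + semiNorm g :=
  semiNorm_le (add_nonneg f.semiNorm_nonneg g.semiNorm_nonneg) fun x y => by
    rw [add_apply, add_apply, add_sub_add_comm, add_mul]
    exact (norm_add_le _ _).trans
      (add_le_add (f.norm_sub_le_semiNorm x y) (g.norm_sub_le_semiNorm x y))

theorem norm_smul_le' (c : ℝ) (f : HolderAlg α S) : ‖c • f‖ ≤ ‖c‖ * ‖f‖ := by
  rw [norm_def f, mul_add]
  refine norm_le (mul_nonneg (norm_nonneg c) f.supNorm_nonneg)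
    (mul_nonneg (norm_nonneg c) f.semiNorm_nonneg) (fun x => ?_) fun x y => ?_
  · rw [smul_apply, norm_smul]
    exact mul_le_mul_of_nonneg_left (f.norm_apply_le_supNorm x) (norm_nonneg c)
  · rw [smul_apply, smul_apply, ← smul_sub, norm_smul, mul_assoc]
    exact mul_le_mul_of_nonneg_left (f.norm_sub_le_semiNorm x y) (norm_nonneg c)

theorem normCore : NormedSpace.Core ℝ (HolderAlg α S) where
  norm_nonneg f := norm_nonneg' f
  norm_smul c f := by
    refine le_antisymm (norm_smul_le' c f) ?_
    rcases eq_or_ne c 0 with rfl | hc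
    · simpa using norm_nonneg' ((0 : ℝ) • f)
    · have := norm_smul_le' c⁻¹ (c • f)
      rw [smul_smul, inv_mul_cancel₀ hc, one_smul, norm_inv] at this
      rwa [← div_eq_inv_mul, le_div_iff₀ (norm_pos_iff.2 hc), mul_comm] at this
  norm_triangle f g := by
    rw [norm_def, norm_def, norm_def]
    linarith [supNorm_add f g, semiNorm_add f g]
  norm_eq_zero_iff f := by
    constructor
    · intro h
      ext x
      have := f.norm_apply_le x
      rw [h] at this
      exact norm_le_zero_iff.1 this
    · rintro rfl
      refine le_antisymm ?_ (norm_nonneg' _)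
      have := norm_le (f := (0 : HolderAlg α S)) le_rfl le_rfl (by simp) (by simp)
      simpa using this

/-- The additive normed group structure, from which the normed ring structure is built. -/
abbrev normedAddCommGroup : NormedAddCommGroup (HolderAlg α S) := NormedAddCommGroup.ofCore normCore

theorem norm_mul_le' (f g : HolderAlg α S) : ‖f * g‖ ≤ ‖f‖ * ‖g‖ := by
  have h1 := f.supNorm_nonneg
  have h2 := g.supNorm_nonneg
  have h3 := f.semiNorm_nonneg
  have h4 := g.semiNorm_nonneg
  have : ‖f * g‖ ≤ supNorm f * supNorm g + (supNorm f * semiNorm g + semiNorm f * supNorm g) := by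
    refine norm_le (by positivity) (by positivity) (fun x => ?_) fun x y => ?_
    · rw [mul_apply, norm_mul]
      exact mul_le_mul (f.norm_apply_le_supNorm x) (g.norm_apply_le_supNorm x) (norm_nonneg _) h1
    · have e : (f * g) x - (f * g) y = f x * (g x - g y) + (f x - f y) * g y := by
        rw [mul_apply, mul_apply]; ring
      rw [e]
      calc _ ≤ ‖f x‖ * ‖g x - g y‖ + ‖f x - f y‖ * ‖g y‖ := by
            rw [← norm_mul, ← norm_mul]; exact norm_add_le _ _
        _ ≤ supNorm f * (semiNorm g * dist x y ^ (α : ℝ)) +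
            (semiNorm f * dist x y ^ (α : ℝ)) * supNorm g :=
            add_le_add (mul_le_mul (f.norm_apply_le_supNorm x) (g.norm_sub_le_semiNorm x y)
              (norm_nonneg _) h1) (mul_le_mul (f.norm_sub_le_semiNorm x y)
                (g.norm_apply_le_supNorm y) (norm_nonneg _) (by positivity))
        _ = _ := by ring
  rw [norm_def f, norm_def g]
  nlinarith [mul_nonneg h3 h4]

instance : NormedCommRing (HolderAlg α S) :=
  { normedAddCommGroup, (inferInstance : CommRing (HolderAlg α S)) with
    norm_mul_le := norm_mul_le' }

instance : NormedAlgebra ℝ (HolderAlg α S) :=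
  { (inferInstance : Algebra ℝ (HolderAlg α S)) with
    norm_smul_le := fun c f => norm_smul_le' c f }

theorem continuous_coe [Fact (0 < α)] (f : HolderAlg α S) : Continuous f := by
  have : HolderWith ‖f‖.toNNReal α (f : S → ℂ) := fun x y => by
    rw [edist_dist, edist_dist, dist_eq_norm]
    have hα : (0 : ℝ) ≤ α := α.2
    rw [ENNReal.ofReal_rpow_of_nonneg dist_nonneg hα]
    have : ((‖f‖.toNNReal : ℝ≥0) : ENNReal) = ENNReal.ofReal ‖f‖ := rfl
    rw [this, ← ENNReal.ofReal_mul (norm_nonneg f)]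
    exact ENNReal.ofReal_le_ofReal (f.norm_sub_le x y)
  exact this.continuous (Fact.out : 0 < α)

/-- A Hölder function, from the bounds. -/
def mk' (f : S → ℂ) (K : ℝ) (h1 : ∀ x, ‖f x‖ ≤ K)
    (h2 : ∀ x y, ‖f x - f y‖ ≤ K * dist x y ^ (α : ℝ)) : HolderAlg α S := ⟨f, K, h1, h2⟩

@[simp] theorem mk'_apply (f : S → ℂ) (K : ℝ) (h1 : ∀ x, ‖f x‖ ≤ K)
    (h2 : ∀ x y, ‖f x - f y‖ ≤ K * dist x y ^ (α : ℝ)) (x : S) :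
    mk' f K h1 h2 x = f x := rfl

/-- Both bounds that define the algebra survive pointwise limits. Hence the pointwise limit of a
Cauchy sequence belongs to the algebra, and the same remark applied to `u n - u m` gives convergence
in norm. -/
instance : CompleteSpace (HolderAlg α S) := by
  refine Metric.complete_of_cauchySeq_tendsto fun u hu => ?_
  have hpt : ∀ x, ∃ l, Tendsto (fun n => u n x) atTop (𝓝 l) := fun x => by
    refine cauchySeq_tendsto_of_complete ?_
    refine Metric.cauchySeq_iff.2 fun ε hε => ?_
    obtain ⟨N, hN⟩ := Metric.cauchySeq_iff.1 hu ε hε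
    refine ⟨N, fun m hm n hn => lt_of_le_of_lt ?_ (hN m hm n hn)⟩
    rw [dist_eq_norm, dist_eq_norm, ← sub_apply]
    exact norm_apply_le _ x
  choose l hl using hpt
  obtain ⟨K, hK⟩ := hu.norm_bddAbove
  have hK' : ∀ n, ‖u n‖ ≤ K := fun n => hK ⟨n, rfl⟩
  let f : HolderAlg α S := mk' l K
    (fun x => le_of_tendsto (hl x).norm (Eventually.of_forall fun n =>
      ((u n).norm_apply_le x).trans (hK' n)))
    (fun x y => le_of_tendsto ((hl x).sub (hl y)).norm (Eventually.of_forall fun n =>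
      ((u n).norm_sub_le x y).trans (mul_le_mul_of_nonneg_right (hK' n) (by positivity))))
  refine ⟨f, Metric.tendsto_atTop.2 fun ε hε => ?_⟩
  obtain ⟨N, hN⟩ := Metric.cauchySeq_iff.1 hu (ε / 4) (by positivity)
  refine ⟨N, fun n hn => ?_⟩
  have key : ∀ m ≥ N, ‖u n - u m‖ ≤ ε / 4 := fun m hm => by
    rw [← dist_eq_norm]; exact (hN n hn m hm).le
  rw [dist_eq_norm]
  have : ‖u n - f‖ ≤ ε / 4 + ε / 4 := by
    refine norm_le (by positivity) (by positivity) (fun x => ?_) fun x y => ?_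
    · refine le_of_tendsto (tendsto_const_nhds.sub (hl x)).norm
        (eventually_atTop.2 ⟨N, fun m hm => ?_⟩)
      exact (norm_apply_le (u n - u m) x).trans (key m hm)
    · refine le_of_tendsto ((tendsto_const_nhds.sub (hl x)).sub
        (tendsto_const_nhds.sub (hl y))).norm (eventually_atTop.2 ⟨N, fun m hm => ?_⟩)
      exact (norm_sub_le (u n - u m) x y).trans
        (mul_le_mul_of_nonneg_right (key m hm) (by positivity))
  linarith

end HolderAlg

end HolderAlg

/-! ### Area integrals on the disc and estimates of kernels -/

section DiscArea

/-- The normalized area measure of the unit disc. -/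
def discArea : Measure ℂ := ENNReal.ofReal Real.pi⁻¹ • volume.restrict (Metric.ball (0 : ℂ) 1)

instance : IsProbabilityMeasure discArea := by
  refine ⟨?_⟩
  rw [discArea, Measure.smul_apply, Measure.restrict_apply_univ, Complex.volume_ball]
  simp only [ENNReal.ofReal_one, one_pow, one_mul, smul_eq_mul]
  rw [← ENNReal.ofReal_coe_nnreal, NNReal.coe_real_pi, ← ENNReal.ofReal_mul (by positivity),
    inv_mul_cancel₀ Real.pi_ne_zero, ENNReal.ofReal_one]

theorem integral_discArea (u : ℂ → ℂ) :
    ∫ y, u y ∂discArea = (Real.pi : ℂ)⁻¹ * ∫ y in Metric.ball (0 : ℂ) 1, u y := by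
  rw [discArea, integral_smul_measure, ENNReal.toReal_ofReal (by positivity)]
  simp [Complex.real_smul]

theorem integral_discArea_real (u : ℂ → ℝ) :
    ∫ y, u y ∂discArea = Real.pi⁻¹ * ∫ y in Metric.ball (0 : ℂ) 1, u y := by
  rw [discArea, integral_smul_measure, ENNReal.toReal_ofReal (by positivity), smul_eq_mul]

theorem ae_discArea : ∀ᵐ y ∂discArea, y ∈ Metric.ball (0 : ℂ) 1 :=
  Measure.ae_smul_measure (ae_restrict_mem Metric.isOpen_ball.measurableSet) _

theorem ae_discArea_ne (z : ℂ) : ∀ᵐ y ∂discArea, y ≠ z := by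
  refine Measure.ae_smul_measure (ae_restrict_of_ae ?_) _
  simp [ae_iff]

theorem integrable_discArea_iff {E : Type*} [NormedAddCommGroup E] {u : ℂ → E} :
    Integrable u discArea ↔ IntegrableOn u (Metric.ball 0 1) := by
  rw [discArea, integrable_smul_measure (by positivity) ENNReal.ofReal_ne_top]
  rfl

/-- A continuous function is integrable on the disc. -/
theorem integrable_discArea_of_continuous {u : ℂ → ℂ} (hu : Continuous u) :
    Integrable u discArea := by
  rw [integrable_discArea_iff]
  exact (hu.continuousOn.integrableOn_compact (isCompact_closedBall 0 1)).mono_set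
    Metric.ball_subset_closedBall

theorem integrable_discArea_of_bound {u : ℂ → ℂ} {K : ℝ} (hm : AEStronglyMeasurable u discArea)
    (hu : ∀ y ∈ Metric.ball (0 : ℂ) 1, ‖u y‖ ≤ K) : Integrable u discArea :=
  (integrable_const K).mono' hm (ae_discArea.mono hu)

/-- The area integral is invariant under the complex conjugation. -/
theorem integral_discArea_conj (u : ℂ → ℂ) :
    ∫ y, u (starRingEnd ℂ y) ∂discArea = ∫ y, u y ∂discArea := by
  rw [integral_discArea, integral_discArea]
  congr 1
  have h := Complex.conjLIE.measurePreserving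
  have := h.setIntegral_preimage_emb Complex.conjLIE.toHomeomorph.measurableEmbedding u
    (Metric.ball 0 1)
  have hpre : (Complex.conjLIE : ℂ → ℂ) ⁻¹' Metric.ball 0 1 = Metric.ball 0 1 := by
    ext z; simp
  rw [hpre] at this
  exact this

theorem integrableOn_norm_inv : IntegrableOn (fun u : ℂ => ‖u‖⁻¹) (Metric.ball 0 2) := by
  refine integrableOn_ball_of_norm_le_rpow (C := 1) (α := 1) (by simp) (by simp) ?_ ?_
  · refine Eventually.of_forall fun x => ?_
    simp [Real.rpow_neg_one]
  · exact (measurable_norm.inv).aestronglyMeasurable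

theorem integrable_norm_sub_inv {z : ℂ} (hz : ‖z‖ ≤ 1) :
    Integrable (fun y => ‖y - z‖⁻¹) discArea := by
  rw [integrable_discArea_iff]
  have h := integrableOn_norm_inv
  have hm := measurePreserving_sub_right (volume : Measure ℂ) z
  have := (hm.integrableOn_comp_preimage (MeasurableEquiv.subRight z).measurableEmbedding).2 h
  refine this.mono_set fun y hy => ?_
  simp only [mem_preimage, Metric.mem_ball, dist_zero_right] at hy ⊢
  exact (norm_sub_le _ _).trans_lt (by linarith)

/-- A bound of the area integrals of `1 / |y - z|`. -/
def cauchyConst : ℝ := Real.pi⁻¹ * ∫ u in Metric.ball (0 : ℂ) 2, ‖u‖⁻¹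

/-- Translation by `z` carries the unit disc into the disc of radius `2`, so one constant serves all
`z`. -/
theorem integral_norm_sub_inv_le {z : ℂ} (hz : ‖z‖ ≤ 1) :
    ∫ y, ‖y - z‖⁻¹ ∂discArea ≤ cauchyConst := by
  rw [integral_discArea_real, cauchyConst]
  refine mul_le_mul_of_nonneg_left ?_ (by positivity)
  have hm := measurePreserving_sub_right (volume : Measure ℂ) z
  have he := (MeasurableEquiv.subRight z).measurableEmbedding
  have h1 := hm.setIntegral_preimage_emb he (fun u : ℂ => ‖u‖⁻¹) (Metric.ball 0 2)
  have h2 := (hm.integrableOn_comp_preimage he).2 integrableOn_norm_inv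
  rw [← h1]
  refine setIntegral_mono_set h2 (Eventually.of_forall fun _ => by positivity) ?_
  refine LE.le.eventuallyLE fun y hy => ?_
  simp only [mem_preimage, Metric.mem_ball, dist_zero_right] at hy ⊢
  exact (norm_sub_le _ _).trans_lt (by linarith)

theorem cauchyConst_nonneg : 0 ≤ cauchyConst :=
  mul_nonneg (by positivity) (integral_nonneg fun _ => by positivity)

/-- The last term is nonnegative on the disc, so `|1 - z ȳ|` dominates `|y - z|`. This lets Hölder
increments absorb part of the singularity of the kernels. -/
theorem norm_one_sub_mul_conj_sq (z y : ℂ) :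
    ‖1 - z * starRingEnd ℂ y‖ ^ 2 = ‖y - z‖ ^ 2 + (1 - ‖z‖ ^ 2) * (1 - ‖y‖ ^ 2) := by
  rw [← Complex.normSq_eq_norm_sq, ← Complex.normSq_eq_norm_sq, ← Complex.normSq_eq_norm_sq,
    ← Complex.normSq_eq_norm_sq]
  simp only [Complex.normSq_apply, Complex.sub_re, Complex.sub_im, Complex.mul_re, Complex.mul_im,
    Complex.conj_re, Complex.conj_im, Complex.one_re, Complex.one_im]
  ring

theorem norm_sub_le_norm_one_sub {z y : ℂ} (hz : ‖z‖ ≤ 1) (hy : ‖y‖ ≤ 1) :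
    ‖y - z‖ ≤ ‖1 - z * starRingEnd ℂ y‖ := by
  have h := norm_one_sub_mul_conj_sq z y
  have h1 : 0 ≤ (1 - ‖z‖ ^ 2) * (1 - ‖y‖ ^ 2) :=
    mul_nonneg (by nlinarith [norm_nonneg z]) (by nlinarith [norm_nonneg y])
  exact le_of_sq_le_sq (by linarith) (norm_nonneg _)
where
  le_of_sq_le_sq {a b : ℝ} (h : a ^ 2 ≤ b ^ 2) (hb : 0 ≤ b) : a ≤ b :=
    (abs_le_of_sq_le_sq' h hb).2

theorem one_sub_norm_le {z y : ℂ} (hy : ‖y‖ ≤ 1) :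
    1 - ‖z‖ ≤ ‖1 - z * starRingEnd ℂ y‖ := by
  have h := norm_sub_norm_le (1 : ℂ) (z * starRingEnd ℂ y)
  rw [norm_mul, RCLike.norm_conj, norm_one] at h
  nlinarith [norm_nonneg z]

/-- The Forelli–Rudin estimate. -/
theorem exists_integral_kernel_le {a : ℝ} (ha : a < 1) :
    ∃ K, 0 ≤ K ∧ ∀ z : ℂ, ‖z‖ < 1 →
      ∫ y, ‖1 - z * starRingEnd ℂ y‖ ^ (a - 3) ∂discArea ≤ K * (1 - ‖z‖) ^ (a - 1) := by
  -- The exponent `3 - a` exceeds the real dimension `2` of the plane. The integral over the disc is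
  -- compared with this one by the scaling `u = (y - z) / d`, which contributes `d ^ (a - 3) * d ^
  -- 2`.
  have hint : Integrable (fun u : ℂ => (1 + ‖u‖) ^ (-(3 - a))) :=
    integrable_one_add_norm (by simp; linarith)
  set c := ∫ u : ℂ, (1 + ‖u‖) ^ (-(3 - a)) with hc
  have hc0 : 0 ≤ c := integral_nonneg fun u => by positivity
  refine ⟨Real.pi⁻¹ * ((2 : ℝ) ^ (3 - a) * c), by positivity, fun z hz => ?_⟩
  set d := 1 - ‖z‖ with hd
  have hd0 : 0 < d := by linarith
  have hI : Integrable (fun y : ℂ => (1 + ‖d⁻¹ • (y - z)‖) ^ (-(3 - a))) :=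
    (hint.comp_smul (inv_ne_zero hd0.ne')).comp_sub_right z
  have hval : ∫ y : ℂ, (1 + ‖d⁻¹ • (y - z)‖) ^ (-(3 - a)) = d ^ 2 * c := by
    rw [integral_sub_right_eq_self (fun y : ℂ => (1 + ‖d⁻¹ • y‖) ^ (-(3 - a))) z,
      Measure.integral_comp_inv_smul_of_nonneg _ (fun u : ℂ => (1 + ‖u‖) ^ (-(3 - a))) hd0.le]
    simp [hc]
  rw [integral_discArea_real, mul_assoc]
  refine mul_le_mul_of_nonneg_left ?_ (by positivity)
  have hle : ∀ y ∈ Metric.ball (0 : ℂ) 1, ‖1 - z * starRingEnd ℂ y‖ ^ (a - 3) ≤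
      2 ^ (3 - a) * d ^ (a - 3) * (1 + ‖d⁻¹ • (y - z)‖) ^ (-(3 - a)) := by
    intro y hy
    have hy1 : ‖y‖ ≤ 1 := by simpa using (Metric.mem_ball.1 hy).le
    have h1 := norm_sub_le_norm_one_sub hz.le hy1
    have h2 := one_sub_norm_le (z := z) hy1
    -- The mean of the two lower bounds `d` and `|y - z|` of `|1 - z ȳ|` has the homogeneity that
    -- the scaling requires.
    have h3 : d * (1 + ‖d⁻¹ • (y - z)‖) / 2 ≤ ‖1 - z * starRingEnd ℂ y‖ := by
      rw [norm_smul, mul_add, ← mul_assoc, Real.norm_of_nonneg (by positivity),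
        mul_inv_cancel₀ hd0.ne']
      linarith
    have h4 : ‖1 - z * starRingEnd ℂ y‖ ^ (a - 3) ≤
        (d * (1 + ‖d⁻¹ • (y - z)‖) / 2) ^ (a - 3) :=
      Real.rpow_le_rpow_of_nonpos (by positivity) h3 (by linarith)
    refine h4.trans (le_of_eq ?_)
    rw [Real.div_rpow (by positivity) (by positivity), Real.mul_rpow hd0.le (by positivity),
      show a - 3 = -(3 - a) by ring, Real.rpow_neg zero_le_two]
    field_simp
  calc ∫ y in Metric.ball (0 : ℂ) 1, ‖1 - z * starRingEnd ℂ y‖ ^ (a - 3)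
      ≤ ∫ y in Metric.ball (0 : ℂ) 1,
          2 ^ (3 - a) * d ^ (a - 3) * (1 + ‖d⁻¹ • (y - z)‖) ^ (-(3 - a)) := by
        refine integral_mono_of_nonneg (Eventually.of_forall fun _ => by positivity)
          (hI.const_mul _).integrableOn ?_
        exact (ae_restrict_mem Metric.isOpen_ball.measurableSet).mono hle
    _ ≤ ∫ y : ℂ, 2 ^ (3 - a) * d ^ (a - 3) * (1 + ‖d⁻¹ • (y - z)‖) ^ (-(3 - a)) :=
        setIntegral_le_integral (hI.const_mul _) (Eventually.of_forall fun _ => by positivity)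
    _ = 2 ^ (3 - a) * c * d ^ (a - 1) := by
        rw [integral_const_mul, hval, show a - 1 = (a - 3) + 2 by ring, Real.rpow_add hd0,
          Real.rpow_two]
        ring

theorem integrable_discArea_of_continuousOn {u : ℂ → ℂ} {K : ℝ}
    (hc : ContinuousOn u (Metric.ball 0 1)) (hu : ∀ y ∈ Metric.ball (0 : ℂ) 1, ‖u y‖ ≤ K) :
    Integrable u discArea := by
  rw [integrable_discArea_iff]
  exact Integrable.mono' (g := fun _ => K) (integrableOn_const (by simp))
    (hc.aestronglyMeasurable Metric.isOpen_ball.measurableSet)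
    ((ae_restrict_mem Metric.isOpen_ball.measurableSet).mono hu)

/-- Polar coordinates in the disc. -/
theorem integral_discArea_polar {u : ℂ → ℂ} {K : ℝ} (hc : ContinuousOn u (Metric.ball 0 1))
    (hu : ∀ y ∈ Metric.ball (0 : ℂ) 1, ‖u y‖ ≤ K) :
    ∫ y, u y ∂discArea = (Real.pi : ℂ)⁻¹ * ∫ r in (0 : ℝ)..1,
      (r : ℂ) * ∫ θ in (-Real.pi)..Real.pi, u (r * Complex.exp (θ * Complex.I)) := by
  have hpi : -Real.pi ≤ Real.pi := by linarith [Real.pi_pos]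
  rw [integral_discArea]
  congr 1
  rw [← integral_indicator Metric.isOpen_ball.measurableSet,
    ← Complex.integral_comp_polarCoord_symm]
  have hmap : ∀ p : ℝ × ℝ, Complex.polarCoord.symm p = p.1 * Complex.exp (p.2 * Complex.I) := by
    intro p
    rw [Complex.polarCoord_symm_apply, Complex.exp_mul_I]
    push_cast
    ring
  have hset : Ioo (0 : ℝ) 1 ×ˢ Ioo (-Real.pi) Real.pi ⊆ polarCoord.target := by
    rw [polarCoord_target]
    exact prod_mono Ioo_subset_Ioi_self subset_rfl
  have hnorm : ∀ p ∈ Ioo (0 : ℝ) 1 ×ˢ Ioo (-Real.pi) Real.pi,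
      (p.1 * Complex.exp (p.2 * Complex.I) : ℂ) ∈ Metric.ball (0 : ℂ) 1 := by
    rintro p ⟨⟨h0, h1⟩, -⟩
    simpa [Complex.norm_exp_ofReal_mul_I, abs_of_pos h0] using h1
  have hms : MeasurableSet (Ioo (0 : ℝ) 1 ×ˢ Ioo (-Real.pi) Real.pi) :=
    (isOpen_Ioo.prod isOpen_Ioo).measurableSet
  have e1 : ∫ p in polarCoord.target,
      p.1 • (Metric.ball (0 : ℂ) 1).indicator u (Complex.polarCoord.symm p) =
      ∫ p in Ioo (0 : ℝ) 1 ×ˢ Ioo (-Real.pi) Real.pi,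
        (p.1 : ℂ) * u (p.1 * Complex.exp (p.2 * Complex.I)) := by
    have e2 : ∫ p in Ioo (0 : ℝ) 1 ×ˢ Ioo (-Real.pi) Real.pi,
        (p.1 : ℂ) * u (p.1 * Complex.exp (p.2 * Complex.I)) =
        ∫ p in Ioo (0 : ℝ) 1 ×ˢ Ioo (-Real.pi) Real.pi,
          p.1 • (Metric.ball (0 : ℂ) 1).indicator u (Complex.polarCoord.symm p) := by
      refine setIntegral_congr_fun hms fun p hp => ?_
      simp only [hmap]
      rw [indicator_of_mem (hnorm p hp), Complex.real_smul]
    rw [e2]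
    refine setIntegral_eq_of_subset_of_forall_sdiff_eq_zero
      polarCoord.open_target.measurableSet hset ?_
    · rintro p ⟨hp, hp'⟩
      rw [polarCoord_target] at hp
      rw [indicator_of_notMem, smul_zero]
      intro h
      refine hp' ⟨⟨hp.1, ?_⟩, hp.2⟩
      rw [hmap] at h
      simpa [Complex.norm_exp_ofReal_mul_I, abs_of_pos (show 0 < p.1 from hp.1)] using h
  rw [e1, Measure.volume_eq_prod, setIntegral_prod]
  · rw [intervalIntegral.integral_of_le zero_le_one, integral_Ioc_eq_integral_Ioo]
    refine setIntegral_congr_fun measurableSet_Ioo fun r _ => ?_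
    simp only
    rw [intervalIntegral.integral_of_le hpi, integral_Ioc_eq_integral_Ioo, integral_const_mul]
  · refine Integrable.mono' (g := fun _ => K) ?_ ?_ ?_
    · refine integrableOn_const ?_
      rw [Measure.prod_prod]
      exact ENNReal.mul_ne_top (by simp) (by simp)
    · refine ContinuousOn.aestronglyMeasurable ?_ hms
      refine ContinuousOn.mul (by fun_prop) (hc.comp (by fun_prop) hnorm)
    · refine (ae_restrict_mem hms).mono fun p hp => ?_
      rw [norm_mul, Complex.norm_real, Real.norm_of_nonneg hp.1.1.le]
      have := hu _ (hnorm p hp)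
      nlinarith [hp.1.1, hp.1.2, norm_nonneg (u (p.1 * Complex.exp (p.2 * Complex.I)))]

end DiscArea

/-! ### Extension of functions from the closed disc to the plane -/

section Retraction

theorem norm_coe_le (z : closedDisc) : ‖(z : ℂ)‖ ≤ 1 := mem_closedBall_zero_iff.1 z.2

/-- The radial retraction of the plane onto the closed disc. -/
def discProj (z : ℂ) : closedDisc :=
  ⟨(max 1 ‖z‖)⁻¹ • z, by
    rw [mem_closedBall_zero_iff, norm_smul, norm_inv, Real.norm_of_nonneg (by positivity),
      inv_mul_le_iff₀ (by positivity), mul_one]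
    exact le_max_right _ _⟩

theorem continuous_discProj : Continuous discProj := by
  refine Continuous.subtype_mk ?_ _
  refine Continuous.smul (Continuous.inv₀ (continuous_const.max continuous_norm) fun z => ?_)
    continuous_id
  positivity

theorem discProj_of_le {z : ℂ} (hz : ‖z‖ ≤ 1) : discProj z = ⟨z, mem_closedBall_zero_iff.2 hz⟩ := by
  refine Subtype.ext ?_
  simp [discProj, max_eq_left hz]

@[simp] theorem coe_discProj_of_le {z : ℂ} (hz : ‖z‖ ≤ 1) : (discProj z : ℂ) = z := by
  rw [discProj_of_le hz]

@[simp] theorem discProj_coe (z : closedDisc) : discProj z = z := discProj_of_le (norm_coe_le z)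

end Retraction

namespace HolderAlg

variable {α : ℝ≥0}

/-! ### Averages of compositions with 1-Lipschitz maps, the common source of bounded operators -/

section Avg

variable {S S' T : Type*} [MetricSpace S] [MetricSpace S'] [MeasurableSpace T] [TopologicalSpace T]
  [OpensMeasurableSpace T] [Fact (0 < α)]

theorem integrable_avg {μ : Measure T} {w : T → ℂ} (hw : Integrable w μ) {γ : T → S}
    (hγ : Continuous γ) (p : HolderAlg α S) : Integrable (fun t => w t * p (γ t)) μ := by
  refine (hw.mul_bdd (c := ‖p‖) ?_ ?_)
  · exact (p.continuous_coe.comp hγ).aestronglyMeasurable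
  · exact Eventually.of_forall fun t => p.norm_apply_le _

/-- The average of the compositions of a Hölder function with a family of 1-Lipschitz maps. -/
def avg (μ : Measure T) (w : T → ℂ) (γ : T → S' → S) (hw : Integrable w μ)
    (hγ : ∀ t, LipschitzWith 1 (γ t)) (hc : ∀ x, Continuous fun t => γ t x) :
    HolderAlg α S →L[ℝ] HolderAlg α S' :=
  have h1 : ∀ (p : HolderAlg α S) x, ‖∫ t, w t * p (γ t x) ∂μ‖ ≤ (∫ t, ‖w t‖ ∂μ) * supNorm p := by
    intro p x
    rw [← integral_mul_const]
    refine norm_integral_le_of_norm_le (hw.norm.mul_const _) (Eventually.of_forall fun t => ?_)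
    rw [norm_mul]
    exact mul_le_mul_of_nonneg_left (p.norm_apply_le_supNorm _) (norm_nonneg _)
  have h2 : ∀ (p : HolderAlg α S) x y, ‖∫ t, w t * p (γ t x) ∂μ - ∫ t, w t * p (γ t y) ∂μ‖ ≤
      (∫ t, ‖w t‖ ∂μ) * semiNorm p * dist x y ^ (α : ℝ) := by
    intro p x y
    rw [← integral_sub (integrable_avg hw (hc x) p) (integrable_avg hw (hc y) p), mul_assoc,
      ← integral_mul_const]
    refine norm_integral_le_of_norm_le (hw.norm.mul_const _) (Eventually.of_forall fun t => ?_)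
    rw [← mul_sub, norm_mul]
    refine mul_le_mul_of_nonneg_left ((p.norm_sub_le_semiNorm _ _).trans ?_) (norm_nonneg _)
    refine mul_le_mul_of_nonneg_left ?_ p.semiNorm_nonneg
    refine Real.rpow_le_rpow dist_nonneg ?_ α.2
    simpa using (hγ t).dist_le_mul x y
  have hw0 : 0 ≤ ∫ t, ‖w t‖ ∂μ := integral_nonneg fun _ => norm_nonneg _
  LinearMap.mkContinuous
    { toFun := fun p => mk' (fun x => ∫ t, w t * p (γ t x) ∂μ) ((∫ t, ‖w t‖ ∂μ) * ‖p‖)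
        (fun x => (h1 p x).trans (mul_le_mul_of_nonneg_left p.supNorm_le_norm hw0))
        (fun x y => (h2 p x y).trans (mul_le_mul_of_nonneg_right
          (mul_le_mul_of_nonneg_left p.semiNorm_le_norm hw0) (by positivity)))
      map_add' := fun p q => by
        ext x
        rw [add_apply, mk'_apply, mk'_apply, mk'_apply,
          ← integral_add (integrable_avg hw (hc x) p) (integrable_avg hw (hc x) q)]
        simp_rw [add_apply, mul_add]
      map_smul' := fun c p => by
        ext x
        rw [RingHom.id_apply, smul_apply, mk'_apply, mk'_apply, ← integral_smul]
        simp_rw [smul_apply, mul_smul_comm] }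
    (∫ t, ‖w t‖ ∂μ) fun p => by
      rw [norm_def p, mul_add]
      exact norm_le (mul_nonneg hw0 p.supNorm_nonneg) (mul_nonneg hw0 p.semiNorm_nonneg)
        (h1 p) (h2 p)

theorem avg_apply {μ : Measure T} {w : T → ℂ} {γ : T → S' → S} (hw : Integrable w μ)
    (hγ : ∀ t, LipschitzWith 1 (γ t)) (hc : ∀ x, Continuous fun t => γ t x) (p : HolderAlg α S)
    (x : S') : avg μ w γ hw hγ hc p x = ∫ t, w t * p (γ t x) ∂μ := rfl

theorem norm_avg_le {μ : Measure T} {w : T → ℂ} {γ : T → S' → S} (hw : Integrable w μ)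
    (hγ : ∀ t, LipschitzWith 1 (γ t)) (hc : ∀ x, Continuous fun t => γ t x) (p : HolderAlg α S) :
    ‖avg μ w γ hw hγ hc p‖ ≤ (∫ t, ‖w t‖ ∂μ) * ‖p‖ := by
  refine (avg μ w γ hw hγ hc).le_of_opNorm_le ?_ p
  unfold avg
  exact LinearMap.mkContinuous_norm_le _ (integral_nonneg fun _ => norm_nonneg _) _

/-- Composition with a 1-Lipschitz map. -/
def comp (γ : S' → S) (hγ : LipschitzWith 1 γ) : HolderAlg α S →L[ℝ] HolderAlg α S' :=
  avg (Measure.dirac ()) 1 (fun _ => γ) (integrable_const 1) (fun _ => hγ)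
    (fun _ => continuous_const)

@[simp] theorem comp_apply (γ : S' → S) (hγ : LipschitzWith 1 γ) (p : HolderAlg α S) (x : S') :
    comp γ hγ p x = p (γ x) := by
  simp [comp, avg_apply]

end Avg

section Conj

variable {S : Type*} [MetricSpace S]

/-- The complex conjugation of Hölder functions. -/
def conj : HolderAlg α S →L[ℝ] HolderAlg α S :=
  have h1 : ∀ (p : HolderAlg α S) x, ‖starRingEnd ℂ (p x)‖ ≤ supNorm p := fun p x => by
    rw [RCLike.norm_conj]; exact p.norm_apply_le_supNorm x
  have h2 : ∀ (p : HolderAlg α S) x y, ‖starRingEnd ℂ (p x) - starRingEnd ℂ (p y)‖ ≤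
      semiNorm p * dist x y ^ (α : ℝ) := fun p x y => by
    rw [← map_sub, RCLike.norm_conj]; exact p.norm_sub_le_semiNorm x y
  LinearMap.mkContinuous
    { toFun := fun p => mk' (fun x => starRingEnd ℂ (p x)) ‖p‖
        (fun x => (h1 p x).trans p.supNorm_le_norm)
        (fun x y => (h2 p x y).trans
          (mul_le_mul_of_nonneg_right p.semiNorm_le_norm (by positivity)))
      map_add' := fun p q => by
        ext x; simp
      map_smul' := fun c p => by
        ext x
        simp }
    1 fun p => by
      rw [one_mul, norm_def p]
      exact norm_le p.supNorm_nonneg p.semiNorm_nonneg (h1 p) (h2 p)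

@[simp] theorem conj_apply (p : HolderAlg α S) (x : S) : conj p x = starRingEnd ℂ (p x) := rfl

end Conj

section Disc

/-- The continuous extension to the plane of a Hölder function on the closed disc. -/
def extd (p : HolderAlg α closedDisc) (z : ℂ) : ℂ := p (discProj z)

@[simp] theorem extd_coe (p : HolderAlg α closedDisc) (z : closedDisc) : extd p z = p z := by
  rw [extd, discProj_coe]

theorem extd_of_le (p : HolderAlg α closedDisc) {z : ℂ} (hz : ‖z‖ ≤ 1) :
    extd p z = p ⟨z, mem_closedBall_zero_iff.2 hz⟩ := by
  rw [extd, discProj_of_le hz]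

theorem norm_extd_le (p : HolderAlg α closedDisc) (z : ℂ) : ‖extd p z‖ ≤ ‖p‖ := p.norm_apply_le _

@[fun_prop] theorem continuous_extd [Fact (0 < α)] (p : HolderAlg α closedDisc) :
    Continuous (extd p) := p.continuous_coe.comp continuous_discProj

@[simp] theorem extd_add (p q : HolderAlg α closedDisc) (z : ℂ) :
    extd (p + q) z = extd p z + extd q z := rfl
@[simp] theorem extd_sub (p q : HolderAlg α closedDisc) (z : ℂ) :
    extd (p - q) z = extd p z - extd q z := rfl
@[simp] theorem extd_mul (p q : HolderAlg α closedDisc) (z : ℂ) :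
    extd (p * q) z = extd p z * extd q z := rfl
@[simp] theorem extd_neg (p : HolderAlg α closedDisc) (z : ℂ) : extd (-p) z = -extd p z := rfl
@[simp] theorem extd_smul (c : ℝ) (p : HolderAlg α closedDisc) (z : ℂ) :
    extd (c • p) z = c • extd p z := rfl
@[simp] theorem extd_zero (z : ℂ) : extd (0 : HolderAlg α closedDisc) z = 0 := rfl
@[simp] theorem extd_one (z : ℂ) : extd (1 : HolderAlg α closedDisc) z = 1 := rfl
@[simp] theorem extd_conj (p : HolderAlg α closedDisc) (z : ℂ) :
    extd (conj p) z = starRingEnd ℂ (extd p z) := rfl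

theorem norm_extd_sub_le (p : HolderAlg α closedDisc) {z w : ℂ} (hz : ‖z‖ ≤ 1) (hw : ‖w‖ ≤ 1) :
    ‖extd p z - extd p w‖ ≤ ‖p‖ * ‖z - w‖ ^ (α : ℝ) := by
  rw [extd_of_le p hz, extd_of_le p hw]
  refine (p.norm_sub_le _ _).trans (le_of_eq ?_)
  rw [Subtype.dist_eq, dist_eq_norm]

/-- Two Hölder functions that agree in the open disc are equal. -/
theorem ext_of_ball [Fact (0 < α)] {p q : HolderAlg α closedDisc}
    (h : ∀ z ∈ Metric.ball (0 : ℂ) 1, extd p z = extd q z) : p = q := by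
  ext z
  rw [← extd_coe, ← extd_coe q]
  have hcl : closure (Metric.ball (0 : ℂ) 1) = closedDisc := closure_ball 0 one_ne_zero
  exact (EqOn.closure (s := Metric.ball (0 : ℂ) 1) h (continuous_extd p) (continuous_extd q))
    (by rw [hcl]; exact z.2)

/-- The identity function of the closed disc. -/
def idDisc [Fact (α < 1)] : HolderAlg α closedDisc :=
  mk' (fun z => z) 2 (fun z => (norm_coe_le z).trans one_le_two) fun z w => by
    rw [← dist_eq_norm, ← Subtype.dist_eq]
    have hd : dist z w ≤ 2 := by
      rw [Subtype.dist_eq, dist_eq_norm]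
      exact (_root_.norm_sub_le _ _).trans (by linarith [norm_coe_le z, norm_coe_le w])
    have hα1 : (α : ℝ) ≤ 1 := by exact_mod_cast (Fact.out : α < 1).le
    rcases eq_or_lt_of_le (dist_nonneg (x := z) (y := w)) with h | h
    · rw [← h]; positivity
    · calc dist z w = dist z w ^ (1 - (α : ℝ)) * dist z w ^ (α : ℝ) := by
            rw [← Real.rpow_add h]; simp
        _ ≤ 2 ^ (1 - (α : ℝ)) * dist z w ^ (α : ℝ) :=
            mul_le_mul_of_nonneg_right (Real.rpow_le_rpow dist_nonneg hd (by linarith))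
              (by positivity)
        _ ≤ 2 * dist z w ^ (α : ℝ) := by
            refine mul_le_mul_of_nonneg_right ?_ (by positivity)
            exact (Real.rpow_le_rpow_of_exponent_le one_le_two
              (by linarith [α.2] : 1 - (α : ℝ) ≤ 1)).trans (by simp)

@[simp] theorem idDisc_apply [Fact (α < 1)] (z : closedDisc) :
    (idDisc : HolderAlg α closedDisc) z = z := rfl

theorem extd_idDisc [Fact (α < 1)] {z : ℂ} (hz : ‖z‖ ≤ 1) :
    extd (idDisc : HolderAlg α closedDisc) z = z := by
  rw [extd_of_le _ hz, idDisc_apply]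

end Disc

/-! ### Weakly singular integrals on Hölder functions -/

section Singular

variable [Fact (0 < α)]

/-- The kernel of `singularInt` as a function of `y`. -/
def singularKernel (c : HolderAlg α (closedDisc × closedDisc)) (z : closedDisc) (y : ℂ) : ℂ :=
  (c (discProj y, z) - c (z, z)) / (y - z)

theorem aestronglyMeasurable_singularKernel (c : HolderAlg α (closedDisc × closedDisc))
    (z : closedDisc) : AEStronglyMeasurable (singularKernel c z) discArea := by
  have h : Continuous fun y : ℂ => c (discProj y, z) - c (z, z) :=
    (c.continuous_coe.comp (continuous_discProj.prodMk continuous_const)).sub continuous_const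
  have h2 : Measurable (fun y : ℂ => y - (z : ℂ)) := measurable_id.sub_const _
  exact (h.measurable.div h2).aestronglyMeasurable

theorem norm_singularKernel_le (c : HolderAlg α (closedDisc × closedDisc)) (z : closedDisc)
    (y : ℂ) : ‖singularKernel c z y‖ ≤ 2 * ‖c‖ * ‖y - z‖⁻¹ := by
  rw [singularKernel, norm_div, div_eq_mul_inv]
  refine mul_le_mul_of_nonneg_right ?_ (by positivity)
  have e1 := c.norm_apply_le (discProj y, z)
  have e2 := c.norm_apply_le (z, z)
  exact (_root_.norm_sub_le _ _).trans (by linarith)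

theorem integrable_singularKernel (c : HolderAlg α (closedDisc × closedDisc)) (z : closedDisc) :
    Integrable (singularKernel c z) discArea :=
  ((integrable_norm_sub_inv (norm_coe_le z)).const_mul _).mono'
    (aestronglyMeasurable_singularKernel c z)
    (Eventually.of_forall fun y => norm_singularKernel_le c z y)

/-- If `y` is at distance at least `|z₁ - z₂|` from `z₂`, the difference of numerators and the
difference of denominators are estimated separately; otherwise each quotient is already small, its
numerator being at most `3 K |z₁ - z₂| ^ a`. The factor `|z₁ - z₂| ^ a` comes out in both cases,
multiplied by integrable singularities only. -/
theorem norm_kernel_sub_le {a : ℝ} (ha0 : 0 < a) (ha1 : a < 1) {K : ℝ} (hK : 0 ≤ K)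
    {y z₁ z₂ c₁ c₂ : ℂ} (h1 : ‖c₁‖ ≤ K * ‖y - z₁‖ ^ a) (h2 : ‖c₂‖ ≤ K * ‖y - z₂‖ ^ a)
    (h12 : ‖c₁ - c₂‖ ≤ 2 * K * ‖z₁ - z₂‖ ^ a) (hy1 : y ≠ z₁) (hy2 : y ≠ z₂) :
    ‖c₁ / (y - z₁) - c₂ / (y - z₂)‖ ≤
      3 * K * ‖z₁ - z₂‖ ^ a * (‖y - z₁‖⁻¹ + ‖y - z₂‖⁻¹) := by
  have hd1 : 0 < ‖y - z₁‖ := norm_pos_iff.2 (sub_ne_zero.2 hy1)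
  have hd2 : 0 < ‖y - z₂‖ := norm_pos_iff.2 (sub_ne_zero.2 hy2)
  have hδ : 0 ≤ ‖z₁ - z₂‖ := norm_nonneg _
  have hδa : 0 ≤ ‖z₁ - z₂‖ ^ a := by positivity
  have htri1 : ‖y - z₁‖ ≤ ‖y - z₂‖ + ‖z₁ - z₂‖ := by
    have : y - z₁ = (y - z₂) - (z₁ - z₂) := by ring
    rw [this]; exact _root_.norm_sub_le _ _
  have htri2 : ‖y - z₂‖ ≤ ‖y - z₁‖ + ‖z₁ - z₂‖ := by
    have : y - z₂ = (y - z₁) + (z₁ - z₂) := by ring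
    rw [this]; exact norm_add_le _ _
  by_cases hfar : ‖z₁ - z₂‖ ≤ ‖y - z₂‖
  · have e : c₁ / (y - z₁) - c₂ / (y - z₂) =
        (c₁ - c₂) / (y - z₁) + c₂ * (z₁ - z₂) / ((y - z₁) * (y - z₂)) := by
      have := sub_ne_zero.2 hy1
      have := sub_ne_zero.2 hy2
      field_simp
      ring
    have hb : ‖y - z₂‖ ^ a * ‖z₁ - z₂‖ ≤ ‖z₁ - z₂‖ ^ a * ‖y - z₂‖ := by
      rcases eq_or_lt_of_le hδ with h0 | h0
      · rw [← h0]; simp; positivity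
      · have h3 : ‖z₁ - z₂‖ ^ (1 - a) ≤ ‖y - z₂‖ ^ (1 - a) :=
          Real.rpow_le_rpow hδ hfar (by linarith)
        have e1 : ‖z₁ - z₂‖ = ‖z₁ - z₂‖ ^ (1 - a) * ‖z₁ - z₂‖ ^ a := by
          rw [← Real.rpow_add h0]; simp
        have e2 : ‖y - z₂‖ = ‖y - z₂‖ ^ (1 - a) * ‖y - z₂‖ ^ a := by
          rw [← Real.rpow_add hd2]; simp
        calc ‖y - z₂‖ ^ a * ‖z₁ - z₂‖ = ‖y - z₂‖ ^ a * (‖z₁ - z₂‖ ^ (1 - a) * ‖z₁ - z₂‖ ^ a) := by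
              rw [← e1]
          _ ≤ ‖y - z₂‖ ^ a * (‖y - z₂‖ ^ (1 - a) * ‖z₁ - z₂‖ ^ a) := by gcongr
          _ = ‖z₁ - z₂‖ ^ a * (‖y - z₂‖ ^ (1 - a) * ‖y - z₂‖ ^ a) := by ring
          _ = _ := by rw [← e2]
    rw [e]
    calc _ ≤ ‖c₁ - c₂‖ / ‖y - z₁‖ + ‖c₂‖ * ‖z₁ - z₂‖ / (‖y - z₁‖ * ‖y - z₂‖) := by
          refine (norm_add_le _ _).trans (le_of_eq ?_)
          rw [norm_div, norm_div, norm_mul, norm_mul]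
      _ ≤ 2 * K * ‖z₁ - z₂‖ ^ a / ‖y - z₁‖ +
          K * ‖z₁ - z₂‖ ^ a * ‖y - z₂‖ / (‖y - z₁‖ * ‖y - z₂‖) := by
          gcongr ?_ / _ + ?_ / _
          calc ‖c₂‖ * ‖z₁ - z₂‖ ≤ K * ‖y - z₂‖ ^ a * ‖z₁ - z₂‖ := by gcongr
            _ = K * (‖y - z₂‖ ^ a * ‖z₁ - z₂‖) := by ring
            _ ≤ K * (‖z₁ - z₂‖ ^ a * ‖y - z₂‖) := by gcongr
            _ = _ := by ring
      _ = 3 * K * ‖z₁ - z₂‖ ^ a * ‖y - z₁‖⁻¹ := by field_simp; ring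
      _ ≤ _ := by
          refine mul_le_mul_of_nonneg_left ?_ (by positivity)
          exact le_add_of_nonneg_right (by positivity)
  · rw [not_le] at hfar
    have h2a : (2 : ℝ) ^ a ≤ 2 := by
      simpa using Real.rpow_le_rpow_of_exponent_le one_le_two ha1.le
    have hn1 : ‖y - z₁‖ ^ a ≤ 3 * ‖z₁ - z₂‖ ^ a := by
      calc ‖y - z₁‖ ^ a ≤ (2 * ‖z₁ - z₂‖) ^ a :=
            Real.rpow_le_rpow hd1.le (by linarith) ha0.le
        _ = 2 ^ a * ‖z₁ - z₂‖ ^ a := Real.mul_rpow zero_le_two hδ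
        _ ≤ _ := by gcongr; linarith
    have hn2 : ‖y - z₂‖ ^ a ≤ 3 * ‖z₁ - z₂‖ ^ a := by
      calc ‖y - z₂‖ ^ a ≤ ‖z₁ - z₂‖ ^ a := Real.rpow_le_rpow hd2.le hfar.le ha0.le
        _ ≤ _ := by linarith
    calc _ ≤ ‖c₁‖ * ‖y - z₁‖⁻¹ + ‖c₂‖ * ‖y - z₂‖⁻¹ := by
          refine (_root_.norm_sub_le _ _).trans (le_of_eq ?_)
          rw [norm_div, norm_div, div_eq_mul_inv, div_eq_mul_inv]
      _ ≤ (K * (3 * ‖z₁ - z₂‖ ^ a)) * ‖y - z₁‖⁻¹ + (K * (3 * ‖z₁ - z₂‖ ^ a)) * ‖y - z₂‖⁻¹ := by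
          gcongr
          · exact h1.trans (by gcongr)
          · exact h2.trans (by gcongr)
      _ = _ := by ring

/-- Subtraction of the diagonal value makes the numerator `O(|y - z| ^ α)`, which is what the
pointwise estimate of the kernels needs. -/
theorem norm_integral_singularKernel_sub_le (hα1 : α < 1)
    (c : HolderAlg α (closedDisc × closedDisc)) (z₁ z₂ : closedDisc) :
    ‖∫ y, singularKernel c z₁ y ∂discArea - ∫ y, singularKernel c z₂ y ∂discArea‖ ≤
      6 * cauchyConst * ‖c‖ * dist z₁ z₂ ^ (α : ℝ) := by
  rw [← integral_sub (integrable_singularKernel c z₁) (integrable_singularKernel c z₂)]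
  have h1 := integrable_norm_sub_inv (norm_coe_le z₁)
  have h2 := integrable_norm_sub_inv (norm_coe_le z₂)
  have hα0 : (0 : ℝ) < α := by exact_mod_cast (Fact.out : 0 < α)
  have hb : ∀ᵐ y ∂discArea, ‖singularKernel c z₁ y - singularKernel c z₂ y‖ ≤
      3 * ‖c‖ * ‖(z₁ : ℂ) - z₂‖ ^ (α : ℝ) * (‖y - z₁‖⁻¹ + ‖y - z₂‖⁻¹) := by
    filter_upwards [ae_discArea, ae_discArea_ne z₁, ae_discArea_ne z₂] with y hy hy1 hy2
    have hyn : ‖y‖ ≤ 1 := (mem_ball_zero_iff.1 hy).le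
    have hdist : ∀ z : closedDisc,
        ‖c (discProj y, z) - c (z, z)‖ ≤ ‖c‖ * ‖y - z‖ ^ (α : ℝ) := fun z => by
      refine (c.norm_sub_le _ _).trans (le_of_eq ?_)
      rw [Prod.dist_eq]
      simp [Subtype.dist_eq, coe_discProj_of_le hyn, dist_eq_norm]
    refine norm_kernel_sub_le hα0 (by exact_mod_cast hα1) (norm_nonneg c) (hdist z₁) (hdist z₂)
      ?_ hy1 hy2
    -- In the product both points of each regrouped difference are at distance `|z₁ - z₂|`, because
    -- the distance is the maximum of the two; this is the origin of the factor `2 * K`.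
    have e : c (discProj y, z₁) - c (z₁, z₁) - (c (discProj y, z₂) - c (z₂, z₂)) =
        (c (discProj y, z₁) - c (discProj y, z₂)) - (c (z₁, z₁) - c (z₂, z₂)) := by ring
    rw [e]
    refine (_root_.norm_sub_le _ _).trans ?_
    have e1 := c.norm_sub_le (discProj y, z₁) (discProj y, z₂)
    have e2 := c.norm_sub_le (z₁, z₁) (z₂, z₂)
    rw [Prod.dist_eq] at e1 e2
    simp only [dist_self, max_self, Subtype.dist_eq, dist_eq_norm] at e1 e2
    rw [max_eq_right (norm_nonneg _)] at e1
    linarith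
  refine (norm_integral_le_of_norm_le ((h1.add h2).const_mul _) hb).trans ?_
  rw [integral_const_mul]
  simp only [Pi.add_apply]
  rw [integral_add h1 h2, Subtype.dist_eq, dist_eq_norm]
  have := integral_norm_sub_inv_le (norm_coe_le z₁)
  have := integral_norm_sub_inv_le (norm_coe_le z₂)
  calc _ ≤ 3 * ‖c‖ * ‖(z₁ : ℂ) - z₂‖ ^ (α : ℝ) * (cauchyConst + cauchyConst) := by gcongr
    _ = _ := by ring

/-- The operator `c ↦ (z ↦ (1/π) ∫ (c(y, z) - c(z, z)) / (y - z) dA(y))`. -/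
def singularInt [Fact (α < 1)] :
    HolderAlg α (closedDisc × closedDisc) →L[ℝ] HolderAlg α closedDisc :=
  have hK := cauchyConst_nonneg
  have h1 : ∀ (c : HolderAlg α (closedDisc × closedDisc)) z,
      ‖∫ y, singularKernel c z y ∂discArea‖ ≤ 2 * cauchyConst * ‖c‖ := fun c z => by
    refine (norm_integral_le_of_norm_le ((integrable_norm_sub_inv (norm_coe_le z)).const_mul _)
      (Eventually.of_forall fun y => norm_singularKernel_le c z y)).trans ?_
    rw [integral_const_mul]
    have := mul_le_mul_of_nonneg_left (integral_norm_sub_inv_le (norm_coe_le z))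
      (by positivity : 0 ≤ 2 * ‖c‖)
    linarith
  LinearMap.mkContinuous
    { toFun := fun c => mk' (fun z => ∫ y, singularKernel c z y ∂discArea) (6 * cauchyConst * ‖c‖)
        (fun z => (h1 c z).trans (by gcongr; norm_num))
        (norm_integral_singularKernel_sub_le Fact.out c)
      map_add' := fun c d => by
        ext z
        rw [add_apply, mk'_apply, mk'_apply, mk'_apply, ← integral_add (integrable_singularKernel c z) (integrable_singularKernel d z)]
        congr 1; ext y
        simp only [singularKernel, add_apply]
        ring
      map_smul' := fun a c => by
        ext z
        rw [RingHom.id_apply, smul_apply, mk'_apply, mk'_apply, ← integral_smul]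
        congr 1; ext y
        simp only [singularKernel, smul_apply, Complex.real_smul]
        ring }
    (2 * cauchyConst + 6 * cauchyConst) fun c => by
      rw [add_mul]
      exact norm_le (by positivity) (by positivity) (h1 c)
        (norm_integral_singularKernel_sub_le Fact.out c)

theorem singularInt_apply [Fact (α < 1)] (c : HolderAlg α (closedDisc × closedDisc))
    (z : closedDisc) : singularInt c z = ∫ y, singularKernel c z y ∂discArea := rfl

end Singular

end HolderAlg

/-! ### The mean value property with radial weights -/

section MeanValue

theorem integral_discArea_circleAverage {u : ℂ → ℂ} {K : ℝ}
    (hc : ContinuousOn u (Metric.ball 0 1)) (hu : ∀ y ∈ Metric.ball (0 : ℂ) 1, ‖u y‖ ≤ K) :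
    ∫ y, u y ∂discArea = ∫ r in (0 : ℝ)..1, (2 * r : ℂ) * Real.circleAverage u 0 r := by
  rw [integral_discArea_polar hc hu, ← intervalIntegral.integral_const_mul]
  refine intervalIntegral.integral_congr fun r _ => ?_
  have hper : Function.Periodic (fun θ : ℝ => u (r * Complex.exp (θ * Complex.I)))
      (2 * Real.pi) := fun θ => by
    simp only
    congr 2
    push_cast
    rw [add_mul, Complex.exp_add]
    simp
  have h := hper.intervalIntegral_add_eq (-Real.pi) 0
  rw [show -Real.pi + 2 * Real.pi = Real.pi by ring, zero_add] at h
  simp only [Real.circleAverage_def, circleMap, zero_add]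
  rw [h, Complex.real_smul]
  generalize ∫ θ in (0 : ℝ)..2 * Real.pi, u (r * Complex.exp (θ * Complex.I)) = J
  have : (Real.pi : ℂ) ≠ 0 := by exact_mod_cast Real.pi_ne_zero
  push_cast
  field_simp

theorem circleAverage_holomorphic {u : ℂ → ℂ} (hd : DifferentiableOn ℂ u (Metric.ball 0 1)) {r : ℝ}
    (hr0 : 0 ≤ r) (hr : r < 1) : Real.circleAverage u 0 r = u 0 := by
  refine DiffContOnCl.circleAverage ?_
  rw [abs_of_nonneg hr0]
  exact hd.diffContOnCl_ball (Metric.closedBall_subset_ball hr)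

/-- The mean value property, with a radial weight. -/
theorem integral_radial_mul_holomorphic {u : ℂ → ℂ} {K : ℝ}
    (hd : DifferentiableOn ℂ u (Metric.ball 0 1)) (hu : ∀ y ∈ Metric.ball (0 : ℂ) 1, ‖u y‖ ≤ K)
    {f : ℂ → ℂ} (hf : Continuous f) (hrad : ∀ y : ℂ, f y = f (‖y‖ : ℂ)) :
    ∫ y, f y * u y ∂discArea = 2 * (∫ r in (0 : ℝ)..1, (r : ℂ) * f r) * u 0 := by
  obtain ⟨M, hM⟩ := (isCompact_closedBall (0 : ℂ) 1).bddAbove_image hf.norm.continuousOn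
  have hM' : ∀ y ∈ Metric.ball (0 : ℂ) 1, ‖f y‖ ≤ M := fun y hy =>
    hM ⟨y, Metric.ball_subset_closedBall hy, rfl⟩
  have hM0 : 0 ≤ M := (norm_nonneg _).trans (hM' 0 (Metric.mem_ball_self one_pos))
  rw [integral_discArea_circleAverage (u := fun y => f y * u y) (K := M * K)
    (hf.continuousOn.mul hd.continuousOn)]
  · rw [mul_assoc, ← intervalIntegral.integral_mul_const, ← intervalIntegral.integral_const_mul]
    refine intervalIntegral.integral_congr_ae ?_
    rw [uIoc_of_le zero_le_one]
    have h1 : ∀ᵐ r : ℝ, r ≠ 1 := by simp [ae_iff]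
    filter_upwards [h1] with r hr hr'
    have hr1 : r < 1 := lt_of_le_of_ne hr'.2 hr
    have e : Real.circleAverage (fun y => f y * u y) 0 r =
        Real.circleAverage (fun y => f r • u y) 0 r := by
      refine Real.circleAverage_congr_sphere fun y hy => ?_
      have : ‖y‖ = r := by simpa [abs_of_pos hr'.1] using hy
      simp only [smul_eq_mul]
      rw [hrad, this]
    rw [e, Real.circleAverage_fun_smul, circleAverage_holomorphic hd hr'.1.le hr1]
    simp only [smul_eq_mul]
    ring
  · intro y hy
    rw [norm_mul]
    exact mul_le_mul (hM' y hy) (hu y hy) (norm_nonneg _) hM0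

theorem integral_holomorphic {u : ℂ → ℂ} {K : ℝ}
    (hd : DifferentiableOn ℂ u (Metric.ball 0 1)) (hu : ∀ y ∈ Metric.ball (0 : ℂ) 1, ‖u y‖ ≤ K) :
    ∫ y, u y ∂discArea = u 0 := by
  have h := integral_radial_mul_holomorphic hd hu (f := fun _ => 1) continuous_const fun _ => rfl
  simp only [one_mul, mul_one] at h
  rw [h]
  have : ∫ r in (0 : ℝ)..1, (r : ℂ) = 1 / 2 := by
    rw [intervalIntegral.integral_ofReal]
    norm_num [integral_id]
  rw [this]
  ring

end MeanValue

/-! ### Integral operators with kernel `(1 - z ȳ)⁻ⁿ` -/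

section CauchyPow

/-- The integral operators of kernel `(1 - z ȳ)⁻ⁿ`. -/
def cauchyPow (n : ℕ) (u : ℂ → ℂ) (z : ℂ) : ℂ :=
  ∫ y, u y * ((1 - z * starRingEnd ℂ y) ^ n)⁻¹ ∂discArea

theorem one_sub_ne_zero {z y : ℂ} (hz : ‖z‖ < 1) (hy : ‖y‖ ≤ 1) :
    1 - z * starRingEnd ℂ y ≠ 0 := by
  have := one_sub_norm_le (z := z) hy
  exact norm_pos_iff.1 (by linarith)

theorem aestronglyMeasurable_cauchyPow {u : ℂ → ℂ} (hu : AEStronglyMeasurable u discArea) (n : ℕ)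
    (z : ℂ) :
    AEStronglyMeasurable (fun y => u y * ((1 - z * starRingEnd ℂ y) ^ n)⁻¹) discArea := by
  refine hu.mul (Measurable.aestronglyMeasurable ?_)
  exact ((continuous_const.sub (continuous_const.mul Complex.continuous_conj)).pow n).measurable.inv

theorem norm_cauchyPow_kernel_le {n : ℕ} {z y : ℂ} {r : ℝ} (hr : r < 1) (hz : ‖z‖ ≤ r)
    (hy : ‖y‖ ≤ 1) : ‖((1 - z * starRingEnd ℂ y) ^ n)⁻¹‖ ≤ ((1 - r) ^ n)⁻¹ := by
  have := one_sub_norm_le (z := z) hy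
  rw [norm_inv, norm_pow]
  have h1 : 0 < 1 - r := by linarith
  gcongr
  linarith

theorem integrable_cauchyPow {u : ℂ → ℂ} {K : ℝ} (hm : AEStronglyMeasurable u discArea)
    (hu : ∀ y ∈ Metric.ball (0 : ℂ) 1, ‖u y‖ ≤ K) (n : ℕ) {z : ℂ} (hz : ‖z‖ < 1) :
    Integrable (fun y => u y * ((1 - z * starRingEnd ℂ y) ^ n)⁻¹) discArea := by
  refine integrable_discArea_of_bound (K := K * ((1 - ‖z‖) ^ n)⁻¹)
    (aestronglyMeasurable_cauchyPow hm n z) fun y hy => ?_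
  rw [norm_mul]
  exact mul_le_mul (hu y hy) (norm_cauchyPow_kernel_le hz le_rfl (mem_ball_zero_iff.1 hy).le)
    (norm_nonneg _) ((norm_nonneg _).trans (hu y hy))

theorem hasDerivAt_cauchyPow {u : ℂ → ℂ} {K : ℝ} (hm : AEStronglyMeasurable u discArea)
    (hu : ∀ y ∈ Metric.ball (0 : ℂ) 1, ‖u y‖ ≤ K) (n : ℕ) {z : ℂ} (hz : ‖z‖ < 1) :
    HasDerivAt (cauchyPow n u) (n * cauchyPow (n + 1) (fun y => starRingEnd ℂ y * u y) z) z := by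
  obtain ⟨r, hr1, hr2⟩ := exists_between hz
  have hcm : AEStronglyMeasurable (fun y => starRingEnd ℂ y * u y) discArea :=
    Complex.continuous_conj.aestronglyMeasurable.mul hm
  have hs : Metric.ball (0 : ℂ) r ∈ 𝓝 z :=
    Metric.isOpen_ball.mem_nhds (mem_ball_zero_iff.2 hr1)
  have key := hasDerivAt_integral_of_dominated_loc_of_deriv_le (μ := discArea) (𝕜 := ℂ)
    (F := fun z y => u y * ((1 - z * starRingEnd ℂ y) ^ n)⁻¹)
    (F' := fun z y => n * ((starRingEnd ℂ y * u y) * ((1 - z * starRingEnd ℂ y) ^ (n + 1))⁻¹))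
    (bound := fun _ => n * (K * ((1 - r) ^ (n + 1))⁻¹)) (x₀ := z) hs
    (Eventually.of_forall fun z => aestronglyMeasurable_cauchyPow hm n z)
    (integrable_cauchyPow hm hu n hz)
    ((aestronglyMeasurable_cauchyPow hcm (n + 1) z).const_mul _) ?_ (integrable_const _) ?_
  · have := key.2
    rwa [integral_const_mul] at this
  · filter_upwards [ae_discArea] with y hy x hx
    have hy' := (mem_ball_zero_iff.1 hy).le
    have hK := (norm_nonneg _).trans (hu y hy)
    rw [norm_mul, norm_mul, norm_mul, RCLike.norm_conj, Complex.norm_natCast]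
    gcongr
    · calc ‖y‖ * ‖u y‖ ≤ 1 * K := mul_le_mul hy' (hu y hy) (norm_nonneg _) zero_le_one
        _ = K := one_mul K
    · exact norm_cauchyPow_kernel_le hr2 (mem_ball_zero_iff.1 hx).le hy'
  · filter_upwards [ae_discArea] with y hy x hx
    have hne := one_sub_ne_zero ((mem_ball_zero_iff.1 hx).trans hr2) (mem_ball_zero_iff.1 hy).le
    have h1 : HasDerivAt (fun x : ℂ => 1 - x * starRingEnd ℂ y) (-starRingEnd ℂ y) x := by
      simpa using ((hasDerivAt_id x).mul_const (starRingEnd ℂ y)).const_sub 1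
    have h2 := ((h1.pow n).inv (pow_ne_zero n hne)).const_mul (u y)
    refine h2.congr_deriv ?_
    -- The derivative of the power involves the truncated exponent `n - 1`, so `n = 0` is treated
    -- apart.
    rcases Nat.eq_zero_or_pos n with rfl | hn
    · simp
    · obtain ⟨m, rfl⟩ := Nat.exists_eq_succ_of_ne_zero hn.ne'
      simp only [Nat.succ_eq_add_one, Nat.add_sub_cancel, Pi.pow_apply]
      field_simp
      ring

theorem differentiableOn_cauchyPow {u : ℂ → ℂ} {K : ℝ} (hm : AEStronglyMeasurable u discArea)
    (hu : ∀ y ∈ Metric.ball (0 : ℂ) 1, ‖u y‖ ≤ K) (n : ℕ) :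
    DifferentiableOn ℂ (cauchyPow n u) (Metric.ball 0 1) := fun _ hz =>
  (hasDerivAt_cauchyPow hm hu n (mem_ball_zero_iff.1 hz)).differentiableAt.differentiableWithinAt

/-- The conjugate of the integrand is holomorphic and vanishes at the centre. This cancellation
allows `q(z)` to be subtracted from `q(y)` in the derivative of the Bergman projection. -/
theorem integral_conj_kernel {z : ℂ} (hz : ‖z‖ < 1) (n : ℕ) :
    ∫ y, starRingEnd ℂ y * ((1 - z * starRingEnd ℂ y) ^ n)⁻¹ ∂discArea = 0 := by
  set u : ℂ → ℂ := fun y => y * ((1 - starRingEnd ℂ z * y) ^ n)⁻¹ with hu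
  have e : ∀ y, starRingEnd ℂ y * ((1 - z * starRingEnd ℂ y) ^ n)⁻¹ = starRingEnd ℂ (u y) := by
    intro y
    simp [hu]
  simp_rw [e]
  rw [integral_conj]
  have hne : ∀ y ∈ Metric.ball (0 : ℂ) 1, 1 - starRingEnd ℂ z * y ≠ 0 := by
    intro y hy h
    have h2 := one_sub_ne_zero hz (mem_ball_zero_iff.1 hy).le
    apply h2
    have := congrArg (starRingEnd ℂ) h
    simpa using this
  rw [integral_holomorphic (u := u) (K := ((1 - ‖z‖) ^ n)⁻¹)]
  · simp [hu]
  · intro y hy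
    refine DifferentiableWithinAt.mul (by fun_prop) (DifferentiableWithinAt.inv ?_
      (pow_ne_zero n (hne y hy)))
    fun_prop
  · intro y hy
    have hy' := (mem_ball_zero_iff.1 hy).le
    have h1 := norm_cauchyPow_kernel_le (n := n) hz le_rfl hy'
    have h2 : ‖((1 - starRingEnd ℂ z * y) ^ n)⁻¹‖ = ‖((1 - z * starRingEnd ℂ y) ^ n)⁻¹‖ := by
      rw [← RCLike.norm_conj (((1 - starRingEnd ℂ z * y) ^ n)⁻¹)]
      simp
    rw [hu, norm_mul, h2]
    calc _ ≤ 1 * ((1 - ‖z‖) ^ n)⁻¹ := mul_le_mul hy' h1 (norm_nonneg _) zero_le_one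
      _ = _ := one_mul _

end CauchyPow

/-! ### From growth of the derivative to Hölder continuity up to the circle -/

section HardyLittlewood

/-- Along the radius the derivative at `t z` is at most `K (1 - t) ^ (a - 1)`, since the exponent is
nonpositive and `t |z| ≤ t`. A primitive of this bound is `-(K / a) (1 - t) ^ a`. -/
theorem norm_sub_smul_le_of_deriv {u : ℂ → ℂ} {K a : ℝ} (ha : 0 < a)
    (hd : DifferentiableOn ℂ u (Metric.ball 0 1)) (hK : 0 ≤ K)
    (hu : ∀ z ∈ Metric.ball (0 : ℂ) 1, ‖deriv u z‖ ≤ K * (1 - ‖z‖) ^ (a - 1)) (ha1 : a ≤ 1) {z : ℂ}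
    (hz : ‖z‖ < 1) {s : ℝ} (hs0 : 0 ≤ s) (hs1 : s ≤ 1) :
    ‖u z - u (s * z)‖ ≤ K / a * (1 - s) ^ a := by
  have hmem : ∀ t ∈ Icc s 1, (t * z : ℂ) ∈ Metric.ball (0 : ℂ) 1 := by
    intro t ht
    rw [mem_ball_zero_iff, norm_mul, Complex.norm_real, Real.norm_of_nonneg (hs0.trans ht.1)]
    nlinarith [norm_nonneg z, ht.2, ht.1]
  have hder : ∀ t ∈ Icc s 1, HasDerivAt (fun t : ℝ => u (t * z) - u (s * z))
      (z * deriv u (t * z)) t := by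
    intro t ht
    have h1 : HasDerivAt u (deriv u (t * z)) (t * z) :=
      (hd.differentiableAt (Metric.isOpen_ball.mem_nhds (hmem t ht))).hasDerivAt
    have h2 : HasDerivAt (fun t : ℝ => (t * z : ℂ)) z t := by
      simpa using (Complex.ofRealCLM.hasDerivAt (x := t)).mul_const z
    have h3 := (h1.comp t h2).sub_const (u (s * z))
    refine h3.congr_deriv (mul_comm _ _)
  have h := image_norm_le_of_norm_deriv_right_le_deriv_boundary' (a := s) (b := 1)
    (f := fun t : ℝ => u (t * z) - u (s * z)) (f' := fun t => z * deriv u (t * z))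
    (fun t ht => (hder t ht).continuousAt.continuousWithinAt)
    (fun t ht => (hder t (Ico_subset_Icc_self ht)).hasDerivWithinAt)
    (B := fun t => K / a * ((1 - s) ^ a - (1 - t) ^ a)) (B' := fun t => K * (1 - t) ^ (a - 1))
    (by simp) ?_ ?_ ?_ (right_mem_Icc.2 hs1)
  · simpa [Real.zero_rpow ha.ne'] using h
  · refine ContinuousOn.mul continuousOn_const (continuousOn_const.sub ?_)
    exact ContinuousOn.rpow_const (by fun_prop) fun _ _ => Or.inr ha.le
  · intro t ht
    have h1 : HasDerivAt (fun t : ℝ => 1 - t) (-1) t := by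
      simpa using (hasDerivAt_id t).const_sub 1
    have h2 := ((h1.rpow_const (p := a) (Or.inl (by linarith [ht.2]))).const_sub
      ((1 - s) ^ a)).const_mul (K / a)
    refine (h2.congr_deriv ?_).hasDerivWithinAt
    field_simp
  · intro t ht
    have hm := hmem t (Ico_subset_Icc_self ht)
    have ht0 : 0 ≤ t := hs0.trans ht.1
    have h1 := hu _ hm
    have hn : ‖(t * z : ℂ)‖ = t * ‖z‖ := by
      rw [norm_mul, Complex.norm_real, Real.norm_of_nonneg ht0]
    have h2 : (1 - ‖(t * z : ℂ)‖) ^ (a - 1) ≤ (1 - t) ^ (a - 1) := by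
      refine Real.rpow_le_rpow_of_nonpos (by linarith [ht.2]) ?_ (by linarith)
      rw [hn]
      nlinarith [norm_nonneg z]
    rw [norm_mul]
    calc ‖z‖ * ‖deriv u (t * z)‖ ≤ 1 * ‖deriv u (t * z)‖ := by gcongr
      _ = ‖deriv u (t * z)‖ := one_mul _
      _ ≤ _ := h1.trans (by gcongr)

/-- The Hardy–Littlewood lemma. -/
theorem norm_sub_le_of_deriv_le {u : ℂ → ℂ} {K a : ℝ} (ha : 0 < a) (ha1 : a ≤ 1)
    (hd : DifferentiableOn ℂ u (Metric.ball 0 1)) (hK : 0 ≤ K)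
    (hu : ∀ z ∈ Metric.ball (0 : ℂ) 1, ‖deriv u z‖ ≤ K * (1 - ‖z‖) ^ (a - 1)) {z w : ℂ}
    (hz : ‖z‖ < 1) (hw : ‖w‖ < 1) :
    ‖u z - u w‖ ≤ (2 * (K / a) + K) * ‖z - w‖ ^ a := by
  have hKa : 0 ≤ K / a := by positivity
  -- With `δ = |z - w|` at most `1`, the path goes inwards from `z` to `(1 - δ) z`, across to `(1 -
  -- δ) w` where the derivative is at most `K δ ^ (a - 1)`, and out to `w`. For larger `δ` it goes
  -- through the centre.
  rcases le_total ‖z - w‖ 1 with hδ | hδ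
  · rcases eq_or_lt_of_le (norm_nonneg (z - w)) with h0 | h0
    · rw [eq_comm, norm_eq_zero, sub_eq_zero] at h0
      rw [h0]
      simp [Real.zero_rpow ha.ne']
    set δ := ‖z - w‖ with hδd
    have e1 := norm_sub_smul_le_of_deriv ha hd hK hu ha1 hz (s := 1 - δ) (by linarith) (by linarith)
    have e2 := norm_sub_smul_le_of_deriv ha hd hK hu ha1 hw (s := 1 - δ) (by linarith) (by linarith)
    rw [sub_sub_cancel] at e1 e2
    have hsub : ∀ x : ℂ, ‖x‖ < 1 → ((1 - δ : ℝ) * x : ℂ) ∈ Metric.closedBall (0 : ℂ) (1 - δ) := by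
      intro x hx
      rw [mem_closedBall_zero_iff, norm_mul, Complex.norm_real,
        Real.norm_of_nonneg (by linarith : (0 : ℝ) ≤ 1 - δ)]
      nlinarith [norm_nonneg x]
    have hball : Metric.closedBall (0 : ℂ) (1 - δ) ⊆ Metric.ball 0 1 :=
      Metric.closedBall_subset_ball (by linarith)
    have e3 := (convex_closedBall (0 : ℂ) (1 - δ)).norm_image_sub_le_of_norm_deriv_le
      (f := u) (C := K * δ ^ (a - 1))
      (fun x hx => hd.differentiableAt (Metric.isOpen_ball.mem_nhds (hball hx)))
      (fun x hx => (hu x (hball hx)).trans ?_) (hsub w hw) (hsub z hz)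
    · have e4 : ‖((1 - δ : ℝ) * z : ℂ) - ((1 - δ : ℝ) * w : ℂ)‖ ≤ δ := by
        rw [← mul_sub, norm_mul, Complex.norm_real,
          Real.norm_of_nonneg (by linarith : (0 : ℝ) ≤ 1 - δ)]
        nlinarith [norm_nonneg (z - w)]
      have e5 : K * δ ^ (a - 1) * ‖((1 - δ : ℝ) * z : ℂ) - ((1 - δ : ℝ) * w : ℂ)‖ ≤ K * δ ^ a := by
        calc _ ≤ K * δ ^ (a - 1) * δ := by gcongr
          _ = K * (δ ^ (a - 1) * δ ^ (1 : ℝ)) := by rw [Real.rpow_one]; ring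
          _ = _ := by rw [← Real.rpow_add h0]; simp
      have e6 : u z - u w = (u z - u ((1 - δ : ℝ) * z)) - (u w - u ((1 - δ : ℝ) * w)) +
          (u ((1 - δ : ℝ) * z) - u ((1 - δ : ℝ) * w)) := by ring
      rw [e6]
      refine (norm_add_le _ _).trans ?_
      have := _root_.norm_sub_le (u z - u ((1 - δ : ℝ) * z)) (u w - u ((1 - δ : ℝ) * w))
      linarith
    · refine mul_le_mul_of_nonneg_left ?_ hK
      refine Real.rpow_le_rpow_of_nonpos h0 ?_ (by linarith)
      linarith [mem_closedBall_zero_iff.1 hx]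
  · have e1 := norm_sub_smul_le_of_deriv ha hd hK hu ha1 hz (s := 0) le_rfl zero_le_one
    have e2 := norm_sub_smul_le_of_deriv ha hd hK hu ha1 hw (s := 0) le_rfl zero_le_one
    simp only [Complex.ofReal_zero, zero_mul, sub_zero, Real.one_rpow, mul_one] at e1 e2
    have h1 : 1 ≤ ‖z - w‖ ^ a := Real.one_le_rpow hδ ha.le
    have e3 : u z - u w = (u z - u 0) - (u w - u 0) := by ring
    rw [e3]
    refine (_root_.norm_sub_le _ _).trans ?_
    nlinarith

theorem tendsto_one_sub_inv : Tendsto (fun n : ℕ => 1 - ((n : ℝ) + 2)⁻¹) atTop (𝓝 1) := by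
  have : Tendsto (fun n : ℕ => ((n : ℝ) + 2)⁻¹) atTop (𝓝 0) :=
    tendsto_inv_atTop_zero.comp (tendsto_natCast_atTop_atTop.atTop_add tendsto_const_nhds)
  simpa using this.const_sub 1

theorem one_sub_inv_mem (n : ℕ) : 0 < 1 - ((n : ℝ) + 2)⁻¹ ∧ 1 - ((n : ℝ) + 2)⁻¹ < 1 := by
  have h : (0 : ℝ) < ((n : ℝ) + 2)⁻¹ := by positivity
  have h2 : ((n : ℝ) + 2)⁻¹ < 1 := inv_lt_one_of_one_lt₀ (by linarith [n.cast_nonneg (α := ℝ)])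
  constructor <;> linarith

/-- A bounded Hölder function on the open disc extends to the closed disc. -/
theorem exists_extension {α : ℝ≥0} [Fact (0 < α)] {u : ℂ → ℂ} {M K : ℝ}
    (hM : ∀ z ∈ Metric.ball (0 : ℂ) 1, ‖u z‖ ≤ M)
    (hK : ∀ z ∈ Metric.ball (0 : ℂ) 1, ∀ w ∈ Metric.ball (0 : ℂ) 1,
      ‖u z - u w‖ ≤ K * ‖z - w‖ ^ (α : ℝ)) (hK0 : 0 ≤ K) :
    ∃ p : HolderAlg α closedDisc, (∀ z ∈ Metric.ball (0 : ℂ) 1, p.extd z = u z) ∧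
      ‖p‖ ≤ M + K := by
  have hα0 : (0 : ℝ) < α := by exact_mod_cast (Fact.out : 0 < α)
  have hM0 : 0 ≤ M := (norm_nonneg _).trans (hM 0 (Metric.mem_ball_self one_pos))
  set r : ℕ → ℝ := fun n => 1 - ((n : ℝ) + 2)⁻¹ with hr
  have hrt : Tendsto r atTop (𝓝 1) := tendsto_one_sub_inv
  have hmem : ∀ (z : closedDisc) n, (r n * z : ℂ) ∈ Metric.ball (0 : ℂ) 1 := by
    intro z n
    obtain ⟨h1, h2⟩ := one_sub_inv_mem n
    rw [mem_ball_zero_iff, norm_mul, Complex.norm_real, Real.norm_of_nonneg h1.le]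
    nlinarith [norm_coe_le z, norm_nonneg (z : ℂ)]
  have hex : ∀ z : closedDisc, ∃ l, Tendsto (fun n => u (r n * z)) atTop (𝓝 l) := by
    intro z
    refine cauchySeq_tendsto_of_complete ?_
    refine Metric.cauchySeq_iff.2 fun ε hε => ?_
    have hc := hrt.cauchySeq
    have hlim : Tendsto (fun t : ℝ => K * t ^ (α : ℝ)) (𝓝 0) (𝓝 0) := by
      have : ContinuousAt (fun t : ℝ => K * t ^ (α : ℝ)) 0 :=
        continuousAt_const.mul (Real.continuousAt_rpow_const _ _ (Or.inr hα0.le))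
      simpa [ContinuousAt, Real.zero_rpow hα0.ne'] using this
    obtain ⟨η, hη, hη'⟩ := Metric.tendsto_nhds_nhds.1 hlim ε hε
    obtain ⟨N, hN⟩ := Metric.cauchySeq_iff.1 hc η hη
    refine ⟨N, fun m hm n hn => ?_⟩
    rw [dist_eq_norm]
    refine (hK _ (hmem z m) _ (hmem z n)).trans_lt ?_
    have h1 : ‖(r m * z : ℂ) - r n * z‖ ≤ dist (r m) (r n) := by
      rw [← sub_mul, norm_mul, ← Complex.ofReal_sub, Complex.norm_real, dist_eq_norm]
      exact mul_le_of_le_one_right (norm_nonneg _) (norm_coe_le z)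
    have h2 := hη' (x := ‖(r m * z : ℂ) - r n * z‖) (by
      rw [dist_zero_right, norm_norm]; exact h1.trans_lt (hN m hm n hn))
    rw [dist_zero_right] at h2
    exact (le_abs_self _).trans_lt h2
  choose l hl using hex
  have b1 : ∀ z, ‖l z‖ ≤ M := fun z =>
    le_of_tendsto (hl z).norm (Eventually.of_forall fun n => hM _ (hmem z n))
  have b2 : ∀ z w, ‖l z - l w‖ ≤ K * dist z w ^ (α : ℝ) := fun z w => by
    refine le_of_tendsto ((hl z).sub (hl w)).norm (Eventually.of_forall fun n => ?_)
    refine (hK _ (hmem z n) _ (hmem w n)).trans ?_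
    obtain ⟨h1, h2⟩ := one_sub_inv_mem n
    rw [Subtype.dist_eq, dist_eq_norm, ← mul_sub, norm_mul, Complex.norm_real,
      Real.norm_of_nonneg h1.le]
    gcongr
    exact mul_le_of_le_one_left (norm_nonneg _) h2.le
  refine ⟨HolderAlg.mk' l (M + K) (fun z => (b1 z).trans (by linarith)) (fun z w => (b2 z w).trans ?_),
    fun z hz => ?_, HolderAlg.norm_le hM0 hK0 b1 b2⟩
  · gcongr; linarith
  · have hz' := mem_ball_zero_iff.1 hz
    rw [HolderAlg.extd_of_le _ hz'.le, HolderAlg.mk'_apply]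
    refine tendsto_nhds_unique (hl _) ?_
    have hcont : ContinuousAt u z := by
      rw [Metric.continuousAt_iff']
      intro ε hε
      have hlim : Tendsto (fun x : ℂ => K * ‖x - z‖ ^ (α : ℝ)) (𝓝 z) (𝓝 0) := by
        have : ContinuousAt (fun x : ℂ => K * ‖x - z‖ ^ (α : ℝ)) z :=
          continuousAt_const.mul (ContinuousAt.rpow_const (by fun_prop) (Or.inr hα0.le))
        simpa [ContinuousAt, Real.zero_rpow hα0.ne'] using this
      filter_upwards [hlim.eventually_lt_const hε, Metric.isOpen_ball.mem_nhds hz] with x hx hx'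
      rw [dist_eq_norm]
      exact (hK x hx' z hz).trans_lt hx
    refine hcont.tendsto.comp ?_
    have : Tendsto (fun n => (r n * z : ℂ)) atTop (𝓝 ((1 : ℝ) * z)) :=
      ((Complex.continuous_ofReal.tendsto 1).comp hrt).mul_const z
    simpa using this

end HardyLittlewood

namespace HolderAlg

/-! ### The Bergman projection on Hölder functions -/

section Bergman

variable {α : ℝ≥0} [Fact (0 < α)] [Fact (α < 1)]

/-- A constant in the estimate of the Bergman projection. -/
def bergmanConst (α : ℝ≥0) [h : Fact (α < 1)] : ℝ :=
  (exists_integral_kernel_le (a := α) (by exact_mod_cast h.out)).choose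

theorem bergmanConst_nonneg : 0 ≤ bergmanConst α :=
  (exists_integral_kernel_le (a := α) (by exact_mod_cast (Fact.out : α < 1))).choose_spec.1

theorem integral_kernel_le {z : ℂ} (hz : ‖z‖ < 1) :
    ∫ y, ‖1 - z * starRingEnd ℂ y‖ ^ ((α : ℝ) - 3) ∂discArea ≤
      bergmanConst α * (1 - ‖z‖) ^ ((α : ℝ) - 1) :=
  (exists_integral_kernel_le (a := α) (by exact_mod_cast (Fact.out : α < 1))).choose_spec.2 z hz

/-- The derivative has kernel `2 ȳ (1 - z ȳ)⁻³`, too singular for a bounded density. As this kernel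
has integral zero, `q(y)` may be replaced by `q(y) - q(z)`, which is `O(|1 - z ȳ| ^ α)`; the
Forelli–Rudin estimate with exponent `α - 3` then applies. -/
theorem norm_deriv_bergman_le (q : HolderAlg α closedDisc) {z : ℂ} (hz : ‖z‖ < 1) :
    ‖deriv (cauchyPow 2 (extd q)) z‖ ≤ 2 * bergmanConst α * ‖q‖ * (1 - ‖z‖) ^ ((α : ℝ) - 1) := by
  have hm : AEStronglyMeasurable (extd q) discArea := (continuous_extd q).aestronglyMeasurable
  have hb : ∀ y ∈ Metric.ball (0 : ℂ) 1, ‖extd q y‖ ≤ ‖q‖ := fun y _ => norm_extd_le q y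
  have hα1 : (α : ℝ) < 1 := by exact_mod_cast (Fact.out : α < 1)
  have hcm : AEStronglyMeasurable (fun y => starRingEnd ℂ y * extd q y) discArea :=
    (Complex.continuous_conj.mul (continuous_extd q)).aestronglyMeasurable
  have hcb : ∀ y ∈ Metric.ball (0 : ℂ) 1, ‖starRingEnd ℂ y * extd q y‖ ≤ ‖q‖ := fun y hy => by
    rw [norm_mul, RCLike.norm_conj]
    have := mul_le_mul (mem_ball_zero_iff.1 hy).le (norm_extd_le q y) (norm_nonneg _) zero_le_one
    linarith
  have hc1 : ∀ y ∈ Metric.ball (0 : ℂ) 1, ‖starRingEnd ℂ y‖ ≤ 1 := fun y hy => by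
    rw [RCLike.norm_conj]; exact (mem_ball_zero_iff.1 hy).le
  rw [(hasDerivAt_cauchyPow hm hb 2 hz).deriv]
  have e : cauchyPow (2 + 1) (fun y => starRingEnd ℂ y * extd q y) z =
      ∫ y, (extd q y - extd q z) * (starRingEnd ℂ y * ((1 - z * starRingEnd ℂ y) ^ 3)⁻¹)
        ∂discArea := by
    have h1 := integrable_cauchyPow hcm hcb 3 hz
    have h2 := (integrable_cauchyPow Complex.continuous_conj.aestronglyMeasurable hc1 3 hz).const_mul
      (extd q z)
    have h3 := integral_sub h1 h2
    rw [integral_const_mul, integral_conj_kernel hz, mul_zero, sub_zero] at h3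
    rw [cauchyPow, ← h3]
    congr 1; ext y; ring
  rw [e, norm_mul]
  have hint : Integrable (fun y => ‖1 - z * starRingEnd ℂ y‖ ^ ((α : ℝ) - 3)) discArea := by
    have hK : ∀ y ∈ Metric.ball (0 : ℂ) 1,
        ‖‖1 - z * starRingEnd ℂ y‖ ^ ((α : ℝ) - 3)‖ ≤ (1 - ‖z‖) ^ ((α : ℝ) - 3) := fun y hy => by
      rw [Real.norm_of_nonneg (by positivity)]
      exact Real.rpow_le_rpow_of_nonpos (by linarith)
        (one_sub_norm_le (mem_ball_zero_iff.1 hy).le) (by linarith)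
    refine (integrable_const _).mono' ?_ (ae_discArea.mono hK)
    refine Measurable.aestronglyMeasurable ?_
    exact ((continuous_const.sub
      (continuous_const.mul Complex.continuous_conj)).norm.measurable).pow_const _
  have hle : ‖∫ y, (extd q y - extd q z) * (starRingEnd ℂ y * ((1 - z * starRingEnd ℂ y) ^ 3)⁻¹)
      ∂discArea‖ ≤ ‖q‖ * (bergmanConst α * (1 - ‖z‖) ^ ((α : ℝ) - 1)) := by
    refine (norm_integral_le_of_norm_le (hint.const_mul ‖q‖) ?_).trans ?_
    · filter_upwards [ae_discArea] with y hy
      have hy' := (mem_ball_zero_iff.1 hy).le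
      have hpos : 0 < ‖1 - z * starRingEnd ℂ y‖ := norm_pos_iff.2 (one_sub_ne_zero hz hy')
      rw [norm_mul, norm_mul, RCLike.norm_conj, norm_inv, norm_pow]
      have h1 := norm_extd_sub_le q hy' hz.le
      have h2 : ‖y - z‖ ^ (α : ℝ) ≤ ‖1 - z * starRingEnd ℂ y‖ ^ (α : ℝ) :=
        Real.rpow_le_rpow (norm_nonneg _) (norm_sub_le_norm_one_sub hz.le hy') α.2
      calc _ ≤ (‖q‖ * ‖1 - z * starRingEnd ℂ y‖ ^ (α : ℝ)) *
            (1 * (‖1 - z * starRingEnd ℂ y‖ ^ 3)⁻¹) := by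
            gcongr
            exact h1.trans (by gcongr)
        _ = _ := by
            rw [Real.rpow_sub hpos, one_mul, mul_assoc]
            norm_num [div_eq_mul_inv]
    · rw [integral_const_mul]
      exact mul_le_mul_of_nonneg_left (integral_kernel_le hz) (norm_nonneg q)
  calc _ ≤ 2 * (‖q‖ * (bergmanConst α * (1 - ‖z‖) ^ ((α : ℝ) - 1))) := by
        gcongr; simp
    _ = _ := by ring

/-- The growth of the derivative gives a Hölder bound by the Hardy–Littlewood lemma. The sup bound
follows by comparison with the value at the centre, a plain average of `q`. -/
theorem exists_bergman : ∃ K, ∀ q : HolderAlg α closedDisc, ∃ p : HolderAlg α closedDisc,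
    (∀ z ∈ Metric.ball (0 : ℂ) 1, extd p z = cauchyPow 2 (extd q) z) ∧ ‖p‖ ≤ K * ‖q‖ := by
  have hα0 : (0 : ℝ) < α := by exact_mod_cast (Fact.out : 0 < α)
  have hα1 : (α : ℝ) < 1 := by exact_mod_cast (Fact.out : α < 1)
  set c := 2 * bergmanConst α with hc
  have hc0 : 0 ≤ c := mul_nonneg zero_le_two bergmanConst_nonneg
  set L := 2 * (c / α) + c with hL
  have hL0 : 0 ≤ L := by positivity
  refine ⟨1 + L + L, fun q => ?_⟩
  have hm : AEStronglyMeasurable (extd q) discArea := (continuous_extd q).aestronglyMeasurable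
  have hb : ∀ y ∈ Metric.ball (0 : ℂ) 1, ‖extd q y‖ ≤ ‖q‖ := fun y _ => norm_extd_le q y
  have hH : ∀ z ∈ Metric.ball (0 : ℂ) 1, ∀ w ∈ Metric.ball (0 : ℂ) 1,
      ‖cauchyPow 2 (extd q) z - cauchyPow 2 (extd q) w‖ ≤ L * ‖q‖ * ‖z - w‖ ^ (α : ℝ) := by
    intro z hz w hw
    have := norm_sub_le_of_deriv_le hα0 hα1.le (differentiableOn_cauchyPow hm hb 2)
      (mul_nonneg hc0 (norm_nonneg q))
      (fun z hz => norm_deriv_bergman_le q (mem_ball_zero_iff.1 hz)) (mem_ball_zero_iff.1 hz)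
      (mem_ball_zero_iff.1 hw)
    refine this.trans (le_of_eq ?_)
    rw [hL]; ring
  have h0 : ‖cauchyPow 2 (extd q) 0‖ ≤ ‖q‖ := by
    rw [cauchyPow]
    refine (norm_integral_le_of_norm_le (integrable_const ‖q‖)
      (Eventually.of_forall fun y => ?_)).trans (by simp)
    simpa using norm_extd_le q y
  have hM : ∀ z ∈ Metric.ball (0 : ℂ) 1, ‖cauchyPow 2 (extd q) z‖ ≤ (1 + L) * ‖q‖ := by
    intro z hz
    have h1 := hH z hz 0 (Metric.mem_ball_self one_pos)
    rw [sub_zero] at h1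
    have h2 : ‖z‖ ^ (α : ℝ) ≤ 1 :=
      Real.rpow_le_one (norm_nonneg z) (mem_ball_zero_iff.1 hz).le hα0.le
    have h3 : L * ‖q‖ * ‖z‖ ^ (α : ℝ) ≤ L * ‖q‖ :=
      mul_le_of_le_one_right (by positivity) h2
    have h4 := norm_add_le (cauchyPow 2 (extd q) z - cauchyPow 2 (extd q) 0)
      (cauchyPow 2 (extd q) 0)
    rw [sub_add_cancel] at h4
    linarith
  obtain ⟨p, hp, hpn⟩ := exists_extension hM hH (by positivity)
  exact ⟨p, hp, hpn.trans (le_of_eq (by ring))⟩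

/-- The Bergman projection. -/
def bergman : HolderAlg α closedDisc →L[ℝ] HolderAlg α closedDisc :=
  have h := (exists_bergman (α := α)).choose_spec
  have hspec : ∀ (q : HolderAlg α closedDisc), ∀ z ∈ Metric.ball (0 : ℂ) 1,
      extd (h q).choose z = cauchyPow 2 (extd q) z := fun q => (h q).choose_spec.1
  have hm : ∀ q : HolderAlg α closedDisc, AEStronglyMeasurable (extd q) discArea := fun q =>
    (continuous_extd q).aestronglyMeasurable
  LinearMap.mkContinuous
    { toFun := fun q => (h q).choose
      map_add' := fun q s => by
        refine ext_of_ball fun z hz => ?_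
        have hz' := mem_ball_zero_iff.1 hz
        rw [extd_add, hspec _ z hz, hspec _ z hz, hspec _ z hz, cauchyPow, cauchyPow, cauchyPow,
          ← integral_add (integrable_cauchyPow (hm q) (fun y _ => norm_extd_le q y) 2 hz')
            (integrable_cauchyPow (hm s) (fun y _ => norm_extd_le s y) 2 hz')]
        simp_rw [extd_add, add_mul]
      map_smul' := fun c q => by
        refine ext_of_ball fun z hz => ?_
        rw [RingHom.id_apply, extd_smul, hspec _ z hz, hspec _ z hz, cauchyPow, cauchyPow,
          ← integral_smul]
        simp_rw [extd_smul, smul_mul_assoc] }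
    (exists_bergman (α := α)).choose fun q => (h q).choose_spec.2

theorem bergman_apply (q : HolderAlg α closedDisc) {z : ℂ} (hz : ‖z‖ < 1) :
    extd (bergman q) z = cauchyPow 2 (extd q) z :=
  ((exists_bergman (α := α)).choose_spec q).choose_spec.1 z (mem_ball_zero_iff.2 hz)

end Bergman

end HolderAlg

/-! ### Taylor coefficients as area moments -/

section TaylorCoeff

/-- The coefficients of the power series at `0`. -/
def taylorCoeff (u : ℂ → ℂ) (n : ℕ) : ℂ := (Function.swap dslope 0)^[n] u 0

theorem taylorCoeff_zero (u : ℂ → ℂ) : taylorCoeff u 0 = u 0 := rfl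

theorem taylorCoeff_succ (u : ℂ → ℂ) (n : ℕ) :
    taylorCoeff u (n + 1) = taylorCoeff (dslope u 0) n := by
  rw [taylorCoeff, Function.iterate_succ_apply]
  rfl

theorem taylorCoeff_eq_coeff {u : ℂ → ℂ} {p : FormalMultilinearSeries ℂ ℂ ℂ}
    (hp : HasFPowerSeriesAt u p 0) (n : ℕ) : taylorCoeff u n = p.coeff n := by
  have h0 := (hp.has_fpower_series_iterate_dslope_fslope n).coeff_zero 1
  rw [taylorCoeff, ← h0]
  change (FormalMultilinearSeries.fslope^[n] p).coeff 0 = _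
  rw [FormalMultilinearSeries.coeff_iterate_fslope, Nat.zero_add]

theorem hasSum_taylorCoeff {u : ℂ → ℂ} (hd : DifferentiableOn ℂ u (Metric.ball 0 1)) {z : ℂ}
    (hz : ‖z‖ < 1) : HasSum (fun n => taylorCoeff u n * z ^ n) (u z) := by
  obtain ⟨r, hr1, hr2⟩ := exists_between hz
  have hr0 : 0 < r := (norm_nonneg z).trans_lt hr1
  have h := (hd.mono (Metric.closedBall_subset_ball hr2) : DifferentiableOn ℂ u
    (Metric.closedBall 0 ((⟨r, hr0.le⟩ : ℝ≥0) : ℝ))).hasFPowerSeriesOnBall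
    (R := ⟨r, hr0.le⟩) hr0
  have hs := h.hasSum (y := z) (by
    rw [Metric.mem_eball, edist_zero_right, enorm_eq_nnnorm]
    exact ENNReal.coe_lt_coe.2 hr1)
  rw [zero_add] at hs
  convert! hs using 2 with n
  rw [taylorCoeff_eq_coeff h.hasFPowerSeriesAt, FormalMultilinearSeries.apply_eq_pow_smul_coeff,
    smul_eq_mul, mul_comm]

theorem taylorCoeff_of_hasSum {u : ℂ → ℂ} {a : ℕ → ℂ}
    (h : ∀ z : ℂ, ‖z‖ < 1 → HasSum (fun n => a n * z ^ n) (u z)) (n : ℕ) :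
    taylorCoeff u n = a n := by
  have hp : HasFPowerSeriesAt u (FormalMultilinearSeries.ofScalars ℂ a) 0 := by
    rw [hasFPowerSeriesAt_iff]
    filter_upwards [Metric.ball_mem_nhds (0 : ℂ) one_pos] with z hz
    have := h z (mem_ball_zero_iff.1 hz)
    rw [zero_add]
    simpa [FormalMultilinearSeries.coeff_ofScalars, mul_comm] using this
  rw [taylorCoeff_eq_coeff hp, FormalMultilinearSeries.coeff_ofScalars]

theorem eqOn_of_taylorCoeff {u v : ℂ → ℂ} (hu : DifferentiableOn ℂ u (Metric.ball 0 1))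
    (hv : DifferentiableOn ℂ v (Metric.ball 0 1)) (h : ∀ n, taylorCoeff u n = taylorCoeff v n)
    {z : ℂ} (hz : ‖z‖ < 1) : u z = v z := by
  have h1 := hasSum_taylorCoeff hu hz
  simp_rw [h] at h1
  exact h1.unique (hasSum_taylorCoeff hv hz)

theorem zero_mem_ball : (0 : ℂ) ∈ Metric.ball (0 : ℂ) 1 := Metric.mem_ball_self one_pos

theorem differentiableOn_dslope_ball {u : ℂ → ℂ} {c : ℂ} (hc : ‖c‖ < 1)
    (hu : DifferentiableOn ℂ u (Metric.ball 0 1)) :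
    DifferentiableOn ℂ (dslope u c) (Metric.ball 0 1) :=
  (Complex.differentiableOn_dslope
    (Metric.isOpen_ball.mem_nhds (mem_ball_zero_iff.2 hc))).2 hu

/-- Difference quotients of bounded holomorphic functions are bounded. -/
theorem exists_bound_dslope {u : ℂ → ℂ} {c : ℂ} (hc : ‖c‖ < 1) {K : ℝ}
    (hu : DifferentiableOn ℂ u (Metric.ball 0 1)) (hK : ∀ y ∈ Metric.ball (0 : ℂ) 1, ‖u y‖ ≤ K) :
    ∃ K', ∀ y ∈ Metric.ball (0 : ℂ) 1, ‖dslope u c y‖ ≤ K' := by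
  obtain ⟨r, hr1, hr2⟩ := exists_between hc
  have hcont := (differentiableOn_dslope_ball hc hu).continuousOn
  obtain ⟨M, hM⟩ := (isCompact_closedBall (0 : ℂ) r).bddAbove_image
    ((hcont.mono (Metric.closedBall_subset_ball hr2)).norm)
  refine ⟨max M ((K + K) / (r - ‖c‖)), fun y hy => ?_⟩
  rcases le_or_gt ‖y‖ r with h | h
  · exact le_max_of_le_left (hM ⟨y, mem_closedBall_zero_iff.2 h, rfl⟩)
  · refine le_max_of_le_right ?_
    have hne : y ≠ c := by rintro rfl; linarith
    have h1 : r - ‖c‖ ≤ ‖y - c‖ := by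
      have := norm_sub_norm_le y c
      linarith
    have h2 : 0 < r - ‖c‖ := by linarith
    rw [dslope_of_ne _ hne, slope_def_field, norm_div]
    have h3 := (norm_sub_le (u y) (u c)).trans
      (add_le_add (hK y hy) (hK c (mem_ball_zero_iff.2 hc)))
    gcongr
    exact (norm_nonneg _).trans h3

/-- The moments of a holomorphic function, with a radial weight. -/
theorem integral_radial_mul_holomorphic_mul_conj_pow (n : ℕ) : ∀ {u : ℂ → ℂ} {K : ℝ},
    DifferentiableOn ℂ u (Metric.ball 0 1) → (∀ y ∈ Metric.ball (0 : ℂ) 1, ‖u y‖ ≤ K) →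
    ∀ {f : ℂ → ℂ}, Continuous f → (∀ y : ℂ, f y = f (‖y‖ : ℂ)) →
    ∫ y, f y * u y * starRingEnd ℂ y ^ n ∂discArea =
      2 * (∫ r in (0 : ℝ)..1, (r : ℂ) ^ (2 * n + 1) * f r) * taylorCoeff u n := by
  induction n with
  | zero =>
    intro u K hd hu f hf hrad
    simpa [taylorCoeff_zero] using integral_radial_mul_holomorphic hd hu hf hrad
  | succ n ih =>
    intro u K hd hu f hf hrad
    obtain ⟨K', hK'⟩ := exists_bound_dslope (c := 0) (by simp) hd hu
    have hd' := differentiableOn_dslope_ball (c := 0) (by simp) hd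
    -- Write `u = u(0) + y v` with `v` the difference quotient at `0`. One factor `ȳ` combines with
    -- `y` into `|y|²`, which joins the radial weight: the moment of order `n + 1` of `u` becomes
    -- one of order `n` of `v`, and the exponent of the radius grows by `2`.
    set g : ℂ → ℂ := fun y => f y * (‖y‖ : ℂ) ^ 2 with hg
    have hgc : Continuous g := by fun_prop
    have hgr : ∀ y : ℂ, g y = g (‖y‖ : ℂ) := fun y => by
      simp only [hg]; rw [hrad y]; simp
    have h1 := ih hd' hK' hgc hgr
    rw [taylorCoeff_succ]
    obtain ⟨M, hM⟩ := (isCompact_closedBall (0 : ℂ) 1).bddAbove_image hf.norm.continuousOn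
    have hsplit : ∀ y : ℂ, f y * u y * starRingEnd ℂ y ^ (n + 1) =
        u 0 * (f y * starRingEnd ℂ y ^ (n + 1)) + g y * dslope u 0 y * starRingEnd ℂ y ^ n := by
      intro y
      have e : u y = u 0 + y * dslope u 0 y := by
        have := sub_smul_dslope u 0 y
        rw [sub_zero, smul_eq_mul] at this
        rw [this]; ring
      have e2 : ((‖y‖ : ℝ) : ℂ) ^ 2 = y * starRingEnd ℂ y := (Complex.mul_conj' y).symm
      simp only [hg]
      rw [e, e2]
      ring
    simp_rw [hsplit]
    have hz : ∫ y, f y * starRingEnd ℂ y ^ (n + 1) ∂discArea = 0 := by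
      have hfs : ∀ y : ℂ, (starRingEnd ℂ (f y)) = (starRingEnd ℂ (f (‖y‖ : ℂ))) := fun y => by
        rw [← hrad]
      have := integral_radial_mul_holomorphic (u := fun y => y ^ (n + 1)) (K := 1)
        (by fun_prop) (fun y hy => by
          rw [norm_pow]; exact pow_le_one₀ (norm_nonneg _) (mem_ball_zero_iff.1 hy).le)
        (f := fun y => starRingEnd ℂ (f y)) (by fun_prop) hfs
      have h2 := congrArg (starRingEnd ℂ) this
      rw [← integral_conj] at h2
      simpa using h2
    rw [integral_add, integral_const_mul, hz, mul_zero, zero_add, h1]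
    · congr 3
      ext r
      simp only [hg]
      rw [show 2 * (n + 1) + 1 = (2 * n + 1) + 2 by ring, pow_add]
      simp only [Complex.norm_real, Real.norm_eq_abs]
      rw [← Complex.ofReal_pow |r|, sq_abs]
      push_cast
      ring
    · exact (integrable_discArea_of_continuous (by fun_prop)).const_mul _
    · obtain ⟨M, hM⟩ := (isCompact_closedBall (0 : ℂ) 1).bddAbove_image hgc.norm.continuousOn
      have hM' : ∀ y ∈ Metric.ball (0 : ℂ) 1, ‖g y‖ ≤ M := fun y hy =>
        hM ⟨y, Metric.ball_subset_closedBall hy, rfl⟩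
      refine integrable_discArea_of_continuousOn (K := M * K' * 1) ?_ fun y hy => ?_
      · exact (hgc.continuousOn.mul hd'.continuousOn).mul (by fun_prop)
      · rw [norm_mul, norm_mul, norm_pow, RCLike.norm_conj]
        have h0 := (norm_nonneg _).trans (hM' y hy)
        have h0' := (norm_nonneg _).trans (hK' y hy)
        have := mem_ball_zero_iff.1 hy
        gcongr
        · exact hM' y hy
        · exact hK' y hy
        · exact pow_le_one₀ (norm_nonneg _) this.le

theorem integral_holomorphic_mul_conj_pow (n : ℕ) {u : ℂ → ℂ} {K : ℝ}
    (hd : DifferentiableOn ℂ u (Metric.ball 0 1)) (hu : ∀ y ∈ Metric.ball (0 : ℂ) 1, ‖u y‖ ≤ K) :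
    ∫ y, u y * starRingEnd ℂ y ^ n ∂discArea = taylorCoeff u n / (n + 1) := by
  have h := integral_radial_mul_holomorphic_mul_conj_pow n hd hu (f := fun _ => 1)
    continuous_const fun _ => rfl
  simp only [one_mul, mul_one] at h
  rw [h]
  have : ∫ r in (0 : ℝ)..1, (r : ℂ) ^ (2 * n + 1) = 1 / (2 * (n + 1)) := by
    have h1 : ∀ r : ℝ, (r : ℂ) ^ (2 * n + 1) = ((r ^ (2 * n + 1) : ℝ) : ℂ) := fun r => by simp
    simp_rw [h1]
    rw [intervalIntegral.integral_ofReal, integral_pow]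
    have h2 : (n + 1 : ℂ) ≠ 0 := by exact_mod_cast n.succ_ne_zero
    have h3 : (2 * n + 1 + 1 : ℂ) ≠ 0 := by
      rw [show (2 * n + 1 + 1 : ℂ) = 2 * (n + 1) by ring]
      exact mul_ne_zero two_ne_zero h2
    push_cast
    simp only [one_pow, ne_eq, Nat.add_eq_zero_iff, one_ne_zero, and_false, not_false_eq_true,
      zero_pow, sub_zero]
    field_simp
    ring
  rw [this]
  have : (n + 1 : ℂ) ≠ 0 := by exact_mod_cast n.succ_ne_zero
  field_simp

/-- The moments of an antiholomorphic function times `y ȳⁿ`, with a radial weight, vanish. -/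
theorem integral_conj_holomorphic_eq_zero {u : ℂ → ℂ} {K : ℝ}
    (hd : DifferentiableOn ℂ u (Metric.ball 0 1)) (hu : ∀ y ∈ Metric.ball (0 : ℂ) 1, ‖u y‖ ≤ K)
    (h0 : u 0 = 0) {f : ℂ → ℂ} (hf : Continuous f) (hrad : ∀ y : ℂ, f y = f (‖y‖ : ℂ)) :
    ∫ y, f y * starRingEnd ℂ (u y) ∂discArea = 0 := by
  have hfs : ∀ y : ℂ, (starRingEnd ℂ (f y)) = (starRingEnd ℂ (f (‖y‖ : ℂ))) := fun y => by
    rw [← hrad]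
  have := integral_radial_mul_holomorphic hd hu (f := fun y => starRingEnd ℂ (f y))
    (by fun_prop) hfs
  have h2 := congrArg (starRingEnd ℂ) this
  rw [← integral_conj, h0] at h2
  simpa using h2

/-- The Taylor coefficients of `cauchyPow 2 u`. -/
theorem taylorCoeff_cauchyPow_two {u : ℂ → ℂ} {K : ℝ} (hm : AEStronglyMeasurable u discArea)
    (hu : ∀ y ∈ Metric.ball (0 : ℂ) 1, ‖u y‖ ≤ K) (n : ℕ) :
    taylorCoeff (cauchyPow 2 u) n = (n + 1) * ∫ y, u y * starRingEnd ℂ y ^ n ∂discArea := by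
  have hmm : ∀ n : ℕ, AEStronglyMeasurable (fun y => u y * starRingEnd ℂ y ^ n) discArea :=
    fun n => hm.mul (Complex.continuous_conj.pow n).aestronglyMeasurable
  have hbb : ∀ n : ℕ, ∀ y ∈ Metric.ball (0 : ℂ) 1, ‖u y * starRingEnd ℂ y ^ n‖ ≤ K := by
    intro n y hy
    rw [norm_mul, norm_pow, RCLike.norm_conj]
    have h1 := pow_le_one₀ (n := n) (norm_nonneg y) (mem_ball_zero_iff.1 hy).le
    have h2 := hu y hy
    nlinarith [norm_nonneg (u y)]
  refine taylorCoeff_of_hasSum (a := fun n => (n + 1) * ∫ y, u y * starRingEnd ℂ y ^ n ∂discArea)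
    (fun z hz => ?_) n
  have hK : 0 ≤ K := (norm_nonneg _).trans (hu 0 zero_mem_ball)
  have hsumm : Summable fun n : ℕ => (n + 1 : ℝ) * ‖z‖ ^ n * K := by
    refine Summable.mul_right K ?_
    have h1 := (hasSum_coe_mul_geometric_of_norm_lt_one (𝕜 := ℝ) (r := ‖z‖) (by simpa using hz)).summable
    have h2 := summable_geometric_of_lt_one (norm_nonneg z) hz
    exact (h1.add h2).congr fun n => by ring
  -- Termwise integration of `(1 - z ȳ)⁻² = ∑ (n + 1) (z ȳ)ⁿ`.
  have key := hasSum_integral_of_summable_integral_norm (μ := discArea)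
    (F := fun (n : ℕ) y => (n + 1 : ℂ) * z ^ n * (u y * starRingEnd ℂ y ^ n))
    (fun n => (integrable_discArea_of_bound (hmm n) (hbb n)).const_mul _) ?_
  · have e : cauchyPow 2 u z =
        ∫ y, ∑' n : ℕ, (n + 1 : ℂ) * z ^ n * (u y * starRingEnd ℂ y ^ n) ∂discArea := by
      refine integral_congr_ae ?_
      filter_upwards [ae_discArea] with y hy
      have hlt : ‖z * starRingEnd ℂ y‖ < 1 := by
        rw [norm_mul, RCLike.norm_conj]
        nlinarith [norm_nonneg z, norm_nonneg y, mem_ball_zero_iff.1 hy]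
      have hne : 1 - z * starRingEnd ℂ y ≠ 0 := one_sub_ne_zero hz (mem_ball_zero_iff.1 hy).le
      have h1 := hasSum_coe_mul_geometric_of_norm_lt_one hlt
      have h2 := hasSum_geometric_of_norm_lt_one hlt
      have h3 := ((h1.add h2).mul_left (u y)).tsum_eq
      rw [← tsum_congr (fun n : ℕ => ?_)] at h3
      · refine Eq.trans ?_ h3.symm
        field_simp
        ring
      · rw [mul_pow]
        ring
    rw [e]
    convert! key using 2 with n
    rw [integral_const_mul]
    ring
  · refine Summable.of_nonneg_of_le (fun n => integral_nonneg fun y => norm_nonneg _)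
      (fun n => ?_) hsumm
    refine (integral_mono_ae (g := fun _ => (n + 1 : ℝ) * ‖z‖ ^ n * K)
      ((integrable_discArea_of_bound (hmm n) (hbb n)).const_mul _).norm
      (integrable_const _) ?_).trans (by simp)
    filter_upwards [ae_discArea] with y hy
    rw [norm_mul, norm_mul, norm_pow]
    have : ‖(n + 1 : ℂ)‖ = n + 1 := by
      rw [← Nat.cast_add_one, Complex.norm_natCast]; simp
    rw [this]
    exact mul_le_mul_of_nonneg_left (hbb n y hy) (by positivity)

/-- The reproducing formula. -/
theorem cauchyPow_two_holomorphic {u : ℂ → ℂ} {K : ℝ}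
    (hd : DifferentiableOn ℂ u (Metric.ball 0 1)) (hu : ∀ y ∈ Metric.ball (0 : ℂ) 1, ‖u y‖ ≤ K)
    {z : ℂ} (hz : ‖z‖ < 1) : cauchyPow 2 u z = u z := by
  have hm : AEStronglyMeasurable u discArea :=
    (integrable_discArea_of_continuousOn hd.continuousOn hu).aestronglyMeasurable
  refine eqOn_of_taylorCoeff (differentiableOn_cauchyPow hm hu 2) hd (fun n => ?_) hz
  rw [taylorCoeff_cauchyPow_two hm hu, integral_holomorphic_mul_conj_pow n hd hu]
  have : (n + 1 : ℂ) ≠ 0 := by exact_mod_cast n.succ_ne_zero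
  field_simp

end TaylorCoeff

namespace HolderAlg

variable {α : ℝ≥0} [Fact (0 < α)] [Fact (α < 1)]

/-! ### Divided differences of holomorphic functions, as averages over segments -/

section Segments

/-- The point `z + t (y - z)` of the closed disc. -/
def segPoint (t : unitInterval) (q : closedDisc × closedDisc) : closedDisc :=
  ⟨q.2 + (t : ℝ) * (q.1 - q.2), by
    have h := (convex_closedBall (0 : ℂ) 1) q.2.2 q.1.2 (sub_nonneg.2 t.2.2) t.2.1
      (sub_add_cancel _ _)
    convert! h using 1
    simp only [Complex.real_smul]
    push_cast
    ring⟩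

theorem lipschitzWith_segPoint (t : unitInterval) : LipschitzWith 1 (segPoint t) := by
  refine LipschitzWith.of_dist_le_mul fun q s => ?_
  rw [NNReal.coe_one, one_mul, Subtype.dist_eq, dist_eq_norm]
  have e : (segPoint t q : ℂ) - segPoint t s =
      ((1 - (t : ℝ) : ℝ) : ℂ) * (q.2 - s.2) + ((t : ℝ) : ℂ) * (q.1 - s.1) := by
    simp only [segPoint]; push_cast; ring
  rw [e]
  refine (norm_add_le _ _).trans ?_
  rw [norm_mul, norm_mul, Complex.norm_real, Complex.norm_real,
    Real.norm_of_nonneg (sub_nonneg.2 t.2.2), Real.norm_of_nonneg t.2.1]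
  have h1 : ‖(q.1 : ℂ) - s.1‖ ≤ dist q s := by
    rw [← dist_eq_norm, ← Subtype.dist_eq]; exact le_max_left _ _
  have h2 : ‖(q.2 : ℂ) - s.2‖ ≤ dist q s := by
    rw [← dist_eq_norm, ← Subtype.dist_eq]; exact le_max_right _ _
  nlinarith [t.2.1, t.2.2]

theorem continuous_segPoint (q : closedDisc × closedDisc) : Continuous fun t => segPoint t q := by
  refine Continuous.subtype_mk ?_ _
  fun_prop

theorem integrable_weight (k : ℕ) :
    Integrable (fun t : unitInterval => ((1 - (t : ℝ) : ℝ) : ℂ) ^ k) volume := by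
  have : Continuous (fun t : unitInterval => ((1 - (t : ℝ) : ℝ) : ℂ) ^ k) := by fun_prop
  exact this.integrable_of_hasCompactSupport (HasCompactSupport.of_compactSpace _)

/-- The averages `∫₀¹ (1 - t)ᵏ p(z + t (y - z)) dt` over segments. -/
def segAvg (k : ℕ) : HolderAlg α closedDisc →L[ℝ] HolderAlg α (closedDisc × closedDisc) :=
  avg volume (fun t : unitInterval => ((1 - (t : ℝ) : ℝ) : ℂ) ^ k) segPoint (integrable_weight k)
    lipschitzWith_segPoint continuous_segPoint

theorem integral_unitInterval (f : ℝ → ℂ) : ∫ t : unitInterval, f t = ∫ t in (0 : ℝ)..1, f t := by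
  rw [intervalIntegral.integral_of_le zero_le_one, ← integral_Icc_eq_integral_Ioc]
  exact integral_subtype_comap measurableSet_Icc f

theorem segAvg_apply (k : ℕ) (p : HolderAlg α closedDisc) (y z : closedDisc) :
    segAvg k p (y, z) =
      ∫ t in (0 : ℝ)..1, ((1 - t : ℝ) : ℂ) ^ k * extd p (z + t * (y - z)) := by
  rw [← integral_unitInterval (fun t => ((1 - t : ℝ) : ℂ) ^ k * extd p (z + t * (y - z))), segAvg,
    avg_apply]
  refine integral_congr_ae (Eventually.of_forall fun t => ?_)
  simp only
  rw [← extd_coe]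
  rfl

/-- The pullback by the first projection. -/
def pullFst : HolderAlg α closedDisc →L[ℝ] HolderAlg α (closedDisc × closedDisc) :=
  comp Prod.fst LipschitzWith.prod_fst

/-- The pullback by the second projection. -/
def pullSnd : HolderAlg α closedDisc →L[ℝ] HolderAlg α (closedDisc × closedDisc) :=
  comp Prod.snd LipschitzWith.prod_snd

@[simp] theorem pullFst_apply (p : HolderAlg α closedDisc) (q : closedDisc × closedDisc) :
    pullFst p q = p q.1 := comp_apply _ _ _ _

@[simp] theorem pullSnd_apply (p : HolderAlg α closedDisc) (q : closedDisc × closedDisc) :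
    pullSnd p q = p q.2 := comp_apply _ _ _ _

theorem lipschitzWith_prodMk_left (y : closedDisc) :
    LipschitzWith 1 (fun z : closedDisc => (y, z)) := by
  refine LipschitzWith.of_dist_le_mul fun z w => ?_
  simp [Prod.dist_eq]

/-- The centre of the closed disc. -/
def discZero : closedDisc := ⟨0, by simp⟩

/-- The averages `∫₀¹ tᵏ p(t z) dt` over radii. -/
def radAvg (k : ℕ) : HolderAlg α closedDisc →L[ℝ] HolderAlg α closedDisc :=
  (comp (fun z => (discZero, z)) (lipschitzWith_prodMk_left discZero)).comp (segAvg k)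

theorem radAvg_apply (k : ℕ) (p : HolderAlg α closedDisc) (z : closedDisc) :
    radAvg k p z = ∫ t in (0 : ℝ)..1, (t : ℂ) ^ k * extd p (t * z) := by
  have h := intervalIntegral.integral_comp_sub_left (a := 0) (b := 1)
    (fun t : ℝ => (t : ℂ) ^ k * extd p (t * z)) 1
  rw [sub_self, sub_zero] at h
  rw [← h, radAvg, ContinuousLinearMap.comp_apply, comp_apply, segAvg_apply]
  refine intervalIntegral.integral_congr fun t _ => ?_
  congr 2
  change (z : ℂ) + t * (0 - z) = _
  push_cast
  ring

/-- The primitive vanishing at `0`. -/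
def prim : HolderAlg α closedDisc →L[ℝ] HolderAlg α closedDisc :=
  (ContinuousLinearMap.mul ℝ (HolderAlg α closedDisc) idDisc).comp (radAvg 0)

theorem prim_apply (p : HolderAlg α closedDisc) (z : closedDisc) :
    prim p z = z * ∫ t in (0 : ℝ)..1, extd p (t * z) := by
  rw [prim, ContinuousLinearMap.comp_apply, ContinuousLinearMap.mul_apply', mul_apply, idDisc_apply,
    radAvg_apply]
  simp

theorem extd_prim (p : HolderAlg α closedDisc) {z : ℂ} (hz : ‖z‖ ≤ 1) :
    extd (prim p) z = z * ∫ t in (0 : ℝ)..1, extd p (t * z) := by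
  rw [extd_of_le _ hz, prim_apply]

/-- The point `(y, z)` of the product of the closed disc with itself. -/
def pt (y z : ℂ) : closedDisc × closedDisc := (discProj y, discProj z)

@[fun_prop] theorem continuous_pt : Continuous fun q : ℂ × ℂ => pt q.1 q.2 :=
  (continuous_discProj.comp continuous_fst).prodMk (continuous_discProj.comp continuous_snd)

theorem continuous_apply_pt (c : HolderAlg α (closedDisc × closedDisc)) :
    Continuous fun q : ℂ × ℂ => c (pt q.1 q.2) := c.continuous_coe.comp continuous_pt

theorem continuous_apply_pt_left (c : HolderAlg α (closedDisc × closedDisc)) (z : ℂ) :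
    Continuous fun y : ℂ => c (pt y z) :=
  (continuous_apply_pt c).comp (continuous_id.prodMk continuous_const)

theorem continuous_apply_pt_right (c : HolderAlg α (closedDisc × closedDisc)) (y : ℂ) :
    Continuous fun z : ℂ => c (pt y z) :=
  (continuous_apply_pt c).comp (continuous_const.prodMk continuous_id)

theorem pullFst_pt (p : HolderAlg α closedDisc) (y z : ℂ) : pullFst p (pt y z) = extd p y :=
  pullFst_apply _ _

theorem pullSnd_pt (p : HolderAlg α closedDisc) (y z : ℂ) : pullSnd p (pt y z) = extd p z :=
  pullSnd_apply _ _

theorem segAvg_pt (k : ℕ) (p : HolderAlg α closedDisc) {y z : ℂ} (hy : ‖y‖ ≤ 1) (hz : ‖z‖ ≤ 1) :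
    segAvg k p (pt y z) =
      ∫ t in (0 : ℝ)..1, ((1 - t : ℝ) : ℂ) ^ k * extd p (z + t * (y - z)) := by
  rw [pt, segAvg_apply, coe_discProj_of_le hy, coe_discProj_of_le hz]

theorem ext_of_ball_prod {c d : HolderAlg α (closedDisc × closedDisc)}
    (h : ∀ y z : ℂ, ‖y‖ < 1 → ‖z‖ < 1 → c (pt y z) = d (pt y z)) : c = d := by
  ext q
  have hcl : closure (Metric.ball (0 : ℂ) 1 ×ˢ Metric.ball (0 : ℂ) 1) =
      closedDisc ×ˢ closedDisc := by rw [closure_prod_eq, closure_ball 0 one_ne_zero]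
  have := EqOn.closure (s := Metric.ball (0 : ℂ) 1 ×ˢ Metric.ball (0 : ℂ) 1)
    (f := fun q : ℂ × ℂ => c (pt q.1 q.2)) (g := fun q : ℂ × ℂ => d (pt q.1 q.2))
    (fun q hq => h q.1 q.2 (mem_ball_zero_iff.1 hq.1) (mem_ball_zero_iff.1 hq.2))
    (continuous_apply_pt c) (continuous_apply_pt d)
  rw [hcl] at this
  have h2 := this (x := ((q.1 : ℂ), (q.2 : ℂ))) ⟨q.1.2, q.2.2⟩
  simpa [pt] using h2

theorem segment_mem_ball {y z : ℂ} (hy : ‖y‖ < 1) (hz : ‖z‖ < 1) {t : ℝ} (ht : t ∈ uIcc (0 : ℝ) 1) :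
    z + t * (y - z) ∈ Metric.ball (0 : ℂ) 1 := by
  rw [uIcc_of_le zero_le_one] at ht
  have h := (convex_ball (0 : ℂ) 1) (mem_ball_zero_iff.2 hz) (mem_ball_zero_iff.2 hy)
    (sub_nonneg.2 ht.2) ht.1 (sub_add_cancel _ _)
  convert! h using 1
  simp only [Complex.real_smul]
  push_cast
  ring

theorem hasDerivAt_segment (y z : ℂ) (t : ℝ) :
    HasDerivAt (fun t : ℝ => z + t * (y - z)) (y - z) t := by
  simpa using ((Complex.ofRealCLM.hasDerivAt (x := t)).mul_const (y - z)).const_add z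

theorem continuous_extd_segment (p : HolderAlg α closedDisc) (y z : ℂ) :
    Continuous fun t : ℝ => extd p (z + t * (y - z)) :=
  (continuous_extd p).comp (by fun_prop)

theorem sub_mul_integral_segment {p : HolderAlg α closedDisc} {g : ℂ → ℂ}
    (hg : ∀ z ∈ Metric.ball (0 : ℂ) 1, HasDerivAt g (extd p z) z) {y z : ℂ} (hy : ‖y‖ < 1)
    (hz : ‖z‖ < 1) :
    (y - z) * ∫ t in (0 : ℝ)..1, extd p (z + t * (y - z)) = g y - g z := by
  have h := intervalIntegral.integral_eq_sub_of_hasDerivAt (a := 0) (b := 1)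
    (f := fun t : ℝ => g (z + t * (y - z))) (f' := fun t => (y - z) * extd p (z + t * (y - z)))
    (fun t ht => ((hg _ (segment_mem_ball hy hz ht)).comp t (hasDerivAt_segment y z t)).congr_deriv
      (mul_comm _ _))
    ((continuous_const.mul (continuous_extd_segment p y z)).intervalIntegrable _ _)
  rw [intervalIntegral.integral_const_mul] at h
  rw [h]
  simp

/-- A holomorphic Hölder function is the derivative of its primitive. -/
theorem hasDerivAt_prim {p : HolderAlg α closedDisc}
    (hp : DifferentiableOn ℂ (extd p) (Metric.ball 0 1)) {z : ℂ} (hz : ‖z‖ < 1) :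
    HasDerivAt (extd (prim p)) (extd p z) z := by
  obtain ⟨g, hg⟩ := hp.isExactOn_ball
  have hz' : Metric.ball (0 : ℂ) 1 ∈ 𝓝 z := Metric.isOpen_ball.mem_nhds (mem_ball_zero_iff.2 hz)
  refine ((hg z (mem_ball_zero_iff.2 hz)).sub_const (g 0)).congr_of_eventuallyEq ?_
  filter_upwards [hz'] with w hw
  have hw' := mem_ball_zero_iff.1 hw
  rw [extd_prim p hw'.le]
  have := sub_mul_integral_segment hg hw' (z := 0) (by simp)
  simpa using this

theorem differentiableOn_prim {p : HolderAlg α closedDisc}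
    (hp : DifferentiableOn ℂ (extd p) (Metric.ball 0 1)) :
    DifferentiableOn ℂ (extd (prim p)) (Metric.ball 0 1) := fun _ hz =>
  (hasDerivAt_prim hp (mem_ball_zero_iff.1 hz)).differentiableAt.differentiableWithinAt

/-- The fundamental theorem of calculus on the segment from `z` to `y`. So `segAvg 0 p` is the first
divided difference of the primitive, in a form that is Hölder up to the diagonal and the boundary.
-/
theorem sub_mul_segAvg_zero {p : HolderAlg α closedDisc}
    (hp : DifferentiableOn ℂ (extd p) (Metric.ball 0 1)) :
    (pullFst idDisc - pullSnd idDisc) * segAvg 0 p = pullFst (prim p) - pullSnd (prim p) := by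
  refine ext_of_ball_prod fun y z hy hz => ?_
  rw [mul_apply, sub_apply, sub_apply, pullFst_pt, pullSnd_pt, pullFst_pt, pullSnd_pt,
    segAvg_pt 0 p hy.le hz.le, extd_idDisc hy.le, extd_idDisc hz.le,
    ← sub_mul_integral_segment (fun z hz => hasDerivAt_prim hp (mem_ball_zero_iff.1 hz)) hy hz]
  simp

/-- Integration by parts in `t`. So `segAvg 1 p` is the second divided difference of the double
primitive, with the node `z` repeated. -/
theorem sub_mul_segAvg_one {p : HolderAlg α closedDisc}
    (hp : DifferentiableOn ℂ (extd p) (Metric.ball 0 1)) :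
    (pullFst idDisc - pullSnd idDisc) * segAvg 1 p = segAvg 0 (prim p) - pullSnd (prim p) := by
  refine ext_of_ball_prod fun y z hy hz => ?_
  rw [mul_apply, sub_apply, sub_apply, pullFst_pt, pullSnd_pt, pullSnd_pt,
    segAvg_pt 0 _ hy.le hz.le, segAvg_pt 1 _ hy.le hz.le, extd_idDisc hy.le, extd_idDisc hz.le]
  have h := intervalIntegral.integral_mul_deriv_eq_deriv_mul (a := 0) (b := 1)
    (u := fun t : ℝ => ((1 - t : ℝ) : ℂ)) (u' := fun _ => -1)
    (v := fun t : ℝ => extd (prim p) (z + t * (y - z)))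
    (v' := fun t => (y - z) * extd p (z + t * (y - z)))
    (fun t _ => by simpa using ((Complex.ofRealCLM.hasDerivAt (x := t)).const_sub 1))
    (fun t ht => (HasDerivAt.comp (h₂ := extd (prim p)) t
      (hasDerivAt_prim hp (mem_ball_zero_iff.1 (segment_mem_ball hy hz ht)))
      (hasDerivAt_segment y z t)).congr_deriv (mul_comm _ _))
    (continuous_const.intervalIntegrable _ _)
    ((continuous_const.mul (continuous_extd_segment p y z)).intervalIntegrable _ _)
  have e : ∫ t in (0 : ℝ)..1, ((1 - t : ℝ) : ℂ) * ((y - z) * extd p (z + t * (y - z))) =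
      (y - z) * ∫ t in (0 : ℝ)..1, ((1 - t : ℝ) : ℂ) ^ 1 * extd p (z + t * (y - z)) := by
    rw [← intervalIntegral.integral_const_mul]
    refine intervalIntegral.integral_congr fun t _ => ?_
    ring
  rw [← e, h]
  simp
  ring

theorem sub_mul_segAvg_zero_pt {p : HolderAlg α closedDisc}
    (hp : DifferentiableOn ℂ (extd p) (Metric.ball 0 1)) {y z : ℂ} (hy : ‖y‖ ≤ 1) (hz : ‖z‖ ≤ 1) :
    (y - z) * segAvg 0 p (pt y z) = extd (prim p) y - extd (prim p) z := by
  have h := DFunLike.congr_fun (sub_mul_segAvg_zero hp) (pt y z)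
  rwa [mul_apply, sub_apply, sub_apply, pullFst_pt, pullSnd_pt, pullFst_pt, pullSnd_pt,
    extd_idDisc hy, extd_idDisc hz] at h

theorem sub_mul_segAvg_one_pt {p : HolderAlg α closedDisc}
    (hp : DifferentiableOn ℂ (extd p) (Metric.ball 0 1)) {y z : ℂ} (hy : ‖y‖ ≤ 1) (hz : ‖z‖ ≤ 1) :
    (y - z) * segAvg 1 p (pt y z) = segAvg 0 (prim p) (pt y z) - extd (prim p) z := by
  have h := DFunLike.congr_fun (sub_mul_segAvg_one hp) (pt y z)
  rwa [mul_apply, sub_apply, sub_apply, pullFst_pt, pullSnd_pt, pullSnd_pt,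
    extd_idDisc hy, extd_idDisc hz] at h

theorem segAvg_diag (k : ℕ) (p : HolderAlg α closedDisc) {z : ℂ} (hz : ‖z‖ ≤ 1) :
    segAvg k p (pt z z) = extd p z / (k + 1) := by
  rw [segAvg_pt k p hz hz]
  simp only [sub_self, mul_zero, add_zero]
  rw [intervalIntegral.integral_mul_const]
  have h := intervalIntegral.integral_comp_sub_left (a := 0) (b := 1) (fun t : ℝ => (t : ℂ) ^ k) 1
  have h2 : ∫ t in (0 : ℝ)..1, (t : ℂ) ^ k = 1 / (k + 1) := by
    have h1 : ∀ r : ℝ, (r : ℂ) ^ k = ((r ^ k : ℝ) : ℂ) := fun r => by simp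
    simp_rw [h1]
    rw [intervalIntegral.integral_ofReal, integral_pow]
    simp
  rw [h, sub_self, sub_zero, h2]
  ring

/-- The derivative of the primitive, up to the boundary. -/
theorem hasDerivWithinAt_prim {p : HolderAlg α closedDisc}
    (hp : DifferentiableOn ℂ (extd p) (Metric.ball 0 1)) {z : ℂ} (hz : ‖z‖ ≤ 1) :
    HasDerivWithinAt (extd (prim p)) (extd p z) closedDisc z := by
  rw [hasDerivWithinAt_iff_tendsto_slope]
  -- The difference quotient is `segAvg 0 p`, which is continuous up to the diagonal even at
  -- boundary points and has the value `p(z)` there.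
  have h1 : Tendsto (fun w => segAvg 0 p (pt w z)) (𝓝[closedDisc \ {z}] z) (𝓝 (extd p z)) := by
    have := ((continuous_apply_pt_left (segAvg 0 p) z).tendsto z)
    rw [segAvg_diag 0 p hz] at this
    simp only [Nat.cast_zero, zero_add, div_one] at this
    exact this.mono_left nhdsWithin_le_nhds
  refine h1.congr' ?_
  filter_upwards [self_mem_nhdsWithin] with w hw
  have hne : w - z ≠ 0 := sub_ne_zero.2 hw.2
  rw [slope_def_field, ← sub_mul_segAvg_zero_pt hp (mem_closedBall_zero_iff.1 hw.1) hz]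
  field_simp

/-- Removable singularities. -/
theorem differentiableOn_of_sub_mul {u v : ℂ → ℂ} {c : ℂ} (hc : ‖c‖ < 1)
    (hu : ContinuousOn u (Metric.ball 0 1)) (hv : DifferentiableOn ℂ v (Metric.ball 0 1))
    (h : ∀ z ∈ Metric.ball (0 : ℂ) 1, (z - c) * u z = v z) :
    DifferentiableOn ℂ u (Metric.ball 0 1) := by
  have hcn : Metric.ball (0 : ℂ) 1 ∈ 𝓝 c := Metric.isOpen_ball.mem_nhds (mem_ball_zero_iff.2 hc)
  rw [← Complex.differentiableOn_compl_singleton_and_continuousAt_iff hcn]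
  refine ⟨?_, hu.continuousAt hcn⟩
  have h1 : DifferentiableOn ℂ (fun z => v z / (z - c)) (Metric.ball 0 1 \ {c}) :=
    (hv.mono sdiff_subset).div (by fun_prop) fun z hz => sub_ne_zero.2 hz.2
  refine h1.congr fun z hz => ?_
  rw [← h z hz.1]
  have : z - c ≠ 0 := sub_ne_zero.2 hz.2
  field_simp

/-- Off the diagonal the average is a quotient of holomorphic functions; the point `z = y` is
removable because the average is continuous there. -/
theorem differentiableOn_segAvg_zero_right {p : HolderAlg α closedDisc}
    (hp : DifferentiableOn ℂ (extd p) (Metric.ball 0 1)) {y : ℂ} (hy : ‖y‖ < 1) :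
    DifferentiableOn ℂ (fun z => segAvg 0 p (pt y z)) (Metric.ball 0 1) := by
  refine differentiableOn_of_sub_mul hy (continuous_apply_pt_right _ y).continuousOn
    ((differentiableOn_prim hp).sub_const (extd (prim p) y)) fun z hz => ?_
  have := sub_mul_segAvg_zero_pt hp hy.le (mem_ball_zero_iff.1 hz).le
  linear_combination -this

theorem differentiableOn_segAvg_one_right {p : HolderAlg α closedDisc}
    (hp : DifferentiableOn ℂ (extd p) (Metric.ball 0 1)) {y : ℂ} (hy : ‖y‖ < 1) :
    DifferentiableOn ℂ (fun z => segAvg 1 p (pt y z)) (Metric.ball 0 1) := by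
  refine differentiableOn_of_sub_mul hy (continuous_apply_pt_right _ y).continuousOn
    ((differentiableOn_prim hp).sub
      (differentiableOn_segAvg_zero_right (differentiableOn_prim hp) hy)) fun z hz => ?_
  have := sub_mul_segAvg_one_pt hp hy.le (mem_ball_zero_iff.1 hz).le
  simp only [Pi.sub_apply]
  linear_combination -this

theorem differentiableOn_segAvg_zero_left {p : HolderAlg α closedDisc}
    (hp : DifferentiableOn ℂ (extd p) (Metric.ball 0 1)) {z : ℂ} (hz : ‖z‖ < 1) :
    DifferentiableOn ℂ (fun y => segAvg 0 p (pt y z)) (Metric.ball 0 1) := by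
  refine differentiableOn_of_sub_mul hz (continuous_apply_pt_left _ z).continuousOn
    ((differentiableOn_prim hp).sub_const (extd (prim p) z)) fun y hy => ?_
  exact sub_mul_segAvg_zero_pt hp (mem_ball_zero_iff.1 hy).le hz.le

theorem differentiableOn_segAvg_one_left {p : HolderAlg α closedDisc}
    (hp : DifferentiableOn ℂ (extd p) (Metric.ball 0 1)) {z : ℂ} (hz : ‖z‖ < 1) :
    DifferentiableOn ℂ (fun y => segAvg 1 p (pt y z)) (Metric.ball 0 1) := by
  refine differentiableOn_of_sub_mul hz (continuous_apply_pt_left _ z).continuousOn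
    ((differentiableOn_segAvg_zero_left (differentiableOn_prim hp) hz).sub_const
      (extd (prim p) z)) fun y hy => ?_
  exact sub_mul_segAvg_one_pt hp (mem_ball_zero_iff.1 hy).le hz.le

/-- The derivative of the first average. -/
theorem hasDerivAt_segAvg_zero_right {p : HolderAlg α closedDisc}
    (hp : DifferentiableOn ℂ (extd p) (Metric.ball 0 1)) {y z : ℂ} (hy : ‖y‖ < 1) (hz : ‖z‖ < 1)
    (hyz : y ≠ z) :
    HasDerivAt (fun z => segAvg 0 (prim p) (pt y z)) (segAvg 1 p (pt y z)) z := by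
  have hne : y - z ≠ 0 := sub_ne_zero.2 hyz
  have hp' := differentiableOn_prim hp
  have h1 : HasDerivAt (fun w => (extd (prim (prim p)) y - extd (prim (prim p)) w) / (y - w))
      (((-extd (prim p) z) * (y - z) - (extd (prim (prim p)) y - extd (prim (prim p)) z) * (-1)) /
        (y - z) ^ 2) z :=
    ((hasDerivAt_prim hp' hz).const_sub _).div (by simpa using (hasDerivAt_id z).const_sub y) hne
  have h2 : HasDerivAt (fun z => segAvg 0 (prim p) (pt y z))
      (((-extd (prim p) z) * (y - z) - (extd (prim (prim p)) y - extd (prim (prim p)) z) * (-1)) /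
        (y - z) ^ 2) z := by
    refine h1.congr_of_eventuallyEq ?_
    filter_upwards [Metric.isOpen_ball.mem_nhds (mem_ball_zero_iff.2 hz),
      isOpen_ne.mem_nhds hyz.symm] with w hw hwy
    have : y - w ≠ 0 := sub_ne_zero.2 (Ne.symm hwy)
    rw [← sub_mul_segAvg_zero_pt hp' hy.le (mem_ball_zero_iff.1 hw).le]
    field_simp
  refine h2.congr_deriv ?_
  have e1 := sub_mul_segAvg_one_pt hp hy.le hz.le
  have e2 := sub_mul_segAvg_zero_pt hp' hy.le hz.le
  rw [div_eq_iff (pow_ne_zero 2 hne), ← e2]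
  linear_combination -(y - z) * e1

/-- The derivative of the second average. -/
theorem hasDerivAt_segAvg_one_right {p : HolderAlg α closedDisc}
    (hp : DifferentiableOn ℂ (extd p) (Metric.ball 0 1)) {y z : ℂ} (hy : ‖y‖ < 1) (hz : ‖z‖ < 1)
    (hyz : y ≠ z) :
    HasDerivAt (fun z => segAvg 1 p (pt y z))
      ((2 * segAvg 1 p (pt y z) - extd p z) / (y - z)) z := by
  have hne : y - z ≠ 0 := sub_ne_zero.2 hyz
  have h1 : HasDerivAt (fun w => (segAvg 0 (prim p) (pt y w) - extd (prim p) w) / (y - w))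
      (((segAvg 1 p (pt y z) - extd p z) * (y - z) -
        (segAvg 0 (prim p) (pt y z) - extd (prim p) z) * (-1)) / (y - z) ^ 2) z :=
    ((hasDerivAt_segAvg_zero_right hp hy hz hyz).sub (hasDerivAt_prim hp hz)).div
      (by simpa using (hasDerivAt_id z).const_sub y) hne
  have h2 : HasDerivAt (fun z => segAvg 1 p (pt y z))
      (((segAvg 1 p (pt y z) - extd p z) * (y - z) -
        (segAvg 0 (prim p) (pt y z) - extd (prim p) z) * (-1)) / (y - z) ^ 2) z := by
    refine h1.congr_of_eventuallyEq ?_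
    filter_upwards [Metric.isOpen_ball.mem_nhds (mem_ball_zero_iff.2 hz),
      isOpen_ne.mem_nhds hyz.symm] with w hw hwy
    have : y - w ≠ 0 := sub_ne_zero.2 (Ne.symm hwy)
    rw [← sub_mul_segAvg_one_pt hp hy.le (mem_ball_zero_iff.1 hw).le]
    field_simp
  refine h2.congr_deriv ?_
  have e1 := sub_mul_segAvg_one_pt hp hy.le hz.le
  rw [← e1]
  field_simp
  ring

end Segments

/-! ### Area integrals depending on a parameter and their derivatives -/

section AreaInt

/-- The operator `c ↦ (z ↦ (1/π) ∫ c(y, z) dA(y))`. -/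
def areaInt : HolderAlg α (closedDisc × closedDisc) →L[ℝ] HolderAlg α closedDisc :=
  avg discArea (fun _ => 1) (fun y z => (discProj y, z)) (integrable_const 1)
    (fun y => lipschitzWith_prodMk_left (discProj y))
    (fun _ => continuous_discProj.prodMk continuous_const)

theorem extd_areaInt (c : HolderAlg α (closedDisc × closedDisc)) (z : ℂ) :
    extd (areaInt c) z = ∫ y, c (pt y z) ∂discArea := by
  rw [extd, areaInt, avg_apply]
  simp [pt]

theorem extd_singularInt (c : HolderAlg α (closedDisc × closedDisc)) {z : ℂ} (hz : ‖z‖ ≤ 1) :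
    extd (singularInt c) z = ∫ y, (c (pt y z) - c (pt z z)) / (y - z) ∂discArea := by
  rw [extd, singularInt_apply]
  unfold singularKernel
  rw [coe_discProj_of_le hz]
  rfl

/-- Differentiation of an area integral with respect to the parameter. -/
theorem hasDerivAt_areaInt (ρ : HolderAlg α closedDisc)
    {m k l : HolderAlg α (closedDisc × closedDisc)}
    (hm : ∀ y : ℂ, ‖y‖ < 1 → DifferentiableOn ℂ (fun z => m (pt y z)) (Metric.ball 0 1))
    (hk : ∀ z : ℂ, k (pt z z) = 0)
    (hd : ∀ y z : ℂ, ‖y‖ < 1 → ‖z‖ < 1 → y ≠ z →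
      HasDerivAt (fun z => m (pt y z)) (k (pt y z) / (y - z) + l (pt y z)) z) {z : ℂ}
    (hz : ‖z‖ < 1) :
    HasDerivAt (extd (areaInt (pullFst ρ * m)))
      (extd (singularInt (pullFst ρ * k) + areaInt (pullFst ρ * l)) z) z := by
  -- The formula `k / (y - z) + l` is not dominated uniformly for `z` in a neighbourhood. The
  -- domination comes instead from the Cauchy estimate for `m(y, ·)`, holomorphic and bounded by
  -- `‖m‖`, on discs of radius `d` contained in the unit disc.
  set d := (1 - ‖z‖) / 2 with hdd
  have hd0 : 0 < d := by linarith
  have hball : ∀ x ∈ Metric.ball z d, Metric.closedBall x d ⊆ Metric.ball (0 : ℂ) 1 := by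
    intro x hx w hw
    rw [mem_ball_zero_iff]
    rw [Metric.mem_ball, dist_eq_norm] at hx
    rw [Metric.mem_closedBall, dist_eq_norm] at hw
    have e : w = (w - x) + (x - z) + z := by ring
    rw [e]
    refine (norm_add_le _ _).trans_lt ?_
    linarith [norm_add_le (w - x) (x - z)]
  have hae : ∀ᵐ y ∂discArea, extd ρ y * deriv (fun z => m (pt y z)) z =
      (pullFst ρ * k) (pt y z) / (y - z) + (pullFst ρ * l) (pt y z) := by
    filter_upwards [ae_discArea, ae_discArea_ne z] with y hy hyz
    rw [(hd y z (mem_ball_zero_iff.1 hy) hz hyz).deriv, mul_apply, mul_apply, pullFst_pt]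
    ring
  have hmeas : AEStronglyMeasurable (fun y => (pullFst ρ * k) (pt y z) / (y - z) +
      (pullFst ρ * l) (pt y z)) discArea := by
    refine AEStronglyMeasurable.add ?_ (continuous_apply_pt_left _ z).aestronglyMeasurable
    exact ((continuous_apply_pt_left _ z).measurable.div
      (measurable_id.sub_const z)).aestronglyMeasurable
  have key := hasDerivAt_integral_of_dominated_loc_of_deriv_le (μ := discArea) (𝕜 := ℂ)
    (F := fun z y => (pullFst ρ * m) (pt y z))
    (F' := fun z y => extd ρ y * deriv (fun z => m (pt y z)) z)
    (bound := fun _ => ‖ρ‖ * (‖m‖ / d)) (x₀ := z) (Metric.ball_mem_nhds z hd0)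
    (Eventually.of_forall fun z => (continuous_apply_pt_left _ z).aestronglyMeasurable)
    (integrable_discArea_of_continuous (continuous_apply_pt_left _ z))
    (hmeas.congr (hae.mono fun y hy => hy.symm)) ?_ (integrable_const _) ?_
  · have h2 := key.2
    have e1 : (fun n => ∫ y, (pullFst ρ * m) (pt y n) ∂discArea) =
        extd (areaInt (pullFst ρ * m)) := by
      ext n; rw [extd_areaInt]
    rw [e1] at h2
    refine h2.congr_deriv ?_
    have hi : Integrable (fun y => (pullFst ρ * k) (pt y z) / (y - z)) discArea := by
      have h3 := integrable_singularKernel (pullFst ρ * k) (discProj z)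
      refine h3.congr (Eventually.of_forall fun y => ?_)
      have h4 : (pullFst ρ * k) (discProj z, discProj z) = 0 := by
        have := hk z
        rw [pt] at this
        rw [mul_apply, this, mul_zero]
      simp only [singularKernel, h4, sub_zero, coe_discProj_of_le hz.le]
      rfl
    rw [integral_congr_ae hae, integral_add hi
      (integrable_discArea_of_continuous (continuous_apply_pt_left _ z)), extd_add,
      extd_areaInt, extd_singularInt _ hz.le]
    congr 2
    ext y
    rw [mul_apply (pullFst ρ) k (pt z z), hk z, mul_zero, sub_zero]
  · filter_upwards [ae_discArea] with y hy x hx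
    have hy' := mem_ball_zero_iff.1 hy
    rw [norm_mul]
    refine mul_le_mul (norm_extd_le _ _) ?_ (norm_nonneg _) (norm_nonneg _)
    refine Complex.norm_deriv_le_of_forall_mem_sphere_norm_le hd0 ?_ fun w _ =>
      m.norm_apply_le _
    exact ((hm y hy').mono (hball x hx)).diffContOnCl_ball subset_rfl
  · filter_upwards [ae_discArea] with y hy x hx
    have hy' := mem_ball_zero_iff.1 hy
    have hx' : x ∈ Metric.ball (0 : ℂ) 1 := hball x hx (Metric.mem_closedBall_self hd0.le)
    have h1 := ((hm y hy').differentiableAt (Metric.isOpen_ball.mem_nhds hx')).hasDerivAt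
    have h2 := h1.const_mul (extd ρ y)
    refine h2.congr_of_eventuallyEq (Eventually.of_forall fun w => ?_)
    simp only [mul_apply, pullFst_pt]

end AreaInt

end HolderAlg

namespace HolderAlg

variable {α : ℝ≥0}

/-! ### Schwarz reflection and the space of symmetric holomorphic functions -/

section Reflect

variable {S : Type*} [MetricSpace S] [Fact (0 < α)]

/-- The Schwarz reflection of a Hölder function. -/
def reflect (γ : S → S) (hγ : LipschitzWith 1 γ) : HolderAlg α S →L[ℝ] HolderAlg α S :=
  conj.comp (comp γ hγ)

@[simp] theorem reflect_apply (γ : S → S) (hγ : LipschitzWith 1 γ) (p : HolderAlg α S) (x : S) :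
    reflect γ hγ p x = starRingEnd ℂ (p (γ x)) := by
  rw [reflect, ContinuousLinearMap.comp_apply, conj_apply, comp_apply]

theorem reflect_mul (γ : S → S) (hγ : LipschitzWith 1 γ) (p q : HolderAlg α S) :
    reflect γ hγ (p * q) = reflect γ hγ p * reflect γ hγ q := by
  ext x; simp

theorem reflect_one (γ : S → S) (hγ : LipschitzWith 1 γ) :
    reflect γ hγ (1 : HolderAlg α S) = 1 := by
  ext x; simp

theorem reflect_conj (γ : S → S) (hγ : LipschitzWith 1 γ) (p : HolderAlg α S) :
    reflect γ hγ (conj p) = conj (reflect γ hγ p) := by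
  ext x; simp

theorem reflect_inverse (γ : S → S) (hγ : LipschitzWith 1 γ) {a : HolderAlg α S} (ha : IsUnit a)
    (h : reflect γ hγ a = a) : reflect γ hγ (Ring.inverse a) = Ring.inverse a := by
  have h1 : a * reflect γ hγ (Ring.inverse a) = 1 := by
    rw [← reflect_one (α := α) γ hγ, ← Ring.mul_inverse_cancel a ha, reflect_mul, h]
  have h2 := Ring.inverse_mul_cancel a ha
  calc reflect γ hγ (Ring.inverse a) = Ring.inverse a * a * reflect γ hγ (Ring.inverse a) := by
        rw [h2, one_mul]
    _ = Ring.inverse a := by rw [mul_assoc, h1, mul_one]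

end Reflect

/-- The complex conjugation of the closed disc. -/
def discConj (z : closedDisc) : closedDisc :=
  ⟨starRingEnd ℂ z, by simpa using norm_coe_le z⟩

theorem lipschitzWith_discConj : LipschitzWith 1 discConj := by
  refine LipschitzWith.of_dist_le_mul fun z w => ?_
  rw [NNReal.coe_one, one_mul, Subtype.dist_eq, Subtype.dist_eq, dist_eq_norm, dist_eq_norm]
  simp only [discConj]
  rw [← map_sub, RCLike.norm_conj]

theorem discProj_conj (z : ℂ) : discProj (starRingEnd ℂ z) = discConj (discProj z) := by
  refine Subtype.ext ?_
  simp [discProj, discConj]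

theorem lipschitzWith_prodMap_discConj : LipschitzWith 1 (Prod.map discConj discConj) := by
  refine LipschitzWith.of_dist_le_mul fun z w => ?_
  rw [NNReal.coe_one, one_mul, Prod.dist_eq, Prod.dist_eq]
  refine max_le_max ?_ ?_
  · simpa using lipschitzWith_discConj.dist_le_mul z.1 w.1
  · simpa using lipschitzWith_discConj.dist_le_mul z.2 w.2

variable [Fact (0 < α)]

/-- The Schwarz reflection on the disc. -/
def reflectDisc : HolderAlg α closedDisc →L[ℝ] HolderAlg α closedDisc :=
  reflect discConj lipschitzWith_discConj

/-- The Schwarz reflection on the bidisc. -/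
def reflectProd : HolderAlg α (closedDisc × closedDisc) →L[ℝ]
    HolderAlg α (closedDisc × closedDisc) :=
  reflect (Prod.map discConj discConj) lipschitzWith_prodMap_discConj

theorem extd_reflectDisc (p : HolderAlg α closedDisc) (z : ℂ) :
    extd (reflectDisc p) z = starRingEnd ℂ (extd p (starRingEnd ℂ z)) := by
  rw [extd, reflectDisc, reflect_apply, extd, discProj_conj]

theorem reflectProd_pt (c : HolderAlg α (closedDisc × closedDisc)) (y z : ℂ) :
    reflectProd c (pt y z) = starRingEnd ℂ (c (pt (starRingEnd ℂ y) (starRingEnd ℂ z))) := by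
  rw [reflectProd, reflect_apply, pt, pt, discProj_conj, discProj_conj]
  rfl

theorem reflectDisc_mul (p q : HolderAlg α closedDisc) :
    reflectDisc (p * q) = reflectDisc p * reflectDisc q := reflect_mul _ _ _ _

theorem reflectDisc_one : reflectDisc (1 : HolderAlg α closedDisc) = 1 := reflect_one _ _

theorem reflectDisc_conj (p : HolderAlg α closedDisc) :
    reflectDisc (conj p) = conj (reflectDisc p) := reflect_conj _ _ _

theorem reflectDisc_reflectDisc (p : HolderAlg α closedDisc) :
    reflectDisc (reflectDisc p) = p :=
  ext_of_ball fun z _ => by simp [extd_reflectDisc]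

theorem reflectProd_mul (p q : HolderAlg α (closedDisc × closedDisc)) :
    reflectProd (p * q) = reflectProd p * reflectProd q := reflect_mul _ _ _ _

theorem reflectProd_one : reflectProd (1 : HolderAlg α (closedDisc × closedDisc)) = 1 :=
  reflect_one _ _

section Ops

variable [Fact (α < 1)]

theorem reflectDisc_idDisc : reflectDisc (idDisc : HolderAlg α closedDisc) = idDisc :=
  ext_of_ball fun z hz => by
    have hz' := (mem_ball_zero_iff.1 hz).le
    rw [extd_reflectDisc, extd_idDisc (by simpa using hz'), extd_idDisc hz', Complex.conj_conj]

theorem reflectProd_segAvg (k : ℕ) (p : HolderAlg α closedDisc) :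
    reflectProd (segAvg k p) = segAvg k (reflectDisc p) := by
  refine ext_of_ball_prod fun y z hy hz => ?_
  rw [reflectProd_pt, segAvg_pt k p (by simpa using hy.le) (by simpa using hz.le),
    segAvg_pt k _ hy.le hz.le, intervalIntegral.integral_of_le zero_le_one,
    intervalIntegral.integral_of_le zero_le_one, ← integral_conj]
  refine integral_congr_ae (Eventually.of_forall fun t => ?_)
  simp [extd_reflectDisc]

theorem reflectProd_pullFst (p : HolderAlg α closedDisc) :
    reflectProd (pullFst p) = pullFst (reflectDisc p) := by
  refine ext_of_ball_prod fun y z _ _ => ?_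
  rw [reflectProd_pt, pullFst_pt, pullFst_pt, extd_reflectDisc]

theorem reflectProd_pullSnd (p : HolderAlg α closedDisc) :
    reflectProd (pullSnd p) = pullSnd (reflectDisc p) := by
  refine ext_of_ball_prod fun y z _ _ => ?_
  rw [reflectProd_pt, pullSnd_pt, pullSnd_pt, extd_reflectDisc]

theorem reflectDisc_prim (p : HolderAlg α closedDisc) :
    reflectDisc (prim p) = prim (reflectDisc p) := by
  refine ext_of_ball fun z hz => ?_
  have hz' := (mem_ball_zero_iff.1 hz).le
  rw [extd_reflectDisc, extd_prim p (by simpa using hz'), extd_prim _ hz',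
    intervalIntegral.integral_of_le zero_le_one,
    intervalIntegral.integral_of_le zero_le_one, map_mul, ← integral_conj, Complex.conj_conj]
  congr 1
  refine integral_congr_ae (Eventually.of_forall fun t => ?_)
  simp [extd_reflectDisc]

theorem reflectDisc_areaInt (c : HolderAlg α (closedDisc × closedDisc)) :
    reflectDisc (areaInt c) = areaInt (reflectProd c) := by
  refine ext_of_ball fun z hz => ?_
  rw [extd_reflectDisc, extd_areaInt, extd_areaInt, ← integral_conj, ← integral_discArea_conj]
  simp_rw [reflectProd_pt]

theorem reflectDisc_singularInt (c : HolderAlg α (closedDisc × closedDisc)) :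
    reflectDisc (singularInt c) = singularInt (reflectProd c) := by
  refine ext_of_ball fun z hz => ?_
  have hz' := (mem_ball_zero_iff.1 hz).le
  rw [extd_reflectDisc, extd_singularInt _ (by simpa using hz'), extd_singularInt _ hz',
    ← integral_conj, ← integral_discArea_conj]
  refine integral_congr_ae (Eventually.of_forall fun y => ?_)
  simp [reflectProd_pt]

theorem reflectDisc_bergman (q : HolderAlg α closedDisc) :
    reflectDisc (bergman q) = bergman (reflectDisc q) := by
  refine ext_of_ball fun z hz => ?_
  have hz' := mem_ball_zero_iff.1 hz
  rw [extd_reflectDisc, bergman_apply q (by simpa using hz'), bergman_apply _ hz', cauchyPow,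
    cauchyPow, ← integral_conj, ← integral_discArea_conj]
  refine integral_congr_ae (Eventually.of_forall fun y => ?_)
  simp [extd_reflectDisc]

theorem differentiableOn_bergman (q : HolderAlg α closedDisc) :
    DifferentiableOn ℂ (extd (bergman q)) (Metric.ball 0 1) :=
  (differentiableOn_cauchyPow (continuous_extd q).aestronglyMeasurable
    (fun y _ => norm_extd_le q y) 2).congr fun _ hz => bergman_apply q (mem_ball_zero_iff.1 hz)

theorem bergman_of_differentiableOn {p : HolderAlg α closedDisc}
    (hp : DifferentiableOn ℂ (extd p) (Metric.ball 0 1)) : bergman p = p :=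
  ext_of_ball fun z hz => by
    rw [bergman_apply p (mem_ball_zero_iff.1 hz),
      cauchyPow_two_holomorphic hp (fun y _ => norm_extd_le p y) (mem_ball_zero_iff.1 hz)]

variable (α) in
/-- The Hölder functions that are holomorphic in the disc and symmetric. -/
def holSymm : Submodule ℝ (HolderAlg α closedDisc) where
  carrier := {p | DifferentiableOn ℂ (extd p) (Metric.ball 0 1) ∧ reflectDisc p = p}
  zero_mem' := ⟨differentiableOn_const (0 : ℂ), map_zero _⟩
  add_mem' := fun ha hb => ⟨ha.1.add hb.1, by rw [map_add, ha.2, hb.2]⟩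
  smul_mem' := fun c _ ha => ⟨ha.1.const_smul c, by rw [map_smul, ha.2]⟩

theorem bergman_mem_holSymm {q : HolderAlg α closedDisc} (hq : reflectDisc q = q) :
    bergman q ∈ holSymm α :=
  ⟨differentiableOn_bergman q, by rw [reflectDisc_bergman, hq]⟩

variable (α) in
/-- A continuous linear projection onto `holSymm`. -/
def holProj : HolderAlg α closedDisc →L[ℝ] holSymm α :=
  (bergman.comp ((2⁻¹ : ℝ) • (ContinuousLinearMap.id ℝ _ + reflectDisc))).codRestrict (holSymm α)
    fun q => bergman_mem_holSymm (by
      change reflectDisc ((2⁻¹ : ℝ) • (q + reflectDisc q)) = (2⁻¹ : ℝ) • (q + reflectDisc q)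
      rw [map_smul, map_add, reflectDisc_reflectDisc, add_comm])

theorem holProj_of_mem {p : HolderAlg α closedDisc} (hp : p ∈ holSymm α) :
    holProj α p = ⟨p, hp⟩ := by
  refine Subtype.ext ?_
  change bergman ((2⁻¹ : ℝ) • (p + reflectDisc p)) = p
  rw [hp.2, ← two_smul ℝ p, smul_smul]
  norm_num
  exact bergman_of_differentiableOn hp.1

/-- The subspace is the set of fixed points of a continuous projection. -/
theorem isClosed_holSymm : IsClosed (holSymm α : Set (HolderAlg α closedDisc)) := by
  have : (holSymm α : Set (HolderAlg α closedDisc)) =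
      {p | ((holProj α p : holSymm α) : HolderAlg α closedDisc) = p} := by
    ext p
    constructor
    · intro hp
      simp [holProj_of_mem (p := p) hp]
    · intro hp
      rw [← show ((holProj α p : holSymm α) : HolderAlg α closedDisc) = p from hp]
      exact (holProj α p).2
  rw [this]
  exact isClosed_eq (by fun_prop) continuous_id

instance : CompleteSpace (holSymm α) := isClosed_holSymm.completeSpace_coe

end Ops

end HolderAlg

/-! ### Cauchy integrals at the boundary -/

section CauchyBoundary

theorem norm_cauchyPow_one_kernel_le {z y : ℂ} (hz : ‖z‖ ≤ 1) (hy : ‖y‖ ≤ 1) (hne : y ≠ z) :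
    ‖((1 - z * starRingEnd ℂ y) ^ 1)⁻¹‖ ≤ ‖y - z‖⁻¹ := by
  rw [pow_one, norm_inv]
  exact inv_anti₀ (norm_pos_iff.2 (sub_ne_zero.2 hne)) (norm_sub_le_norm_one_sub hz hy)

theorem ae_norm_cauchyPow_one_le {u : ℂ → ℂ} {K : ℝ}
    (hu : ∀ y ∈ Metric.ball (0 : ℂ) 1, ‖u y‖ ≤ K) {z : ℂ} (hz : ‖z‖ ≤ 1) :
    ∀ᵐ y ∂discArea, ‖u y * ((1 - z * starRingEnd ℂ y) ^ 1)⁻¹‖ ≤ K * ‖y - z‖⁻¹ := by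
  filter_upwards [ae_discArea, ae_discArea_ne z] with y hy hne
  rw [norm_mul]
  exact mul_le_mul (hu y hy) (norm_cauchyPow_one_kernel_le hz (mem_ball_zero_iff.1 hy).le hne)
    (norm_nonneg _) ((norm_nonneg _).trans (hu y hy))

theorem integrable_cauchyPow_one {u : ℂ → ℂ} {K : ℝ} (hm : AEStronglyMeasurable u discArea)
    (hu : ∀ y ∈ Metric.ball (0 : ℂ) 1, ‖u y‖ ≤ K) {z : ℂ} (hz : ‖z‖ ≤ 1) :
    Integrable (fun y => u y * ((1 - z * starRingEnd ℂ y) ^ 1)⁻¹) discArea :=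
  ((integrable_norm_sub_inv hz).const_mul K).mono' (aestronglyMeasurable_cauchyPow hm 1 z)
    (ae_norm_cauchyPow_one_le hu hz)

theorem norm_cauchyPow_one_le {u : ℂ → ℂ} {K : ℝ}
    (hu : ∀ y ∈ Metric.ball (0 : ℂ) 1, ‖u y‖ ≤ K) {z : ℂ} (hz : ‖z‖ ≤ 1) :
    ‖cauchyPow 1 u z‖ ≤ cauchyConst * K := by
  have hK : 0 ≤ K := (norm_nonneg _).trans (hu 0 zero_mem_ball)
  refine (norm_integral_le_of_norm_le ((integrable_norm_sub_inv hz).const_mul K)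
    (ae_norm_cauchyPow_one_le hu hz)).trans ?_
  rw [integral_const_mul, mul_comm]
  exact mul_le_mul_of_nonneg_right (integral_norm_sub_inv_le hz) hK

/-- The radial limits of the Cauchy type integrals. -/
theorem tendsto_cauchyPow_one {u : ℂ → ℂ} {K : ℝ} (hm : AEStronglyMeasurable u discArea)
    (hu : ∀ y ∈ Metric.ball (0 : ℂ) 1, ‖u y‖ ≤ K) {w : ℂ} (hw : ‖w‖ = 1) :
    Tendsto (fun r : ℝ => cauchyPow 1 u (r * w)) (𝓝[<] 1) (𝓝 (cauchyPow 1 u w)) := by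
  refine tendsto_integral_filter_of_dominated_convergence (fun y => 2 * K * ‖y - w‖⁻¹)
    (Eventually.of_forall fun r => aestronglyMeasurable_cauchyPow hm 1 _) ?_
    ((integrable_norm_sub_inv hw.le).const_mul _) ?_
  · filter_upwards [Ioo_mem_nhdsLT (zero_lt_one' ℝ)] with r hr
    filter_upwards [ae_discArea, ae_discArea_ne w] with y hy hne
    have hy' := (mem_ball_zero_iff.1 hy).le
    have hK : 0 ≤ K := (norm_nonneg _).trans (hu y hy)
    -- Passing from `r w` to `w` costs at most `1 - r`, which is itself at most `|1 - r w ȳ|`. This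
    -- yields a dominating function that is independent of `r`.
    have h1 : ‖1 - w * starRingEnd ℂ y‖ ≤ 2 * ‖1 - r * w * starRingEnd ℂ y‖ := by
      have h2 := one_sub_norm_le (z := r * w) hy'
      rw [norm_mul, hw, mul_one, Complex.norm_real, Real.norm_of_nonneg hr.1.le] at h2
      have h3 : 1 - w * starRingEnd ℂ y = (1 - r * w * starRingEnd ℂ y) -
        ((1 - r : ℝ) : ℂ) * (w * starRingEnd ℂ y) := by push_cast; ring
      rw [h3]
      refine (norm_sub_le _ _).trans ?_
      rw [norm_mul, Complex.norm_real, Real.norm_of_nonneg (by linarith [hr.2]), norm_mul, hw,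
        RCLike.norm_conj]
      nlinarith [hr.2, norm_nonneg y]
    have h0 : 0 < ‖y - w‖ := norm_pos_iff.2 (sub_ne_zero.2 hne)
    have h4 := norm_sub_le_norm_one_sub hw.le hy'
    rw [norm_mul, norm_inv, pow_one]
    calc ‖u y‖ * ‖1 - r * w * starRingEnd ℂ y‖⁻¹ ≤ K * (‖y - w‖ / 2)⁻¹ := by
          refine mul_le_mul (hu y hy) (inv_anti₀ (by positivity) (by linarith)) (by positivity) hK
      _ = 2 * K * ‖y - w‖⁻¹ := by rw [inv_div]; ring
  · filter_upwards [ae_discArea] with y hy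
    have hy' := mem_ball_zero_iff.1 hy
    have hne : (1 - ((1 : ℝ) : ℂ) * w * starRingEnd ℂ y) ^ 1 ≠ 0 := by
      rw [pow_one, Complex.ofReal_one, one_mul]
      have h1 := norm_sub_norm_le (1 : ℂ) (w * starRingEnd ℂ y)
      rw [norm_mul, hw, RCLike.norm_conj, norm_one, one_mul] at h1
      exact norm_pos_iff.1 (by linarith)
    have hc : ContinuousAt (fun r : ℝ => u y * ((1 - (r : ℂ) * w * starRingEnd ℂ y) ^ 1)⁻¹) 1 := by
      refine continuousAt_const.mul (ContinuousAt.inv₀ ?_ hne)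
      fun_prop
    have := hc.tendsto
    simp only [Complex.ofReal_one, one_mul] at this
    exact this.mono_left nhdsWithin_le_nhds

/-- After conjugation this is the `j`-th moment of the holomorphic function `y ^ k / (1 - z̄ y)`,
whose Taylor coefficients are powers of `z̄`, shifted by `k`. -/
theorem cauchyPow_one_monomial_of_lt (j k : ℕ) {z : ℂ} (hz : ‖z‖ < 1) :
    cauchyPow 1 (fun y => y ^ j * starRingEnd ℂ y ^ k) z =
      (if k ≤ j then z ^ (j - k) else 0) / (j + 1) := by
  set u : ℂ → ℂ := fun y => y ^ k * (1 - starRingEnd ℂ z * y)⁻¹ with hu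
  have hzc : ‖starRingEnd ℂ z‖ < 1 := by simpa using hz
  have hlt : ∀ y : ℂ, ‖y‖ < 1 → ‖starRingEnd ℂ z * y‖ < 1 := fun y hy => by
    rw [norm_mul]
    calc _ ≤ ‖starRingEnd ℂ z‖ * 1 := by gcongr
      _ < 1 := by linarith
  have hne : ∀ y : ℂ, ‖y‖ < 1 → 1 - starRingEnd ℂ z * y ≠ 0 := fun y hy h => by
    have := hlt y hy
    rw [← sub_eq_zero.1 h, norm_one] at this
    exact lt_irrefl _ this
  have hd : DifferentiableOn ℂ u (Metric.ball 0 1) :=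
    (by fun_prop : DifferentiableOn ℂ (fun y : ℂ => y ^ k) _).mul
      (DifferentiableOn.inv (by fun_prop) fun y hy => hne y (mem_ball_zero_iff.1 hy))
  have hb : ∀ y ∈ Metric.ball (0 : ℂ) 1, ‖u y‖ ≤ 1 * (1 - ‖z‖)⁻¹ := by
    intro y hy
    have hy' := mem_ball_zero_iff.1 hy
    rw [hu, norm_mul, norm_pow, norm_inv]
    have h1 := norm_sub_norm_le (1 : ℂ) (starRingEnd ℂ z * y)
    rw [norm_mul, RCLike.norm_conj, norm_one] at h1
    have h2 : 1 - ‖z‖ ≤ ‖1 - starRingEnd ℂ z * y‖ := by nlinarith [norm_nonneg z]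
    exact mul_le_mul (pow_le_one₀ (norm_nonneg _) hy'.le) (inv_anti₀ (by linarith) h2)
      (by positivity) zero_le_one
  have ht : taylorCoeff u j = if k ≤ j then starRingEnd ℂ z ^ (j - k) else 0 := by
    refine taylorCoeff_of_hasSum (a := fun j => if k ≤ j then starRingEnd ℂ z ^ (j - k) else 0)
      (fun y hy => ?_) j
    have h1 := (hasSum_geometric_of_norm_lt_one (hlt y hy)).mul_left (y ^ k)
    have h2 : HasSum (fun n => (if k ≤ n + k then starRingEnd ℂ z ^ (n + k - k) else 0) *
        y ^ (n + k)) (u y) := by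
      convert! h1 using 2 with n
      simp only [Nat.le_add_left, if_true, Nat.add_sub_cancel]
      ring
    rw [hasSum_nat_add_iff (f := fun n => (if k ≤ n then starRingEnd ℂ z ^ (n - k) else 0) *
      y ^ n)] at h2
    rwa [Finset.sum_eq_zero, add_zero] at h2
    intro i hi
    rw [if_neg (by simpa using hi), zero_mul]
  have h := integral_holomorphic_mul_conj_pow j hd hb
  rw [ht] at h
  have h3 := congrArg (starRingEnd ℂ) h
  rw [← integral_conj] at h3
  rw [cauchyPow]
  convert! h3 using 1
  · refine integral_congr_ae (Eventually.of_forall fun y => ?_)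
    simp only [hu, map_mul, map_pow, map_inv₀, map_sub, map_one, Complex.conj_conj, pow_one]
    ring
  · split_ifs <;> simp

theorem cauchyPow_one_monomial (j k : ℕ) {w : ℂ} (hw : ‖w‖ = 1) :
    cauchyPow 1 (fun y => y ^ j * starRingEnd ℂ y ^ k) w =
      (if k ≤ j then w ^ (j - k) else 0) / (j + 1) := by
  have hb : ∀ y ∈ Metric.ball (0 : ℂ) 1, ‖y ^ j * starRingEnd ℂ y ^ k‖ ≤ 1 := by
    intro y hy
    have hy' := (mem_ball_zero_iff.1 hy).le
    rw [norm_mul, norm_pow, norm_pow, RCLike.norm_conj]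
    exact mul_le_one₀ (pow_le_one₀ (norm_nonneg _) hy') (by positivity)
      (pow_le_one₀ (norm_nonneg _) hy')
  have h1 := tendsto_cauchyPow_one (u := fun y => y ^ j * starRingEnd ℂ y ^ k)
    (by fun_prop : Continuous _).aestronglyMeasurable hb hw
  have h2 : Tendsto (fun r : ℝ => (if k ≤ j then ((r : ℂ) * w) ^ (j - k) else 0) / ((j : ℂ) + 1))
      (𝓝[<] 1) (𝓝 ((if k ≤ j then w ^ (j - k) else 0) / (j + 1))) := by
    have hc : Continuous fun r : ℝ =>
        (if k ≤ j then ((r : ℂ) * w) ^ (j - k) else 0) / ((j : ℂ) + 1) := by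
      split_ifs <;> fun_prop
    have := hc.tendsto 1
    simp only [Complex.ofReal_one, one_mul] at this
    exact this.mono_left nhdsWithin_le_nhds
  refine tendsto_nhds_unique h1 (h2.congr' ?_)
  filter_upwards [Ioo_mem_nhdsLT (zero_lt_one' ℝ)] with r hr
  rw [cauchyPow_one_monomial_of_lt]
  rw [norm_mul, hw, mul_one, Complex.norm_real, Real.norm_of_nonneg hr.1.le]
  exact hr.2

end CauchyBoundary

namespace HolderAlg

variable {α : ℝ≥0} [Fact (0 < α)] [Fact (α < 1)]

/-! ### Sup-norm density of polynomials -/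

section Density

theorem conj_taylorCoeff {p : HolderAlg α closedDisc} (hp : p ∈ holSymm α) (n : ℕ) :
    starRingEnd ℂ (taylorCoeff (extd p) n) = taylorCoeff (extd p) n := by
  refine (taylorCoeff_of_hasSum (a := fun n => starRingEnd ℂ (taylorCoeff (extd p) n))
    (fun z hz => ?_) n).symm
  have h := (hasSum_taylorCoeff hp.1 (z := starRingEnd ℂ z) (by simpa using hz)).map
    (starRingEnd ℂ) Complex.continuous_conj
  rw [← extd_reflectDisc, hp.2] at h
  convert! h using 2 with n
  simp

theorem norm_prim_le (p : HolderAlg α closedDisc) : supNorm (prim p) ≤ supNorm p := by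
  refine supNorm_le p.supNorm_nonneg fun z => ?_
  rw [prim_apply, norm_mul]
  have h1 : ‖∫ t in (0 : ℝ)..1, extd p (t * z)‖ ≤ supNorm p * |1 - 0| :=
    intervalIntegral.norm_integral_le_of_norm_le_const fun t _ => p.norm_apply_le_supNorm _
  rw [sub_zero, abs_one, mul_one] at h1
  calc _ ≤ 1 * supNorm p := mul_le_mul (norm_coe_le z) h1 (norm_nonneg _) zero_le_one
    _ = _ := one_mul _

/-- The polynomials are dense in `holSymm` for the sup norm. -/
theorem exists_polynomial_supNorm_sub_le {p : HolderAlg α closedDisc} (hp : p ∈ holSymm α) {ε : ℝ}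
    (hε : 0 < ε) : ∃ (N : ℕ) (a : ℕ → ℝ),
      supNorm (p - ∑ k ∈ Finset.range N, a k • (idDisc : HolderAlg α closedDisc) ^ k) ≤ ε := by
  have hα0 : (0 : ℝ) < α := by exact_mod_cast (Fact.out : 0 < α)
  have h1 : Tendsto (fun ρ : ℝ => ‖p‖ * (1 - ρ) ^ (α : ℝ)) (𝓝[<] 1) (𝓝 0) := by
    have hc : ContinuousAt (fun ρ : ℝ => ‖p‖ * (1 - ρ) ^ (α : ℝ)) 1 := by
      refine continuousAt_const.mul (ContinuousAt.rpow_const (by fun_prop) (Or.inr hα0.le))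
    have := hc.tendsto
    rw [sub_self, Real.zero_rpow hα0.ne', mul_zero] at this
    exact this.mono_left nhdsWithin_le_nhds
  -- The dilation `p(ρ z)` is uniformly close to `p` by Hölder continuity, and its Taylor series
  -- converges uniformly on the closed disc. The approximation is claimed for the sup norm only.
  obtain ⟨ρ, hρ1, hρ⟩ := ((h1.eventually (gt_mem_nhds (half_pos hε))).and
    (Ioo_mem_nhdsLT (zero_lt_one' ℝ))).exists
  set c := taylorCoeff (extd p) with hc
  have hs := (hasSum_taylorCoeff hp.1 (z := (ρ : ℂ)) (by
    rw [Complex.norm_real, Real.norm_of_nonneg hρ.1.le]; exact hρ.2)).summable.norm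
  have hu := tendstoUniformlyOn_tsum_nat (f := fun n (z : ℂ) => c n * (ρ * z) ^ n) hs
    (s := closedDisc) (fun n z hz => by
      rw [norm_mul, norm_mul, mul_pow, norm_mul]
      refine mul_le_mul_of_nonneg_left ?_ (norm_nonneg _)
      refine mul_le_of_le_one_right (norm_nonneg _) ?_
      rw [norm_pow]
      exact pow_le_one₀ (norm_nonneg _) (mem_closedBall_zero_iff.1 hz))
  rw [Metric.tendstoUniformlyOn_iff] at hu
  obtain ⟨N, hN⟩ := (hu (ε / 2) (half_pos hε)).exists
  refine ⟨N, fun k => (c k).re * ρ ^ k, supNorm_le hε.le fun z => ?_⟩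
  have hlt : ‖(ρ : ℂ) * z‖ < 1 := by
    rw [norm_mul, Complex.norm_real, Real.norm_of_nonneg hρ.1.le]
    nlinarith [norm_coe_le z, hρ.1, hρ.2, norm_nonneg (z : ℂ)]
  have h2 := hN z z.2
  rw [(hasSum_taylorCoeff hp.1 hlt).tsum_eq, dist_eq_norm] at h2
  have h3 : ‖extd p z - extd p (ρ * z)‖ ≤ ‖p‖ * (1 - ρ) ^ (α : ℝ) := by
    refine (norm_extd_sub_le p (norm_coe_le z) hlt.le).trans ?_
    refine mul_le_mul_of_nonneg_left (Real.rpow_le_rpow (norm_nonneg _) ?_ hα0.le) (norm_nonneg _)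
    have : (z : ℂ) - ρ * z = ((1 - ρ : ℝ) : ℂ) * z := by push_cast; ring
    rw [this, norm_mul, Complex.norm_real, Real.norm_of_nonneg (by linarith [hρ.2])]
    exact mul_le_of_le_one_right (by linarith [hρ.2]) (norm_coe_le z)
  have h4 : (∑ k ∈ Finset.range N, ((c k).re * ρ ^ k) • (idDisc : HolderAlg α closedDisc) ^ k) z =
      ∑ n ∈ Finset.range N, c n * (ρ * z) ^ n := by
    have hcoe : ∀ k, (((idDisc : HolderAlg α closedDisc) ^ k : HolderAlg α closedDisc)) z =
        (z : ℂ) ^ k := fun k => by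
      induction k with
      | zero => simp
      | succ k ih => rw [pow_succ, mul_apply, ih, pow_succ, idDisc_apply]
    have hsum : ∀ (s : Finset ℕ) (f : ℕ → HolderAlg α closedDisc),
        (∑ k ∈ s, f k) z = ∑ k ∈ s, f k z := fun s f => by
      classical
      induction s using Finset.induction_on with
      | empty => simp
      | insert a s ha ih => rw [Finset.sum_insert ha, Finset.sum_insert ha, add_apply, ih]
    rw [hsum]
    refine Finset.sum_congr rfl fun k _ => ?_
    rw [smul_apply, hcoe, Complex.real_smul, mul_pow]
    have : ((c k).re : ℂ) = c k := Complex.conj_eq_iff_re.1 (conj_taylorCoeff hp k)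
    push_cast
    rw [this]
    ring
  rw [sub_apply, h4, ← extd_coe]
  have e : extd p z - ∑ n ∈ Finset.range N, c n * (ρ * z) ^ n = (extd p z - extd p (ρ * z)) +
    (extd p (ρ * z) - ∑ n ∈ Finset.range N, c n * (ρ * z) ^ n) := by ring
  rw [e]
  refine (norm_add_le _ _).trans ?_
  linarith

/-- A linear functional bounded for the sup norm is determined by its values on powers. -/
theorem eq_zero_of_pow {Λ : HolderAlg α closedDisc →ₗ[ℝ] ℂ} {K : ℝ}
    (hK : ∀ p, ‖Λ p‖ ≤ K * supNorm p) (h : ∀ k, Λ (idDisc ^ k) = 0) {p : HolderAlg α closedDisc}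
    (hp : p ∈ holSymm α) : Λ p = 0 := by
  have hle : ∀ ε > 0, ‖Λ p‖ ≤ |K| * ε := fun ε hε => by
    obtain ⟨N, a, ha⟩ := exists_polynomial_supNorm_sub_le hp hε
    have h1 : Λ (p - ∑ k ∈ Finset.range N, a k • (idDisc : HolderAlg α closedDisc) ^ k) = Λ p := by
      rw [map_sub, map_sum, Finset.sum_eq_zero, sub_zero]
      intro k _
      rw [map_smul, h, smul_zero]
    rw [← h1]
    refine (hK _).trans ?_
    calc _ ≤ |K| * supNorm (p - ∑ k ∈ Finset.range N,
            a k • (idDisc : HolderAlg α closedDisc) ^ k) :=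
          mul_le_mul_of_nonneg_right (le_abs_self K) (supNorm_nonneg _)
      _ ≤ |K| * ε := mul_le_mul_of_nonneg_left ha (abs_nonneg K)
  have h2 : Tendsto (fun ε : ℝ => |K| * ε) (𝓝[>] 0) (𝓝 0) := by
    have : Continuous fun ε : ℝ => |K| * ε := by fun_prop
    simpa using (this.tendsto 0).mono_left nhdsWithin_le_nhds
  have h3 : ‖Λ p‖ ≤ 0 := ge_of_tendsto h2 (eventually_mem_nhdsWithin.mono fun ε hε => hle ε hε)
  exact norm_le_zero_iff.1 h3

end Density

end HolderAlg

namespace HolderAlg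

variable {α : ℝ≥0} [Fact (0 < α)] [Fact (α < 1)]

/-! ### The rotation term as a Cauchy integral -/

section Sesquilinear

@[simp] theorem conj_mul {S : Type*} [MetricSpace S] (p q : HolderAlg α S) :
    conj (p * q) = conj p * conj q := by
  ext x; simp

@[simp] theorem conj_one {S : Type*} [MetricSpace S] : conj (1 : HolderAlg α S) = 1 := by
  ext x; simp

@[simp] theorem extd_pow (p : HolderAlg α closedDisc) (n : ℕ) (z : ℂ) :
    extd (p ^ n) z = extd p z ^ n := by
  induction n with
  | zero => simp
  | succ k ih => rw [pow_succ, extd_mul, ih, pow_succ]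

/-- The density attached to a pair of functions, given with their derivatives. -/
def crossDensity (u v : HolderAlg α closedDisc × HolderAlg α closedDisc × HolderAlg α closedDisc) :
    HolderAlg α closedDisc :=
  -- For `u = z ^ (j + 1)` and `v = z ^ (k + 1)` this is `(j + 2) (j - k) z ^ (j + 1) z̄ ^ (k + 1)`.
  -- The factor `j + 2` is the one that the Cauchy integral divides by, so that `(j - k) w ^ (j -
  -- k)` remains on the circle when `k ≤ j`.
  ((2 : ℝ) • (idDisc * u.2.1) + idDisc * idDisc * u.2.2) * conj v.1 -
    (u.1 + idDisc * u.2.1) * conj (idDisc * v.2.1)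

theorem crossDensity_add (u u' v) :
    crossDensity (u + u') v = (crossDensity u v + crossDensity u' v : HolderAlg α closedDisc) := by
  simp only [crossDensity, Prod.fst_add, Prod.snd_add, mul_add, smul_add]
  ring

theorem crossDensity_smul (c : ℝ) (u v) :
    crossDensity (c • u) v = c • (crossDensity u v : HolderAlg α closedDisc) := by
  simp only [crossDensity, Prod.smul_fst, Prod.smul_snd, mul_smul_comm, smul_comm (2 : ℝ) c,
    ← smul_add, smul_mul_assoc, ← smul_sub]

theorem crossDensity_add_right (u v v') :
    crossDensity u (v + v') = (crossDensity u v + crossDensity u v' : HolderAlg α closedDisc) := by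
  simp only [crossDensity, Prod.fst_add, Prod.snd_add, mul_add, map_add]
  ring

theorem crossDensity_smul_right (c : ℝ) (u v) :
    crossDensity u (c • v) = c • (crossDensity u v : HolderAlg α closedDisc) := by
  simp only [crossDensity, Prod.smul_fst, Prod.smul_snd, mul_smul_comm, map_smul, ← smul_sub]

theorem cauchyPow_one_add (p q : HolderAlg α closedDisc) {w : ℂ} (hw : ‖w‖ ≤ 1) :
    cauchyPow 1 (extd (p + q)) w = cauchyPow 1 (extd p) w + cauchyPow 1 (extd q) w := by
  rw [cauchyPow, cauchyPow, cauchyPow, ← integral_add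
    (integrable_cauchyPow_one (continuous_extd p).aestronglyMeasurable
      (fun y _ => norm_extd_le p y) hw)
    (integrable_cauchyPow_one (continuous_extd q).aestronglyMeasurable
      (fun y _ => norm_extd_le q y) hw)]
  simp_rw [extd_add, add_mul]

theorem cauchyPow_smul (n : ℕ) (c : ℝ) (p : HolderAlg α closedDisc) (w : ℂ) :
    cauchyPow n (extd (c • p)) w = c • cauchyPow n (extd p) w := by
  rw [cauchyPow, cauchyPow, ← integral_smul]
  simp_rw [extd_smul, smul_mul_assoc]

/-- The defect in the formula for `Im (w u'(w) conj (u(w)))`, in polarized form. -/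
def crossDefect (w : ℂ)
    (u v : HolderAlg α closedDisc × HolderAlg α closedDisc × HolderAlg α closedDisc) : ℂ :=
  cauchyPow 1 (extd (crossDensity u v)) w - starRingEnd ℂ (cauchyPow 1 (extd (crossDensity v u)) w) -
    w * extd u.2.1 w * starRingEnd ℂ (extd v.1 w) +
    starRingEnd ℂ (w * extd v.2.1 w * starRingEnd ℂ (extd u.1 w))

theorem crossDefect_swap (w : ℂ)
    (u v : HolderAlg α closedDisc × HolderAlg α closedDisc × HolderAlg α closedDisc) :
    crossDefect w v u = -starRingEnd ℂ (crossDefect w u v) := by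
  simp only [crossDefect, map_sub, map_add, map_mul, Complex.conj_conj]
  ring

/-- `crossDefect` as a linear map in the first variable. -/
def crossDefectₗ {w : ℂ} (hw : ‖w‖ ≤ 1)
    (v : HolderAlg α closedDisc × HolderAlg α closedDisc × HolderAlg α closedDisc) :
    HolderAlg α closedDisc × HolderAlg α closedDisc × HolderAlg α closedDisc →ₗ[ℝ] ℂ where
  toFun u := crossDefect w u v
  map_add' u u' := by
    simp only [crossDefect, crossDensity_add, crossDensity_add_right, cauchyPow_one_add _ _ hw,
      Prod.fst_add, Prod.snd_add, extd_add, map_add, map_mul]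
    ring
  map_smul' c u := by
    simp only [crossDefect, crossDensity_smul, crossDensity_smul_right, cauchyPow_smul,
      Prod.smul_fst, Prod.smul_snd, extd_smul, Complex.real_smul, map_mul, Complex.conj_ofReal,
      RingHom.id_apply]
    ring

/-- The second primitive of a function, with its derivatives. -/
def primJet : HolderAlg α closedDisc →ₗ[ℝ]
    HolderAlg α closedDisc × HolderAlg α closedDisc × HolderAlg α closedDisc :=
  LinearMap.prod (prim.comp prim).toLinearMap
    (LinearMap.prod (prim : HolderAlg α closedDisc →L[ℝ] _).toLinearMap LinearMap.id)

theorem primJet_apply (p : HolderAlg α closedDisc) : primJet p = (prim (prim p), prim p, p) := rfl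

/-- The jet of `z ^ (n + 1)`. -/
def powJet (n : ℕ) : HolderAlg α closedDisc × HolderAlg α closedDisc × HolderAlg α closedDisc :=
  -- For `n = 0` the exponent `n - 1` is truncated, but its coefficient vanishes.
  (idDisc ^ (n + 1), ((n : ℝ) + 1) • idDisc ^ n, (((n : ℝ) + 1) * n) • idDisc ^ (n - 1))

theorem prim_pow (n : ℕ) :
    prim ((idDisc : HolderAlg α closedDisc) ^ n) = ((n : ℝ) + 1)⁻¹ • idDisc ^ (n + 1) := by
  refine ext_of_ball fun z hz => ?_
  have hz' := (mem_ball_zero_iff.1 hz).le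
  rw [extd_prim _ hz', extd_smul, extd_pow, extd_idDisc hz', Complex.real_smul]
  have h1 : ∫ t in (0 : ℝ)..1, extd (idDisc ^ n : HolderAlg α closedDisc) (t * z) =
      ∫ t in (0 : ℝ)..1, ((t ^ n : ℝ) : ℂ) * z ^ n := by
    refine intervalIntegral.integral_congr fun t ht => ?_
    rw [uIcc_of_le zero_le_one] at ht
    rw [extd_pow, extd_idDisc, mul_pow]
    · push_cast; rfl
    · rw [norm_mul, Complex.norm_real, Real.norm_of_nonneg ht.1]
      exact mul_le_one₀ ht.2 (norm_nonneg _) hz'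
  rw [h1, intervalIntegral.integral_mul_const, intervalIntegral.integral_ofReal, integral_pow]
  push_cast
  simp
  ring

theorem primJet_pow (n : ℕ) : primJet ((idDisc : HolderAlg α closedDisc) ^ n) =
    (((n : ℝ) + 1) * (n + 2))⁻¹ • powJet (n + 1) := by
  have h1 : (n : ℝ) + 1 ≠ 0 := by positivity
  have h2 : (n : ℝ) + 2 ≠ 0 := by positivity
  rw [primJet_apply, prim_pow, map_smul, prim_pow, powJet, Prod.smul_mk, Prod.smul_mk, smul_smul,
    smul_smul, smul_smul]
  congr 1
  · congr 1
    push_cast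
    field_simp
    ring
  · congr 1
    · congr 1
      push_cast
      field_simp
      ring
    · rw [Nat.add_sub_cancel]
      conv_lhs => rw [← one_smul ℝ ((idDisc : HolderAlg α closedDisc) ^ n)]
      congr 1
      push_cast
      field_simp
      ring

theorem cauchyPow_crossDensity_powJet (j k : ℕ) {w : ℂ} (hw : ‖w‖ = 1) :
    cauchyPow 1 (extd (crossDensity (powJet j) (powJet k) : HolderAlg α closedDisc)) w =
      if k ≤ j then ((j : ℂ) - k) * w ^ (j - k) else 0 := by
  have h1 : cauchyPow 1 (extd (crossDensity (powJet j) (powJet k) : HolderAlg α closedDisc)) w =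
      (((j : ℂ) + 2) * (j - k)) *
        cauchyPow 1 (fun y => y ^ (j + 1) * starRingEnd ℂ y ^ (k + 1)) w := by
    rw [cauchyPow, cauchyPow, ← integral_const_mul]
    refine integral_congr_ae ?_
    filter_upwards [ae_discArea] with y hy
    have hy' := (mem_ball_zero_iff.1 hy).le
    simp only [crossDensity, powJet, extd_add, extd_sub, extd_mul, extd_smul, extd_pow, extd_conj,
      extd_idDisc hy', map_pow, map_smul, Complex.real_smul, conj_mul]
    push_cast
    have h2 : (j : ℂ) * y ^ (j - 1) * y = j * y ^ j := by
      rcases j with _ | j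
      · simp
      · rw [Nat.add_sub_cancel, mul_assoc, ← pow_succ]
    linear_combination (((j : ℂ) + 1) * y * starRingEnd ℂ y ^ (k + 1) *
      ((1 - w * starRingEnd ℂ y) ^ 1)⁻¹) * h2
  rw [h1, cauchyPow_one_monomial _ _ hw]
  have h3 : (j : ℂ) + 2 ≠ 0 := by exact_mod_cast (by omega : j + 2 ≠ 0)
  by_cases h : k ≤ j
  · rw [if_pos h, if_pos (Nat.succ_le_succ h), Nat.succ_sub_succ]
    push_cast
    rw [show (j : ℂ) + 1 + 1 = j + 2 by ring]
    field_simp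
  · rw [if_neg h, if_neg (by omega)]
    simp

/-- By antisymmetry under exchange, let `k ≤ j`. Then the second Cauchy integral vanishes and the
first is `(j - k) w ^ (j - k)`, the same as `((j + 1) - (k + 1)) w ^ (j + 1) w̄ ^ (k + 1)` because
`w w̄ = 1`. -/
theorem crossDefect_powJet (j k : ℕ) {w : ℂ} (hw : ‖w‖ = 1) :
    crossDefect w (powJet j) (powJet k : HolderAlg α closedDisc × HolderAlg α closedDisc ×
      HolderAlg α closedDisc) = 0 := by
  wlog hjk : k ≤ j generalizing j k with H
  · rw [crossDefect_swap, H k j (by omega)]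
    simp
  have hww : w * starRingEnd ℂ w = 1 := by
    rw [Complex.mul_conj, Complex.normSq_eq_norm_sq, hw]; simp
  rw [crossDefect, cauchyPow_crossDensity_powJet j k hw, cauchyPow_crossDensity_powJet k j hw,
    if_pos hjk]
  simp only [powJet, extd_smul, extd_pow, extd_idDisc hw.le, map_mul, map_pow, Complex.real_smul,
    Complex.conj_conj]
  push_cast
  simp only [map_add, map_one, map_natCast]
  obtain ⟨d, rfl⟩ := Nat.exists_eq_add_of_le hjk
  have h1 : w ^ (k + d + 1) * starRingEnd ℂ w ^ (k + 1) = w ^ d := by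
    rw [show k + d + 1 = d + (k + 1) by ring, pow_add, mul_assoc, ← mul_pow, hww, one_pow, mul_one]
  have h2 : (if k + d ≤ k then ((k : ℂ) - (k + d : ℕ)) * w ^ (k - (k + d)) else 0) = 0 := by
    split_ifs with h
    · have : d = 0 := by omega
      subst this; simp
    · rfl
  rw [h2, Nat.add_sub_cancel_left, map_zero]
  push_cast
  linear_combination (-(d : ℂ)) * h1

/-- Seen as a functional of the second derivative, the defect is bounded for the sup norm, since
primitives do not increase it. Vanishing on powers therefore implies vanishing on `holSymm α`. -/
theorem norm_crossDefect_primJet_le {w : ℂ} (hw : ‖w‖ ≤ 1)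
    (v : HolderAlg α closedDisc × HolderAlg α closedDisc × HolderAlg α closedDisc)
    (p : HolderAlg α closedDisc) :
    ‖crossDefect w (primJet p) v‖ ≤
      (cauchyConst * (3 * ‖v.1‖ + 2 * ‖v.2.1‖) +
        cauchyConst * (3 * ‖v.2.1‖ + ‖v.2.2‖ + ‖v.1‖) + ‖v.1‖ + ‖v.2.1‖) * supNorm p := by
  set s := supNorm p with hs
  have hs0 : 0 ≤ s := p.supNorm_nonneg
  have b0 : ∀ y, ‖extd p y‖ ≤ s := fun y => p.norm_apply_le_supNorm _
  have b1 : ∀ y, ‖extd (prim p) y‖ ≤ s := fun y =>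
    ((prim p).norm_apply_le_supNorm _).trans (norm_prim_le p)
  have b2 : ∀ y, ‖extd (prim (prim p)) y‖ ≤ s := fun y =>
    ((prim (prim p)).norm_apply_le_supNorm _).trans ((norm_prim_le _).trans (norm_prim_le p))
  have v0 := fun y => norm_extd_le v.1 y
  have v1 := fun y => norm_extd_le v.2.1 y
  have v2 := fun y => norm_extd_le v.2.2 y
  have e1 : ‖cauchyPow 1 (extd (crossDensity (primJet p) v)) w‖ ≤
      cauchyConst * (3 * s * ‖v.1‖ + 2 * s * ‖v.2.1‖) := by
    refine norm_cauchyPow_one_le (fun y hy => ?_) hw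
    have hy' := (mem_ball_zero_iff.1 hy).le
    simp only [crossDensity, primJet_apply, extd_add, extd_sub, extd_mul, extd_smul, extd_conj,
      extd_idDisc hy', map_mul, Complex.real_smul]
    refine (_root_.norm_sub_le _ _).trans (add_le_add ?_ ?_)
    · rw [norm_mul, RCLike.norm_conj]
      refine mul_le_mul ?_ (v0 y) (norm_nonneg _) (by positivity)
      refine (norm_add_le _ _).trans ?_
      rw [norm_mul, norm_mul, norm_mul, norm_mul, Complex.norm_real]
      have h1 : ‖y‖ * ‖extd (prim p) y‖ ≤ 1 * s := mul_le_mul hy' (b1 y) (norm_nonneg _) zero_le_one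
      have h2 : ‖y‖ * ‖y‖ * ‖extd p y‖ ≤ 1 * s :=
        mul_le_mul (mul_le_one₀ hy' (norm_nonneg _) hy') (b0 y) (norm_nonneg _) zero_le_one
      norm_num
      linarith
    · rw [norm_mul, norm_mul, RCLike.norm_conj, RCLike.norm_conj]
      have h1 : ‖y‖ * ‖extd (prim p) y‖ ≤ 1 * s := mul_le_mul hy' (b1 y) (norm_nonneg _) zero_le_one
      refine mul_le_mul ?_ ?_ (by positivity) (by positivity)
      · refine (norm_add_le _ _).trans ?_
        rw [norm_mul]
        linarith [b2 y]
      · calc ‖y‖ * ‖extd v.2.1 y‖ ≤ 1 * ‖v.2.1‖ :=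
              mul_le_mul hy' (v1 y) (norm_nonneg _) zero_le_one
          _ = _ := one_mul _
  have e2 : ‖cauchyPow 1 (extd (crossDensity v (primJet p))) w‖ ≤
      cauchyConst * ((2 * ‖v.2.1‖ + ‖v.2.2‖) * s + (‖v.1‖ + ‖v.2.1‖) * s) := by
    refine norm_cauchyPow_one_le (fun y hy => ?_) hw
    have hy' := (mem_ball_zero_iff.1 hy).le
    simp only [crossDensity, primJet_apply, extd_add, extd_sub, extd_mul, extd_smul, extd_conj,
      extd_idDisc hy', map_mul, Complex.real_smul]
    have h1 : ‖y‖ * ‖extd v.2.1 y‖ ≤ 1 * ‖v.2.1‖ :=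
      mul_le_mul hy' (v1 y) (norm_nonneg _) zero_le_one
    have h2 : ‖y‖ * ‖y‖ * ‖extd v.2.2 y‖ ≤ 1 * ‖v.2.2‖ :=
      mul_le_mul (mul_le_one₀ hy' (norm_nonneg _) hy') (v2 y) (norm_nonneg _) zero_le_one
    refine (_root_.norm_sub_le _ _).trans (add_le_add ?_ ?_)
    · rw [norm_mul, RCLike.norm_conj]
      refine mul_le_mul ?_ (b2 y) (norm_nonneg _) (by positivity)
      refine (norm_add_le _ _).trans ?_
      rw [norm_mul, norm_mul, norm_mul, norm_mul, Complex.norm_real]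
      norm_num
      linarith
    · rw [norm_mul, norm_mul, RCLike.norm_conj, RCLike.norm_conj]
      refine mul_le_mul ?_ ?_ (by positivity) (by positivity)
      · refine (norm_add_le _ _).trans ?_
        rw [norm_mul]
        linarith [v0 y]
      · calc ‖y‖ * ‖extd (prim p) y‖ ≤ 1 * s :=
              mul_le_mul hy' (b1 y) (norm_nonneg _) zero_le_one
          _ = _ := one_mul _
  have e3 : ‖w * extd (prim p) w * starRingEnd ℂ (extd v.1 w)‖ ≤ 1 * s * ‖v.1‖ := by
    rw [norm_mul, norm_mul, RCLike.norm_conj]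
    exact mul_le_mul (mul_le_mul hw (b1 w) (norm_nonneg _) zero_le_one) (v0 w) (norm_nonneg _)
      (by positivity)
  have e4 : ‖starRingEnd ℂ (w * extd v.2.1 w * starRingEnd ℂ (extd (prim (prim p)) w))‖ ≤
      1 * ‖v.2.1‖ * s := by
    rw [RCLike.norm_conj, norm_mul, norm_mul, RCLike.norm_conj]
    exact mul_le_mul (mul_le_mul hw (v1 w) (norm_nonneg _) zero_le_one) (b2 w) (norm_nonneg _)
      (by positivity)
  rw [crossDefect]
  refine (norm_add_le _ _).trans ?_
  refine (add_le_add ((_root_.norm_sub_le _ _).trans (add_le_add (_root_.norm_sub_le _ _) e3)) e4).trans ?_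
  rw [RCLike.norm_conj]
  refine (add_le_add (add_le_add (add_le_add e1 e2) le_rfl) le_rfl).trans (le_of_eq ?_)
  ring

/-- The jet of `z + φ(z)`, where `φ'' = p`. -/
def mapJet (p : HolderAlg α closedDisc) :
    HolderAlg α closedDisc × HolderAlg α closedDisc × HolderAlg α closedDisc :=
  (idDisc + prim (prim p), 1 + prim p, p)

theorem mapJet_eq (p : HolderAlg α closedDisc) : mapJet p = powJet 0 + primJet p := by
  simp [mapJet, powJet, primJet_apply]

theorem crossDefect_mapJet_of {w : ℂ} (hw : ‖w‖ ≤ 1)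
    {v : HolderAlg α closedDisc × HolderAlg α closedDisc × HolderAlg α closedDisc}
    (h : ∀ j, crossDefect w (powJet j) v = 0) {p : HolderAlg α closedDisc} (hp : p ∈ holSymm α) :
    crossDefect w (mapJet p) v = 0 := by
  have h1 : crossDefect w (primJet p) v = 0 :=
    eq_zero_of_pow (Λ := (crossDefectₗ hw v).comp primJet)
      (fun p => norm_crossDefect_primJet_le hw v p) (fun k => by
        change crossDefectₗ hw v (primJet _) = 0
        rw [primJet_pow, map_smul]
        change _ • crossDefect w _ v = 0
        rw [h, smul_zero]) hp
  rw [mapJet_eq]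
  have h2 := (crossDefectₗ hw v).map_add (powJet 0) (primJet p)
  change crossDefect w _ v = crossDefect w _ v + crossDefect w _ v at h2
  rw [h2, h, h1, add_zero]

/-- The boundary values of `Im (w Φ'(w) conj (Φ(w)))`. -/
theorem im_mul_deriv_mul_conj {w : ℂ} (hw : ‖w‖ = 1) {p : HolderAlg α closedDisc}
    (hp : p ∈ holSymm α) :
    (w * extd (1 + prim p) w * starRingEnd ℂ (extd (idDisc + prim (prim p)) w)).im =
      (cauchyPow 1 (extd (crossDensity (mapJet p) (mapJet p))) w).im := by
  -- The density argument is used once in each variable, the two being exchanged by antisymmetry.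
  have h : crossDefect w (mapJet p) (mapJet p) = 0 := by
    refine crossDefect_mapJet_of hw.le (fun j => ?_) hp
    rw [crossDefect_swap, crossDefect_mapJet_of hw.le (fun k => crossDefect_powJet k j hw) hp]
    simp
  have h2 := congrArg Complex.im h
  simp only [crossDefect, Complex.add_im, Complex.sub_im, Complex.conj_im, Complex.zero_im] at h2
  change _ - _ - (w * extd (1 + prim p) w * starRingEnd ℂ (extd (idDisc + prim (prim p)) w)).im +
    -(w * extd (1 + prim p) w * starRingEnd ℂ (extd (idDisc + prim (prim p)) w)).im = 0 at h2
  linarith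

end Sesquilinear

end HolderAlg

/-! ### A maximum principle with radial boundary values -/

section MaximumPrinciple

/-- A holomorphic function with bounded derivative whose radial limits are real is real. -/
theorem im_eq_zero_of_radial_limits {G g Gb : ℂ → ℂ} {L : ℝ}
    (hG : ∀ z : ℂ, ‖z‖ < 1 → HasDerivAt G (g z) z) (hL : ∀ z : ℂ, ‖z‖ < 1 → ‖g z‖ ≤ L)
    (hlim : ∀ w : ℂ, ‖w‖ = 1 → Tendsto (fun r : ℝ => G (r * w)) (𝓝[<] 1) (𝓝 (Gb w)))
    (him : ∀ w : ℂ, ‖w‖ = 1 → (Gb w).im = 0) {z : ℂ} (hz : ‖z‖ < 1) : (G z).im = 0 := by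
  have hLip : ∀ x y : ℂ, ‖x‖ < 1 → ‖y‖ < 1 → ‖G y - G x‖ ≤ L * ‖y - x‖ := fun x y hx hy =>
    (convex_ball (0 : ℂ) 1).norm_image_sub_le_of_norm_hasDerivWithin_le
      (fun z hz => (hG z (mem_ball_zero_iff.1 hz)).hasDerivWithinAt)
      (fun z hz => hL z (mem_ball_zero_iff.1 hz)) (mem_ball_zero_iff.2 hx) (mem_ball_zero_iff.2 hy)
  have hnorm : ∀ (r : ℝ) (w : ℂ), 0 ≤ r → ‖w‖ = 1 → ‖(r : ℂ) * w‖ = r := fun r w hr hw => by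
    rw [norm_mul, hw, mul_one, Complex.norm_real, Real.norm_of_nonneg hr]
  -- The Lipschitz bound along the radius, together with the real limit at its end, controls `Im G`
  -- on the whole circle of radius `r`.
  have hbd : ∀ r : ℝ, 0 < r → r < 1 → ∀ w : ℂ, ‖w‖ = 1 → |(G (r * w)).im| ≤ L * (1 - r) := by
    intro r hr0 hr1 w hw
    have h1 : Tendsto (fun s : ℝ => |(G (s * w) - G (r * w)).im|) (𝓝[<] 1)
        (𝓝 |(Gb w - G (r * w)).im|) :=
      ((Complex.continuous_im.tendsto _).comp ((hlim w hw).sub_const _)).abs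
    have h2 : |(Gb w - G (r * w)).im| ≤ L * (1 - r) := by
      have h3 : Tendsto (fun s : ℝ => L * (s - r)) (𝓝[<] 1) (𝓝 (L * (1 - r))) := by
        have : Continuous fun s : ℝ => L * (s - r) := by fun_prop
        exact (this.tendsto 1).mono_left nhdsWithin_le_nhds
      refine le_of_tendsto_of_tendsto h1 h3 ?_
      filter_upwards [Ioo_mem_nhdsLT hr1] with s hs
      refine (Complex.abs_im_le_norm _).trans ?_
      refine (hLip _ _ ((hnorm r w hr0.le hw).trans_lt hr1)
        ((hnorm s w (hr0.trans hs.1).le hw).trans_lt hs.2)).trans (le_of_eq ?_)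
      have : (s : ℂ) * w - r * w = ((s - r : ℝ) : ℂ) * w := by push_cast; ring
      rw [this, hnorm _ _ (sub_nonneg.2 hs.1.le) hw]
    rw [Complex.sub_im, him w hw, zero_sub, abs_neg] at h2
    exact h2
  -- The maximum principle is applied to `exp (c G)`, whose modulus is `exp (Re (c G))`; the two
  -- values of `c` bound `Im G` from both sides.
  have key : ∀ c : ℂ, (c = Complex.I ∨ c = -Complex.I) → (c * G z).re ≤ 0 := by
    intro c hc
    have hcre : ∀ x : ℂ, (c * x).re ≤ |x.im| := by
      intro x
      rcases hc with rfl | rfl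
      · simpa using neg_le_abs x.im
      · simpa using le_abs_self x.im
    have hle : ∀ r : ℝ, ‖z‖ < r → r < 1 → (c * G z).re ≤ L * (1 - r) := by
      intro r hr hr1
      have hr0 : 0 < r := (norm_nonneg z).trans_lt hr
      have hd : DifferentiableOn ℂ (fun x => Complex.exp (c * G x)) (Metric.ball 0 1) := by
        intro x hx
        have := (hG x (mem_ball_zero_iff.1 hx)).differentiableAt.const_mul c
        exact this.cexp.differentiableWithinAt
      have hdc : DiffContOnCl ℂ (fun x => Complex.exp (c * G x)) (Metric.ball 0 r) :=
        (hd.mono (Metric.closedBall_subset_ball hr1)).diffContOnCl_ball subset_rfl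
      have h1 := Complex.norm_le_of_forall_mem_frontier_norm_le Metric.isBounded_ball hdc
        (C := Real.exp (L * (1 - r))) (fun x hx => by
          rw [frontier_ball 0 hr0.ne', mem_sphere_zero_iff_norm] at hx
          rw [Complex.norm_exp, Real.exp_le_exp]
          refine (hcre _).trans ?_
          have e : x = (r : ℂ) * (x / r) := by
            have : (r : ℂ) ≠ 0 := by exact_mod_cast hr0.ne'
            field_simp
          rw [e]
          refine hbd r hr0 hr1 _ ?_
          rw [norm_div, hx, Complex.norm_real, Real.norm_of_nonneg hr0.le, div_self hr0.ne'])
        (subset_closure (mem_ball_zero_iff.2 hr))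
      rwa [Complex.norm_exp, Real.exp_le_exp] at h1
    have h3 : Tendsto (fun s : ℝ => L * (1 - s)) (𝓝[<] 1) (𝓝 0) := by
      have : Continuous fun s : ℝ => L * (1 - s) := by fun_prop
      simpa using (this.tendsto 1).mono_left nhdsWithin_le_nhds
    refine ge_of_tendsto h3 ?_
    filter_upwards [Ioo_mem_nhdsLT hz] with s hs
    exact hle s hs.1 hs.2
  have h1 := key _ (Or.inl rfl)
  have h2 := key _ (Or.inr rfl)
  simp at h1 h2
  linarith

/-- A holomorphic function with real values has a vanishing derivative. -/
theorem deriv_eq_zero_of_im_eq_zero {G : ℂ → ℂ} {d z : ℂ} (hG : HasDerivAt G d z)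
    (h : ∀ᶠ x in 𝓝 z, (G x).im = 0) : d = 0 := by
  have key : ∀ v : ℂ, (d * v).im = 0 := by
    intro v
    have h1 : HasDerivAt (fun t : ℝ => z + t * v) v 0 := by
      simpa using ((Complex.ofRealCLM.hasDerivAt (x := (0 : ℝ))).mul_const v).const_add z
    have h0 : z + ((0 : ℝ) : ℂ) * v = z := by simp
    have h2 : HasDerivAt (fun t : ℝ => G (z + t * v)) (d * v) 0 :=
      HasDerivAt.comp (h₂ := G) (0 : ℝ) (by rw [h0]; exact hG) h1
    have h3 : HasDerivAt (fun t : ℝ => (G (z + t * v)).im) (d * v).im 0 :=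
      Complex.imCLM.hasFDerivAt.comp_hasDerivAt (0 : ℝ) h2
    have h4 : (fun t : ℝ => (G (z + t * v)).im) =ᶠ[𝓝 0] fun _ => 0 := by
      have := h1.continuousAt.tendsto
      rw [h0] at this
      exact this.eventually h
    exact h3.unique ((hasDerivAt_const (0 : ℝ) (0 : ℝ)).congr_of_eventuallyEq h4)
  have h1 := key 1
  have h2 := key Complex.I
  simp at h1 h2
  exact Complex.ext h2 h1

end MaximumPrinciple

namespace HolderAlg

variable {α : ℝ≥0} [Fact (0 < α)] [Fact (α < 1)]

/-! ### The holomorphic function behind the boundary functional -/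

section Potential

/-- The inverse of `(Φ(y) - Φ(z)) / (y - z)`. -/
def quotInv (p : HolderAlg α closedDisc) : HolderAlg α (closedDisc × closedDisc) :=
  -- The first divided difference of `Φ` is `1 + segAvg 0 (prim p)`. `Ring.inverse` is `0` off the
  -- units; the later statements assume a unit, which is the case near `p = 0`.
  Ring.inverse (1 + segAvg 0 (prim p))

/-- The density `f |Φ'|²`. -/
def pushDensity (r p : HolderAlg α closedDisc) : HolderAlg α closedDisc :=
  r * ((1 + prim p) * conj (1 + prim p))

/-- The regular part of the Cauchy integral. -/
def regInt (r p : HolderAlg α closedDisc) : HolderAlg α closedDisc :=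
  -- With `S₀ = segAvg 0 (prim p)` and `S₁ = segAvg 1 p` at `(y, w)`, one has `Φ(w) - Φ(y) = (w - y)
  -- (1 + S₀)` and `Φ'(w) = 1 + S₀ + (w - y) S₁`. So `Φ'(w) / (Φ(w) - Φ(y))` is `1 / (w - y)` plus
  -- the kernel `S₁ / (1 + S₀)`.
  areaInt (pullFst (pushDensity r p) * (segAvg 1 p * quotInv p))

/-- The derivative of the regular part of the Cauchy integral. -/
def regIntDeriv (r p : HolderAlg α closedDisc) : HolderAlg α closedDisc :=
  singularInt (pullFst (pushDensity r p) * (((2 : ℝ) • segAvg 1 p - pullSnd p) * quotInv p)) +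
    areaInt (pullFst (pushDensity r p) * -(segAvg 1 p * segAvg 1 p * (quotInv p * quotInv p)))

/-- The contribution of the rotation to the derivative of the potential. -/
def rotDefect (p : HolderAlg α closedDisc) : HolderAlg α closedDisc :=
  bergman (conj idDisc * crossDensity (mapJet p) (mapJet p))

/-- The contribution of the velocity to the derivative of the potential. -/
def velDefect (r p : HolderAlg α closedDisc) : HolderAlg α closedDisc :=
  (2⁻¹ : ℝ) • (bergman (conj idDisc * pushDensity r p) - regInt r p - idDisc * regIntDeriv r p)

/-- The derivative of the potential. -/
def defect (Ω : ℝ) (r p : HolderAlg α closedDisc) : HolderAlg α closedDisc :=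
  Ω • rotDefect p + velDefect r p

/-- A holomorphic function whose imaginary part on the circle is the boundary functional. -/
def potential (Ω : ℝ) (r p : HolderAlg α closedDisc) (z : ℂ) : ℂ :=
  Ω * cauchyPow 1 (extd (crossDensity (mapJet p) (mapJet p))) z +
    2⁻¹ * (cauchyPow 1 (extd (pushDensity r p)) z - z * extd (regInt r p) z)

variable {r p : HolderAlg α closedDisc}

theorem quotInv_apply (hu : IsUnit (1 + segAvg 0 (prim p))) (q : closedDisc × closedDisc) :
    (1 + segAvg 0 (prim p) q) * quotInv p q = 1 :=
  DFunLike.congr_fun (Ring.mul_inverse_cancel _ hu) q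

theorem one_add_segAvg_ne_zero (hu : IsUnit (1 + segAvg 0 (prim p)))
    (q : closedDisc × closedDisc) : 1 + segAvg 0 (prim p) q ≠ 0 := fun h => by
  have := quotInv_apply hu q
  rw [h, zero_mul] at this
  exact zero_ne_one this

theorem quotInv_eq (hu : IsUnit (1 + segAvg 0 (prim p))) (q : closedDisc × closedDisc) :
    quotInv p q = (1 + segAvg 0 (prim p) q)⁻¹ :=
  eq_inv_of_mul_eq_one_right (quotInv_apply hu q)

/-- In `z`, the derivative of `segAvg 1 p` is `(2 segAvg 1 p - p(z)) / (y - z)`, whose numerator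
vanishes on the diagonal and feeds the singular integral. The derivative of `quotInv p` is `-segAvg
1 p * quotInv p ^ 2`, without singularity. -/
theorem hasDerivAt_regInt (hp : DifferentiableOn ℂ (extd p) (Metric.ball 0 1))
    (hu : IsUnit (1 + segAvg 0 (prim p))) {z : ℂ} (hz : ‖z‖ < 1) :
    HasDerivAt (extd (regInt r p)) (extd (regIntDeriv r p) z) z := by
  refine hasDerivAt_areaInt _ (fun y hy => ?_) (fun z => ?_) (fun y z hy hz hyz => ?_) hz
  · simp only [mul_apply, quotInv_eq hu]
    refine (differentiableOn_segAvg_one_right hp hy).mul (DifferentiableOn.inv ?_ ?_)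
    · exact (differentiableOn_segAvg_zero_right (differentiableOn_prim hp) hy).const_add 1
    · exact fun z _ => one_add_segAvg_ne_zero hu _
  · have h1 : pt z z = pt (discProj z : ℂ) (discProj z : ℂ) := by simp [pt]
    rw [h1, mul_apply, sub_apply, smul_apply, segAvg_diag 1 p (norm_coe_le _), pullSnd_pt,
      Complex.real_smul]
    push_cast
    ring
  · have h1 := hasDerivAt_segAvg_one_right hp hy hz hyz
    have h2 := ((hasDerivAt_segAvg_zero_right hp hy hz hyz).const_add 1).inv
      (one_add_segAvg_ne_zero hu (pt y z))
    have h3 := h1.mul h2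
    have e : (fun z => (segAvg 1 p * quotInv p) (pt y z)) =
        (fun z => segAvg 1 p (pt y z)) * (fun z => 1 + segAvg 0 (prim p) (pt y z))⁻¹ := by
      ext z
      simp only [mul_apply, quotInv_eq hu, Pi.mul_apply, Pi.inv_apply]
    rw [e]
    refine h3.congr_deriv ?_
    simp only [mul_apply, sub_apply, neg_apply, smul_apply, pullSnd_pt, quotInv_eq hu,
      Complex.real_smul, Pi.inv_apply]
    have := one_add_segAvg_ne_zero hu (pt y z)
    push_cast
    field_simp

theorem hasDerivAt_cauchyPow_one (q : HolderAlg α closedDisc) {z : ℂ} (hz : ‖z‖ < 1) :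
    HasDerivAt (cauchyPow 1 (extd q)) (extd (bergman (conj idDisc * q)) z) z := by
  refine (hasDerivAt_cauchyPow (continuous_extd q).aestronglyMeasurable
    (fun y _ => norm_extd_le q y) 1 hz).congr_deriv ?_
  rw [bergman_apply _ hz, Nat.cast_one, one_mul, cauchyPow, cauchyPow]
  refine integral_congr_ae ?_
  filter_upwards [ae_discArea] with y hy
  rw [extd_mul, extd_conj, extd_idDisc (mem_ball_zero_iff.1 hy).le]

theorem hasDerivAt_potential (Ω : ℝ) (hp : DifferentiableOn ℂ (extd p) (Metric.ball 0 1))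
    (hu : IsUnit (1 + segAvg 0 (prim p))) {z : ℂ} (hz : ‖z‖ < 1) :
    HasDerivAt (potential Ω r p) (extd (defect Ω r p) z) z := by
  have h1 := (hasDerivAt_cauchyPow_one (crossDensity (mapJet p) (mapJet p)) hz).const_mul (Ω : ℂ)
  have h2 := hasDerivAt_cauchyPow_one (pushDensity r p) hz
  have h3 := (hasDerivAt_id z).mul (hasDerivAt_regInt (r := r) hp hu hz)
  refine (h1.add ((h2.sub h3).const_mul 2⁻¹)).congr_deriv ?_
  simp only [defect, rotDefect, velDefect, extd_add, extd_sub, extd_smul, extd_mul,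
    extd_idDisc hz.le, Complex.real_smul, id_eq, one_mul]
  push_cast
  ring

theorem tendsto_potential (Ω : ℝ) {w : ℂ} (hw : ‖w‖ = 1) :
    Tendsto (fun s : ℝ => potential Ω r p (s * w)) (𝓝[<] 1) (𝓝 (potential Ω r p w)) := by
  have h1 := fun q : HolderAlg α closedDisc => tendsto_cauchyPow_one
    (continuous_extd q).aestronglyMeasurable (fun y _ => norm_extd_le q y) hw
  have h2 : Tendsto (fun s : ℝ => (s * w) * extd (regInt r p) (s * w)) (𝓝[<] 1)
      (𝓝 (w * extd (regInt r p) w)) := by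
    have : Continuous fun s : ℝ => (s * w) * extd (regInt r p) (s * w) := by fun_prop
    simpa using (this.tendsto 1).mono_left nhdsWithin_le_nhds
  exact ((h1 _).const_mul _).add (((h1 _).sub h2).const_mul _)

/-- On the circle `w / (w - y)` is the conjugate of `1 / (1 - w ȳ)`. Since the density is real, the
singular part of the velocity is the conjugate of a Cauchy integral, and conjugation only reverses
the sign of the imaginary part; this accounts for the opposite signs of the two velocity terms in
`potential`. -/
theorem boundaryDefect_eq (Ω : ℝ) (hp : p ∈ holSymm α) (hu : IsUnit (1 + segAvg 0 (prim p)))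
    {f : ℂ → ℝ} {Φ : ℂ → ℂ} (hf : ∀ y ∈ closedDisc, (f y : ℂ) = extd r y)
    (hΦ : ∀ z ∈ closedDisc, Φ z = extd (idDisc + prim (prim p)) z)
    (hΦ' : ∀ z ∈ closedDisc, discDeriv Φ z = extd (1 + prim p) z) {w : ℂ} (hw : ‖w‖ = 1) :
    boundaryDefect Ω f Φ w = (potential Ω r p w).im := by
  have hwc : w ∈ closedDisc := mem_closedBall_zero_iff.2 hw.le
  have hww : starRingEnd ℂ w * w = 1 := by
    rw [mul_comm, Complex.mul_conj, Complex.normSq_eq_norm_sq, hw]; simp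
  have hw0 : w ≠ 0 := norm_pos_iff.1 (by rw [hw]; exact one_pos)
  set ρ := pushDensity r p with hρ
  have hρy : ∀ y ∈ closedDisc, extd ρ y = (f y : ℂ) * ((‖discDeriv Φ y‖ ^ 2 : ℝ) : ℂ) := by
    intro y hy
    rw [hρ, pushDensity, extd_mul, extd_mul, ← hf y hy, extd_conj, ← hΦ' y hy, Complex.mul_conj,
      Complex.normSq_eq_norm_sq]
  have hρc : ∀ y ∈ closedDisc, starRingEnd ℂ (extd ρ y) = extd ρ y := fun y hy => by
    rw [hρy y hy, map_mul, Complex.conj_ofReal, Complex.conj_ofReal]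
  have hcau : Integrable (fun y => starRingEnd ℂ (extd ρ y * ((1 - w * starRingEnd ℂ y) ^ 1)⁻¹))
      discArea := by
    have := integrable_cauchyPow_one (continuous_extd ρ).aestronglyMeasurable
      (fun y _ => norm_extd_le ρ y) hw.le
    exact (Complex.conjCLE : ℂ →L[ℝ] ℂ).integrable_comp this
  have hreg : Integrable (fun y => w * (pullFst ρ * (segAvg 1 p * quotInv p)) (pt y w)) discArea :=
    (integrable_discArea_of_continuous (continuous_apply_pt_left _ w)).const_mul w
  have hI : (1 / (2 * (Real.pi : ℂ)) * ∫ y in Metric.ball (0 : ℂ) 1,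
      (f y : ℂ) / (Φ w - Φ y) * ((‖discDeriv Φ y‖ ^ 2 : ℝ) : ℂ)) * discDeriv Φ w * w =
      2⁻¹ * (starRingEnd ℂ (cauchyPow 1 (extd ρ) w) + w * extd (regInt r p) w) := by
    have h1 : 1 / (2 * (Real.pi : ℂ)) * ∫ y in Metric.ball (0 : ℂ) 1,
        (f y : ℂ) / (Φ w - Φ y) * ((‖discDeriv Φ y‖ ^ 2 : ℝ) : ℂ) =
        2⁻¹ * ∫ y, (f y : ℂ) / (Φ w - Φ y) * ((‖discDeriv Φ y‖ ^ 2 : ℝ) : ℂ) ∂discArea := by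
      rw [integral_discArea]
      field_simp
    rw [h1, mul_assoc, mul_assoc, ← integral_mul_const, cauchyPow, ← integral_conj, regInt,
      extd_areaInt, ← hρ, ← integral_const_mul w, ← integral_add hcau hreg]
    congr 1
    refine integral_congr_ae ?_
    filter_upwards [ae_discArea, ae_discArea_ne w] with y hy hne
    have hyc : y ∈ closedDisc := Metric.ball_subset_closedBall hy
    have hy' := (mem_ball_zero_iff.1 hy)
    have hd0 := sub_mul_segAvg_zero_pt (differentiableOn_prim hp.1) hy'.le hw.le
    have hd1 := sub_mul_segAvg_one_pt hp.1 hy'.le hw.le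
    have hq := one_add_segAvg_ne_zero hu (pt y w)
    have hyw : y - w ≠ 0 := sub_ne_zero.2 hne
    have hΦd : Φ w - Φ y = (w - y) * (1 + segAvg 0 (prim p) (pt y w)) := by
      rw [hΦ w hwc, hΦ y hyc, extd_add, extd_add, extd_idDisc hw.le, extd_idDisc hy'.le]
      linear_combination hd0
    have hΦw : discDeriv Φ w = 1 + segAvg 0 (prim p) (pt y w) - (y - w) * segAvg 1 p (pt y w) := by
      rw [hΦ' w hwc, extd_add, extd_one, hd1]
      ring
    have hk : starRingEnd ℂ ((1 - w * starRingEnd ℂ y) ^ 1)⁻¹ = w * (w - y)⁻¹ := by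
      rw [pow_one, map_inv₀, map_sub, map_one, map_mul, Complex.conj_conj]
      have e : 1 - starRingEnd ℂ w * y = starRingEnd ℂ w * (w - y) := by
        rw [mul_sub, hww]
      have hcw : starRingEnd ℂ w = w⁻¹ := eq_inv_of_mul_eq_one_left hww
      rw [e, hcw, mul_inv, inv_inv]
    have hwy : w - y ≠ 0 := sub_ne_zero.2 hne.symm
    rw [map_mul, hρc y hyc, hk, mul_apply, mul_apply, pullFst_pt, quotInv_eq hu, hΦd, hΦw,
      hρy y hyc]
    field_simp
    ring
  have hm := im_mul_deriv_mul_conj hw hp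
  have h2 : ((Ω : ℂ) * starRingEnd ℂ (Φ w) - 1 / (2 * (Real.pi : ℂ)) *
      ∫ y in Metric.ball (0 : ℂ) 1,
        (f y : ℂ) / (Φ w - Φ y) * ((‖discDeriv Φ y‖ ^ 2 : ℝ) : ℂ)) * discDeriv Φ w * w =
      Ω * (w * extd (1 + prim p) w * starRingEnd ℂ (extd (idDisc + prim (prim p)) w)) -
      2⁻¹ * (starRingEnd ℂ (cauchyPow 1 (extd ρ) w) + w * extd (regInt r p) w) := by
    rw [← hI, hΦ w hwc, hΦ' w hwc]
    ring
  have e2 : (2⁻¹ : ℂ) = ((2⁻¹ : ℝ) : ℂ) := by push_cast; rfl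
  rw [boundaryDefect, h2, potential, e2, Complex.sub_im, Complex.add_im, Complex.im_ofReal_mul,
    Complex.im_ofReal_mul, Complex.im_ofReal_mul, Complex.im_ofReal_mul, hm, Complex.add_im,
    Complex.sub_im, Complex.conj_im]
  ring

end Potential

/-! ### Symmetry and the reduction to the vanishing of a derivative -/

section Symmetry

variable {r p : HolderAlg α closedDisc}

theorem reflectDisc_crossDensity (hp : reflectDisc p = p) :
    reflectDisc (crossDensity (mapJet p) (mapJet p)) = crossDensity (mapJet p) (mapJet p) := by
  simp only [crossDensity, mapJet, map_add, map_sub, map_smul, reflectDisc_mul, reflectDisc_conj,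
    reflectDisc_prim, reflectDisc_one, reflectDisc_idDisc, hp]

theorem reflectDisc_pushDensity (hr : reflectDisc r = r) (hp : reflectDisc p = p) :
    reflectDisc (pushDensity r p) = pushDensity r p := by
  simp only [pushDensity, map_add, reflectDisc_mul, reflectDisc_conj,
    reflectDisc_prim, reflectDisc_one, hp, hr]

theorem reflectProd_quotInv (hp : reflectDisc p = p) (hu : IsUnit (1 + segAvg 0 (prim p))) :
    reflectProd (quotInv p) = quotInv p := by
  refine reflect_inverse _ _ hu ?_
  change reflectProd _ = _
  rw [map_add, reflectProd_one, reflectProd_segAvg, reflectDisc_prim, hp]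

theorem reflectDisc_defect (Ω : ℝ) (hr : reflectDisc r = r) (hp : reflectDisc p = p)
    (hu : IsUnit (1 + segAvg 0 (prim p))) : reflectDisc (defect Ω r p) = defect Ω r p := by
  simp only [defect, rotDefect, velDefect, regInt, regIntDeriv, map_add, map_sub, map_smul, map_neg,
    reflectDisc_mul, reflectDisc_bergman, reflectDisc_conj, reflectDisc_idDisc,
    reflectDisc_crossDensity hp, reflectDisc_pushDensity hr hp, reflectDisc_areaInt,
    reflectDisc_singularInt, reflectProd_mul, reflectProd_pullFst, reflectProd_pullSnd,
    reflectProd_segAvg, reflectProd_quotInv hp hu, hp]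

theorem defect_mem_holSymm (Ω : ℝ) (hr : reflectDisc r = r) (hp : p ∈ holSymm α)
    (hu : IsUnit (1 + segAvg 0 (prim p))) : defect Ω r p ∈ holSymm α := by
  refine ⟨?_, reflectDisc_defect Ω hr hp.2 hu⟩
  have h1 : DifferentiableOn ℂ (potential Ω r p) (Metric.ball 0 1) := fun z hz =>
    (hasDerivAt_potential Ω hp.1 hu (mem_ball_zero_iff.1 hz)).differentiableAt.differentiableWithinAt
  refine (h1.deriv Metric.isOpen_ball).congr fun z hz => ?_
  exact (hasDerivAt_potential Ω hp.1 hu (mem_ball_zero_iff.1 hz)).deriv.symm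

theorem im_integral_eq_zero {q : HolderAlg α closedDisc} (hq : reflectDisc q = q) :
    (cauchyPow 1 (extd q) 0).im = 0 := by
  have h1 : starRingEnd ℂ (cauchyPow 1 (extd q) 0) = cauchyPow 1 (extd q) 0 := by
    rw [cauchyPow, ← integral_conj, ← integral_discArea_conj]
    refine integral_congr_ae (Eventually.of_forall fun y => ?_)
    simp [← extd_reflectDisc, hq]
  exact Complex.conj_eq_iff_im.1 h1

theorem im_potential_zero (Ω : ℝ) (hr : reflectDisc r = r) (hp : reflectDisc p = p) :
    (potential Ω r p 0).im = 0 := by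
  have e2 : (2⁻¹ : ℂ) = ((2⁻¹ : ℝ) : ℂ) := by push_cast; rfl
  rw [potential, zero_mul, sub_zero, e2, Complex.add_im, Complex.im_ofReal_mul,
    Complex.im_ofReal_mul, im_integral_eq_zero (reflectDisc_crossDensity hp),
    im_integral_eq_zero (reflectDisc_pushDensity hr hp)]
  simp

/-- If the imaginary part vanishes on the circle, it vanishes in the disc by the maximum principle,
and a real-valued holomorphic function has zero derivative. Conversely a zero derivative makes the
potential constant, and its value at the centre is real by symmetry; the radial limits carry this
value to the circle. -/
theorem boundary_iff_defect_eq_zero (Ω : ℝ) (hr : reflectDisc r = r) (hp : p ∈ holSymm α)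
    (hu : IsUnit (1 + segAvg 0 (prim p))) :
    (∀ w : ℂ, ‖w‖ = 1 → (potential Ω r p w).im = 0) ↔ defect Ω r p = 0 := by
  have hG := fun (z : ℂ) (hz : ‖z‖ < 1) => hasDerivAt_potential (r := r) Ω hp.1 hu hz
  constructor
  · intro h
    refine ext_of_ball fun z hz => ?_
    rw [extd_zero]
    refine deriv_eq_zero_of_im_eq_zero (hG z (mem_ball_zero_iff.1 hz)) ?_
    filter_upwards [Metric.isOpen_ball.mem_nhds hz] with x hx
    exact im_eq_zero_of_radial_limits hG (fun z _ => norm_extd_le _ z)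
      (fun w hw => tendsto_potential Ω hw) h (mem_ball_zero_iff.1 hx)
  · intro h w hw
    have hconst : ∀ z ∈ Metric.ball (0 : ℂ) 1, potential Ω r p z = potential Ω r p 0 := by
      intro z hz
      refine Metric.isOpen_ball.is_const_of_deriv_eq_zero (convex_ball (0 : ℂ) 1).isPreconnected
        (fun z hz => (hG z (mem_ball_zero_iff.1 hz)).differentiableAt.differentiableWithinAt)
        (fun z hz => ?_) hz zero_mem_ball
      rw [(hG z (mem_ball_zero_iff.1 hz)).deriv, h, extd_zero]
      rfl
    have h1 : Tendsto (fun s : ℝ => potential Ω r p (s * w)) (𝓝[<] 1)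
        (𝓝 (potential Ω r p 0)) := by
      refine tendsto_const_nhds.congr' ?_
      filter_upwards [Ioo_mem_nhdsLT (zero_lt_one' ℝ)] with s hs
      refine (hconst _ (mem_ball_zero_iff.2 ?_)).symm
      rw [norm_mul, hw, mul_one, Complex.norm_real, Real.norm_of_nonneg hs.1.le]
      exact hs.2
    rw [tendsto_nhds_unique (tendsto_potential Ω hw) h1]
    exact im_potential_zero Ω hr hp.2

end Symmetry

end HolderAlg

namespace HolderAlg

variable {α : ℝ≥0} [Fact (0 < α)] [Fact (α < 1)]

/-! ### Area moments as linear functionals -/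

section Moments

/-- The normalized moment `((n + 1) / π) ∫ p(y) ȳⁿ dA(y)`. -/
def moment (n : ℕ) : HolderAlg α closedDisc →ₗ[ℝ] ℂ where
  toFun p := (n + 1) * ∫ y, extd p y * starRingEnd ℂ y ^ n ∂discArea
  map_add' p q := by
    rw [← mul_add, ← integral_add (integrable_discArea_of_continuous (by fun_prop))
      (integrable_discArea_of_continuous (by fun_prop))]
    simp_rw [extd_add, add_mul]
  map_smul' c p := by
    rw [RingHom.id_apply, Complex.real_smul, mul_left_comm, ← integral_const_mul (c : ℂ)]
    simp_rw [extd_smul, Complex.real_smul, mul_assoc]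

theorem moment_apply (n : ℕ) (p : HolderAlg α closedDisc) :
    moment n p = (n + 1) * ∫ y, extd p y * starRingEnd ℂ y ^ n ∂discArea := rfl

theorem norm_moment_le (n : ℕ) (p : HolderAlg α closedDisc) :
    ‖moment n p‖ ≤ (n + 1) * supNorm p := by
  have h : ‖∫ y, extd p y * starRingEnd ℂ y ^ n ∂discArea‖ ≤ supNorm p := by
    have h1 := norm_integral_le_of_norm_le (μ := discArea) (integrable_const (supNorm p))
      (f := fun y => extd p y * starRingEnd ℂ y ^ n) (ae_discArea.mono fun y hy => by
        rw [norm_mul, norm_pow, RCLike.norm_conj]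
        exact mul_le_of_le_one_right (norm_nonneg _) (pow_le_one₀ (norm_nonneg _)
          (mem_ball_zero_iff.1 hy).le) |>.trans (p.norm_apply_le_supNorm _))
    simpa using h1
  rw [moment_apply, norm_mul, ← Nat.cast_add_one, Complex.norm_natCast, Nat.cast_add_one]
  exact mul_le_mul_of_nonneg_left h (by positivity)

/-- Moments extend the Taylor coefficients to linear functionals on the whole algebra that are
bounded for the sup norm, so that identities between them can be tested on powers. -/
theorem moment_eq_taylorCoeff (n : ℕ) {p : HolderAlg α closedDisc}
    (hp : DifferentiableOn ℂ (extd p) (Metric.ball 0 1)) :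
    moment n p = taylorCoeff (extd p) n := by
  have : (n + 1 : ℂ) ≠ 0 := by exact_mod_cast n.succ_ne_zero
  rw [moment_apply, integral_holomorphic_mul_conj_pow n hp fun y _ => norm_extd_le p y]
  field_simp

theorem hasSum_moment {p : HolderAlg α closedDisc}
    (hp : DifferentiableOn ℂ (extd p) (Metric.ball 0 1)) {z : ℂ} (hz : ‖z‖ < 1) :
    HasSum (fun n => moment n p * z ^ n) (extd p z) := by
  simp_rw [moment_eq_taylorCoeff _ hp]
  exact hasSum_taylorCoeff hp hz

theorem ext_of_moment {p q : HolderAlg α closedDisc}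
    (hp : DifferentiableOn ℂ (extd p) (Metric.ball 0 1))
    (hq : DifferentiableOn ℂ (extd q) (Metric.ball 0 1)) (h : ∀ n, moment n p = moment n q) :
    p = q := by
  refine ext_of_ball fun z hz => ?_
  have h1 := hasSum_moment hp (mem_ball_zero_iff.1 hz)
  simp_rw [h] at h1
  exact h1.unique (hasSum_moment hq (mem_ball_zero_iff.1 hz))

theorem moment_pow (n m : ℕ) :
    moment n ((idDisc : HolderAlg α closedDisc) ^ m) = if m = n then 1 else 0 := by
  have h : ∀ z : ℂ, ‖z‖ < 1 → HasSum (fun k => (if m = k then (1 : ℂ) else 0) * z ^ k)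
      (extd ((idDisc : HolderAlg α closedDisc) ^ m) z) := by
    intro z hz
    rw [extd_pow, extd_idDisc hz.le]
    have := hasSum_ite_eq m (z ^ m)
    convert! this using 2 with k
    by_cases hk : m = k
    · subst hk; simp
    · rw [if_neg hk, if_neg (Ne.symm hk), zero_mul]
  rw [moment_eq_taylorCoeff]
  · exact taylorCoeff_of_hasSum h n
  · have hd : DifferentiableOn ℂ (fun z : ℂ => z ^ m) (Metric.ball 0 1) := by fun_prop
    exact hd.congr fun z hz => by rw [extd_pow, extd_idDisc (mem_ball_zero_iff.1 hz).le]

/-- Linear functionals bounded for the sup norm that agree on powers agree on `holSymm`. -/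
theorem eq_of_pow {Λ Λ' : HolderAlg α closedDisc →ₗ[ℝ] ℂ} {K K' : ℝ}
    (hK : ∀ p, ‖Λ p‖ ≤ K * supNorm p) (hK' : ∀ p, ‖Λ' p‖ ≤ K' * supNorm p)
    (h : ∀ k, Λ (idDisc ^ k) = Λ' (idDisc ^ k)) {p : HolderAlg α closedDisc}
    (hp : p ∈ holSymm α) : Λ p = Λ' p := by
  rw [← sub_eq_zero]
  refine eq_zero_of_pow (Λ := Λ - Λ') (K := K + K') (fun p => ?_) (fun k => ?_) hp
  · rw [LinearMap.sub_apply, add_mul]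
    exact (_root_.norm_sub_le _ _).trans (add_le_add (hK p) (hK' p))
  · rw [LinearMap.sub_apply, h, sub_self]

theorem prim_mem_holSymm {p : HolderAlg α closedDisc} (hp : p ∈ holSymm α) :
    prim p ∈ holSymm α :=
  ⟨differentiableOn_prim hp.1, by rw [reflectDisc_prim, hp.2]⟩

theorem moment_prim (k : ℕ) {p : HolderAlg α closedDisc} (hp : p ∈ holSymm α) :
    moment (k + 1) (prim p) = moment k p / (k + 1) := by
  have h := eq_of_pow (Λ := (moment (k + 1)).comp (prim : HolderAlg α closedDisc →L[ℝ] _).toLinearMap)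
    (Λ' := ((k : ℝ) + 1)⁻¹ • moment k) (K := (k + 1 : ℕ) + 1) (K' := ((k : ℝ) + 1)⁻¹ * (k + 1))
    (fun p => (norm_moment_le _ _).trans
      (mul_le_mul_of_nonneg_left (norm_prim_le p) (by positivity)))
    (fun p => by
      rw [LinearMap.smul_apply, norm_smul, Real.norm_of_nonneg (by positivity), mul_assoc]
      exact mul_le_mul_of_nonneg_left (norm_moment_le _ _) (by positivity))
    (fun n => by
      change moment (k + 1) (prim (idDisc ^ n)) = ((k : ℝ) + 1)⁻¹ • moment k (idDisc ^ n)
      rw [prim_pow, map_smul, moment_pow, moment_pow]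
      by_cases hnk : n = k
      · subst hnk; simp
      · rw [if_neg hnk, if_neg (by omega), smul_zero, smul_zero]) hp
  change moment (k + 1) (prim p) = ((k : ℝ) + 1)⁻¹ • moment k p at h
  rw [h, Complex.real_smul]
  push_cast
  ring

theorem supNorm_mul_idDisc_le (p : HolderAlg α closedDisc) :
    supNorm (idDisc * p) ≤ supNorm p := by
  refine supNorm_le p.supNorm_nonneg fun z => ?_
  rw [mul_apply, norm_mul, idDisc_apply]
  calc _ ≤ 1 * supNorm p :=
        mul_le_mul (norm_coe_le z) (p.norm_apply_le_supNorm z) (norm_nonneg _) zero_le_one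
    _ = _ := one_mul _

theorem idDisc_mul_mem_holSymm {p : HolderAlg α closedDisc} (hp : p ∈ holSymm α) :
    idDisc * p ∈ holSymm α := by
  refine ⟨?_, by rw [reflectDisc_mul, reflectDisc_idDisc, hp.2]⟩
  refine (differentiableOn_id.mul hp.1).congr fun z hz => ?_
  rw [extd_mul, extd_idDisc (mem_ball_zero_iff.1 hz).le]
  rfl

theorem moment_idDisc_mul (k : ℕ) {p : HolderAlg α closedDisc} (hp : p ∈ holSymm α) :
    moment (k + 1) (idDisc * p) = moment k p :=
  eq_of_pow (Λ := (moment (k + 1)).comp (LinearMap.mul ℝ (HolderAlg α closedDisc) idDisc))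
    (Λ' := moment k) (K := (k + 1 : ℕ) + 1)
    (fun p => (norm_moment_le _ _).trans
      (mul_le_mul_of_nonneg_left (supNorm_mul_idDisc_le p) (by positivity)))
    (fun p => norm_moment_le k p)
    (fun n => by
      change moment (k + 1) (idDisc * idDisc ^ n) = _
      rw [← pow_succ', moment_pow, moment_pow]
      simp) hp

theorem radAvg_pow (j n : ℕ) : radAvg j ((idDisc : HolderAlg α closedDisc) ^ n) =
    ((n : ℝ) + j + 1)⁻¹ • idDisc ^ n := by
  refine ext_of_ball fun z hz => ?_
  have hz' := (mem_ball_zero_iff.1 hz).le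
  rw [extd_of_le _ hz', radAvg_apply, extd_smul, extd_pow, extd_idDisc hz', Complex.real_smul]
  have h1 : ∫ t in (0 : ℝ)..1, (t : ℂ) ^ j * extd (idDisc ^ n : HolderAlg α closedDisc) (t * z) =
      ∫ t in (0 : ℝ)..1, ((t ^ (n + j) : ℝ) : ℂ) * z ^ n := by
    refine intervalIntegral.integral_congr fun t ht => ?_
    rw [uIcc_of_le zero_le_one] at ht
    rw [extd_pow, extd_idDisc, mul_pow]
    · push_cast; ring
    · rw [norm_mul, Complex.norm_real, Real.norm_of_nonneg ht.1]
      exact mul_le_one₀ ht.2 (norm_nonneg _) hz'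
  simp only
  rw [h1, intervalIntegral.integral_mul_const, intervalIntegral.integral_ofReal, integral_pow]
  push_cast
  simp

theorem norm_radAvg_le (j : ℕ) (p : HolderAlg α closedDisc) :
    supNorm (radAvg j p) ≤ supNorm p := by
  refine supNorm_le p.supNorm_nonneg fun z => ?_
  rw [radAvg_apply]
  have h1 : ‖∫ t in (0 : ℝ)..1, (t : ℂ) ^ j * extd p (t * z)‖ ≤ supNorm p * |1 - 0| := by
    refine intervalIntegral.norm_integral_le_of_norm_le_const fun t ht => ?_
    rw [uIoc_of_le zero_le_one] at ht
    rw [norm_mul, norm_pow, Complex.norm_real, Real.norm_of_nonneg ht.1.le]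
    exact (mul_le_of_le_one_left (norm_nonneg _) (pow_le_one₀ ht.1.le ht.2)).trans
      (p.norm_apply_le_supNorm _)
  simpa using h1

theorem moment_radAvg (j k : ℕ) {p : HolderAlg α closedDisc} (hp : p ∈ holSymm α) :
    moment k (radAvg j p) = moment k p / (k + j + 1) := by
  have h := eq_of_pow (Λ := (moment k).comp (radAvg j : HolderAlg α closedDisc →L[ℝ] _).toLinearMap)
    (Λ' := ((k : ℝ) + j + 1)⁻¹ • moment k) (K := (k : ℝ) + 1)
    (K' := ((k : ℝ) + j + 1)⁻¹ * (k + 1))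
    (fun p => (norm_moment_le _ _).trans
      (mul_le_mul_of_nonneg_left (norm_radAvg_le j p) (by positivity)))
    (fun p => by
      rw [LinearMap.smul_apply, norm_smul, Real.norm_of_nonneg (by positivity), mul_assoc]
      exact mul_le_mul_of_nonneg_left (norm_moment_le _ _) (by positivity))
    (fun n => by
      change moment k (radAvg j (idDisc ^ n)) = ((k : ℝ) + j + 1)⁻¹ • moment k (idDisc ^ n)
      rw [radAvg_pow, map_smul, moment_pow]
      by_cases hnk : n = k
      · subst hnk; simp
      · rw [if_neg hnk, smul_zero, smul_zero]) hp
  change moment k (radAvg j p) = ((k : ℝ) + j + 1)⁻¹ • moment k p at h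
  rw [h, Complex.real_smul]
  push_cast
  ring

theorem moment_bergman_conj (k : ℕ) (q : HolderAlg α closedDisc) :
    moment k (bergman (conj idDisc * q)) =
      (k + 1) * ∫ y, extd q y * starRingEnd ℂ y ^ (k + 1) ∂discArea := by
  rw [moment_eq_taylorCoeff k (differentiableOn_bergman _)]
  set s : HolderAlg α closedDisc := conj idDisc * q
  have h2 := taylorCoeff_cauchyPow_two (continuous_extd s).aestronglyMeasurable
    (fun y _ => norm_extd_le s y) k
  have hb := differentiableOn_cauchyPow (continuous_extd s).aestronglyMeasurable
    (fun y _ => norm_extd_le s y) 2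
  have h3 : taylorCoeff (extd (bergman s)) k = taylorCoeff (cauchyPow 2 (extd s)) k := by
    refine taylorCoeff_of_hasSum (fun z hz => ?_) k
    rw [bergman_apply s hz]
    exact hasSum_taylorCoeff hb hz
  rw [h3, h2]
  congr 1
  refine integral_congr_ae ?_
  filter_upwards [ae_discArea] with y hy
  rw [extd_mul, extd_conj, extd_idDisc (mem_ball_zero_iff.1 hy).le]
  ring

end Moments

/-! ### The linearization at the disc, on Taylor coefficients -/

section Linearization

/-- The linearization of `rotDefect` at `0`. -/
def rotLin (p : HolderAlg α closedDisc) : HolderAlg α closedDisc :=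
  bergman (conj idDisc * (crossDensity (powJet 0) (primJet p) + crossDensity (primJet p) (powJet 0)))

/-- The linearization of `velDefect f` at `0`. -/
def velLin (f p : HolderAlg α closedDisc) : HolderAlg α closedDisc :=
  (2⁻¹ : ℝ) • (bergman (conj idDisc * (f * (prim p + conj (prim p)))) -
    areaInt (pullFst f * segAvg 1 p) -
    idDisc * singularInt (pullFst f * ((2 : ℝ) • segAvg 1 p - pullSnd p)))

/-- As `y ȳ ^ (k + 1) = |y|² ȳ ^ k`, the integrand is a radial weight times an antiholomorphic
function vanishing at the centre. -/
theorem integral_normSq_mul_conj_eq_zero {p : HolderAlg α closedDisc}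
    (hp : DifferentiableOn ℂ (extd p) (Metric.ball 0 1)) (h0 : extd p 0 = 0) (k : ℕ) :
    ∫ y, y * starRingEnd ℂ (extd p y) * starRingEnd ℂ y ^ (k + 1) ∂discArea = 0 := by
  have h := integral_conj_holomorphic_eq_zero (u := fun y => extd p y * y ^ k) (K := ‖p‖ * 1)
    (f := fun y => ((‖y‖ ^ 2 : ℝ) : ℂ)) (hp.mul (by fun_prop)) (fun y hy => by
      rw [norm_mul, norm_pow]
      exact mul_le_mul (norm_extd_le p y) (pow_le_one₀ (norm_nonneg _) (mem_ball_zero_iff.1 hy).le)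
        (by positivity) (norm_nonneg _)) (by simp [h0]) (by fun_prop) (fun y => by simp)
  rw [← h]
  congr 1
  ext y
  rw [← Complex.normSq_eq_norm_sq, Complex.normSq_eq_conj_mul_self, map_mul, map_pow]
  ring

theorem extd_prim_zero (p : HolderAlg α closedDisc) : extd (prim p) 0 = 0 := by
  rw [extd_prim p (by simp), zero_mul]

/-- Only the cross density with `p` in the holomorphic slot contributes: the other one is, up to
radial weights, antiholomorphic and vanishing at the centre. The remaining one is `u ȳ` with `u`
holomorphic, whence the moment of order `k + 2` of `u`. -/
theorem moment_rotLin (k : ℕ) {p : HolderAlg α closedDisc} (hp : p ∈ holSymm α) :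
    moment k (rotLin p) = (k + 1) / (k + 2) * moment k p := by
  have hp1 := prim_mem_holSymm hp
  have hp2 := prim_mem_holSymm hp1
  set u : HolderAlg α closedDisc :=
    idDisc * prim p + idDisc * (idDisc * p) - prim (prim p) with hu
  have hum : moment (k + 2) u = (k + 3) / (k + 2) * moment k p := by
    have h1 : (k + 1 : ℂ) ≠ 0 := by exact_mod_cast k.succ_ne_zero
    have h2 : (k + 2 : ℂ) ≠ 0 := by exact_mod_cast (by omega : k + 2 ≠ 0)
    rw [hu, map_sub, map_add, moment_idDisc_mul _ hp1, moment_idDisc_mul _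
      (idDisc_mul_mem_holSymm hp), moment_idDisc_mul _ hp, moment_prim _ hp1, moment_prim _ hp]
    push_cast
    rw [show (k : ℂ) + 1 + 1 = k + 2 by ring]
    field_simp
    ring
  have hI1 : ∫ y, extd (crossDensity (powJet 0) (primJet p) : HolderAlg α closedDisc) y *
      starRingEnd ℂ y ^ (k + 1) ∂discArea = 0 := by
    have e1 := integral_normSq_mul_conj_eq_zero hp2.1 (extd_prim_zero _) k
    have e2 := integral_normSq_mul_conj_eq_zero (idDisc_mul_mem_holSymm hp1).1
      (by simp [extd_prim_zero]) k
    have hi : ∀ q : HolderAlg α closedDisc, Integrable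
        (fun y => 2 * (y * starRingEnd ℂ (extd q y) * starRingEnd ℂ y ^ (k + 1))) discArea :=
      fun q => integrable_discArea_of_continuous (by fun_prop)
    have e3 : ∫ y, extd (crossDensity (powJet 0) (primJet p) : HolderAlg α closedDisc) y *
        starRingEnd ℂ y ^ (k + 1) ∂discArea =
        ∫ y, (2 * (y * starRingEnd ℂ (extd (prim (prim p)) y) * starRingEnd ℂ y ^ (k + 1)) -
          2 * (y * starRingEnd ℂ (extd (idDisc * prim p) y) * starRingEnd ℂ y ^ (k + 1)))
          ∂discArea := by
      refine integral_congr_ae ?_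
      filter_upwards [ae_discArea] with y hy
      have hy' := (mem_ball_zero_iff.1 hy).le
      simp only [crossDensity, powJet, primJet_apply, extd_add, extd_sub, extd_mul, extd_smul,
        extd_pow, extd_conj, extd_idDisc hy', map_mul, Complex.real_smul]
      push_cast
      ring
    rw [e3, integral_sub (hi _) (hi _), integral_const_mul, integral_const_mul, e1, e2]
    simp
  have hI2 : ∫ y, extd (crossDensity (primJet p) (powJet 0) : HolderAlg α closedDisc) y *
      starRingEnd ℂ y ^ (k + 1) ∂discArea = moment k p / (k + 2) := by
    have h3 : (k + 3 : ℂ) ≠ 0 := by exact_mod_cast (by omega : k + 3 ≠ 0)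
    have h2 : (k + 2 : ℂ) ≠ 0 := by exact_mod_cast (by omega : k + 2 ≠ 0)
    have e : ∫ y, extd (crossDensity (primJet p) (powJet 0) : HolderAlg α closedDisc) y *
      starRingEnd ℂ y ^ (k + 1) ∂discArea =
        ∫ y, extd u y * starRingEnd ℂ y ^ (k + 2) ∂discArea := by
      refine integral_congr_ae ?_
      filter_upwards [ae_discArea] with y hy
      have hy' := (mem_ball_zero_iff.1 hy).le
      simp only [crossDensity, powJet, primJet_apply, hu, extd_add, extd_sub, extd_mul, extd_smul,
        extd_pow, extd_conj, extd_idDisc hy', map_mul, Complex.real_smul]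
      push_cast
      simp only [pow_zero, mul_one, zero_add, map_one, pow_one]
      ring
    rw [moment_apply] at hum
    push_cast at hum
    rw [show (k : ℂ) + 2 + 1 = k + 3 by ring] at hum
    rw [e]
    field_simp
    field_simp at hum
    linear_combination hum
  rw [rotLin, moment_bergman_conj]
  simp_rw [extd_add, add_mul]
  rw [integral_add (integrable_discArea_of_continuous (by fun_prop))
    (integrable_discArea_of_continuous (by fun_prop)), hI1, hI2]
  ring

variable {f : HolderAlg α closedDisc}

theorem segAvg_one_pt_zero (p : HolderAlg α closedDisc) (z : ℂ) :
    segAvg 1 p (pt 0 z) = extd (radAvg 1 p) z := by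
  rw [extd, radAvg, ContinuousLinearMap.comp_apply, comp_apply, pt,
    discProj_of_le (z := (0 : ℂ)) (by simp)]
  rfl

/-- The mean value property in `y`, with the radial weight `f`, evaluates `segAvg 1 p` at `y = 0`.
-/
theorem areaInt_radial (hf : ∀ y : ℂ, extd f y = extd f (‖y‖ : ℂ)) {c : ℝ}
    (hc : ∫ s in (0 : ℝ)..1, (s : ℂ) * extd f s = c) {p : HolderAlg α closedDisc}
    (hp : DifferentiableOn ℂ (extd p) (Metric.ball 0 1)) :
    areaInt (pullFst f * segAvg 1 p) = (2 * c) • radAvg 1 p := by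
  refine ext_of_ball fun z hz => ?_
  have hz' := mem_ball_zero_iff.1 hz
  rw [extd_areaInt]
  have h := integral_radial_mul_holomorphic (differentiableOn_segAvg_one_left hp hz')
    (fun y _ => (segAvg 1 p).norm_apply_le _) (continuous_extd f) hf
  simp_rw [mul_apply, pullFst_pt]
  rw [h, hc, extd_smul, Complex.real_smul, segAvg_one_pt_zero]
  push_cast
  ring

/-- For fixed `z` the numerator `v(y) = 2 segAvg 1 p - p(z)` is holomorphic in `y` and vanishes at
`y = z`, so the integrand is `f` times a holomorphic difference quotient. The mean value property
gives the value `-v(0) / z` at `y = 0`, and the factor `z` in front removes the denominator. -/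
theorem singularInt_radial (hf : ∀ y : ℂ, extd f y = extd f (‖y‖ : ℂ)) {c : ℝ}
    (hc : ∫ s in (0 : ℝ)..1, (s : ℂ) * extd f s = c) {p : HolderAlg α closedDisc}
    (hp : DifferentiableOn ℂ (extd p) (Metric.ball 0 1)) :
    idDisc * singularInt (pullFst f * ((2 : ℝ) • segAvg 1 p - pullSnd p)) =
      (2 * c) • (p - (2 : ℝ) • radAvg 1 p) := by
  refine ext_of_ball fun z hz => ?_
  have hz' := mem_ball_zero_iff.1 hz
  rw [extd_mul, extd_idDisc hz'.le, extd_smul, extd_sub, extd_smul, ← segAvg_one_pt_zero]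
  rcases eq_or_ne z 0 with rfl | hz0
  · rw [segAvg_diag 1 p (by simp), Complex.real_smul, Complex.real_smul]
    push_cast
    ring
  set v : ℂ → ℂ := fun y => 2 * segAvg 1 p (pt y z) - extd p z with hv
  have hvz : v z = 0 := by
    rw [hv]
    simp only
    rw [segAvg_diag 1 p hz'.le]
    push_cast
    ring
  have hvd : DifferentiableOn ℂ v (Metric.ball 0 1) :=
    ((differentiableOn_segAvg_one_left hp hz').const_mul 2).sub_const _
  obtain ⟨K, hK⟩ := exists_bound_dslope hz' hvd (K := 2 * ‖segAvg 1 p‖ + ‖p‖) fun y _ => by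
    refine (_root_.norm_sub_le _ _).trans (add_le_add ?_ (norm_extd_le _ _))
    rw [norm_mul, Complex.norm_two]
    exact mul_le_mul_of_nonneg_left ((segAvg 1 p).norm_apply_le _) zero_le_two
  have h := integral_radial_mul_holomorphic (differentiableOn_dslope_ball hz' hvd) hK
    (continuous_extd f) hf
  have e : extd (singularInt (pullFst f * ((2 : ℝ) • segAvg 1 p - pullSnd p))) z =
      ∫ y, extd f y * dslope v z y ∂discArea := by
    rw [extd_singularInt _ hz'.le]
    refine integral_congr_ae ?_
    filter_upwards [ae_discArea_ne z] with y hy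
    have hq : ∀ y : ℂ, ((2 : ℝ) • segAvg 1 p - pullSnd p) (pt y z) = v y := fun y => by
      rw [sub_apply, smul_apply, pullSnd_pt, Complex.real_smul]
      push_cast
      rfl
    rw [dslope_of_ne _ hy, slope_def_field, mul_apply, mul_apply, hq, hq, hvz,
      pullFst_pt]
    ring
  rw [e, h, hc, dslope_of_ne _ hz0.symm, slope_def_field, hvz, hv]
  simp only [Complex.real_smul]
  push_cast
  field_simp
  ring

/-- The density term yields twice the weighted moment of `f`, its antiholomorphic half integrating
to zero. The two kernel terms combine to `2 c (p - radAvg 1 p)`, whose moment is `2 c (1 - 1 / (k +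
2))` times that of `p`. -/
theorem moment_velLin (hf : ∀ y : ℂ, extd f y = extd f (‖y‖ : ℂ)) {c : ℝ}
    (hc : ∫ s in (0 : ℝ)..1, (s : ℂ) * extd f s = c) (k : ℕ) {p : HolderAlg α closedDisc}
    (hp : p ∈ holSymm α) :
    moment k (velLin f p) = ((∫ s in (0 : ℝ)..1, (s : ℂ) ^ (2 * (k + 1) + 1) * extd f s) -
      c * ((k + 1) / (k + 2))) * moment k p := by
  have hp1 := prim_mem_holSymm hp
  have h1 : (k + 1 : ℂ) ≠ 0 := by exact_mod_cast k.succ_ne_zero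
  have h2 : (k + 2 : ℂ) ≠ 0 := by exact_mod_cast (by omega : k + 2 ≠ 0)
  have e1 := integral_radial_mul_holomorphic_mul_conj_pow (k + 1) hp1.1
    (fun y _ => norm_extd_le _ y) (continuous_extd f) hf
  rw [← moment_eq_taylorCoeff _ hp1.1, moment_prim _ hp] at e1
  have e2 : ∫ y, extd f y * starRingEnd ℂ (extd (prim p) y) * starRingEnd ℂ y ^ (k + 1) ∂discArea =
      0 := by
    have h := integral_conj_holomorphic_eq_zero (u := fun y => extd (prim p) y * y ^ (k + 1))
      (K := ‖prim p‖ * 1) (f := extd f) (hp1.1.mul (by fun_prop)) (fun y hy => by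
        rw [norm_mul, norm_pow]
        exact mul_le_mul (norm_extd_le _ y)
          (pow_le_one₀ (norm_nonneg _) (mem_ball_zero_iff.1 hy).le) (by positivity)
          (norm_nonneg _)) (by simp) (continuous_extd f) hf
    rw [← h]
    congr 1
    ext y
    rw [map_mul, map_pow, mul_assoc]
  have e3 : moment k (bergman (conj idDisc * (f * (prim p + conj (prim p))))) =
      2 * (∫ s in (0 : ℝ)..1, (s : ℂ) ^ (2 * (k + 1) + 1) * extd f s) * moment k p := by
    rw [moment_bergman_conj]
    simp_rw [extd_mul, extd_add, extd_conj, mul_add, add_mul]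
    rw [integral_add (integrable_discArea_of_continuous (by fun_prop))
      (integrable_discArea_of_continuous (by fun_prop)), e1, e2, add_zero]
    generalize (∫ s in (0 : ℝ)..1, (s : ℂ) ^ (2 * (k + 1) + 1) * extd f s) = J
    field_simp
  rw [velLin, areaInt_radial hf hc hp.1, singularInt_radial hf hc hp.1]
  simp only [map_smul, map_sub, e3, moment_radAvg 1 k hp, Complex.real_smul]
  push_cast
  rw [show (k : ℂ) + 1 + 1 = k + 2 by ring]
  generalize (∫ s in (0 : ℝ)..1, (s : ℂ) ^ (2 * (k + 1) + 1) * extd f s) = J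
  field_simp
  ring

end Linearization

end HolderAlg

namespace HolderAlg

variable {α : ℝ≥0} [Fact (0 < α)] [Fact (α < 1)]

/-! ### Smoothness of the defect and its directional derivatives -/

section Smoothness

theorem isUnit_one_add_zero :
    IsUnit (1 + segAvg 0 (prim (0 : HolderAlg α closedDisc))) := by
  simp

theorem quotInv_zero : quotInv (0 : HolderAlg α closedDisc) = 1 := by
  simp [quotInv]

theorem contDiffAt_quotInv {n : WithTop ℕ∞} {p : HolderAlg α closedDisc}
    (hu : IsUnit (1 + segAvg 0 (prim p))) : ContDiffAt ℝ n quotInv p := by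
  obtain ⟨u, hu⟩ := hu
  have h1 : ContDiffAt ℝ n (Ring.inverse : HolderAlg α (closedDisc × closedDisc) → _)
      (1 + segAvg 0 (prim p)) := by
    rw [← hu]; exact contDiffAt_ringInverse ℝ u
  have h2 : ContDiff ℝ n fun p : HolderAlg α closedDisc => 1 + segAvg 0 (prim p) := by fun_prop
  exact h1.comp p h2.contDiffAt

theorem contDiff_rotDefect {n : WithTop ℕ∞} :
    ContDiff ℝ n (rotDefect : HolderAlg α closedDisc → HolderAlg α closedDisc) := by
  unfold rotDefect crossDensity mapJet
  fun_prop

theorem contDiff_pushDensity {n : WithTop ℕ∞} :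
    ContDiff ℝ n fun q : HolderAlg α closedDisc × HolderAlg α closedDisc =>
      pushDensity q.1 q.2 := by
  unfold pushDensity
  fun_prop

theorem contDiffAt_velDefect {n : WithTop ℕ∞} {q : HolderAlg α closedDisc × HolderAlg α closedDisc}
    (hu : IsUnit (1 + segAvg 0 (prim q.2))) :
    ContDiffAt ℝ n (fun q : HolderAlg α closedDisc × HolderAlg α closedDisc =>
      velDefect q.1 q.2) q := by
  have h1 : ContDiffAt ℝ n (fun q : HolderAlg α closedDisc × HolderAlg α closedDisc =>
      quotInv q.2) q := (contDiffAt_quotInv hu).comp q contDiffAt_snd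
  have h2 := (contDiff_pushDensity (α := α) (n := n)).contDiffAt (x := q)
  unfold velDefect regInt regIntDeriv
  fun_prop

theorem rotDefect_zero : rotDefect (0 : HolderAlg α closedDisc) = 0 := by
  have : crossDensity (mapJet (0 : HolderAlg α closedDisc)) (mapJet 0) = 0 := by
    refine ext_of_ball fun y hy => ?_
    have hy' := (mem_ball_zero_iff.1 hy).le
    simp only [crossDensity, mapJet, map_zero, mul_zero, add_zero, mul_one, extd_sub, extd_mul,
      extd_smul, extd_conj, extd_idDisc hy', extd_add, extd_zero, Complex.real_smul]
    push_cast
    ring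
  rw [rotDefect, this, mul_zero, map_zero]

theorem velDefect_zero (r : HolderAlg α closedDisc) :
    velDefect r 0 = (2⁻¹ : ℝ) • bergman (conj idDisc * r) := by
  simp [velDefect, regInt, regIntDeriv, pushDensity]

/-- Only continuity of `c` at `0` is needed. The directional derivatives of the two defects are read
off by factoring out `t`, without differentiating the inverse. -/
theorem hasDerivAt_smul_self {E : Type*} [NormedAddCommGroup E] [NormedSpace ℝ E] {c : ℝ → E}
    (hc : ContinuousAt c 0) : HasDerivAt (fun t : ℝ => t • c t) (c 0) 0 := by
  rw [hasDerivAt_iff_tendsto_slope]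
  refine (hc.tendsto.mono_left nhdsWithin_le_nhds).congr' ?_
  filter_upwards [self_mem_nhdsWithin] with t ht
  rw [slope_def_module, sub_zero, zero_smul, sub_zero, smul_smul, inv_mul_cancel₀ ht, one_smul]

theorem hasDerivAt_rotDefect (p : HolderAlg α closedDisc) :
    HasDerivAt (fun t : ℝ => rotDefect (t • p)) (rotLin p) 0 := by
  have h0 := rotDefect_zero (α := α)
  rw [rotDefect, mapJet_eq, map_zero, add_zero] at h0
  have e : (fun t : ℝ => rotDefect (t • p)) = fun t : ℝ => t • (rotLin p +
      t • bergman (conj idDisc * crossDensity (primJet p) (primJet p))) := by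
    ext1 t
    have h1 : crossDensity (mapJet (t • p)) (mapJet (t • p)) =
        crossDensity (powJet 0) (powJet 0 : HolderAlg α closedDisc × HolderAlg α closedDisc × _) +
        t • (crossDensity (powJet 0) (primJet p) + crossDensity (primJet p) (powJet 0) +
          t • crossDensity (primJet p) (primJet p)) := by
      rw [mapJet_eq, map_smul, crossDensity_add, crossDensity_add_right, crossDensity_add_right,
        crossDensity_smul, crossDensity_smul, crossDensity_smul_right, crossDensity_smul_right]
      module
    rw [rotDefect, h1, mul_add, map_add, h0, zero_add, mul_smul_comm, map_smul, mul_add, map_add,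
      mul_smul_comm, map_smul]
    rfl
  rw [e]
  have := hasDerivAt_smul_self (c := fun t : ℝ => rotLin p +
      t • bergman (conj idDisc * crossDensity (primJet p) (primJet p))) (by fun_prop)
  simpa using this

theorem hasDerivAt_velDefect (f p : HolderAlg α closedDisc) :
    HasDerivAt (fun t : ℝ => velDefect f (t • p)) (velLin f p) 0 := by
  set Q : ℝ → HolderAlg α (closedDisc × closedDisc) := fun t => quotInv (t • p) with hQ
  have hQ0 : Q 0 = 1 := by rw [hQ]; simp only [zero_smul]; exact quotInv_zero
  have hQc : ContinuousAt Q 0 := by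
    have h1 : ContinuousAt (quotInv : HolderAlg α closedDisc → _) ((0 : ℝ) • p) := by
      rw [zero_smul]
      exact (contDiffAt_quotInv (n := 0) isUnit_one_add_zero).continuousAt
    exact h1.comp (f := fun t : ℝ => t • p) (by fun_prop)
  set R : ℝ → HolderAlg α closedDisc := fun t => pushDensity f (t • p) with hR
  have hR0 : R 0 = f := by simp [hR, pushDensity]
  have hRc : ContinuousAt R 0 := by
    rw [hR]; unfold pushDensity; fun_prop
  set c : ℝ → HolderAlg α closedDisc := fun t => (2⁻¹ : ℝ) •
    (bergman (conj idDisc * (f * (prim p + conj (prim p)) + t • (f * (prim p * conj (prim p))))) -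
      areaInt (pullFst (R t) * (segAvg 1 p * Q t)) -
      idDisc * (singularInt (pullFst (R t) * (((2 : ℝ) • segAvg 1 p - pullSnd p) * Q t)) +
        areaInt (pullFst (R t) * -(t • (segAvg 1 p * segAvg 1 p * (Q t * Q t)))))) with hc
  have hcc : ContinuousAt c 0 := by rw [hc]; fun_prop
  have e : (fun t : ℝ => velDefect f (t • p)) = fun t : ℝ => velDefect f 0 + t • c t := by
    ext1 t
    have h1 : pushDensity f (t • p) = f + t • (f * (prim p + conj (prim p)) +
        t • (f * (prim p * conj (prim p)))) := by
      simp only [pushDensity, map_smul, map_add, conj_one, mul_add, add_mul, smul_add, one_mul,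
        mul_one, smul_mul_assoc, mul_smul_comm]
      abel
    have h2 : regInt f (t • p) = t • areaInt (pullFst (R t) * (segAvg 1 p * Q t)) := by
      rw [regInt, map_smul, smul_mul_assoc, mul_smul_comm, map_smul]
    have h3 : regIntDeriv f (t • p) = t •
        (singularInt (pullFst (R t) * (((2 : ℝ) • segAvg 1 p - pullSnd p) * Q t)) +
        areaInt (pullFst (R t) * -(t • (segAvg 1 p * segAvg 1 p * (Q t * Q t))))) := by
      rw [regIntDeriv, map_smul, map_smul, smul_comm (2 : ℝ) t, ← smul_sub, smul_mul_assoc,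
        smul_mul_assoc, mul_smul_comm, mul_smul_comm, smul_mul_assoc, ← smul_neg,
        mul_smul_comm, map_smul, map_smul, smul_add, smul_mul_assoc]
    rw [velDefect, h1, h2, h3, velDefect_zero, mul_add, map_add, mul_smul_comm, map_smul,
      mul_smul_comm, hc]
    module
  rw [e]
  have h := (hasDerivAt_smul_self hcc).const_add (velDefect f 0)
  refine h.congr_deriv ?_
  simp only [hc, hQ0, hR0, zero_smul, add_zero, mul_one, neg_zero, mul_zero, map_zero, velLin]

end Smoothness

end HolderAlg

/-! ### Sequences of size `1 / (k + 1)` as Fourier coefficients -/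

section FourierCoefficients

theorem memℓp_inv_natAbs : Memℓp (fun i : ℤ => ((i.natAbs : ℝ) + 1)⁻¹) 2 := by
  refine memℓp_gen ?_
  have h : Summable fun n : ℕ => ((n : ℝ) + 1)⁻¹ ^ 2 := by
    have := (summable_nat_add_iff 1).2 (Real.summable_one_div_nat_pow.2 one_lt_two)
    refine this.congr fun n => ?_
    push_cast
    rw [one_div, inv_pow]
  have h' : Summable fun i : ℤ => ((i.natAbs : ℝ) + 1)⁻¹ ^ 2 :=
    Summable.of_nat_of_neg (by simpa using h) (by simpa using h)
  refine h'.congr fun i => ?_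
  rw [ENNReal.toReal_ofNat, Real.rpow_two, Real.norm_of_nonneg (by positivity)]

/-- The norm of the sequence `1 / (|i| + 1)` of square integrable sequences. -/
def invNorm : ℝ :=
  ‖(⟨fun i : ℤ => ((i.natAbs : ℝ) + 1)⁻¹, memℓp_inv_natAbs⟩ : lp (fun _ : ℤ => ℝ) 2)‖

theorem invNorm_nonneg : 0 ≤ invNorm := norm_nonneg _

/-- Sequences bounded by `B / (k + 1)` are Fourier coefficients of integrable functions. -/
theorem exists_integrable_fourier (b : ℕ → ℝ) {B : ℝ} (hb : ∀ k : ℕ, |b k| ≤ B / (k + 1)) :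
    ∃ β : AddCircle (1 : ℝ) → ℂ, Integrable β AddCircle.haarAddCircle ∧
      (∫ t, ‖β t‖ ∂AddCircle.haarAddCircle) ≤ invNorm * B ∧
      ∀ k : ℕ, ∫ t, β t * fourier k t ∂AddCircle.haarAddCircle = b k := by
  have hB : 0 ≤ B := by
    have := (abs_nonneg _).trans (hb 0)
    simpa using this
  -- Integration against `fourier k` reads the coefficient of index `-k`, so the data sit at
  -- nonpositive indices. The sequence is square summable, and on a circle of mass one the `L¹` norm
  -- is at most the `L²` norm.
  set v : ℤ → ℂ := fun i => if i ≤ 0 then b i.natAbs else 0 with hv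
  have hvle : ∀ i : ℤ, ‖v i‖ ≤ ‖B • ((i.natAbs : ℝ) + 1)⁻¹‖ := fun i => by
    rw [smul_eq_mul, Real.norm_of_nonneg (by positivity), hv]
    simp only
    split_ifs
    · rw [Complex.norm_real, Real.norm_eq_abs, ← div_eq_mul_inv]
      exact hb _
    · rw [norm_zero]; positivity
  have hmem : Memℓp v 2 := by
    have h1 : Memℓp (fun i : ℤ => B • ((i.natAbs : ℝ) + 1)⁻¹) 2 := memℓp_inv_natAbs.const_smul B
    refine memℓp_gen ?_
    refine Summable.of_nonneg_of_le (fun i => by positivity) (fun i => ?_)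
      (h1.summable (by simp))
    exact Real.rpow_le_rpow (norm_nonneg _) (hvle i) (by simp)
  set V : lp (fun _ : ℤ => ℂ) 2 := ⟨v, hmem⟩ with hV
  have hVn : ‖V‖ ≤ invNorm * B := by
    have h1 := lp.norm_mono (p := 2) (by simp) (x := V)
      (y := B • (⟨fun i : ℤ => ((i.natAbs : ℝ) + 1)⁻¹, memℓp_inv_natAbs⟩ : lp (fun _ : ℤ => ℝ) 2))
      hvle
    rw [norm_smul, Real.norm_of_nonneg hB, mul_comm] at h1
    exact h1
  set β := (fourierBasis (T := (1 : ℝ))).repr.symm V with hβ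
  have hβ2 : MemLp β 2 AddCircle.haarAddCircle := Lp.memLp β
  have hint : Integrable β AddCircle.haarAddCircle := hβ2.integrable one_le_two
  refine ⟨β, hint, ?_, fun k => ?_⟩
  · have h1 : (∫ t, ‖β t‖ ∂AddCircle.haarAddCircle) ≤ ‖β‖ := by
      rw [integral_norm_eq_lintegral_enorm hint.1, ← eLpNorm_one_eq_lintegral_enorm, Lp.norm_def]
      exact ENNReal.toReal_mono hβ2.2.ne
        (eLpNorm_le_eLpNorm_of_exponent_le one_le_two hint.1)
    refine h1.trans ?_
    rw [hβ, LinearIsometryEquiv.norm_map]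
    exact hVn
  · have h1 : fourierCoeff β (-(k : ℤ)) = b k := by
      rw [← fourierBasis_repr, hβ, LinearIsometryEquiv.apply_symm_apply]
      change v (-(k : ℤ)) = b k
      rw [hv]
      simp
    rw [← h1, fourierCoeff]
    refine integral_congr_ae (Eventually.of_forall fun t => ?_)
    simp only [neg_neg, smul_eq_mul]
    ring

end FourierCoefficients

namespace HolderAlg

variable {α : ℝ≥0} [Fact (0 < α)] [Fact (α < 1)]

/-! ### Multipliers of Taylor coefficients as averages of rotations -/

section Multiplier

/-- The rotation of the closed disc. -/
def rotate (t : AddCircle (1 : ℝ)) (z : closedDisc) : closedDisc :=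
  ⟨fourier 1 t * z, by
    rw [mem_closedBall_zero_iff, norm_mul, fourier_one, Circle.norm_coe, one_mul]
    exact norm_coe_le z⟩

theorem lipschitzWith_rotate (t : AddCircle (1 : ℝ)) : LipschitzWith 1 (rotate t) := by
  refine LipschitzWith.of_dist_le_mul fun z w => ?_
  rw [NNReal.coe_one, one_mul, Subtype.dist_eq, Subtype.dist_eq, dist_eq_norm, dist_eq_norm]
  simp only [rotate]
  rw [← mul_sub, norm_mul, fourier_one, Circle.norm_coe, one_mul]

theorem continuous_rotate (z : closedDisc) : Continuous fun t => rotate t z :=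
  Continuous.subtype_mk (by fun_prop) _

theorem moment_bergman (k : ℕ) (q : HolderAlg α closedDisc) :
    moment k (bergman q) = moment k q := by
  rw [moment_eq_taylorCoeff k (differentiableOn_bergman _)]
  have h2 := taylorCoeff_cauchyPow_two (continuous_extd q).aestronglyMeasurable
    (fun y _ => norm_extd_le q y) k
  have hb := differentiableOn_cauchyPow (continuous_extd q).aestronglyMeasurable
    (fun y _ => norm_extd_le q y) 2
  have h3 : taylorCoeff (extd (bergman q)) k = taylorCoeff (cauchyPow 2 (extd q)) k := by
    refine taylorCoeff_of_hasSum (fun z hz => ?_) k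
    rw [bergman_apply q hz]
    exact hasSum_taylorCoeff hb hz
  rw [h3, h2, moment_apply]

theorem moment_reflectDisc (k : ℕ) (q : HolderAlg α closedDisc) :
    moment k (reflectDisc q) = starRingEnd ℂ (moment k q) := by
  rw [moment_apply, moment_apply, map_mul, ← integral_conj, ← integral_discArea_conj]
  simp [extd_reflectDisc]

theorem conj_moment (k : ℕ) {p : HolderAlg α closedDisc} (hp : p ∈ holSymm α) :
    starRingEnd ℂ (moment k p) = moment k p := by
  rw [← moment_reflectDisc, hp.2]

theorem moment_holProj (k : ℕ) (q : HolderAlg α closedDisc) :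
    moment k (holProj α q : HolderAlg α closedDisc) = ((moment k q).re : ℂ) := by
  change moment k (bergman ((2⁻¹ : ℝ) • (q + reflectDisc q))) = _
  rw [moment_bergman, map_smul, map_add, moment_reflectDisc, Complex.add_conj, Complex.real_smul]
  push_cast
  ring

/-- Multipliers of Taylor coefficients. -/
theorem exists_multiplier : ∃ C : ℝ, 0 ≤ C ∧ ∀ (b : ℕ → ℝ) (B : ℝ),
    (∀ k : ℕ, |b k| ≤ B / (k + 1)) → ∃ M : holSymm α →L[ℝ] holSymm α, ‖M‖ ≤ C * B ∧
      ∀ (p : holSymm α) (k : ℕ), moment k (M p : HolderAlg α closedDisc) =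
        b k * moment k (p : HolderAlg α closedDisc) := by
  refine ⟨‖holProj α‖ * invNorm, mul_nonneg (ContinuousLinearMap.opNorm_nonneg _) invNorm_nonneg,
    fun b B hb => ?_⟩
  obtain ⟨β, hβ, hβn, hβc⟩ := exists_integrable_fourier b hb
  -- Averaging rotations with weight `β` sends `z ^ n` to `b n z ^ n`, and its norm is at most the
  -- `L¹` norm of `β`, since rotations are isometries of the disc.
  set A : HolderAlg α closedDisc →L[ℝ] HolderAlg α closedDisc :=
    avg AddCircle.haarAddCircle β rotate hβ lipschitzWith_rotate continuous_rotate with hA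
  have hAm : ∀ p ∈ holSymm α, ∀ k, moment k (A p) = b k * moment k p := by
    intro p hp k
    have hsup : ∀ q, supNorm (A q) ≤ (invNorm * B) * supNorm q := fun q => by
      refine supNorm_le (mul_nonneg (le_trans (integral_nonneg fun _ => norm_nonneg _) hβn)
        q.supNorm_nonneg) fun z => ?_
      rw [hA, avg_apply]
      refine (norm_integral_le_of_norm_le (hβ.norm.mul_const (supNorm q))
        (Eventually.of_forall fun t => ?_)).trans ?_
      · rw [norm_mul]
        exact mul_le_mul_of_nonneg_left (q.norm_apply_le_supNorm _) (norm_nonneg _)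
      · rw [integral_mul_const]
        exact mul_le_mul_of_nonneg_right hβn q.supNorm_nonneg
    have h := eq_of_pow (Λ := (moment k).comp A.toLinearMap) (Λ' := b k • moment k)
      (K := (k + 1) * (invNorm * B)) (K' := |b k| * (k + 1))
      (fun q => (norm_moment_le _ _).trans (by
        rw [mul_assoc]
        exact mul_le_mul_of_nonneg_left (hsup q) (by positivity)))
      (fun q => by
        rw [LinearMap.smul_apply, norm_smul, Real.norm_eq_abs, mul_assoc]
        exact mul_le_mul_of_nonneg_left (norm_moment_le _ _) (abs_nonneg _))
      (fun n => by
        have hpow : A (idDisc ^ n) = b n • (idDisc ^ n : HolderAlg α closedDisc) := by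
          refine ext_of_ball fun z hz => ?_
          have hz' := (mem_ball_zero_iff.1 hz).le
          rw [extd_smul, extd_pow, extd_idDisc hz', extd_of_le _ hz', hA, avg_apply,
            Complex.real_smul, ← hβc n, ← integral_mul_const]
          refine integral_congr_ae (Eventually.of_forall fun t => ?_)
          simp only
          rw [← extd_coe, extd_pow, extd_coe, idDisc_apply]
          simp only [rotate, mul_pow]
          rw [fourier_one, fourier_apply, natCast_zsmul, AddCircle.toCircle_nsmul, Circle.coe_pow]
          ring
        change moment k (A (idDisc ^ n)) = b k • moment k (idDisc ^ n)
        rw [hpow, map_smul, moment_pow]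
        by_cases hnk : n = k
        · subst hnk; rfl
        · rw [if_neg hnk, smul_zero, smul_zero]) hp
    change moment k (A p) = b k • moment k p at h
    rw [h, Complex.real_smul]
  refine ⟨((holProj α).comp A).comp (holSymm α).subtypeL, ?_, fun p k => ?_⟩
  · refine ContinuousLinearMap.opNorm_le_bound _ ?_ fun p => ?_
    · exact mul_nonneg (mul_nonneg (ContinuousLinearMap.opNorm_nonneg _) invNorm_nonneg)
        (by have := (abs_nonneg _).trans (hb 0); simpa using this)
    · change ‖holProj α (A p)‖ ≤ _
      refine ((holProj α).le_opNorm _).trans ?_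
      rw [mul_assoc, mul_assoc]
      refine mul_le_mul_of_nonneg_left ?_ (ContinuousLinearMap.opNorm_nonneg _)
      rw [← mul_assoc]
      exact (norm_avg_le _ _ _ _).trans (mul_le_mul_of_nonneg_right hβn (norm_nonneg _))
  · change moment k (holProj α (A p) : HolderAlg α closedDisc) = _
    rw [moment_holProj, hAm p p.2, Complex.re_ofReal_mul, Complex.ofReal_mul]
    congr 1
    exact Complex.conj_eq_iff_re.1 (conj_moment k p.2)

end Multiplier

end HolderAlg

/-! ### An implicit function theorem uniform in a real parameter -/

section UniformImplicitFunction

variable {Y E F : Type*} [NormedAddCommGroup Y] [NormedSpace ℝ Y] [CompleteSpace Y]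
  [NormedAddCommGroup E] [NormedSpace ℝ E] [CompleteSpace E]
  [NormedAddCommGroup F] [NormedSpace ℝ F] [CompleteSpace F]

/-- A map with an approximate left inverse is invertible, when the inverted map is. -/
theorem isInvertible_of_norm_le {L T : E →L[ℝ] F} {R : F →L[ℝ] E}
    (hLR : L.comp R = ContinuousLinearMap.id ℝ F)
    (hT : ‖ContinuousLinearMap.id ℝ E - R.comp T‖ < 1) : T.IsInvertible := by
  have hu : IsUnit (R.comp T : E →L[ℝ] E) := by
    have := isUnit_one_sub_of_norm_lt_one hT
    convert! this using 1
    rw [ContinuousLinearMap.one_def, sub_sub_cancel]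
  obtain ⟨u, hu⟩ := hu
  set e := ContinuousLinearEquiv.unitsEquiv ℝ E u with he
  have he' : (e : E →L[ℝ] E) = R.comp T := by
    rw [← hu]; rfl
  have hTe : T = L.comp (e : E →L[ℝ] E) := by
    rw [he', ← ContinuousLinearMap.comp_assoc, hLR, ContinuousLinearMap.id_comp]
  set S : F →L[ℝ] E := (e.symm : E →L[ℝ] E).comp R with hS
  have h1 : ∀ x, S (T x) = x := fun x => by
    change e.symm ((R.comp T) x) = x
    rw [← he']
    exact e.symm_apply_apply x
  have h2 : ∀ y, T (S y) = y := fun y => by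
    rw [hTe]
    change L (e (e.symm (R y))) = y
    rw [e.apply_symm_apply]
    exact DFunLike.congr_fun hLR y
  exact ⟨ContinuousLinearEquiv.equivOfInverse T S h1 h2, rfl⟩

/-- Simplified Newton iteration. As `R` is injective, the fixed points of `x - R (G x)` are the
zeros of `G`. This map contracts by `1/2` and preserves the closed ball of radius `2 ‖R (G 0)‖`,
which lies in the open ball; the contraction on the open ball gives uniqueness there. -/
theorem exists_unique_zero {G : E → F} {R : F →L[ℝ] E} (hR : Function.Injective R) {ε : ℝ}
    (hlip : ∀ x ∈ Metric.ball (0 : E) ε, ∀ x' ∈ Metric.ball (0 : E) ε,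
      ‖(x - R (G x)) - (x' - R (G x'))‖ ≤ 2⁻¹ * ‖x - x'‖)
    (h0 : ‖R (G 0)‖ < ε / 2) :
    ∃ x ∈ Metric.ball (0 : E) ε, G x = 0 ∧ ∀ x' ∈ Metric.ball (0 : E) ε, G x' = 0 → x' = x := by
  set T : E → E := fun x => x - R (G x) with hT
  set s := 2 * ‖R (G 0)‖ with hs
  have hs0 : 0 ≤ s := by positivity
  have hsε : s < ε := by linarith
  have hsub : Metric.closedBall (0 : E) s ⊆ Metric.ball 0 ε := Metric.closedBall_subset_ball hsε
  have hT0 : T 0 = -R (G 0) := by simp [hT]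
  have hmaps : MapsTo T (Metric.closedBall 0 s) (Metric.closedBall 0 s) := by
    intro x hx
    have h1 := hlip x (hsub hx) 0 (Metric.mem_ball_self (hs0.trans_lt hsε))
    rw [mem_closedBall_zero_iff] at hx ⊢
    have h2 : T x = (T x - T 0) + T 0 := by abel
    have h3 : ‖T x - T 0‖ ≤ 2⁻¹ * ‖x - 0‖ := h1
    rw [h2]
    refine (norm_add_le _ _).trans ?_
    rw [hT0, norm_neg] at *
    rw [sub_zero] at h3
    linarith
  have hcon : ContractingWith 2⁻¹ (hmaps.restrict T (Metric.closedBall 0 s)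
      (Metric.closedBall 0 s)) := by
    refine ⟨by rw [← NNReal.coe_lt_coe]; norm_num, LipschitzWith.of_dist_le_mul fun x y => ?_⟩
    rw [Subtype.dist_eq, Subtype.dist_eq, dist_eq_norm, dist_eq_norm]
    have := hlip x (hsub x.2) y (hsub y.2)
    rwa [NNReal.coe_inv, NNReal.coe_ofNat]
  obtain ⟨x, hx, hfix, -⟩ := hcon.exists_fixedPoint' Metric.isClosed_closedBall.isComplete hmaps
    (Metric.mem_closedBall_self hs0) (edist_ne_top _ _)
  have hzero : ∀ x, T x = x → G x = 0 := fun x h => by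
    apply hR
    rw [map_zero]
    exact sub_eq_self.1 h
  refine ⟨x, hsub hx, hzero x hfix, fun x' hx' h' => ?_⟩
  have h1 := hlip x' hx' x (hsub hx)
  rw [h', hzero x hfix, map_zero, sub_zero, sub_zero] at h1
  have h2 : ‖x' - x‖ = 0 := by linarith [norm_nonneg (x' - x)]
  exact sub_eq_zero.1 (norm_eq_zero.1 h2)

/-- An implicit function theorem that is uniform with respect to a real parameter. -/
theorem exists_uniform_implicitFunction {A : E → F} {B : Y × E → F} {y₀ : Y}
    (hA : ContDiffAt ℝ 1 A 0) (hB : ContDiffAt ℝ 1 B (y₀, 0)) (hA0 : A 0 = 0)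
    (hB0 : B (y₀, 0) = 0) {I : Set ℝ} (hI : IsOpen I) {K : ℝ} {R : ℝ → F →L[ℝ] E}
    (hR : ∀ Ω ∈ I, ‖R Ω‖ * (1 + |Ω|) ≤ K)
    (hLR : ∀ Ω ∈ I, (Ω • fderiv ℝ A 0 + (fderiv ℝ B (y₀, 0)).comp (.inr ℝ Y E)).comp (R Ω) =
      ContinuousLinearMap.id ℝ F)
    (hRL : ∀ Ω ∈ I, (R Ω).comp (Ω • fderiv ℝ A 0 + (fderiv ℝ B (y₀, 0)).comp (.inr ℝ Y E)) =
      ContinuousLinearMap.id ℝ E)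
    {P : Y × E → Prop} (hP : ∀ᶠ u in 𝓝 (y₀, (0 : E)), P u) :
    ∃ δ ε : ℝ, 0 < δ ∧ δ < 1 ∧ 0 < ε ∧ ε < 1 ∧
      (∀ y ∈ Metric.ball y₀ δ, ∀ x ∈ Metric.ball (0 : E) ε, P (y, x)) ∧
      ∃ n : ℝ × Y → E,
        (∀ Ω ∈ I, ∀ y ∈ Metric.ball y₀ δ, n (Ω, y) ∈ Metric.ball (0 : E) ε) ∧
        (∀ Ω ∈ I, ∀ y ∈ Metric.ball y₀ δ, ∀ x ∈ Metric.ball (0 : E) ε,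
          Ω • A x + B (y, x) = 0 ↔ x = n (Ω, y)) ∧
        (∀ Ω ∈ I, ∀ y ∈ Metric.ball y₀ δ, ContDiffAt ℝ 1 n (Ω, y)) ∧
        ∀ Ω ∈ I, HasFDerivAt (fun y => n (Ω, y))
          (-(R Ω).comp ((fderiv ℝ B (y₀, 0)).comp (.inl ℝ Y E))) y₀ := by
  -- If strict differentiability holds for `A` and `B` with error `η`, the total error is `‖R Ω‖
  -- (|Ω| η + η) ≤ |K| η ≤ 1/2`. The weight `1 + |Ω|` in the bound of `R` makes the radii
  -- independent of `Ω`.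
  set η : ℝ := (2 * (|K| + 1))⁻¹ with hη
  have hη0 : 0 < η := by positivity
  have hKη : |K| * η ≤ 2⁻¹ := by
    rw [hη, mul_inv, ← mul_assoc, mul_comm |K|, mul_assoc, ← div_eq_mul_inv]
    have : |K| / (|K| + 1) ≤ 1 := (div_le_one (by positivity)).2 (by linarith)
    linarith
  have hsA := (hA.hasStrictFDerivAt one_ne_zero).isLittleO.def hη0
  have hsB := (hB.hasStrictFDerivAt one_ne_zero).isLittleO.def hη0
  obtain ⟨r₁, hr₁, h₁⟩ := Metric.eventually_nhds_iff_ball.1 hsA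
  obtain ⟨r₂, hr₂, h₂⟩ := Metric.eventually_nhds_iff_ball.1 hsB
  obtain ⟨r₃, hr₃, h₃⟩ := Metric.eventually_nhds_iff_ball.1 hP
  obtain ⟨r₄, hr₄, h₄⟩ := Metric.eventually_nhds_iff_ball.1 (hA.eventually (by simp))
  obtain ⟨r₅, hr₅, h₅⟩ := Metric.eventually_nhds_iff_ball.1 (hB.eventually (by simp))
  obtain ⟨ε, hε0, hε⟩ : ∃ ε : ℝ, 0 < ε ∧ (ε ≤ r₁ ∧ ε ≤ r₂ ∧ ε ≤ r₃ ∧ ε ≤ r₄ ∧ ε ≤ r₅ ∧ ε < 1) := by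
    refine ⟨min r₁ (min r₂ (min r₃ (min r₄ (min r₅ 2⁻¹)))), by positivity, ?_⟩
    refine ⟨min_le_left _ _, ?_⟩
    refine ⟨(min_le_right _ _).trans (min_le_left _ _), ?_⟩
    refine ⟨((min_le_right _ _).trans (min_le_right _ _)).trans (min_le_left _ _), ?_⟩
    refine ⟨(((min_le_right _ _).trans (min_le_right _ _)).trans (min_le_right _ _)).trans
      (min_le_left _ _), ?_⟩
    have h := (((min_le_right r₁ _).trans (min_le_right r₂ _)).trans (min_le_right r₃ _)).trans
      (min_le_right r₄ (min r₅ (2⁻¹ : ℝ)))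
    exact ⟨h.trans (min_le_left _ _), (h.trans (min_le_right _ _)).trans_lt (by norm_num)⟩
  obtain ⟨e₁, e₂, e₃, e₄, e₅, e₆⟩ := hε
  have hBc : Tendsto (fun y => |K| * ‖B (y, 0)‖) (𝓝 y₀) (𝓝 0) := by
    have h1 : ContinuousAt (fun y => B (y, (0 : E))) y₀ :=
      ContinuousAt.comp (f := fun y => (y, (0 : E))) (g := B) hB.continuousAt (by fun_prop)
    have h2 := (h1.tendsto.norm.const_mul |K|)
    rwa [hB0, norm_zero, mul_zero] at h2
  obtain ⟨r₆, hr₆, h₆⟩ := Metric.eventually_nhds_iff_ball.1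
    (hBc.eventually (gt_mem_nhds (half_pos hε0)))
  obtain ⟨δ, hδ0, d₁, d₂⟩ : ∃ δ : ℝ, 0 < δ ∧ δ ≤ ε ∧ δ ≤ r₆ :=
    ⟨min ε r₆, lt_min hε0 hr₆, min_le_left _ _, min_le_right _ _⟩
  have hmem : ∀ y ∈ Metric.ball y₀ δ, ∀ x ∈ Metric.ball (0 : E) ε,
      (y, x) ∈ Metric.ball (y₀, (0 : E)) ε := fun y hy x hx => by
    rw [← ball_prod_same]
    exact ⟨Metric.ball_subset_ball d₁ hy, hx⟩
  have hlip : ∀ Ω ∈ I, ∀ y ∈ Metric.ball y₀ δ, ∀ x ∈ Metric.ball (0 : E) ε,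
      ∀ x' ∈ Metric.ball (0 : E) ε, ‖(x - R Ω (Ω • A x + B (y, x))) -
        (x' - R Ω (Ω • A x' + B (y, x')))‖ ≤ 2⁻¹ * ‖x - x'‖ := by
    intro Ω hΩ y hy x hx x' hx'
    have a1 := h₁ (x, x') (by
      rw [← ball_prod_same]
      exact ⟨Metric.ball_subset_ball e₁ hx, Metric.ball_subset_ball e₁ hx'⟩)
    have a2 := h₂ ((y, x), (y, x')) (by
      change ((y, x), (y, x')) ∈ Metric.ball ((y₀, (0 : E)), (y₀, (0 : E))) r₂
      rw [← ball_prod_same]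
      exact ⟨Metric.ball_subset_ball e₂ (hmem y hy x hx),
        Metric.ball_subset_ball e₂ (hmem y hy x' hx')⟩)
    change ‖A x - A x' - fderiv ℝ A 0 (x - x')‖ ≤ η * ‖x - x'‖ at a1
    change ‖B (y, x) - B (y, x') - fderiv ℝ B (y₀, 0) ((y, x) - (y, x'))‖ ≤
      η * ‖(y, x) - (y, x')‖ at a2
    have e0 : ((y, x) : Y × E) - (y, x') = (0, x - x') := by simp
    rw [e0] at a2
    have e1 : ‖((0 : Y), x - x')‖ = ‖x - x'‖ := by simp [Prod.norm_def]
    rw [e1] at a2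
    have h := DFunLike.congr_fun (hRL Ω hΩ) (x - x')
    have e2 : (x - R Ω (Ω • A x + B (y, x))) - (x' - R Ω (Ω • A x' + B (y, x'))) =
        -R Ω (Ω • (A x - A x' - fderiv ℝ A 0 (x - x')) +
          (B (y, x) - B (y, x') - fderiv ℝ B (y₀, 0) (0, x - x'))) := by
      have h' : R Ω (Ω • fderiv ℝ A 0 (x - x') + fderiv ℝ B (y₀, 0) (0, x - x')) = x - x' := h
      have : Ω • (A x - A x' - fderiv ℝ A 0 (x - x')) +
          (B (y, x) - B (y, x') - fderiv ℝ B (y₀, 0) (0, x - x')) =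
          (Ω • A x + B (y, x)) - (Ω • A x' + B (y, x')) -
          (Ω • fderiv ℝ A 0 (x - x') + fderiv ℝ B (y₀, 0) (0, x - x')) := by module
      rw [this, map_sub, map_sub, h']
      abel
    rw [e2, norm_neg]
    calc _ ≤ ‖R Ω‖ * (|Ω| * (η * ‖x - x'‖) + η * ‖x - x'‖) := by
          refine ((R Ω).le_opNorm _).trans (mul_le_mul_of_nonneg_left ?_ (norm_nonneg _))
          refine (norm_add_le _ _).trans (add_le_add ?_ a2)
          rw [norm_smul, Real.norm_eq_abs]
          exact mul_le_mul_of_nonneg_left a1 (abs_nonneg _)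
      _ = (‖R Ω‖ * (1 + |Ω|)) * (η * ‖x - x'‖) := by ring
      _ ≤ |K| * (η * ‖x - x'‖) :=
          mul_le_mul_of_nonneg_right ((hR Ω hΩ).trans (le_abs_self K)) (by positivity)
      _ = (|K| * η) * ‖x - x'‖ := by ring
      _ ≤ _ := mul_le_mul_of_nonneg_right hKη (norm_nonneg _)
  have hRn : ∀ Ω ∈ I, ‖R Ω‖ ≤ |K| := fun Ω hΩ => by
    refine le_trans ?_ ((hR Ω hΩ).trans (le_abs_self K))
    nlinarith [norm_nonneg (R Ω), abs_nonneg Ω]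
  have hex : ∀ Ω ∈ I, ∀ y ∈ Metric.ball y₀ δ, ∃ x ∈ Metric.ball (0 : E) ε,
      Ω • A x + B (y, x) = 0 ∧ ∀ x' ∈ Metric.ball (0 : E) ε, Ω • A x' + B (y, x') = 0 → x' = x := by
    intro Ω hΩ y hy
    refine exists_unique_zero (G := fun x => Ω • A x + B (y, x)) (R := R Ω) ?_
      (hlip Ω hΩ y hy) ?_
    · intro a b hab
      have := congrArg (Ω • fderiv ℝ A 0 + (fderiv ℝ B (y₀, 0)).comp (.inr ℝ Y E)) hab
      rw [← ContinuousLinearMap.comp_apply, ← ContinuousLinearMap.comp_apply, hLR Ω hΩ] at this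
      exact this
    · rw [hA0, smul_zero, zero_add]
      refine ((R Ω).le_opNorm _).trans_lt ?_
      exact (mul_le_mul_of_nonneg_right (hRn Ω hΩ) (norm_nonneg _)).trans_lt
        (h₆ y (Metric.ball_subset_ball d₂ hy))
  classical
  set n : ℝ × Y → E := fun q => if h : q.1 ∈ I ∧ q.2 ∈ Metric.ball y₀ δ then
    (hex q.1 h.1 q.2 h.2).choose else 0 with hn
  have hnspec : ∀ Ω ∈ I, ∀ y ∈ Metric.ball y₀ δ, n (Ω, y) ∈ Metric.ball (0 : E) ε ∧
      Ω • A (n (Ω, y)) + B (y, n (Ω, y)) = 0 ∧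
      ∀ x' ∈ Metric.ball (0 : E) ε, Ω • A x' + B (y, x') = 0 → x' = n (Ω, y) := by
    intro Ω hΩ y hy
    have h : n (Ω, y) = (hex Ω hΩ y hy).choose := by rw [hn]; exact dif_pos ⟨hΩ, hy⟩
    rw [h]
    exact (hex Ω hΩ y hy).choose_spec
  -- So far `n` is only a choice at each point. Near each point it coincides with the local implicit
  -- function there, by uniqueness in the ball, and it inherits its regularity jointly in `(Ω, y)`.
  have key : ∀ Ω ∈ I, ∀ y ∈ Metric.ball y₀ δ, ∃ S : (ℝ × Y) →L[ℝ] E, ContDiffAt ℝ 1 n (Ω, y) ∧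
      HasFDerivAt n S (Ω, y) := by
    intro Ω hΩ y hy
    obtain ⟨hx, hz, -⟩ := hnspec Ω hΩ y hy
    set x := n (Ω, y) with hxdef
    set G : (ℝ × Y) × E → F := fun u => u.1.1 • A u.2 + B (u.1.2, u.2) with hG
    have hAx : ContDiffAt ℝ 1 A x := h₄ x (Metric.ball_subset_ball e₄ hx)
    have hBx : ContDiffAt ℝ 1 B (y, x) := h₅ _ (Metric.ball_subset_ball e₅ (hmem y hy x hx))
    have hGc : ContDiffAt ℝ 1 G ((Ω, y), x) := by
      have c1 : ContDiffAt ℝ 1 (fun u : (ℝ × Y) × E => A u.2) ((Ω, y), x) :=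
        ContDiffAt.comp ((Ω, y), x) (g := A) hAx contDiffAt_snd
      have c2 : ContDiffAt ℝ 1 (fun u : (ℝ × Y) × E => B (u.1.2, u.2)) ((Ω, y), x) :=
        ContDiffAt.comp ((Ω, y), x) (g := B) (f := fun u : (ℝ × Y) × E => (u.1.2, u.2)) hBx
          (by fun_prop)
      exact (ContDiffAt.smul (by fun_prop) c1).add c2
    -- The Lipschitz bound `1/2` passes to the derivative of `x - R (G x)`, so that `R` is an
    -- approximate left inverse of the partial derivative at every solution, not only at the base
    -- point.
    have hinv : (fderiv ℝ G ((Ω, y), x) ∘L .inr ℝ (ℝ × Y) E).IsInvertible := by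
      refine isInvertible_of_norm_le (hLR Ω hΩ) ?_
      have hd1 : HasFDerivAt (fun x => G ((Ω, y), x))
          (fderiv ℝ G ((Ω, y), x) ∘L .inr ℝ (ℝ × Y) E) x :=
        HasFDerivAt.comp (g := G) x (hGc.differentiableAt one_ne_zero).hasFDerivAt
          (hasFDerivAt_prodMk_right _ _)
      have hd2 := (hasFDerivAt_id x).sub ((R Ω).hasFDerivAt.comp x hd1)
      have := hd2.le_of_lip' (C := 2⁻¹) (by norm_num) ?_
      · exact this.trans_lt (by norm_num)
      · filter_upwards [Metric.isOpen_ball.mem_nhds hx] with x' hx'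
        exact hlip Ω hΩ y hy x' hx' x hx
    have hψ := hGc.eventually_apply_implicitFunction one_ne_zero hinv
    have hψ0 := hGc.implicitFunction_apply_self one_ne_zero hinv
    have hψc := hGc.contDiffAt_implicitFunction one_ne_zero hinv
    have hψd := hGc.hasStrictFDerivAt_implicitFunction one_ne_zero hinv
    set ψ := hGc.implicitFunction one_ne_zero hinv
    have hev : n =ᶠ[𝓝 (Ω, y)] ψ := by
      have hopen : I ×ˢ Metric.ball y₀ δ ∈ 𝓝 (Ω, y) :=
        (hI.prod Metric.isOpen_ball).mem_nhds ⟨hΩ, hy⟩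
      have hball : ∀ᶠ q in 𝓝 (Ω, y), ψ q ∈ Metric.ball (0 : E) ε := by
        have := hψc.continuousAt.tendsto
        simp only at this hψ0
        rw [hψ0] at this
        exact this.eventually (Metric.isOpen_ball.mem_nhds hx)
      filter_upwards [hψ, hopen, hball] with q hq hqo hqb
      refine ((hnspec q.1 hqo.1 q.2 hqo.2).2.2 _ hqb ?_).symm
      have h0 : G ((Ω, y), x) = 0 := hz
      rw [h0] at hq
      exact hq
    exact ⟨_, hψc.congr_of_eventuallyEq hev, hψd.hasFDerivAt.congr_of_eventuallyEq hev⟩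
  refine ⟨δ, ε, hδ0, d₁.trans_lt e₆, hε0, e₆,
    fun y hy x hx => h₃ _ (Metric.ball_subset_ball e₃ (hmem y hy x hx)), n,
    fun Ω hΩ y hy => (hnspec Ω hΩ y hy).1, fun Ω hΩ y hy x hx =>
      ⟨(hnspec Ω hΩ y hy).2.2 x hx, fun h => h ▸ (hnspec Ω hΩ y hy).2.1⟩,
    fun Ω hΩ y hy => (key Ω hΩ y hy).choose_spec.1, fun Ω hΩ => ?_⟩
  have hy₀ := Metric.mem_ball_self (x := y₀) hδ0
  have hn0 : n (Ω, y₀) = 0 := ((hnspec Ω hΩ y₀ hy₀).2.2 0 (Metric.mem_ball_self hε0)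
    (by rw [hA0, hB0, smul_zero, zero_add])).symm
  obtain ⟨S, -, hS⟩ := key Ω hΩ y₀ hy₀
  set S' := S.comp (ContinuousLinearMap.inr ℝ ℝ Y) with hS'
  have hd : HasFDerivAt (fun y => n (Ω, y)) S' y₀ :=
    HasFDerivAt.comp (g := n) y₀ hS (hasFDerivAt_prodMk_right _ _)
  have hAd : HasFDerivAt (fun y => A (n (Ω, y))) ((fderiv ℝ A 0).comp S') y₀ := by
    refine HasFDerivAt.comp (g := A) y₀ ?_ hd
    rw [hn0]
    exact (hA.differentiableAt one_ne_zero).hasFDerivAt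
  have hBd : HasFDerivAt (fun y => B (y, n (Ω, y)))
      ((fderiv ℝ B (y₀, 0)).comp ((ContinuousLinearMap.id ℝ Y).prod S')) y₀ := by
    refine HasFDerivAt.comp (g := B) (f := fun y => (y, n (Ω, y))) y₀ ?_
      ((hasFDerivAt_id y₀).prodMk hd)
    rw [hn0]
    exact (hB.differentiableAt one_ne_zero).hasFDerivAt
  have hzero : HasFDerivAt (fun y => Ω • A (n (Ω, y)) + B (y, n (Ω, y))) (0 : Y →L[ℝ] F) y₀ := by
    refine (hasFDerivAt_const (0 : F) y₀).congr_of_eventuallyEq ?_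
    filter_upwards [Metric.isOpen_ball.mem_nhds hy₀] with y hy
    exact (hnspec Ω hΩ y hy).2.1
  -- Implicit differentiation: the equation holds identically near `y₀`, so its total derivative is
  -- zero; composing with `R Ω` isolates the derivative of `n`.
  have huniq := ((hAd.const_smul Ω).add hBd).unique hzero
  refine hd.congr_fderiv ?_
  ext h
  have h1 := DFunLike.congr_fun huniq h
  have h2 := DFunLike.congr_fun (hRL Ω hΩ) (S' h)
  have h3 : Ω • fderiv ℝ A 0 (S' h) + fderiv ℝ B (y₀, 0) (h, S' h) = 0 := h1
  have h4 : R Ω (Ω • fderiv ℝ A 0 (S' h) + fderiv ℝ B (y₀, 0) (0, S' h)) = S' h := h2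
  have h5 : ((h, S' h) : Y × E) = (h, 0) + (0, S' h) := by simp
  rw [h5, map_add] at h3
  change S' h = -R Ω (fderiv ℝ B (y₀, 0) (h, 0))
  rw [← h4, ← map_neg]
  congr 1
  rw [eq_neg_iff_add_eq_zero, ← h3]
  abel

end UniformImplicitFunction

namespace HolderAlg

variable {α : ℝ≥0} [Fact (0 < α)] [Fact (α < 1)]

/-! ### The projected equation and the inverse of its linearization -/

section Linearization

theorem hasDerivAt_line {E : Type*} [NormedAddCommGroup E] [NormedSpace ℝ E] (p : E) :
    HasDerivAt (fun t : ℝ => t • p) p 0 := by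
  simpa using (hasDerivAt_id (0 : ℝ)).smul_const p

theorem coe_re_moment (k : ℕ) {p : HolderAlg α closedDisc} (hp : p ∈ holSymm α) :
    ((moment k p).re : ℂ) = moment k p :=
  Complex.conj_eq_iff_re.1 (conj_moment k hp)

/-- The projection of `rotDefect` onto the symmetric holomorphic functions. -/
def rotSymm (p : holSymm α) : holSymm α := holProj α (rotDefect (p : HolderAlg α closedDisc))

/-- The projection of `velDefect` onto the symmetric holomorphic functions. -/
def velSymm (q : HolderAlg α closedDisc × holSymm α) : holSymm α :=
  holProj α (velDefect q.1 (q.2 : HolderAlg α closedDisc))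

theorem contDiff_rotSymm {n : WithTop ℕ∞} : ContDiff ℝ n (rotSymm : holSymm α → holSymm α) :=
  (holProj α).contDiff.comp (contDiff_rotDefect.comp (holSymm α).subtypeL.contDiff)

theorem contDiffAt_velSymm {n : WithTop ℕ∞} {q : HolderAlg α closedDisc × holSymm α}
    (hu : IsUnit (1 + segAvg 0 (prim (q.2 : HolderAlg α closedDisc)))) :
    ContDiffAt ℝ n velSymm q := by
  have h1 : ContDiffAt ℝ n (fun q : HolderAlg α closedDisc × holSymm α =>
      (q.1, (q.2 : HolderAlg α closedDisc))) q :=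
    contDiffAt_fst.prodMk ((holSymm α).subtypeL.contDiff.contDiffAt.comp q contDiffAt_snd)
  exact (holProj α).contDiff.contDiffAt.comp q
    (ContDiffAt.comp q (f := fun q : HolderAlg α closedDisc × holSymm α =>
      (q.1, (q.2 : HolderAlg α closedDisc))) (contDiffAt_velDefect hu) h1)

theorem contDiffAt_velSymm_zero {n : WithTop ℕ∞} (f : HolderAlg α closedDisc) :
    ContDiffAt ℝ n (velSymm : _ → holSymm α) (f, 0) :=
  contDiffAt_velSymm isUnit_one_add_zero

theorem fderiv_rotSymm (p : holSymm α) :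
    fderiv ℝ (rotSymm : holSymm α → holSymm α) 0 p = holProj α (rotLin (p : HolderAlg α _)) := by
  have h1 : HasFDerivAt (rotSymm : holSymm α → holSymm α) (fderiv ℝ rotSymm 0) ((0 : ℝ) • p) := by
    rw [zero_smul]
    exact ((contDiff_rotSymm (n := 1)).differentiable one_ne_zero _).hasFDerivAt
  have h2 := h1.comp_hasDerivAt 0 (hasDerivAt_line p)
  have h3 := (holProj α).hasFDerivAt.comp_hasDerivAt (0 : ℝ)
    (hasDerivAt_rotDefect (p : HolderAlg α closedDisc))
  exact h2.unique h3

theorem fderiv_velSymm_inr (f : HolderAlg α closedDisc) (p : holSymm α) :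
    fderiv ℝ (velSymm : _ → holSymm α) (f, 0) (0, p) =
      holProj α (velLin f (p : HolderAlg α _)) := by
  have h1 : HasFDerivAt (velSymm : _ → holSymm α) (fderiv ℝ velSymm (f, 0)) (f, (0 : ℝ) • p) := by
    rw [zero_smul]
    exact ((contDiffAt_velSymm_zero (n := 1) f).differentiableAt one_ne_zero).hasFDerivAt
  have h2 := h1.comp_hasDerivAt 0 ((hasDerivAt_const (0 : ℝ) f).prodMk (hasDerivAt_line p))
  have h3 := (holProj α).hasFDerivAt.comp_hasDerivAt (0 : ℝ)
    (hasDerivAt_velDefect f (p : HolderAlg α closedDisc))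
  exact h2.unique h3

/-- At `p = 0` the regular part of the Cauchy integral vanishes and the defect is linear in the
density. -/
theorem fderiv_velSymm_inl (f h : HolderAlg α closedDisc) :
    fderiv ℝ (velSymm : _ → holSymm α) (f, 0) (h, 0) =
      holProj α ((2⁻¹ : ℝ) • bergman (conj idDisc * h)) := by
  have h1 : HasFDerivAt (velSymm : _ → holSymm α) (fderiv ℝ velSymm (f, 0))
      (f + (0 : ℝ) • h, 0) := by
    rw [zero_smul, add_zero]
    exact ((contDiffAt_velSymm_zero (n := 1) f).differentiableAt one_ne_zero).hasFDerivAt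
  have h2 := h1.comp_hasDerivAt 0
    (((hasDerivAt_line h).const_add f).prodMk (hasDerivAt_const (0 : ℝ) (0 : holSymm α)))
  have e : (velSymm : _ → holSymm α) ∘ (fun t : ℝ => (f + t • h, (0 : holSymm α))) =
      fun t : ℝ => holProj α ((2⁻¹ : ℝ) • bergman (conj idDisc * f)) +
        t • holProj α ((2⁻¹ : ℝ) • bergman (conj idDisc * h)) := by
    funext t
    change holProj α (velDefect (f + t • h) 0) = _
    have e' : (2⁻¹ : ℝ) • bergman (conj idDisc * (f + t • h)) = (2⁻¹ : ℝ) •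
        bergman (conj idDisc * f) + t • ((2⁻¹ : ℝ) • bergman (conj idDisc * h)) := by
      rw [mul_add, mul_smul_comm, map_add, map_smul, smul_add, smul_comm]
    rw [velDefect_zero, e', map_add, map_smul (holProj α) t]
  rw [e] at h2
  exact h2.unique ((hasDerivAt_line _).const_add _)

theorem moment_linearization {f : HolderAlg α closedDisc}
    (hf : ∀ y : ℂ, extd f y = extd f (‖y‖ : ℂ)) {c : ℝ} {m : ℕ → ℝ}
    (hc : ∫ s in (0 : ℝ)..1, (s : ℂ) * extd f s = c)
    (hm : ∀ k : ℕ, ∫ s in (0 : ℝ)..1, (s : ℂ) ^ (2 * (k + 1) + 1) * extd f s = m k)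
    (Ω : ℝ) (p : holSymm α) (k : ℕ) :
    moment k ((Ω • fderiv ℝ rotSymm 0 p + fderiv ℝ velSymm (f, 0) (0, p) : holSymm α) :
      HolderAlg α closedDisc) =
      (((k + 1) / (k + 2) * (Ω - c) + m k : ℝ) : ℂ) * moment k (p : HolderAlg α closedDisc) := by
  rw [fderiv_rotSymm, fderiv_velSymm_inr, Submodule.coe_add, Submodule.coe_smul, map_add, map_smul,
    moment_holProj, moment_holProj, moment_rotLin k p.2, moment_velLin hf hc k p.2, hm]
  have h1 : ((k : ℂ) + 1) / (k + 2) * moment k (p : HolderAlg α closedDisc) =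
      (((k + 1) / (k + 2) * (moment k (p : HolderAlg α closedDisc)).re : ℝ) : ℂ) := by
    push_cast
    rw [coe_re_moment k p.2]
  have h2 : ((m k : ℂ) - c * ((k + 1) / (k + 2))) * moment k (p : HolderAlg α closedDisc) =
      (((m k - c * ((k + 1) / (k + 2))) * (moment k (p : HolderAlg α closedDisc)).re : ℝ) : ℂ) := by
    push_cast
    rw [coe_re_moment k p.2]
  rw [h1, h2, Complex.ofReal_re, Complex.ofReal_re, Complex.real_smul]
  nth_rewrite 3 [← coe_re_moment k p.2]
  push_cast
  ring

theorem ext_holSymm_of_moment {p q : holSymm α} (h : ∀ n, moment n (p : HolderAlg α closedDisc) =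
    moment n (q : HolderAlg α closedDisc)) : p = q :=
  Subtype.ext (ext_of_moment p.2.1 q.2.1 h)

variable (α) in
/-- Uniformly bounded Fourier multipliers that invert the symbols
`(k + 1) / (k + 2) * (Ω - c) + m k`. -/
theorem exists_symbol_inverse {c M d : ℝ} (hM : 0 ≤ M) (hd : 0 < d) {m : ℕ → ℝ}
    (hm : ∀ k : ℕ, |m k| ≤ M / (k + 1)) {I : Set ℝ}
    (hI : ∀ Ω ∈ I, d * (1 + |Ω|) ≤ |Ω - c| ∧
      ∀ k : ℕ, d * (1 + |Ω|) ≤ |(k + 1) / (k + 2) * (Ω - c) + m k|) :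
    ∃ K : ℝ, ∀ Ω ∈ I, ∃ R : holSymm α →L[ℝ] holSymm α, ‖R‖ * (1 + |Ω|) ≤ K ∧
      ∀ (p : holSymm α) (k : ℕ), moment k (R p : HolderAlg α closedDisc) =
        ((((k + 1) / (k + 2) * (Ω - c) + m k)⁻¹ : ℝ) : ℂ) *
          moment k (p : HolderAlg α closedDisc) := by
  obtain ⟨C, hC0, hC⟩ := exists_multiplier (α := α)
  refine ⟨d⁻¹ + C * (d⁻¹ + M / d ^ 2), fun Ω hΩ => ?_⟩
  obtain ⟨h1, h2⟩ := hI Ω hΩ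
  have hw : 0 < 1 + |Ω| := by positivity
  have hw1 : 1 ≤ 1 + |Ω| := by linarith [abs_nonneg Ω]
  set w := 1 + |Ω| with hwdef
  have hdw : 0 < d * w := by positivity
  have hx0 : Ω - c ≠ 0 := abs_pos.1 (hdw.trans_le h1)
  set B := (d⁻¹ + M / d ^ 2) / w with hB
  -- The symbol tends to `Ω - c` at rate `1 / (k + 1)`. Once the scalar inverse of this limit is
  -- removed, what is left decays enough to be a multiplier.
  set b : ℕ → ℝ := fun k => ((k + 1) / (k + 2) * (Ω - c) + m k)⁻¹ - (Ω - c)⁻¹ with hb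
  have hbB : ∀ k : ℕ, |b k| ≤ B / (k + 1) := by
    intro k
    have hk : (0 : ℝ) < k + 1 := by positivity
    have hk2 : (0 : ℝ) < k + 2 := by positivity
    have h3 := h2 k
    have hl0 : (k + 1) / (k + 2) * (Ω - c) + m k ≠ 0 := abs_pos.1 (hdw.trans_le h3)
    have e : b k = (k + 2 : ℝ)⁻¹ * ((k + 1) / (k + 2) * (Ω - c) + m k)⁻¹ -
        m k * ((k + 1) / (k + 2) * (Ω - c) + m k)⁻¹ * (Ω - c)⁻¹ := by
      rw [hb]
      set l := (k + 1) / (k + 2) * (Ω - c) + m k with hl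
      have : m k = l - (k + 1) / (k + 2) * (Ω - c) := by rw [hl]; ring
      simp only
      rw [this]
      field_simp
      ring
    set l := (k + 1) / (k + 2) * (Ω - c) + m k
    have i1 : |l⁻¹| ≤ (d * w)⁻¹ := by rw [abs_inv]; exact inv_anti₀ hdw h3
    have i2 : |(Ω - c)⁻¹| ≤ (d * w)⁻¹ := by rw [abs_inv]; exact inv_anti₀ hdw h1
    rw [e]
    calc _ ≤ |(k + 2 : ℝ)⁻¹ * l⁻¹| + |m k * l⁻¹ * (Ω - c)⁻¹| := abs_sub _ _
      _ ≤ (k + 1 : ℝ)⁻¹ * (d * w)⁻¹ + M / (k + 1) * (d * w)⁻¹ * (d * 1)⁻¹ := by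
          rw [abs_mul, abs_mul, abs_mul, abs_inv (k + 2 : ℝ), abs_of_pos hk2]
          have i3 : (d * w)⁻¹ ≤ (d * 1)⁻¹ := by
            apply inv_anti₀ (by positivity)
            exact mul_le_mul_of_nonneg_left hw1 hd.le
          have i4 : (k + 2 : ℝ)⁻¹ ≤ (k + 1 : ℝ)⁻¹ := inv_anti₀ hk (by linarith)
          have i5 := hm k
          have i6 := i2.trans i3
          gcongr
      _ = B / (k + 1) := by
          rw [hB]
          field_simp
  obtain ⟨T, hT, hTm⟩ := hC b B hbB
  refine ⟨(Ω - c)⁻¹ • ContinuousLinearMap.id ℝ _ + T, ?_, fun p k => ?_⟩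
  · have h3 : ‖(Ω - c)⁻¹ • ContinuousLinearMap.id ℝ (holSymm α) + T‖ ≤ (d * w)⁻¹ + C * B := by
      have hCB : 0 ≤ C * B := (ContinuousLinearMap.opNorm_nonneg T).trans hT
      refine ContinuousLinearMap.opNorm_le_bound _ (by positivity) fun p => ?_
      change ‖(Ω - c)⁻¹ • p + T p‖ ≤ _
      rw [add_mul]
      refine (norm_add_le _ _).trans (add_le_add ?_ (T.le_of_opNorm_le hT p))
      rw [norm_smul, Real.norm_eq_abs, abs_inv]
      exact mul_le_mul_of_nonneg_right (inv_anti₀ hdw h1) (norm_nonneg _)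
    calc _ ≤ ((d * w)⁻¹ + C * B) * w := mul_le_mul_of_nonneg_right h3 hw.le
      _ = _ := by
          rw [hB]
          field_simp
  · change moment k (((Ω - c)⁻¹ • p + T p : holSymm α) : HolderAlg α closedDisc) = _
    rw [Submodule.coe_add, Submodule.coe_smul, map_add, map_smul, hTm, hb, Complex.real_smul]
    push_cast
    ring

end Linearization

end HolderAlg

/-- A point set stays, relatively, away from a compact set that is disjoint from its closure. -/
theorem exists_mul_le_abs_sub {S I : Set ℝ} (hS : IsCompact S) (hI : closure I ⊆ Sᶜ) :
    ∃ d : ℝ, 0 < d ∧ ∀ Ω ∈ I, ∀ s ∈ S, d * (1 + |Ω|) ≤ |Ω - s| := by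
  obtain ⟨r, hr, h⟩ := Metric.exists_pos_forall_lt_edist hS isClosed_closure
    (disjoint_left.2 fun x hx hx' => hI hx' hx)
  obtain ⟨M, hM⟩ := hS.isBounded.exists_norm_le
  have hr' : (0 : ℝ) < r := hr
  -- From `|Ω| ≤ |Ω - s| + |M|` and `r ≤ |Ω - s|` one gets `1 + |Ω| ≤ ((1 + |M|) / r + 1) |Ω - s|`;
  -- the weight matters far from the origin.
  refine ⟨((1 + |M|) / r + 1)⁻¹, by positivity, fun Ω hΩ s hs => ?_⟩
  have h1 : (r : ℝ) ≤ |Ω - s| := by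
    have := h s hs Ω (subset_closure hΩ)
    rw [edist_nndist, ENNReal.coe_lt_coe, ← NNReal.coe_lt_coe, coe_nndist, dist_comm,
      Real.dist_eq] at this
    exact this.le
  have h2 : |Ω| ≤ |Ω - s| + |M| := by
    have h3 := hM s hs
    rw [Real.norm_eq_abs] at h3
    have h4 := abs_add_le (Ω - s) s
    rw [sub_add_cancel] at h4
    linarith [le_abs_self M]
  rw [inv_mul_le_iff₀ (by positivity), add_mul, one_mul]
  have h5 : 1 + |M| ≤ (1 + |M|) / r * |Ω - s| := by
    rw [div_mul_eq_mul_div, le_div_iff₀ hr']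
    exact mul_le_mul_of_nonneg_left h1 (by positivity)
  linarith

/-! ### Passage between the spaces `C^{k,α}` and the Hölder algebra -/

namespace HolderSpace

variable {k : ℕ} {α : ℝ≥0} {E : Type*} [NormedAddCommGroup E] [NormedSpace ℝ E]

theorem norm_iterDeriv_le {j : ℕ} (hj : j ≤ k) (f : HolderSpace k α E) (z : closedDisc) :
    ‖iterDeriv j f z‖ ≤ ‖f‖ := by
  have h1 := le_ciSup (f.bddAbove_iterDeriv hj) z
  have h2 : (⨆ z : closedDisc, ‖iterDeriv j f z‖) ≤
      ∑ j ∈ Finset.range (k + 1), ⨆ z : closedDisc, ‖iterDeriv j f z‖ :=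
    Finset.single_le_sum (f := fun j => ⨆ z : closedDisc, ‖iterDeriv j f z‖)
      (fun j _ => Real.iSup_nonneg fun _ => norm_nonneg _) (Finset.mem_range.2 (by omega))
  rw [norm_def]
  linarith [NNReal.coe_nonneg (nnHolderNorm α (iterDeriv k f))]

theorem norm_iterDeriv_sub_le (f : HolderSpace k α E) (z w : closedDisc) :
    ‖iterDeriv k f z - iterDeriv k f w‖ ≤ ‖f‖ * dist z w ^ (α : ℝ) := by
  have h1 := f.memHolder.holderWith.dist_le z w
  rw [dist_eq_norm] at h1
  refine h1.trans (mul_le_mul_of_nonneg_right ?_ (by positivity))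
  rw [norm_def]
  exact le_add_of_nonneg_left (Finset.sum_nonneg fun j _ => Real.iSup_nonneg fun _ => norm_nonneg _)

theorem norm_sub_le_of_one (f : HolderSpace 1 α E) (z w : closedDisc) :
    ‖f z - f w‖ ≤ ‖f‖ * dist z w := by
  rw [Subtype.dist_eq, dist_eq_norm]
  refine (convex_closedBall (0 : ℂ) 1).norm_image_sub_le_of_norm_fderivWithin_le (𝕜 := ℝ)
    (f.contDiffOn.differentiableOn (by norm_num)) (fun x hx => ?_) w.2 z.2
  rw [← norm_iteratedFDerivWithin_one _ (uniqueDiffOn_closedDisc x hx)]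
  exact f.norm_iterDeriv_le le_rfl ⟨x, hx⟩

end HolderSpace

theorem dist_le_two_mul_rpow {α : ℝ≥0} (hα : α < 1) (z w : closedDisc) :
    dist z w ≤ 2 * dist z w ^ (α : ℝ) := by
  have hα' : (α : ℝ) < 1 := hα
  have hd : dist z w ≤ 2 := by
    rw [Subtype.dist_eq, dist_eq_norm]
    exact (norm_sub_le _ _).trans (by linarith [norm_coe_le z, norm_coe_le w])
  calc dist z w = dist z w ^ (1 - (α : ℝ)) * dist z w ^ (α : ℝ) := by
        rw [← Real.rpow_add_of_nonneg dist_nonneg (by linarith) α.coe_nonneg, sub_add_cancel,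
          Real.rpow_one]
    _ ≤ 2 ^ (1 - (α : ℝ)) * dist z w ^ (α : ℝ) := by
        refine mul_le_mul_of_nonneg_right ?_ (by positivity)
        exact Real.rpow_le_rpow dist_nonneg hd (by linarith)
    _ ≤ 2 ^ (1 : ℝ) * dist z w ^ (α : ℝ) := by
        refine mul_le_mul_of_nonneg_right ?_ (by positivity)
        exact Real.rpow_le_rpow_of_exponent_le one_le_two (by linarith [α.coe_nonneg])
    _ = _ := by rw [Real.rpow_one]

namespace HolderAlg

variable {α : ℝ≥0} [Fact (0 < α)] [Fact (α < 1)]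

/-- The inclusion of the real functions of class `C^{1,α}` into the Hölder functions. -/
def ofHolderSpace : HolderSpace 1 α ℝ →L[ℝ] HolderAlg α closedDisc :=
  LinearMap.mkContinuous
    { toFun := fun f => ⟨fun z => (f z : ℂ), 2 * ‖f‖, fun z => by
          rw [Complex.norm_real]
          linarith [f.norm_apply_le z, norm_nonneg f], fun z w => by
          rw [← Complex.ofReal_sub, Complex.norm_real, mul_comm 2, mul_assoc]
          exact (f.norm_sub_le_of_one z w).trans (mul_le_mul_of_nonneg_left
            (dist_le_two_mul_rpow Fact.out z w) (norm_nonneg f))⟩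
      map_add' := fun f g => ext_fun fun z => Complex.ofReal_add _ _
      map_smul' := fun c f => ext_fun fun z => by
        change ((c * f z : ℝ) : ℂ) = c • (f z : ℂ)
        rw [Complex.real_smul, Complex.ofReal_mul] }
    3 fun f => by
      rw [show (3 : ℝ) * ‖f‖ = ‖f‖ + 2 * ‖f‖ by ring]
      refine norm_le (norm_nonneg _) (by positivity) (fun z => ?_) fun z w => ?_
      · change ‖((f z : ℝ) : ℂ)‖ ≤ _
        rw [Complex.norm_real]
        exact f.norm_apply_le z
      · change ‖((f z : ℝ) : ℂ) - ((f w : ℝ) : ℂ)‖ ≤ _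
        rw [← Complex.ofReal_sub, Complex.norm_real, mul_comm 2, mul_assoc]
        exact (f.norm_sub_le_of_one z w).trans (mul_le_mul_of_nonneg_left
            (dist_le_two_mul_rpow Fact.out z w) (norm_nonneg f))

theorem extd_ofHolderSpace (f : HolderSpace 1 α ℝ) {z : ℂ} (hz : ‖z‖ ≤ 1) :
    extd (ofHolderSpace f) z = (f z : ℂ) := by
  rw [extd_of_le _ hz]
  rfl

theorem extd_ofHolderSpace_norm {f : HolderSpace 1 α ℝ}
    (hf : ∀ z w : ℂ, ‖z‖ = ‖w‖ → f z = f w) (z : ℂ) :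
    extd (ofHolderSpace f) z = extd (ofHolderSpace f) (‖z‖ : ℂ) := by
  change ((f (discProj z : ℂ) : ℝ) : ℂ) = ((f (discProj (‖z‖ : ℂ) : ℂ) : ℝ) : ℂ)
  rw [hf]
  simp [discProj]

theorem reflectDisc_ofHolderSpace {f : HolderSpace 1 α ℝ}
    (hf : ∀ z : ℂ, ‖z‖ < 1 → f (starRingEnd ℂ z) = f z) :
    reflectDisc (ofHolderSpace f) = ofHolderSpace f := by
  refine ext_of_ball fun z hz => ?_
  have hz' := mem_ball_zero_iff.1 hz
  rw [extd_reflectDisc, extd_ofHolderSpace f (by rw [RCLike.norm_conj]; exact hz'.le),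
    extd_ofHolderSpace f hz'.le, Complex.conj_ofReal, hf z hz']

end HolderAlg

theorem HasCosineExpansion.apply_conj {g : ℂ → ℝ} {c : ℕ → ℝ → ℝ} (h : HasCosineExpansion g c)
    {z : ℂ} (hz : ‖z‖ < 1) : g (starRingEnd ℂ z) = g z := by
  have h1 := h ‖z‖ ⟨norm_nonneg z, hz⟩ z.arg
  have h2 := h ‖z‖ ⟨norm_nonneg z, hz⟩ (-z.arg)
  simp only [mul_neg, Real.cos_neg] at h2
  rw [Complex.norm_mul_exp_arg_mul_I] at h1
  have e : (‖z‖ : ℂ) * Complex.exp ((-z.arg : ℝ) * Complex.I) = starRingEnd ℂ z := by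
    conv_rhs => rw [← Complex.norm_mul_exp_arg_mul_I z]
    rw [map_mul, Complex.conj_ofReal, ← Complex.exp_conj, map_mul, Complex.conj_ofReal,
      Complex.conj_I]
    push_cast
    ring_nf
  rw [e] at h2
  exact h2.unique h1

theorem hasFDerivWithinAt_mul_of_hasDerivWithinAt {f : ℂ → ℂ} {f' z : ℂ} {s : Set ℂ}
    (h : HasDerivWithinAt f f' s z) :
    HasFDerivWithinAt f (ContinuousLinearMap.mul ℝ ℂ f') s z := by
  refine (h.hasFDerivWithinAt.restrictScalars ℝ).congr_fderiv ?_
  ext w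
  simp [mul_comm]

theorem fderivWithin_eq_mul {f : ℂ → ℂ} {f' z : ℂ} {s : Set ℂ} (hs : UniqueDiffWithinAt ℝ s z)
    (h : HasDerivWithinAt f f' s z) :
    fderivWithin ℝ f s z = ContinuousLinearMap.mul ℝ ℂ f' :=
  (hasFDerivWithinAt_mul_of_hasDerivWithinAt h).fderivWithin hs

/-- The real second derivative is multiplication by the complex one, so its size and its Hölder
seminorm are those of the complex second derivative. This compares the norm of `C^{2,α}` with that
of `HolderAlg`. -/
theorem iteratedFDerivWithin_two_eq_mul {f f' f'' : ℂ → ℂ} {s : Set ℂ} (hs : UniqueDiffOn ℝ s)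
    (h : ∀ z ∈ s, HasDerivWithinAt f (f' z) s z) (h' : ∀ z ∈ s, HasDerivWithinAt f' (f'' z) s z)
    {z : ℂ} (hz : z ∈ s) (m : Fin 2 → ℂ) :
    iteratedFDerivWithin ℝ 2 f s z m = f'' z * m 0 * m 1 := by
  have h1 : HasFDerivWithinAt (fderivWithin ℝ f s) ((ContinuousLinearMap.mul ℝ ℂ).comp
      (ContinuousLinearMap.mul ℝ ℂ (f'' z))) s z := by
    refine ((ContinuousLinearMap.mul ℝ ℂ).hasFDerivAt.comp_hasFDerivWithinAt z
      (hasFDerivWithinAt_mul_of_hasDerivWithinAt (h' z hz))).congr (fun w hw => ?_) ?_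
    · exact fderivWithin_eq_mul (hs w hw) (h w hw)
    · exact fderivWithin_eq_mul (hs z hz) (h z hz)
  rw [iteratedFDerivWithin_two_apply f hs hz, h1.fderivWithin (hs z hz)]
  simp

namespace HolderAlg

variable {α : ℝ≥0} [Fact (0 < α)] [Fact (α < 1)]

theorem norm_iterDeriv_two_one_le (f : HolderSpace 2 α ℂ) (z : closedDisc) :
    ‖HolderSpace.iterDeriv 2 f z ![1, 1]‖ ≤ ‖f‖ :=
  (by simpa [Fin.prod_univ_two] using (HolderSpace.iterDeriv 2 f z).le_opNorm ![1, 1] :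
    _ ≤ ‖HolderSpace.iterDeriv 2 f z‖).trans (f.norm_iterDeriv_le le_rfl z)

theorem norm_iterDeriv_two_one_sub_le (f : HolderSpace 2 α ℂ) (z w : closedDisc) :
    ‖HolderSpace.iterDeriv 2 f z ![1, 1] - HolderSpace.iterDeriv 2 f w ![1, 1]‖ ≤
      ‖f‖ * dist z w ^ (α : ℝ) := by
  have h := (HolderSpace.iterDeriv 2 f z - HolderSpace.iterDeriv 2 f w).le_opNorm ![1, 1]
  refine le_trans ?_ (f.norm_iterDeriv_sub_le z w)
  simpa [Fin.prod_univ_two] using h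

/-- The second derivative in the direction of the real axis. -/
def secondDeriv : HolderSpace 2 α ℂ →ₗ[ℝ] HolderAlg α closedDisc where
  toFun f := ⟨fun z => HolderSpace.iterDeriv 2 f z ![1, 1], ‖f‖, norm_iterDeriv_two_one_le f,
    norm_iterDeriv_two_one_sub_le f⟩
  map_add' f g := ext_fun fun z => by
    change HolderSpace.iterDeriv 2 (f + g : HolderSpace 2 α ℂ) z ![1, 1] = _
    rw [HolderSpace.iterDeriv_add le_rfl]
    rfl
  map_smul' c f := ext_fun fun z => by
    change HolderSpace.iterDeriv 2 (c • f : HolderSpace 2 α ℂ) z ![1, 1] = _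
    rw [HolderSpace.iterDeriv_smul le_rfl]
    rfl

theorem secondDeriv_apply (f : HolderSpace 2 α ℂ) (z : closedDisc) :
    secondDeriv f z = HolderSpace.iterDeriv 2 f z ![1, 1] := rfl

theorem norm_secondDeriv_le (f : HolderSpace 2 α ℂ) : ‖secondDeriv f‖ ≤ 2 * ‖f‖ :=
  by
  rw [two_mul]
  exact norm_le (norm_nonneg _) (norm_nonneg _) (norm_iterDeriv_two_one_le f)
    (norm_iterDeriv_two_one_sub_le f)

theorem extd_secondDeriv {f : HolderSpace 2 α ℂ} (hf : DifferentiableOn ℂ f (Metric.ball 0 1))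
    {z : ℂ} (hz : ‖z‖ < 1) : extd (secondDeriv f) z = deriv (deriv f) z := by
  have hd := Metric.isOpen_ball (x := (0 : ℂ)) (ε := 1)
  have hz' := mem_ball_zero_iff.2 hz
  rw [extd_of_le _ hz.le, secondDeriv_apply]
  change iteratedFDerivWithin ℝ 2 f closedDisc z ![1, 1] = _
  have e : (closedDisc : Set ℂ) =ᶠ[𝓝 z] Metric.ball (0 : ℂ) 1 := by
    filter_upwards [hd.mem_nhds hz'] with w hw
    exact propext ⟨fun _ => hw, fun _ => Metric.ball_subset_closedBall hw⟩
  rw [iteratedFDerivWithin_congr_set e, iteratedFDerivWithin_two_eq_mul (f' := deriv f)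
    (f'' := deriv (deriv f)) hd.uniqueDiffOn (fun w hw => ?_) (fun w hw => ?_) hz']
  · simp
  · exact (hf.differentiableAt (hd.mem_nhds hw)).hasDerivAt.hasDerivWithinAt
  · exact ((hf.deriv hd).differentiableAt (hd.mem_nhds hw)).hasDerivAt.hasDerivWithinAt

theorem differentiableOn_secondDeriv {f : HolderSpace 2 α ℂ}
    (hf : DifferentiableOn ℂ f (Metric.ball 0 1)) :
    DifferentiableOn ℂ (extd (secondDeriv f)) (Metric.ball 0 1) :=
  ((hf.deriv Metric.isOpen_ball).deriv Metric.isOpen_ball).congr fun _ hz =>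
    extd_secondDeriv hf (mem_ball_zero_iff.1 hz)

theorem conj_comp_comp_conj (φ : holHolder 2 α) :
    starRingEnd ℂ ∘ φ.1 ∘ starRingEnd ℂ = φ.1 := by
  funext z
  change starRingEnd ℂ (φ.1 (starRingEnd ℂ z)) = φ.1 z
  by_cases hz : z ∈ closedDisc
  · rw [← φ.2.2.2.2 z hz, Complex.conj_conj]
  · have hz' : starRingEnd ℂ z ∉ closedDisc := by
      rwa [mem_closedBall_zero_iff, RCLike.norm_conj, ← mem_closedBall_zero_iff]
    rw [φ.1.2.2.2 z hz, φ.1.2.2.2 _ hz', map_zero]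

theorem secondDeriv_mem_holSymm (φ : holHolder 2 α) : secondDeriv φ.1 ∈ holSymm α := by
  refine ⟨differentiableOn_secondDeriv φ.2.1, ext_of_ball fun z hz => ?_⟩
  have hz' := mem_ball_zero_iff.1 hz
  rw [extd_reflectDisc, extd_secondDeriv φ.2.1 hz', extd_secondDeriv φ.2.1
    (by rwa [RCLike.norm_conj])]
  conv_rhs => rw [← conj_comp_comp_conj φ, deriv_conj_conj, deriv_conj_conj]
  rfl

/-- The conditions `φ(0) = 0` and `φ'(0) = 0` fix the two constants of integration; equality in the
open disc extends to the boundary by continuity. -/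
theorem extd_prim_prim_secondDeriv (φ : holHolder 2 α) {z : ℂ} (hz : ‖z‖ ≤ 1) :
    extd (prim (prim (secondDeriv φ.1))) z = φ.1 z := by
  set p := secondDeriv φ.1 with hp
  have hp1 := differentiableOn_secondDeriv φ.2.1
  have hd := Metric.isOpen_ball (x := (0 : ℂ)) (ε := 1)
  have hc := (convex_ball (0 : ℂ) 1).isPreconnected
  have h0 : (0 : ℂ) ∈ Metric.ball (0 : ℂ) 1 := Metric.mem_ball_self one_pos
  have h1 : EqOn (extd (prim p)) (deriv φ.1) (Metric.ball 0 1) := by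
    refine hd.eqOn_of_deriv_eq hc (differentiableOn_prim hp1) (φ.2.1.deriv hd) (fun w hw => ?_) h0
      ?_
    · have hw' := mem_ball_zero_iff.1 hw
      rw [(hasDerivAt_prim hp1 hw').deriv]
      exact extd_secondDeriv φ.2.1 hw'
    · rw [extd_prim_zero, φ.2.2.2.1]
  have h2 : EqOn (extd (prim (prim p))) φ.1 (Metric.ball 0 1) := by
    refine hd.eqOn_of_deriv_eq hc (differentiableOn_prim (differentiableOn_prim hp1)) φ.2.1
      (fun w hw => ?_) h0 ?_
    · rw [(hasDerivAt_prim (differentiableOn_prim hp1) (mem_ball_zero_iff.1 hw)).deriv, h1 hw]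
    · rw [extd_prim_zero, φ.2.2.1]
  have h3 : EqOn (extd (prim (prim p))) φ.1 closedDisc := by
    refine h2.of_subset_closure (continuous_extd _).continuousOn φ.1.contDiffOn.continuousOn
      Metric.ball_subset_closedBall ?_
    rw [closure_ball _ one_ne_zero]
  exact h3 (mem_closedBall_zero_iff.2 hz)

/-- The double primitive, extended by zero outside of the closed disc. -/
def doublePrim (p : HolderAlg α closedDisc) : ℂ → ℂ :=
  closedDisc.indicator (extd (prim (prim p)))

theorem doublePrim_of_le (p : HolderAlg α closedDisc) {z : ℂ} (hz : ‖z‖ ≤ 1) :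
    doublePrim p z = extd (prim (prim p)) z :=
  indicator_of_mem (mem_closedBall_zero_iff.2 hz) _

theorem doublePrim_eventuallyEq (p : HolderAlg α closedDisc) {z : ℂ} (hz : ‖z‖ < 1) :
    doublePrim p =ᶠ[𝓝 z] extd (prim (prim p)) := by
  filter_upwards [Metric.isOpen_ball.mem_nhds (mem_ball_zero_iff.2 hz)] with w hw
  exact doublePrim_of_le p (mem_ball_zero_iff.1 hw).le

theorem hasDerivWithinAt_doublePrim {p : HolderAlg α closedDisc}
    (hp : DifferentiableOn ℂ (extd p) (Metric.ball 0 1)) {z : ℂ} (hz : z ∈ closedDisc) :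
    HasDerivWithinAt (doublePrim p) (extd (prim p) z) closedDisc z :=
  (hasDerivWithinAt_prim (differentiableOn_prim hp) (mem_closedBall_zero_iff.1 hz)).congr
    (fun _ hw => doublePrim_of_le p (mem_closedBall_zero_iff.1 hw))
    (doublePrim_of_le p (mem_closedBall_zero_iff.1 hz))

theorem iteratedFDerivWithin_two_doublePrim {p : HolderAlg α closedDisc}
    (hp : DifferentiableOn ℂ (extd p) (Metric.ball 0 1)) (z : closedDisc) (m : Fin 2 → ℂ) :
    HolderSpace.iterDeriv 2 (doublePrim p) z m = p z * m 0 * m 1 := by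
  rw [HolderSpace.iterDeriv, iteratedFDerivWithin_two_eq_mul uniqueDiffOn_closedDisc
    (fun w hw => hasDerivWithinAt_doublePrim hp hw)
    (fun w hw => hasDerivWithinAt_prim hp (mem_closedBall_zero_iff.1 hw)) z.2, extd_coe]

theorem contDiffOn_doublePrim {p : HolderAlg α closedDisc}
    (hp : DifferentiableOn ℂ (extd p) (Metric.ball 0 1)) :
    ContDiffOn ℝ (2 : ℕ) (doublePrim p) closedDisc := by
  have key : ∀ {n : ℕ} {f f' : ℂ → ℂ}, (∀ z ∈ closedDisc, HasDerivWithinAt f (f' z) closedDisc z) →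
      ContDiffOn ℝ n f' closedDisc → ContDiffOn ℝ (n + 1 : ℕ) f closedDisc := by
    intro n f f' h h'
    refine contDiffOn_succ_of_fderivWithin
      (fun z hz => (hasFDerivWithinAt_mul_of_hasDerivWithinAt (h z hz)).differentiableWithinAt)
      (by simp) (((ContinuousLinearMap.mul ℝ ℂ).contDiff.comp_contDiffOn h').congr fun z hz => ?_)
    exact fderivWithin_eq_mul (uniqueDiffOn_closedDisc z hz) (h z hz)
  refine key (n := 1) (fun z hz => hasDerivWithinAt_doublePrim hp hz) ?_
  refine key (n := 0) (fun z hz => hasDerivWithinAt_prim hp (mem_closedBall_zero_iff.1 hz)) ?_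
  exact contDiffOn_zero.2 (continuous_extd p).continuousOn

theorem norm_iterDeriv_two_doublePrim_sub_le {p : HolderAlg α closedDisc}
    (hp : DifferentiableOn ℂ (extd p) (Metric.ball 0 1)) (z w : closedDisc) :
    ‖HolderSpace.iterDeriv 2 (doublePrim p) z - HolderSpace.iterDeriv 2 (doublePrim p) w‖ ≤
      ‖p‖ * dist z w ^ (α : ℝ) := by
  refine (ContinuousMultilinearMap.opNorm_le_bound (by positivity) fun m => ?_).trans
    (p.norm_sub_le z w)
  rw [_root_.sub_apply, iteratedFDerivWithin_two_doublePrim hp,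
    iteratedFDerivWithin_two_doublePrim hp, ← sub_mul, ← sub_mul, norm_mul, norm_mul,
    Fin.prod_univ_two, mul_assoc]

theorem holderWith_doublePrim {p : HolderAlg α closedDisc}
    (hp : DifferentiableOn ℂ (extd p) (Metric.ball 0 1)) :
    HolderWith ‖p‖₊ α (HolderSpace.iterDeriv 2 (doublePrim p)) := by
  intro z w
  have h := norm_iterDeriv_two_doublePrim_sub_le hp z w
  rw [← dist_eq_norm, ← coe_nndist, ← coe_nndist, ← coe_nnnorm] at h
  rw [edist_nndist, edist_nndist, ← ENNReal.coe_rpow_of_nonneg _ α.coe_nonneg, ← ENNReal.coe_mul,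
    ENNReal.coe_le_coe]
  exact_mod_cast h

theorem norm_iterDeriv_doublePrim_le {p : HolderAlg α closedDisc}
    (hp : DifferentiableOn ℂ (extd p) (Metric.ball 0 1)) {j : ℕ} (hj : j < 3) (z : closedDisc) :
    ‖HolderSpace.iterDeriv j (doublePrim p) z‖ ≤ ‖p‖ := by
  have h1 := norm_prim_le p
  have h2 := norm_prim_le (prim p)
  have h3 := p.supNorm_le_norm
  interval_cases j
  · rw [HolderSpace.iterDeriv, norm_iteratedFDerivWithin_zero, doublePrim_of_le p (norm_coe_le z),
      extd_coe]
    exact ((norm_apply_le_supNorm _ z).trans h2).trans (h1.trans h3)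
  · rw [HolderSpace.iterDeriv, norm_iteratedFDerivWithin_one _ (uniqueDiffOn_closedDisc z z.2),
      fderivWithin_eq_mul (uniqueDiffOn_closedDisc z z.2) (hasDerivWithinAt_doublePrim hp z.2)]
    refine (ContinuousLinearMap.opNorm_mul_apply_le ℝ ℂ _).trans ?_
    rw [extd_coe]
    exact (norm_apply_le_supNorm _ z).trans (h1.trans h3)
  · refine ContinuousMultilinearMap.opNorm_le_bound (norm_nonneg p) fun m => ?_
    rw [iteratedFDerivWithin_two_doublePrim hp, norm_mul, norm_mul, Fin.prod_univ_two, mul_assoc]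
    exact mul_le_mul_of_nonneg_right (p.norm_apply_le z) (by positivity)

theorem doublePrim_mem_holderSubmodule {p : HolderAlg α closedDisc}
    (hp : DifferentiableOn ℂ (extd p) (Metric.ball 0 1)) :
    doublePrim p ∈ holderSubmodule 2 α ℂ := by
  refine ⟨contDiffOn_doublePrim hp, ?_, fun _ hz => indicator_of_notMem hz _⟩
  have h := (holderWith_doublePrim hp).memHolder
  exact h

/-- The double primitive, as an element of the space `C^{2,α}`. -/
def doublePrimHolder (p : holSymm α) : HolderSpace 2 α ℂ :=
  ⟨doublePrim p, doublePrim_mem_holderSubmodule p.2.1⟩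

/-- Three sup norms, bounded because primitives do not increase the sup norm, and one seminorm. -/
theorem norm_doublePrimHolder_le (p : holSymm α) : ‖doublePrimHolder p‖ ≤ 4 * ‖p‖ := by
  have h1 : (∑ j ∈ Finset.range (2 + 1),
      ⨆ z : closedDisc, ‖HolderSpace.iterDeriv j (doublePrim (p : HolderAlg α closedDisc)) z‖) ≤
      ∑ j ∈ Finset.range (2 + 1), ‖p‖ :=
    Finset.sum_le_sum fun j hj => ciSup_le fun z =>
      norm_iterDeriv_doublePrim_le p.2.1 (Finset.mem_range.1 hj) z
  have h2 : (nnHolderNorm α (HolderSpace.iterDeriv 2 (doublePrim (p : HolderAlg α closedDisc))) : ℝ)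
      ≤ ‖p‖ := by exact_mod_cast (holderWith_doublePrim p.2.1).nnholderNorm_le
  have h3 : ∑ j ∈ Finset.range (2 + 1), ‖p‖ = (2 + 1) * ‖p‖ := by
    rw [Finset.sum_const, Finset.card_range, nsmul_eq_mul]
    norm_num
  rw [h3] at h1
  calc ‖doublePrimHolder p‖ ≤ (2 + 1) * ‖p‖ + ‖p‖ := add_le_add h1 h2
    _ = _ := by ring

theorem doublePrimHolder_mem (p : holSymm α) : doublePrimHolder p ∈ holHolder 2 α := by
  have hp1 := differentiableOn_prim p.2.1
  have hp2 := prim_mem_holSymm (prim_mem_holSymm p.2)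
  refine ⟨?_, ?_, ?_, fun z hz => ?_⟩
  · exact (differentiableOn_prim hp1).congr fun z hz =>
      doublePrim_of_le _ (mem_ball_zero_iff.1 hz).le
  · change doublePrim _ 0 = 0
    rw [doublePrim_of_le _ (by simp), extd_prim_zero]
  · change deriv (doublePrim _) 0 = 0
    rw [(doublePrim_eventuallyEq _ (by simp)).deriv_eq, (hasDerivAt_prim hp1 (by simp)).deriv,
      extd_prim_zero]
  · have hz' := mem_closedBall_zero_iff.1 hz
    change starRingEnd ℂ (doublePrim _ z) = doublePrim _ _
    rw [doublePrim_of_le _ hz', doublePrim_of_le _ (by rwa [RCLike.norm_conj])]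
    conv_rhs => rw [← hp2.2, extd_reflectDisc, Complex.conj_conj]

end HolderAlg

namespace HolderAlg

variable {α : ℝ≥0} [Fact (0 < α)] [Fact (α < 1)]

theorem doublePrimHolder_secondDeriv (φ : holHolder 2 α) :
    doublePrimHolder ⟨secondDeriv φ.1, secondDeriv_mem_holSymm φ⟩ = φ.1 := by
  refine Subtype.ext (funext fun z => ?_)
  change doublePrim (secondDeriv φ.1) z = φ.1 z
  by_cases hz : z ∈ closedDisc
  · have hz' := mem_closedBall_zero_iff.1 hz
    rw [doublePrim_of_le _ hz', extd_prim_prim_secondDeriv φ hz']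
  · rw [φ.1.2.2.2 z hz]
    exact indicator_of_notMem hz _

theorem secondDeriv_doublePrimHolder (p : holSymm α) :
    secondDeriv (doublePrimHolder p) = (p : HolderAlg α closedDisc) := by
  refine ext_fun fun z => ?_
  change HolderSpace.iterDeriv 2 (doublePrim _) z ![1, 1] = _
  rw [iteratedFDerivWithin_two_doublePrim p.2.1]
  simp

/-- The space `holHolder 2 α`, parametrized linearly by the second derivatives. -/
def holLinearEquiv : holHolder 2 α ≃ₗ[ℝ] holSymm α where
  toFun φ := ⟨secondDeriv φ.1, secondDeriv_mem_holSymm φ⟩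
  map_add' φ ψ := Subtype.ext (map_add secondDeriv φ.1 ψ.1)
  map_smul' c φ := Subtype.ext (map_smul secondDeriv c φ.1)
  invFun p := ⟨doublePrimHolder p, doublePrimHolder_mem p⟩
  left_inv φ := Subtype.ext (doublePrimHolder_secondDeriv φ)
  right_inv p := Subtype.ext (secondDeriv_doublePrimHolder p)

theorem norm_holLinearEquiv_le (φ : holHolder 2 α) : ‖holLinearEquiv φ‖ ≤ 2 * ‖φ‖ := by
  rw [Submodule.coe_norm, Submodule.coe_norm]
  exact norm_secondDeriv_le φ.1

theorem norm_holLinearEquiv_symm_le (p : holSymm α) : ‖holLinearEquiv.symm p‖ ≤ 4 * ‖p‖ := by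
  rw [Submodule.coe_norm]
  exact norm_doublePrimHolder_le p

/-- The space `holHolder 2 α`, parametrized by the second derivatives. -/
def holEquiv : holHolder 2 α ≃L[ℝ] holSymm α :=
  holLinearEquiv.toContinuousLinearEquivOfBounds 2 4 norm_holLinearEquiv_le
    norm_holLinearEquiv_symm_le

theorem coe_holEquiv (φ : holHolder 2 α) :
    (holEquiv φ : HolderAlg α closedDisc) = secondDeriv φ.1 := rfl

theorem holEquiv_symm_apply (p : holSymm α) {z : ℂ} (hz : ‖z‖ ≤ 1) :
    (holEquiv.symm p).1 z = extd (prim (prim (p : HolderAlg α closedDisc))) z :=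
  doublePrim_of_le _ hz

/-- Completeness, which the contraction argument needs, is carried over from `holSymm α`. -/
instance : CompleteSpace (holHolder 2 α) :=
  (completeSpace_congr (e := (holEquiv (α := α)).toEquiv) holEquiv.isUniformEmbedding).2 inferInstance

theorem extd_idDisc_add_prim_prim (φ : holHolder 2 α) {z : ℂ} (hz : ‖z‖ ≤ 1) :
    extd (idDisc + prim (prim (holEquiv φ : HolderAlg α closedDisc))) z = z + φ.1 z := by
  rw [extd_add, extd_idDisc hz, coe_holEquiv, extd_prim_prim_secondDeriv φ hz]

theorem discDeriv_id_add (φ : holHolder 2 α) {z : ℂ} (hz : ‖z‖ ≤ 1) :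
    discDeriv (fun z => z + φ.1 z) z =
      extd (1 + prim (holEquiv φ : HolderAlg α closedDisc)) z := by
  have hp := (holEquiv φ).2.1
  have hz' : z ∈ closedDisc := mem_closedBall_zero_iff.2 hz
  have hu : UniqueDiffWithinAt ℂ closedDisc z :=
    (uniqueDiffOn_closedDisc z hz').mono_field
  have h := (hasDerivWithinAt_id z closedDisc).add
    (hasDerivWithinAt_prim (differentiableOn_prim hp) hz)
  have h' : HasDerivWithinAt (fun z => z + φ.1 z)
      (1 + extd (prim (holEquiv φ : HolderAlg α closedDisc)) z) closedDisc z := by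
    refine h.congr_of_mem (fun w hw => ?_) hz'
    change _ = w + extd _ w
    rw [coe_holEquiv, extd_prim_prim_secondDeriv φ (mem_closedBall_zero_iff.1 hw)]
  rw [discDeriv, h'.derivWithin hu, extd_add, extd_one]

end HolderAlg

/-! ### Cosine coefficients and power series up to the circle -/

section CosineCoefficients

theorem integral_exp_int_mul_I {k : ℤ} (hk : k ≠ 0) :
    ∫ θ in (-Real.pi)..Real.pi, Complex.exp (k * Complex.I * θ) = 0 := by
  have hk' : (k : ℂ) * Complex.I ≠ 0 := mul_ne_zero (by exact_mod_cast hk) Complex.I_ne_zero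
  rw [integral_exp_mul_complex hk', div_eq_zero_iff]
  left
  rw [sub_eq_zero, Complex.exp_eq_exp_iff_exists_int]
  exact ⟨k, by push_cast; ring⟩

theorem integral_cos_mul_exp (m : ℕ) {n : ℕ} (hn : 1 ≤ n) :
    ∫ θ in (-Real.pi)..Real.pi, (Real.cos (m * θ) : ℂ) * Complex.exp (-(n * θ) * Complex.I) =
      if m = n then (Real.pi : ℂ) else 0 := by
  have e : ∀ θ : ℝ, (Real.cos (m * θ) : ℂ) * Complex.exp (-(n * θ) * Complex.I) =
      2⁻¹ * Complex.exp (((m : ℤ) - n : ℤ) * Complex.I * θ) +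
        2⁻¹ * Complex.exp ((-(m : ℤ) - n : ℤ) * Complex.I * θ) := by
    intro θ
    rw [Complex.ofReal_cos, Complex.cos, div_mul_eq_mul_div, add_mul, ← Complex.exp_add,
      ← Complex.exp_add]
    push_cast
    ring_nf
  simp_rw [e]
  rw [intervalIntegral.integral_add (Continuous.intervalIntegrable (by fun_prop) _ _)
    (Continuous.intervalIntegrable (by fun_prop) _ _), intervalIntegral.integral_const_mul,
    intervalIntegral.integral_const_mul, integral_exp_int_mul_I (k := -(m : ℤ) - n) (by omega)]
  split_ifs with h
  · subst h
    simp
    ring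
  · rw [integral_exp_int_mul_I (by omega)]
    simp

theorem HasCosineExpansion.integral_mul_exp {g : ℂ → ℝ} {c : ℕ → ℝ → ℝ}
    (h : HasCosineExpansion g c) {r : ℝ} (hr : r ∈ Ico (0 : ℝ) 1) {n : ℕ} (hn : 1 ≤ n) :
    ∫ θ in (-Real.pi)..Real.pi, (g (r * Complex.exp (θ * Complex.I)) : ℂ) *
      Complex.exp (-(n * θ) * Complex.I) = Real.pi * c n r := by
  -- At `θ = 0` every cosine is `1`, and an unconditionally convergent real series converges
  -- absolutely. This dominates the expansion uniformly in `θ`.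
  have hs : Summable fun m => |c m r| := by
    have := (h r hr 0).summable
    simp only [mul_zero, Real.cos_zero, mul_one] at this
    exact this.abs
  have h1 := intervalIntegral.hasSum_integral_of_dominated_convergence (μ := volume)
    (a := -Real.pi) (b := Real.pi)
    (F := fun m θ => (c m r : ℂ) * ((Real.cos (m * θ) : ℂ) * Complex.exp (-(n * θ) * Complex.I)))
    (f := fun θ => (g (r * Complex.exp (θ * Complex.I)) : ℂ) * Complex.exp (-(n * θ) * Complex.I))
    (fun m _ => |c m r|) (fun m => Continuous.aestronglyMeasurable (by fun_prop))
    (fun m => Eventually.of_forall fun θ _ => ?_) (Eventually.of_forall fun _ _ => hs)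
    _root_.intervalIntegrable_const (Eventually.of_forall fun θ _ => ?_)
  · simp_rw [intervalIntegral.integral_const_mul, integral_cos_mul_exp _ hn] at h1
    refine h1.unique ?_
    have h2 := hasSum_ite_eq n ((Real.pi : ℂ) * c n r)
    convert! h2 using 2 with m
    split_ifs with hm
    · rw [hm, mul_comm]
    · rw [mul_zero]
  · have e : ‖Complex.exp (-(n * θ) * Complex.I)‖ = 1 := by
      have := Complex.norm_exp_ofReal_mul_I (-(n * θ))
      push_cast at this
      exact this
    rw [norm_mul, norm_mul, e, mul_one, Complex.norm_real, Complex.norm_real, Real.norm_eq_abs]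
    exact mul_le_of_le_one_right (abs_nonneg _) (Real.abs_cos_le_one _)
  · have h2 := ((Complex.hasSum_ofReal.2 (h r hr θ)).mul_right
      (Complex.exp (-(n * θ) * Complex.I)))
    push_cast at h2 ⊢
    simpa only [mul_assoc] using h2

namespace HolderAlg

variable {α : ℝ≥0} [Fact (0 < α)] [Fact (α < 1)]

theorem integral_ofHolderSpace_mul_conj_pow {h : HolderSpace 1 α ℝ} {c : ℕ → ℝ → ℝ}
    (hc : HasCosineExpansion h c) {n : ℕ} (hn : 1 ≤ n) :
    ∫ y, extd (ofHolderSpace h) y * starRingEnd ℂ y ^ n ∂discArea =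
      ((∫ s in (0 : ℝ)..1, s ^ (n + 1) * c n s : ℝ) : ℂ) := by
  rw [integral_discArea_polar (K := ‖ofHolderSpace h‖) (Continuous.continuousOn (by fun_prop))
    fun y hy => ?_]
  · rw [← intervalIntegral.integral_ofReal, ← intervalIntegral.integral_const_mul]
    refine intervalIntegral.integral_congr_ae ?_
    have h1 : ∀ᵐ s : ℝ, s ≠ 1 := by simp [ae_iff]
    filter_upwards [h1] with s hs1 hs
    rw [uIoc_of_le zero_le_one] at hs
    have hs' : s ∈ Ico (0 : ℝ) 1 := ⟨hs.1.le, lt_of_le_of_ne hs.2 hs1⟩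
    have e : ∀ θ : ℝ, extd (ofHolderSpace h) (s * Complex.exp (θ * Complex.I)) *
        starRingEnd ℂ (s * Complex.exp (θ * Complex.I)) ^ n =
        (s : ℂ) ^ n * ((h (s * Complex.exp (θ * Complex.I)) : ℂ) *
          Complex.exp (-(n * θ) * Complex.I)) := by
      intro θ
      rw [extd_ofHolderSpace h (by
        rw [norm_mul, Complex.norm_exp_ofReal_mul_I, mul_one, Complex.norm_real,
          Real.norm_of_nonneg hs'.1]
        exact hs'.2.le), map_mul, Complex.conj_ofReal, ← Complex.exp_conj, map_mul,
        Complex.conj_ofReal, Complex.conj_I, mul_pow, ← Complex.exp_nat_mul]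
      ring_nf
    simp_rw [e]
    rw [intervalIntegral.integral_const_mul, hc.integral_mul_exp hs' hn]
    have hpi : (Real.pi : ℂ) ≠ 0 := by exact_mod_cast Real.pi_ne_zero
    push_cast
    field_simp
    ring
  · rw [norm_mul, norm_pow, RCLike.norm_conj]
    exact (mul_le_of_le_one_right (norm_nonneg _) (pow_le_one₀ (norm_nonneg _)
      (mem_ball_zero_iff.1 hy).le)).trans (norm_extd_le _ _)

/-- The Cauchy estimate for the Taylor coefficients. -/
theorem norm_moment_le_norm (n : ℕ) {p : HolderAlg α closedDisc} (hp : p ∈ holSymm α) :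
    ‖moment n p‖ ≤ ‖p‖ := by
  have h := ((⟨hp.1, (continuous_extd p).continuousOn⟩ : DiffContOnCl ℂ (extd p)
    (Metric.ball 0 ((1 : ℝ≥0) : ℝ))).hasFPowerSeriesOnBall zero_lt_one).hasFPowerSeriesAt
  have h1 := norm_cauchyPowerSeries_le (extd p) 0 ((1 : ℝ≥0) : ℝ) n
  rw [moment_eq_taylorCoeff n hp.1, taylorCoeff_eq_coeff h,
    ← FormalMultilinearSeries.norm_apply_eq_norm_coef]
  refine h1.trans ?_
  have h2 : ∫ θ in (0 : ℝ)..2 * Real.pi, ‖extd p (circleMap 0 ((1 : ℝ≥0) : ℝ) θ)‖ ≤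
      ‖p‖ * (2 * Real.pi) := by
    have := intervalIntegral.norm_integral_le_of_norm_le_const (a := 0) (b := 2 * Real.pi)
      (f := fun θ => ‖extd p (circleMap 0 ((1 : ℝ≥0) : ℝ) θ)‖) (C := ‖p‖)
      fun θ _ => by rw [norm_norm]; exact norm_extd_le p _
    rw [sub_zero, abs_of_pos Real.two_pi_pos] at this
    exact (le_abs_self _).trans this
  rw [NNReal.coe_one, abs_one, inv_one, one_pow, mul_one] at *
  rw [inv_mul_le_iff₀ Real.two_pi_pos, mul_comm (2 * Real.pi) ‖p‖]
  exact h2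

/-- In the open disc this is the Taylor series. The coefficients are `O(k⁻²)` by the Cauchy
estimate, so the series converges uniformly on the closed disc and the identity extends to the
circle. -/
theorem hasSum_prim_prim {p : HolderAlg α closedDisc} (hp : p ∈ holSymm α) {z : ℂ}
    (hz : ‖z‖ ≤ 1) :
    HasSum (fun k : ℕ => moment k p / ((k + 1) * (k + 2)) * z ^ (k + 2))
      (extd (prim (prim p)) z) := by
  have hp1 := prim_mem_holSymm hp
  have hp2 := prim_mem_holSymm hp1
  have hm : ∀ k : ℕ, moment (k + 2) (prim (prim p)) = moment k p / ((k + 1) * (k + 2)) := by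
    intro k
    rw [moment_prim (k + 1) hp1, moment_prim k hp, div_div]
    push_cast
    ring_nf
  have hin : ∀ z : ℂ, ‖z‖ < 1 →
      HasSum (fun k : ℕ => moment k p / ((k + 1) * (k + 2)) * z ^ (k + 2))
        (extd (prim (prim p)) z) := by
    intro z hz
    have h1 := (hasSum_nat_add_iff' 2).2 (hasSum_moment hp2.1 hz)
    have h0 : moment 0 (prim (prim p)) = 0 := by
      rw [moment_eq_taylorCoeff 0 hp2.1, taylorCoeff_zero, extd_prim_zero]
    have h2 : moment 1 (prim (prim p)) = 0 := by
      rw [moment_prim 0 hp1, moment_eq_taylorCoeff 0 hp1.1, taylorCoeff_zero, extd_prim_zero,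
        zero_div]
    simp only [hm, Finset.sum_range_succ, Finset.sum_range_zero, h0, h2, zero_mul, add_zero,
      sub_zero] at h1
    exact h1
  have hb : ∀ (k : ℕ) (z : ℂ), z ∈ closedDisc →
      ‖moment k p / ((k + 1) * (k + 2)) * z ^ (k + 2)‖ ≤ ‖p‖ * (1 / ((k : ℝ) + 1) ^ 2) := by
    intro k z hz
    have e1 : ‖((k : ℂ) + 1) * (k + 2)‖ = ((k : ℝ) + 1) * (k + 2) := by
      have : ((k : ℂ) + 1) * (k + 2) = ((((k : ℝ) + 1) * (k + 2) : ℝ) : ℂ) := by push_cast; ring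
      rw [this, Complex.norm_real, Real.norm_of_nonneg (by positivity)]
    rw [norm_mul, norm_pow, norm_div, e1]
    have e2 : ‖z‖ ^ (k + 2) ≤ 1 := pow_le_one₀ (norm_nonneg _) (mem_closedBall_zero_iff.1 hz)
    calc _ ≤ ‖moment k p‖ / (((k : ℝ) + 1) * (k + 2)) * 1 :=
          mul_le_mul_of_nonneg_left e2 (by positivity)
      _ = ‖moment k p‖ * (1 / (((k : ℝ) + 1) * (k + 2))) := by ring
      _ ≤ _ := by
          refine mul_le_mul (norm_moment_le_norm k hp) ?_ (by positivity) (norm_nonneg _)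
          refine one_div_le_one_div_of_le (by positivity) ?_
          nlinarith [(Nat.cast_nonneg k : (0 : ℝ) ≤ k)]
  have hs : Summable fun k : ℕ => ‖p‖ * (1 / ((k : ℝ) + 1) ^ 2) := by
    have h1 := (summable_nat_add_iff 1).2 (Real.summable_one_div_nat_pow.2 one_lt_two)
    push_cast at h1
    exact h1.mul_left _
  have hcont : ContinuousOn (fun z => ∑' k : ℕ, moment k p / ((k + 1) * (k + 2)) * z ^ (k + 2))
      closedDisc := continuousOn_tsum (fun k => by fun_prop) hs hb
  have heq : EqOn (fun z => ∑' k : ℕ, moment k p / ((k + 1) * (k + 2)) * z ^ (k + 2))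
      (extd (prim (prim p))) closedDisc := by
    refine EqOn.of_subset_closure (s := Metric.ball 0 1)
      (fun z hz => (hin z (mem_ball_zero_iff.1 hz)).tsum_eq) hcont
      (continuous_extd _).continuousOn Metric.ball_subset_closedBall ?_
    rw [closure_ball _ one_ne_zero]
  have hz' : z ∈ closedDisc := mem_closedBall_zero_iff.2 hz
  rw [← heq hz']
  exact (Summable.of_norm_bounded hs fun k => hb k z hz').hasSum

end HolderAlg

end CosineCoefficients

namespace HolderAlg

variable {α : ℝ≥0} [Fact (0 < α)] [Fact (α < 1)]

/-! ### The singular set and the invertibility of the linearization -/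

section SingularSet

theorem norm_ofHolderSpace_le (f : HolderSpace 1 α ℝ) : ‖ofHolderSpace f‖ ≤ 3 * ‖f‖ :=
  ContinuousLinearMap.le_of_opNorm_le ofHolderSpace
    (LinearMap.mkContinuous_norm_le _ (by norm_num) _) f

theorem integral_pow_mul_ofHolderSpace (f : HolderSpace 1 α ℝ) (n : ℕ) :
    ∫ s in (0 : ℝ)..1, (s : ℂ) ^ n * extd (ofHolderSpace f) s =
      ((∫ s in (0 : ℝ)..1, s ^ n * f (s : ℂ) : ℝ) : ℂ) := by
  rw [← intervalIntegral.integral_ofReal]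
  refine intervalIntegral.integral_congr fun s hs => ?_
  rw [uIcc_of_le zero_le_one] at hs
  rw [extd_ofHolderSpace f (by rw [Complex.norm_real, Real.norm_of_nonneg hs.1]; exact hs.2)]
  push_cast
  rfl

theorem abs_integral_pow_mul_le (f : HolderSpace 1 α ℝ) (n : ℕ) :
    |∫ s in (0 : ℝ)..1, s ^ n * f (s : ℂ)| ≤ ‖f‖ / (n + 1) := by
  have h := intervalIntegral.norm_integral_le_of_norm_le (μ := volume) (zero_le_one (α := ℝ))
    (f := fun s : ℝ => s ^ n * f (s : ℂ)) (g := fun s : ℝ => s ^ n * ‖f‖)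
    (Eventually.of_forall fun s hs => ?_) (Continuous.intervalIntegrable (by fun_prop) _ _)
  · rw [intervalIntegral.integral_mul_const, integral_pow, Real.norm_eq_abs] at h
    refine h.trans (le_of_eq ?_)
    simp
    ring
  · rw [norm_mul, Real.norm_of_nonneg (pow_nonneg hs.1.le n)]
    exact mul_le_mul_of_nonneg_left (f.norm_apply_le _) (pow_nonneg hs.1.le n)

/-- The factor `(k + 1) / (k + 2)` taken out of the moment of `f₀` leaves the coefficient `(n + 1) /
n` of `Ω̂_n`, with `n = k + 1`. -/
theorem symbol_eq (f₀ : HolderSpace 1 α ℝ) (Ω : ℝ) (k : ℕ) :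
    (k + 1) / (k + 2) * (Ω - OmegaHatInfty f₀) +
      ∫ s in (0 : ℝ)..1, s ^ (2 * (k + 1) + 1) * f₀ (s : ℂ) =
      (k + 1) / (k + 2) * (Ω - OmegaHat f₀ (k + 1)) := by
  rw [OmegaHat, OmegaHatInfty]
  generalize (∫ s in (0 : ℝ)..1, s ^ (2 * (k + 1) + 1) * f₀ (s : ℂ)) = x
  have h1 : (k + 1 : ℝ) ≠ 0 := by positivity
  have h2 : (k + 2 : ℝ) ≠ 0 := by positivity
  push_cast
  field_simp
  ring

theorem abs_OmegaHat_sub_le (f₀ : HolderSpace 1 α ℝ) (k : ℕ) :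
    |OmegaHat f₀ (k + 1) - OmegaHatInfty f₀| ≤ 2 * ‖f₀‖ * (1 / ((k : ℝ) + 1)) := by
  have h := abs_integral_pow_mul_le f₀ (2 * (k + 1) + 1)
  rw [OmegaHat, OmegaHatInfty, sub_sub_cancel_left, abs_neg, abs_mul]
  have h0 : (0 : ℝ) < k + 1 := by positivity
  have h1 : |(((k + 1 : ℕ) : ℝ) + 1) / ((k + 1 : ℕ) : ℝ)| ≤ 2 := by
    rw [abs_of_nonneg (by positivity), div_le_iff₀ (by positivity)]
    push_cast
    linarith [(Nat.cast_nonneg k : (0 : ℝ) ≤ k)]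
  rw [mul_assoc]
  refine mul_le_mul h1 (h.trans ?_) (abs_nonneg _) zero_le_two
  rw [div_eq_mul_one_div]
  refine mul_le_mul_of_nonneg_left (one_div_le_one_div_of_le h0 ?_) (norm_nonneg _)
  push_cast
  linarith

/-- As `f₀` is bounded, `Ω̂_n` converges to `Ω̂_∞` at rate `1 / n`, and a convergent sequence
together with its limit is compact. -/
theorem isCompact_singularSet (f₀ : HolderSpace 1 α ℝ) : IsCompact (singularSet f₀) := by
  have e : singularSet f₀ = insert (OmegaHatInfty f₀) (range fun k : ℕ => OmegaHat f₀ (k + 1)) := by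
    ext Ω
    constructor
    · rintro (⟨n, hn, rfl⟩ | rfl)
      · obtain ⟨k, rfl⟩ := Nat.exists_eq_add_of_le' hn
        exact mem_insert_of_mem _ ⟨k, rfl⟩
      · exact mem_insert _ _
    · rintro (rfl | ⟨k, rfl⟩)
      · exact Or.inr rfl
      · exact Or.inl ⟨k + 1, by omega, rfl⟩
  rw [e]
  refine Tendsto.isCompact_insert_range ?_
  rw [tendsto_iff_norm_sub_tendsto_zero]
  refine squeeze_zero (fun _ => norm_nonneg _) (fun k => abs_OmegaHat_sub_le f₀ k) ?_
  simpa using tendsto_one_div_add_atTop_nhds_zero_nat.const_mul (2 * ‖f₀‖)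

theorem ne_OmegaHat {f₀ : HolderSpace 1 α ℝ} {I : Set ℝ} (hI : closure I ⊆ (singularSet f₀)ᶜ)
    {Ω : ℝ} (hΩ : Ω ∈ I) (k : ℕ) : Ω - OmegaHat f₀ (k + 1) ≠ 0 := fun h =>
  hI (subset_closure hΩ) (Or.inl ⟨k + 1, by omega, sub_eq_zero.1 h⟩)

/-- The linearization is uniformly invertible away from the singular set. -/
theorem exists_inverse_of_closure_subset {f₀ : HolderSpace 1 α ℝ} {I : Set ℝ}
    (hI : closure I ⊆ (singularSet f₀)ᶜ) :
    ∃ K : ℝ, ∀ Ω ∈ I, ∃ R : holSymm α →L[ℝ] holSymm α, ‖R‖ * (1 + |Ω|) ≤ K ∧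
      ∀ (p : holSymm α) (k : ℕ), moment k (R p : HolderAlg α closedDisc) =
        ((((k + 1) / (k + 2) * (Ω - OmegaHat f₀ (k + 1)))⁻¹ : ℝ) : ℂ) *
          moment k (p : HolderAlg α closedDisc) := by
  obtain ⟨d, hd, h⟩ := exists_mul_le_abs_sub (isCompact_singularSet f₀) hI
  -- The halved constant pays for the factor `(k + 1) / (k + 2) ≥ 1/2` of the symbol.
  have key := exists_symbol_inverse α (c := OmegaHatInfty f₀) (M := ‖f₀‖) (d := d / 2)
    (norm_nonneg _) (by positivity)
    (m := fun k => ∫ s in (0 : ℝ)..1, s ^ (2 * (k + 1) + 1) * f₀ (s : ℂ)) (I := I)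
    (fun k => ?_) (fun Ω hΩ => ⟨?_, fun k => ?_⟩)
  · simpa only [symbol_eq] using key
  · refine (abs_integral_pow_mul_le f₀ _).trans ?_
    refine div_le_div_of_nonneg_left (norm_nonneg _) (by positivity) ?_
    push_cast
    linarith
  · have h1 := h Ω hΩ _ (Or.inr rfl)
    have h2 : 0 ≤ d * (1 + |Ω|) := by positivity
    linarith
  · have h1 := h Ω hΩ _ (Or.inl ⟨k + 1, by omega, rfl⟩)
    rw [symbol_eq, abs_mul]
    have h2 : (2⁻¹ : ℝ) ≤ |((k : ℝ) + 1) / (k + 2)| := by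
      rw [abs_of_nonneg (by positivity), le_div_iff₀ (by positivity)]
      linarith [(Nat.cast_nonneg k : (0 : ℝ) ≤ k)]
    calc d / 2 * (1 + |Ω|) = 2⁻¹ * (d * (1 + |Ω|)) := by ring
      _ ≤ _ := mul_le_mul h2 h1 (by positivity) (abs_nonneg _)

theorem linearization_comp {f₀ : HolderSpace 1 α ℝ} (hf₀ : ∀ z w : ℂ, ‖z‖ = ‖w‖ → f₀ z = f₀ w)
    (Ω : ℝ) (p : holSymm α) (k : ℕ) :
    moment k ((Ω • fderiv ℝ rotSymm 0 p + fderiv ℝ velSymm (ofHolderSpace f₀, 0) (0, p) :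
      holSymm α) : HolderAlg α closedDisc) =
      (((k + 1) / (k + 2) * (Ω - OmegaHat f₀ (k + 1)) : ℝ) : ℂ) *
        moment k (p : HolderAlg α closedDisc) := by
  rw [moment_linearization (c := OmegaHatInfty f₀)
    (m := fun k => ∫ s in (0 : ℝ)..1, s ^ (2 * (k + 1) + 1) * f₀ (s : ℂ))
    (extd_ofHolderSpace_norm hf₀) ?_ (fun k => integral_pow_mul_ofHolderSpace f₀ _), symbol_eq]
  have h := integral_pow_mul_ofHolderSpace f₀ 1
  simp only [pow_one] at h
  exact h

end SingularSet

end HolderAlg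

namespace HolderAlg

variable {α : ℝ≥0} [Fact (0 < α)] [Fact (α < 1)]

/-! ### The boundary equation in the space of second derivatives -/

section BoundaryEquation

/-- The projection gives the equation a fixed Banach space as target for every density. It loses
nothing here: for a symmetric density and an invertible divided difference, the defect already lies
in `holSymm α`. -/
theorem boundaryF_eq_zero_iff {f₀ : HolderSpace 1 α ℝ}
    (hf₀ : ∀ z w : ℂ, ‖z‖ = ‖w‖ → f₀ z = f₀ w) (Ω : ℝ) (g : symmHolder 1 α) (φ : holHolder 2 α)
    (hu : IsUnit (1 + segAvg 0 (prim (holEquiv φ : HolderAlg α closedDisc)))) :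
    (∀ w : ℂ, ‖w‖ = 1 → boundaryF f₀ Ω g.1 φ.1 w = 0) ↔
      Ω • rotSymm (holEquiv φ) +
        velSymm (ofHolderSpace f₀ + ofHolderSpace g.1, holEquiv φ) = 0 := by
  set r := ofHolderSpace f₀ + ofHolderSpace g.1 with hr
  have hp := (holEquiv φ).2
  have hrr : reflectDisc r = r := by
    obtain ⟨c, hc⟩ := g.2
    rw [hr, map_add, reflectDisc_ofHolderSpace fun z _ => hf₀ _ _ (RCLike.norm_conj z),
      reflectDisc_ofHolderSpace fun z hz => hc.apply_conj hz]
  have h1 : ∀ w : ℂ, ‖w‖ = 1 → boundaryF f₀ Ω g.1 φ.1 w =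
      (potential Ω r (holEquiv φ : HolderAlg α closedDisc) w).im := fun w hw =>
    boundaryDefect_eq Ω hp hu (fun y hy => by
        have hy' := mem_closedBall_zero_iff.1 hy
        rw [hr, extd_add, extd_ofHolderSpace _ hy', extd_ofHolderSpace _ hy', Complex.ofReal_add])
      (fun z hz => (extd_idDisc_add_prim_prim φ (mem_closedBall_zero_iff.1 hz)).symm)
      (fun z hz => discDeriv_id_add φ (mem_closedBall_zero_iff.1 hz)) hw
  have h2 : Ω • rotSymm (holEquiv φ) + velSymm (r, holEquiv φ) =
      ⟨_, defect_mem_holSymm Ω hrr hp hu⟩ := by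
    rw [← holProj_of_mem, defect, map_add, map_smul]
    rfl
  have h3 := boundary_iff_defect_eq_zero Ω hrr hp hu
  rw [h2, Submodule.mk_eq_zero, ← h3]
  exact forall₂_congr fun w hw => by rw [h1 w hw]

theorem eventually_isUnit :
    ∀ᶠ p : holSymm α in 𝓝 0, IsUnit (1 + segAvg 0 (prim (p : HolderAlg α closedDisc))) := by
  have hc : Continuous fun p : holSymm α => 1 + segAvg 0 (prim (p : HolderAlg α closedDisc)) :=
    continuous_const.add ((segAvg 0).continuous.comp (prim.continuous.comp continuous_subtype_val))
  refine hc.continuousAt.eventually (Units.isOpen.mem_nhds ?_)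
  change IsUnit (1 + segAvg 0 (prim ((0 : holSymm α) : HolderAlg α closedDisc)))
  rw [Submodule.coe_zero]
  exact isUnit_one_add_zero

theorem symbol_ne_zero {f₀ : HolderSpace 1 α ℝ} {I : Set ℝ}
    (hI : closure I ⊆ (singularSet f₀)ᶜ) {Ω : ℝ} (hΩ : Ω ∈ I) (k : ℕ) :
    ((((k + 1) / (k + 2) * (Ω - OmegaHat f₀ (k + 1)) : ℝ)) : ℂ) ≠ 0 := by
  have := ne_OmegaHat hI hΩ k
  have h1 : ((k : ℝ) + 1) / (k + 2) ≠ 0 := by positivity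
  exact_mod_cast mul_ne_zero h1 this

theorem moment_fderiv_velSymm_inl (f : HolderAlg α closedDisc) {h : HolderSpace 1 α ℝ}
    {c : ℕ → ℝ → ℝ} (hc : HasCosineExpansion h c) (k : ℕ) :
    moment k (fderiv ℝ (velSymm : _ → holSymm α) (f, 0) (ofHolderSpace h, 0) :
      HolderAlg α closedDisc) =
      ((2⁻¹ * ((k + 1) * ∫ s in (0 : ℝ)..1, s ^ (k + 2) * c (k + 1) s) : ℝ) : ℂ) := by
  rw [fderiv_velSymm_inl, moment_holProj, map_smul, moment_bergman_conj,
    integral_ofHolderSpace_mul_conj_pow hc (by omega), Complex.real_smul]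
  have e : ∀ x : ℝ, ((2⁻¹ : ℝ) : ℂ) * (((k : ℂ) + 1) * (x : ℂ)) =
      ((2⁻¹ * ((k + 1) * x) : ℝ) : ℂ) := fun x => by push_cast; ring
  rw [e, Complex.ofReal_re]

/-- With `n = k + 1`, the factor `(k + 2) / (k + 1)` of the inverse symbol, the `(k + 1) / 2` of the
density term and the `(k + 1)(k + 2)` of the double primitive leave `1 / (2 n)`. The sign is
absorbed by `Ω̂_n - Ω`. -/
theorem coeffA_succ (f₀ : HolderSpace 1 α ℝ) {Ω : ℝ} {k : ℕ}
    (hΩ : Ω - OmegaHat f₀ (k + 1) ≠ 0) (c : ℕ → ℝ → ℝ) :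
    ((k + 1) / (k + 2) * (Ω - OmegaHat f₀ (k + 1)))⁻¹ *
      -(2⁻¹ * ((k + 1) * ∫ s in (0 : ℝ)..1, s ^ (k + 2) * c (k + 1) s)) / ((k + 1) * (k + 2)) =
      coeffA f₀ Ω c (k + 1) := by
  rw [coeffA]
  change _ = (∫ s in (0 : ℝ)..1, s ^ (k + 2) * c (k + 1) s) / _
  generalize (∫ s in (0 : ℝ)..1, s ^ (k + 2) * c (k + 1) s) = x
  have h1 : (k + 1 : ℝ) ≠ 0 := by positivity
  have h2 : (k + 2 : ℝ) ≠ 0 := by positivity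
  have h3 : OmegaHat f₀ (k + 1) - Ω ≠ 0 := by rwa [← neg_sub, neg_ne_zero]
  rw [← neg_sub (OmegaHat f₀ (k + 1)) Ω]
  generalize OmegaHat f₀ (k + 1) - Ω = y at h3
  push_cast
  field_simp

theorem hasSum_derivative {f₀ : HolderSpace 1 α ℝ} {I : Set ℝ}
    (hI : closure I ⊆ (singularSet f₀)ᶜ) {Ω : ℝ} (hΩ : Ω ∈ I) {R : holSymm α →L[ℝ] holSymm α}
    (hR : ∀ (p : holSymm α) (k : ℕ), moment k (R p : HolderAlg α closedDisc) =
        ((((k + 1) / (k + 2) * (Ω - OmegaHat f₀ (k + 1)))⁻¹ : ℝ) : ℂ) *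
          moment k (p : HolderAlg α closedDisc))
    {h : HolderSpace 1 α ℝ} {c : ℕ → ℝ → ℝ} (hc : HasCosineExpansion h c) {z : ℂ}
    (hz : ‖z‖ ≤ 1) :
    HasSum (fun n : ℕ+ => z * ((coeffA f₀ Ω c n : ℝ) : ℂ) * z ^ (n : ℕ))
      ((-holEquiv.symm (R (fderiv ℝ (velSymm : _ → holSymm α) (ofHolderSpace f₀, 0)
        (ofHolderSpace h, 0))) : holHolder 2 α).1 z) := by
  rw [← map_neg, ← map_neg, holEquiv_symm_apply _ hz, ← Equiv.pnatEquivNat.symm.hasSum_iff]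
  convert! hasSum_prim_prim (R _).2 hz using 2 with k
  rw [hR, Submodule.coe_neg, map_neg, moment_fderiv_velSymm_inl _ hc]
  change z * ((coeffA f₀ Ω c (k + 1) : ℝ) : ℂ) * z ^ (k + 1) = _
  rw [← coeffA_succ f₀ (ne_OmegaHat hI hΩ k) c]
  push_cast
  ring

end BoundaryEquation

end HolderAlg

/-! ### Change of unknown in the implicit function theorem -/

section Transfer

variable {Y E F : Type*} [NormedAddCommGroup Y] [NormedSpace ℝ Y] [CompleteSpace Y]
  [NormedAddCommGroup E] [NormedSpace ℝ E] [CompleteSpace E]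
  [NormedAddCommGroup F] [NormedSpace ℝ F] [CompleteSpace F]

/-- The uniform implicit function theorem, with an unknown in an isomorphic space. -/
theorem exists_uniform_implicitFunction_equiv (e : E ≃L[ℝ] F) {A : F → F} {B : Y × F → F} {y₀ : Y}
    (hA : ContDiffAt ℝ 1 A 0) (hB : ContDiffAt ℝ 1 B (y₀, 0)) (hA0 : A 0 = 0)
    (hB0 : B (y₀, 0) = 0) {I : Set ℝ} (hI : IsOpen I) {K : ℝ} {R : ℝ → F →L[ℝ] F}
    (hR : ∀ Ω ∈ I, ‖R Ω‖ * (1 + |Ω|) ≤ K)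
    (hLR : ∀ Ω ∈ I, ∀ p, Ω • fderiv ℝ A 0 (R Ω p) + fderiv ℝ B (y₀, 0) (0, R Ω p) = p)
    (hRL : ∀ Ω ∈ I, ∀ p, R Ω (Ω • fderiv ℝ A 0 p + fderiv ℝ B (y₀, 0) (0, p)) = p)
    {P : F → Prop} (hP : ∀ᶠ p in 𝓝 (0 : F), P p) :
    ∃ δ ε : ℝ, 0 < δ ∧ δ < 1 ∧ 0 < ε ∧ ε < 1 ∧
      (∀ x ∈ Metric.ball (0 : E) ε, P (e x)) ∧
      ∃ n : ℝ × Y → E,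
        (∀ Ω ∈ I, ∀ y ∈ Metric.ball y₀ δ, n (Ω, y) ∈ Metric.ball (0 : E) ε) ∧
        (∀ Ω ∈ I, ∀ y ∈ Metric.ball y₀ δ, ∀ x ∈ Metric.ball (0 : E) ε,
          Ω • A (e x) + B (y, e x) = 0 ↔ x = n (Ω, y)) ∧
        (∀ Ω ∈ I, ∀ y ∈ Metric.ball y₀ δ, ContDiffAt ℝ 1 n (Ω, y)) ∧
        ∀ Ω ∈ I, ∃ D : Y →L[ℝ] E, HasFDerivAt (fun y => n (Ω, y)) D y₀ ∧
          ∀ h, D h = -e.symm (R Ω (fderiv ℝ B (y₀, 0) (h, 0))) := by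
  have hAc : ContDiffAt ℝ 1 (fun x => A (e x)) 0 :=
    ContDiffAt.comp (g := A) (f := e) 0 (by rwa [map_zero]) e.contDiff.contDiffAt
  set J : Y × E →L[ℝ] Y × F := (ContinuousLinearMap.id ℝ Y).prodMap (e : E →L[ℝ] F) with hJ
  have hJ0 : J (y₀, 0) = (y₀, 0) := by simp [hJ]
  have hBc : ContDiffAt ℝ 1 (fun u : Y × E => B (u.1, e u.2)) (y₀, 0) :=
    ContDiffAt.comp (g := B) (f := J) (y₀, 0) (by rwa [hJ0]) J.contDiff.contDiffAt
  have hAd : fderiv ℝ (fun x => A (e x)) 0 = (fderiv ℝ A 0).comp (e : E →L[ℝ] F) := by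
    have h1 : HasFDerivAt A (fderiv ℝ A 0) (e 0) := by
      rw [map_zero]; exact (hA.differentiableAt one_ne_zero).hasFDerivAt
    exact (h1.comp (0 : E) e.hasFDerivAt).fderiv
  have hBd : fderiv ℝ (fun u : Y × E => B (u.1, e u.2)) (y₀, 0) =
      (fderiv ℝ B (y₀, 0)).comp J := by
    have h1 : HasFDerivAt B (fderiv ℝ B (y₀, 0)) (J (y₀, 0)) := by
      rw [hJ0]; exact (hB.differentiableAt one_ne_zero).hasFDerivAt
    exact (h1.comp (y₀, (0 : E)) J.hasFDerivAt).fderiv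
  have hR' : ∀ Ω ∈ I, ‖(e.symm : F →L[ℝ] E).comp (R Ω)‖ * (1 + |Ω|) ≤
      ‖(e.symm : F →L[ℝ] E)‖ * K := fun Ω hΩ => by
    refine (mul_le_mul_of_nonneg_right (ContinuousLinearMap.opNorm_comp_le _ _)
      (by positivity)).trans ?_
    rw [mul_assoc]
    exact mul_le_mul_of_nonneg_left (hR Ω hΩ) (norm_nonneg _)
  have hP' : ∀ᶠ u : Y × E in 𝓝 (y₀, 0), P (e u.2) := by
    have hc : ContinuousAt (fun u : Y × E => e u.2) (y₀, 0) :=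
      (e.continuous.comp continuous_snd).continuousAt
    exact hc.eventually (by simpa using hP)
  obtain ⟨δ, ε, hδ0, hδ1, hε0, hε1, hPb, n, h1, h2, h3, h4⟩ := exists_uniform_implicitFunction
    hAc hBc (by rw [map_zero, hA0]) (by rw [map_zero, hB0]) hI hR' (fun Ω hΩ => by
      rw [hAd, hBd]
      ext p
      simpa [hJ] using hLR Ω hΩ p) (fun Ω hΩ => by
      rw [hAd, hBd]
      ext x
      have h := congrArg e.symm (hRL Ω hΩ (e x))
      rw [e.symm_apply_apply] at h
      exact h) hP'
  refine ⟨δ, ε, hδ0, hδ1, hε0, hε1, fun x hx => hPb y₀ (Metric.mem_ball_self hδ0) x hx, n, h1, h2,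
    h3, fun Ω hΩ => ⟨_, h4 Ω hΩ, fun h => ?_⟩⟩
  rw [hBd]
  simp [hJ]

end Transfer

namespace HolderAlg

variable {α : ℝ≥0} [Fact (0 < α)] [Fact (α < 1)]

/-! ### The implicit function for the projected equation -/

section ImplicitFunction

theorem hasCosineExpansion_of_radial {f₀ : ℂ → ℝ}
    (hf₀ : ∀ z w : ℂ, ‖z‖ = ‖w‖ → f₀ z = f₀ w) :
    HasCosineExpansion f₀ fun n r => if n = 0 then f₀ r else 0 := by
  intro r hr θ
  convert! hasSum_single (f := fun n : ℕ => (if n = 0 then f₀ r else 0) * Real.cos (n * θ)) 0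
    fun n hn => ?_ using 1
  · have : f₀ (r * Complex.exp (θ * Complex.I)) = f₀ r :=
      hf₀ _ _ (by rw [norm_mul, Complex.norm_exp_ofReal_mul_I, mul_one])
    simp [this]
  · rw [if_neg hn, zero_mul]

/-- At `p = 0` the map is linear in the density, hence equal to its own derivative, and a radial
density has no modes of order `n ≥ 1`. So the disc is a solution for every `Ω`. -/
theorem velSymm_radial_zero {f₀ : HolderSpace 1 α ℝ}
    (hf₀ : ∀ z w : ℂ, ‖z‖ = ‖w‖ → f₀ z = f₀ w) :
    velSymm (ofHolderSpace f₀, (0 : holSymm α)) = 0 := by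
  have h : velSymm (ofHolderSpace f₀, (0 : holSymm α)) =
      fderiv ℝ (velSymm : _ → holSymm α) (ofHolderSpace f₀, 0) (ofHolderSpace f₀, 0) := by
    rw [fderiv_velSymm_inl, ← velDefect_zero]
    rfl
  refine ext_holSymm_of_moment fun k => ?_
  rw [h, moment_fderiv_velSymm_inl _ (hasCosineExpansion_of_radial hf₀)]
  simp

/-- The implicit function theorem for the projected equation. -/
theorem exists_implicitFunction {f₀ : HolderSpace 1 α ℝ}
    (hf₀ : ∀ z w : ℂ, ‖z‖ = ‖w‖ → f₀ z = f₀ w) {I : Set ℝ} (hIo : IsOpen I)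
    (hI : closure I ⊆ (singularSet f₀)ᶜ) {K : ℝ} {R : ℝ → holSymm α →L[ℝ] holSymm α}
    (hK : ∀ Ω ∈ I, ‖R Ω‖ * (1 + |Ω|) ≤ K)
    (hR : ∀ Ω ∈ I, ∀ (p : holSymm α) (k : ℕ), moment k (R Ω p : HolderAlg α closedDisc) =
        ((((k + 1) / (k + 2) * (Ω - OmegaHat f₀ (k + 1)))⁻¹ : ℝ) : ℂ) *
          moment k (p : HolderAlg α closedDisc)) :
    ∃ δ ε : ℝ, 0 < δ ∧ δ < 1 ∧ 0 < ε ∧ ε < 1 ∧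
      (∀ φ ∈ Metric.ball (0 : holHolder 2 α) ε,
        IsUnit (1 + segAvg 0 (prim (holEquiv φ : HolderAlg α closedDisc)))) ∧
      ∃ n : ℝ × HolderAlg α closedDisc → holHolder 2 α,
        (∀ Ω ∈ I, ∀ y ∈ Metric.ball (ofHolderSpace f₀) δ,
          n (Ω, y) ∈ Metric.ball (0 : holHolder 2 α) ε) ∧
        (∀ Ω ∈ I, ∀ y ∈ Metric.ball (ofHolderSpace f₀) δ, ∀ φ ∈ Metric.ball (0 : holHolder 2 α) ε,
          Ω • rotSymm (holEquiv φ) + velSymm (y, holEquiv φ) = 0 ↔ φ = n (Ω, y)) ∧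
        (∀ Ω ∈ I, ∀ y ∈ Metric.ball (ofHolderSpace f₀) δ, ContDiffAt ℝ 1 n (Ω, y)) ∧
        ∀ Ω ∈ I, ∃ D : HolderAlg α closedDisc →L[ℝ] holHolder 2 α,
          HasFDerivAt (fun y => n (Ω, y)) D (ofHolderSpace f₀) ∧
          ∀ h, D h = -holEquiv.symm
            (R Ω (fderiv ℝ (velSymm : _ → holSymm α) (ofHolderSpace f₀, 0) (h, 0))) := by
  refine exists_uniform_implicitFunction_equiv holEquiv contDiff_rotSymm.contDiffAt
    (contDiffAt_velSymm_zero _) ?_ (velSymm_radial_zero hf₀) hIo hK (fun Ω hΩ p => ?_)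
    (fun Ω hΩ p => ?_) (P := fun p => IsUnit (1 + segAvg 0 (prim (p : HolderAlg α closedDisc)))) ?_
  · change holProj α (rotDefect (((0 : holSymm α)) : HolderAlg α _)) = 0
    rw [Submodule.coe_zero, rotDefect_zero, map_zero]
  · refine ext_holSymm_of_moment fun k => ?_
    rw [linearization_comp hf₀, hR Ω hΩ, ← mul_assoc, Complex.ofReal_inv,
      mul_inv_cancel₀ (symbol_ne_zero hI hΩ k), one_mul]
  · refine ext_holSymm_of_moment fun k => ?_
    rw [hR Ω hΩ, linearization_comp hf₀, ← mul_assoc, Complex.ofReal_inv,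
      inv_mul_cancel₀ (symbol_ne_zero hI hΩ k), one_mul]
  · exact eventually_isUnit

end ImplicitFunction

end HolderAlg

end RotatingVortex

end

/-! ### The proposition -/

open Set Filter Topology MeasureTheory

open RotatingVortex RotatingVortex.HolderAlg

theorem proposition3p2 (α : ℝ≥0) (hα0 : 0 < α) (hα1 : α < 1)
    (f₀ : RotatingVortex.HolderSpace 1 α ℝ)
    (hf₀ : ∀ z w : ℂ, ‖z‖ = ‖w‖ → f₀ z = f₀ w)
    (I : Set ℝ) (hIopen : IsOpen I) (hIint : I.OrdConnected)
    (hI : closure I ⊆ (RotatingVortex.singularSet f₀)ᶜ) :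
    ∃ δ ε : ℝ, 0 < δ ∧ δ < 1 ∧ 0 < ε ∧ ε < 1 ∧
      ∃ N : ℝ × RotatingVortex.symmHolder 1 α → RotatingVortex.holHolder 2 α,
        Set.MapsTo N (I ×ˢ Metric.ball 0 δ) (Metric.ball 0 ε) ∧
        ContDiffOn ℝ 1 N (I ×ˢ Metric.ball 0 δ) ∧
        (∀ Ω ∈ I, ∀ g ∈ Metric.ball (0 : RotatingVortex.symmHolder 1 α) δ,
          ∀ φ ∈ Metric.ball (0 : RotatingVortex.holHolder 2 α) ε,
            (∀ w : ℂ, ‖w‖ = 1 → RotatingVortex.boundaryF f₀ Ω g.1 φ.1 w = 0) ↔ φ = N (Ω, g)) ∧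
        (∀ Ω ∈ I, ∀ (h : RotatingVortex.symmHolder 1 α) (hn : ℕ → ℝ → ℝ),
          RotatingVortex.HasCosineExpansion h.1 hn →
            ∀ z ∈ Metric.closedBall (0 : ℂ) 1,
              HasSum
                (fun n : ℕ+ => z * ((RotatingVortex.coeffA f₀ Ω hn n : ℝ) : ℂ) * z ^ (n : ℕ))
                ((fderiv ℝ (fun g : RotatingVortex.symmHolder 1 α => N (Ω, g)) 0 h).1 z)) ∧
        (∃ C : ℝ, ∀ Ω ∈ I, ∀ h : RotatingVortex.symmHolder 1 α,
          ‖fderiv ℝ (fun g : RotatingVortex.symmHolder 1 α => N (Ω, g)) 0 h‖ ≤ C * ‖h‖) := by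
  have : Fact (0 < α) := ⟨hα0⟩
  have : Fact (α < 1) := ⟨hα1⟩
  obtain ⟨K, hK⟩ := exists_inverse_of_closure_subset hI
  choose! R hRK hR using hK
  obtain ⟨δ, ε, hδ0, hδ1, hε0, hε1, hu, n, hn1, hn2, hn3, hn4⟩ :=
    exists_implicitFunction hf₀ hIopen hI hRK hR
  -- The radius `δ / 3` compensates the norm bound `3` of the inclusion `ofHolderSpace`.
  have hmem : ∀ g ∈ Metric.ball (0 : symmHolder 1 α) (δ / 3),
      ofHolderSpace f₀ + ofHolderSpace g.1 ∈ Metric.ball (ofHolderSpace f₀) δ := fun g hg => by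
    rw [mem_ball_iff_norm, add_sub_cancel_left]
    have h1 := norm_ofHolderSpace_le g.1
    have h2 : ‖g.1‖ < δ / 3 := mem_ball_zero_iff.1 hg
    linarith
  -- The implicit function is defined over the complete space `HolderAlg` of densities, and `N` is
  -- its composition with the affine map `g ↦ f₀ + g`; completeness of `symmHolder` is never
  -- required.
  set T : symmHolder 1 α →L[ℝ] HolderAlg α closedDisc :=
    ofHolderSpace.comp (symmHolder 1 α).subtypeL with hT
  have hder : ∀ Ω ∈ I, ∀ h : symmHolder 1 α,
      fderiv ℝ (fun g : symmHolder 1 α => n (Ω, ofHolderSpace f₀ + ofHolderSpace g.1)) 0 h =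
        -holEquiv.symm (R Ω (fderiv ℝ (velSymm : _ → holSymm α) (ofHolderSpace f₀, 0)
          (ofHolderSpace h.1, 0))) := fun Ω hΩ h => by
    obtain ⟨D, hD, hDh⟩ := hn4 Ω hΩ
    have h1 : HasFDerivAt (fun y => n (Ω, y)) D (ofHolderSpace f₀ + T 0) := by
      rwa [map_zero, add_zero]
    have h2 := (h1.comp (0 : symmHolder 1 α) (T.hasFDerivAt.const_add (ofHolderSpace f₀))).fderiv
    rw [← hDh]
    exact DFunLike.congr_fun h2 h
  refine ⟨δ / 3, ε, by positivity, by linarith, hε0, hε1,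
    fun q => n (q.1, ofHolderSpace f₀ + ofHolderSpace q.2.1), fun q hq => ?_, fun q hq => ?_,
    fun Ω hΩ g hg φ hφ => ?_, fun Ω hΩ h c hc z hz => ?_, ?_⟩
  · exact hn1 q.1 hq.1 _ (hmem q.2 hq.2)
  · have h1 : ContDiffAt ℝ 1 (fun q : ℝ × symmHolder 1 α => (q.1, ofHolderSpace f₀ + T q.2)) q :=
      contDiffAt_fst.prodMk (contDiffAt_const.add (T.contDiff.contDiffAt.comp q contDiffAt_snd))
    have h2 : ContDiffAt ℝ 1 n (q.1, ofHolderSpace f₀ + T q.2) := hn3 q.1 hq.1 _ (hmem q.2 hq.2)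
    exact (ContDiffAt.comp (g := n)
      (f := fun q : ℝ × symmHolder 1 α => (q.1, ofHolderSpace f₀ + T q.2)) q h2
      h1).contDiffWithinAt
  · rw [boundaryF_eq_zero_iff hf₀ Ω g φ (hu φ hφ)]
    exact hn2 Ω hΩ _ (hmem g hg) φ hφ
  · rw [hder Ω hΩ h]
    exact hasSum_derivative hI hΩ (hR Ω hΩ) hc (mem_closedBall_zero_iff.1 hz)
  · set V := fderiv ℝ (velSymm : _ → holSymm α) (ofHolderSpace f₀, 0)
    refine ⟨4 * (|K| * (‖V‖ * 3)), fun Ω hΩ h => ?_⟩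
    rw [hder Ω hΩ h, norm_neg]
    have h1 : ‖(ofHolderSpace h.1, (0 : holSymm α))‖ ≤ 3 * ‖h‖ := by
      rw [Prod.norm_mk, norm_zero, max_eq_left (norm_nonneg _)]
      exact norm_ofHolderSpace_le h.1
    have h2 : ‖R Ω‖ ≤ |K| := by
      refine le_trans ?_ ((hRK Ω hΩ).trans (le_abs_self K))
      exact le_mul_of_one_le_right (ContinuousLinearMap.opNorm_nonneg _)
        (by linarith [abs_nonneg Ω])
    have h3 : ‖V (ofHolderSpace h.1, 0)‖ ≤ ‖V‖ * (3 * ‖h‖) :=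
      (V.le_opNorm _).trans (mul_le_mul_of_nonneg_left h1 (ContinuousLinearMap.opNorm_nonneg _))
    have h4 : ‖R Ω (V (ofHolderSpace h.1, 0))‖ ≤ |K| * (‖V‖ * (3 * ‖h‖)) :=
      ((R Ω).le_opNorm _).trans (mul_le_mul h2 h3 (norm_nonneg _) (abs_nonneg K))
    refine (norm_holLinearEquiv_symm_le _).trans ?_
    calc _ ≤ 4 * (|K| * (‖V‖ * (3 * ‖h‖))) := mul_le_mul_of_nonneg_left h4 (by norm_num)
      _ = _ := by ring
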